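/- **Setting.** Let $\mathcal H_{\mathbb R}$ be a real Hilbert space, $N\ge 1$ an integer and $q=1/N$. Let $S_0(n)$ be the group of permutations of $[0,n]=\{0,1,\dots,n\}$ and $S(n)\subset S_0(n)$ the stabilizer of $0$. For $\alpha\in S_0(n)$ let $\mathrm{cyc}(\alpha)$ be its number of cycles (fixed points included), $\mathrm{cyc}_0(\alpha)=\mathrm{cyc}(\alpha)-1$ the number of cycles not containing $0$, and $\chi_q(\alpha)=q^{\,n+1-\mathrm{cyc}(\alpha)}$. Write $U_\sigma(h_1\otimes\dots\otimes h_n)=h_{\sigma^{-1}(1)}\otimes\dots\otimes h_{\sigma^{-1}(n)}$. *The algebra.* $\mathcal{TP}(\mathcal H_{\mathbb R})$ is the complex vector space spanned by symbols $T(\alpha\otimes F)$, namely the quotient of $\bigoplus_{n\ge0}\mathbb C[S_0(n)]\otimes\mathcal H_{\mathbb R}^{\otimes n}$ (algebraic tensor powers) by the relations $\alpha\otimes F=\sigma\alpha\sigma^{-1}\otimes U_\sigma F$, $\sigma\in S(n)$. It is a unital $*$-algebra with $T(\alpha\otimes F)\,T(\beta\otimes G)=T((\alpha\cup\beta)\otimes(F\otimes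 G))$, $T(\alpha\otimes F)^*=T(\alpha^{-1}\otimes F)$ and unit $T((0))$; here, for $\alpha\in S_0(n)$ and $\beta\in S_0(k)$, $\alpha\cup\beta\in S_0(n+k)$ is obtained by shifting the nonzero points of $\beta$ by $n$ and concatenating the two cycles of $0$, that of $\alpha$ first. *Contractions and state.* For a transposition $\tau=(ij)\in S(n)$ put $$C_\tau(\alpha\otimes (h_1\otimes\dots\otimes h_n))=q^{\mathrm{cyc}_0((\tau\alpha)|)-\mathrm{cyc}_0(\tau\alpha)+1}\,\langle h_i,h_j\rangle\;(\tau\alpha)|\otimes(h_1\otimes\cdots\hat h_i\cdots\hat h_j\cdots\otimes h_n),$$ where $(\tau\alpha)|$ is $\tau\alpha$ with $i,j$ deleted from its cycles, relabelled in increasing order as an element of $S_0(n-2)$. Let $\mathcal L=\sum_\tau C_\tau$. Let $\overline{\mathcal{TP}}(\mathcal H_{\mathbb R})$ be the space defined like $\mathcal{TP}(\mathcal H_{\mathbb R})$ but with Hilbert space tensor powers, its spanning symbols being written $I(\alpha\otimes F)$; $\mathcal{TP}(\mathcal H_{\mathbb R})$ is embedded in it by $T(x)=I(e^{\mathcal L}x)$.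 The functional $\varphi$ is the linear functional with $\varphi(I((0)))=1$ which vanishes on all $I(\alpha\otimes F)$ of degree $n\ge1$. The form $$\langle I(\alpha\otimes F),I(\beta\otimes G)\rangle_q=\delta_{nk}\sum_{\sigma\in S(n)}\chi_q(\alpha\sigma\beta^{-1}\sigma^{-1})\langle F,U_\sigma G\rangle$$ (sesquilinear, linear in the first argument) is positive semi-definite, and $\mathcal F_{1/N}(\mathcal H)$ is the completion of the quotient of $\overline{\mathcal{TP}}(\mathcal H_{\mathbb R})$ by its kernel. For a closed subspace $\mathcal H'_{\mathbb R}\subset\mathcal H_{\mathbb R}$ with orthogonal projection $P$, the algebraic conditional expectation is the linear map $\varphi[\,I(\alpha\otimes F)\mid\mathcal H'\,]=I(\alpha\otimes P^{\otimes n}F)$. *Random matrices.* Let $\{b_{ij}(h):h\in\mathcal H_{\mathbb R}\}$, $1\le i,j\le N$, be independent standard (centered, with covariance $\langle h,g\rangle$) Gaussian processes on one probability space, and let $X(h)$ be the Hermitian random matrix with $X(h)_{ii}=b_{ii}(h)/\sqrt N$, and $X(h)_{ij}=\overline{X(h)_{ji}}=(b_{ij}(h)+\sqrt{-1}\,b_{ji}(h))/\sqrt{2N}$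 for $i<j$. For $\alpha\in S_0(n)$, $\mathrm{Tr}_\alpha(x_1,\dots,x_n)$ is the product of the $x_i$ along the cycle of $\alpha$ starting with $0$ (with $x_0=I$), multiplied by the product over the other cycles of $\mathrm{Tr}[\prod x_i]$ along the cycle ($\mathrm{Tr}$ is the un-normalized trace). Let $\mathcal A_N^{\mathrm{equiv}}(\mathcal H)$ be the set of random matrices $Q(X(h):h\in\mathcal H_{\mathbb R})$, where $Q$ is an $N\times N$ matrix of polynomials in the formal entries of $N\times N$ matrices $x^{(h)}$ such that $Q(Ux^{(h)}U^*:h)=U\,Q(x^{(h)}:h)\,U^*$ for every unitary $U$; let $\mathcal A_N^{2,\mathrm{equiv}}(\mathcal H)$ be its $L^2$ completion (closure among square integrable random matrices). Random matrices are identified when almost surely equal. When the entry-wise expectation $(I\otimes\mathbb E)[Y]$ is a multiple of the identity, that scalar is denoted $\mathbb E[Y]$. **Theorem.** Let $q=1/N$. (a) There is a linear map $\mathcal E:\mathcal{TP}(\mathcal H_{\mathbb R})\to\mathcal A_N^{\mathrm{equiv}}(\mathcal H)$ with $\mathcal E[T(\alpha\otimes(h_1\otimes\dots\otimes h_n))]=\mathrm{Tr}_\alpha(X(h_1),\dots,X(h_n))$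 for all $n$, $\alpha\in S_0(n)$, $h_k\in\mathcal H_{\mathbb R}$. (b) $\mathcal E$ is a unital $*$-homomorphism of algebras. (c) For every $x$, the entries of $\mathcal E[x]$ are integrable, $(I\otimes\mathbb E)[\mathcal E[x]]$ is scalar, and $\mathbb E[\mathcal E[x]]=\varphi(x)$. The product and the involution of $\mathcal{TP}(\mathcal H_{\mathbb R})$ extend, uniquely subject to $I(\alpha\otimes F)\,I(\beta\otimes G)$ and $I(\alpha\otimes F)^*$ being bounded in $F$ and $G$ (for the Hilbert tensor norms, and the Hilbert norm $\langle z,z\rangle_0^{1/2}$ on $\overline{\mathcal{TP}}(\mathcal H_{\mathbb R})$), to $\overline{\mathcal{TP}}(\mathcal H_{\mathbb R})$. There is a linear map, again denoted $\mathcal E$, from $\mathcal F_{1/N}(\mathcal H)$ onto $\mathcal A_N^{2,\mathrm{equiv}}(\mathcal H)$, extending $\mathcal E$, which is isometric in the sense that $(I\otimes\mathbb E)[\mathcal E[\zeta]^*\mathcal E[\xi]]=\langle\xi,\zeta\rangle_{1/N}\,I_N$ for all $\xi,\zeta$, and whose composition with $\overline{\mathcal{TP}}(\mathcal H_{\mathbb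 R})\to\mathcal F_{1/N}(\mathcal H)$ is multiplicative and $*$-preserving. (d) For every closed subspace $\mathcal H'_{\mathbb R}\subset\mathcal H_{\mathbb R}$ and every $A\in\overline{\mathcal{TP}}(\mathcal H_{\mathbb R})$, entry-wise and almost surely, $$\mathbb E\big[\mathcal E[A]\,\big|\,X(h):h\in\mathcal H'_{\mathbb R}\big]=\mathcal E\big[\varphi[A\mid\mathcal H']\big].$$ In particular, $\mathbb E[\mathrm{Tr}_\alpha(X(h_1),\dots,X(h_n))\mid X(h):h\in\mathcal H'_{\mathbb R}]=\mathcal E\big[\varphi[T(\alpha\otimes(h_1\otimes\dots\otimes h_n))\mid\mathcal H']\big]$. -/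

import Mathlib

open scoped TensorProduct DirectSum ComplexConjugate
open MeasureTheory ProbabilityTheory
noncomputable section
namespace TracePoly

/-- The permutations of `{0, 1, …, n}`: `none` is the point `0`, and `some i` are the points
`1, …, n`. -/
abbrev S0 (n : ℕ) : Type := Equiv.Perm (Option (Fin n))

/-- `S(n)` as the stabilizer of `0`. -/
def incl0 {n : ℕ} (σ : Equiv.Perm (Fin n)) : S0 n := Equiv.optionCongr σ

/-- `σ α σ⁻¹` for `σ ∈ S(n)`. -/
def conj0 {n : ℕ} (σ : Equiv.Perm (Fin n)) (α : S0 n) : S0 n := incl0 σ * α * (incl0 σ)⁻¹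

/-- The number of cycles, fixed points included. -/
def cyc {X : Type*} (α : Equiv.Perm X) : ℕ := Nat.card (Quotient (Equiv.Perm.SameCycle.setoid α))

/-- The character `χ_q(α) = q ^ |α|`, where `|α| = n + 1 - (number of cycles of α)`. -/
def chi (q : ℝ) {n : ℕ} (α : S0 n) : ℝ := q ^ (n + 1 - cyc α)

/-- `α ∪ β`: the points of `β` other than `0` are shifted by `n`, and the cycles of `0` are
concatenated, the one of `α` first. -/
def cup {n k : ℕ} (α : S0 n) (β : S0 k) : S0 (n + k) :=
  β.viaEmbedding (Fin.natAddEmb n).optionMap * α.viaEmbedding (Fin.castAddEmb k).optionMap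

theorem incl0_mul {n : ℕ} (σ τ : Equiv.Perm (Fin n)) : incl0 (σ * τ) = incl0 σ * incl0 τ := by
  ext1 x; cases x <;> rfl

theorem incl0_inv {n : ℕ} (σ : Equiv.Perm (Fin n)) : (incl0 σ)⁻¹ = incl0 σ⁻¹ := rfl

/-- `σ ∈ S(n)` acting on the first `n` of `n + k` points. -/
def permLeft {n : ℕ} (k : ℕ) (σ : Equiv.Perm (Fin n)) : Equiv.Perm (Fin (n + k)) :=
  finSumFinEquiv.permCongr (Equiv.Perm.sumCongr σ 1)

/-- `σ ∈ S(k)` acting on the last `k` of `n + k` points. -/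
def permRight (n : ℕ) {k : ℕ} (σ : Equiv.Perm (Fin k)) : Equiv.Perm (Fin (n + k)) :=
  finSumFinEquiv.permCongr (Equiv.Perm.sumCongr 1 σ)

theorem permLeft_symm_left {n : ℕ} (k : ℕ) (σ : Equiv.Perm (Fin n)) (i : Fin n) :
    (permLeft k σ).symm (Fin.castAdd k i) = Fin.castAdd k (σ.symm i) := by
  rw [Equiv.symm_apply_eq]; simp [permLeft]

theorem permLeft_symm_right {n k : ℕ} (σ : Equiv.Perm (Fin n)) (j : Fin k) :
    (permLeft k σ).symm (Fin.natAdd n j) = Fin.natAdd n j := by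
  rw [Equiv.symm_apply_eq]; simp [permLeft]

theorem permRight_symm_left (n : ℕ) {k : ℕ} (σ : Equiv.Perm (Fin k)) (i : Fin n) :
    (permRight n σ).symm (Fin.castAdd k i) = Fin.castAdd k i := by
  rw [Equiv.symm_apply_eq]; simp [permRight]

theorem permRight_symm_right (n : ℕ) {k : ℕ} (σ : Equiv.Perm (Fin k)) (j : Fin k) :
    (permRight n σ).symm (Fin.natAdd n j) = Fin.natAdd n (σ.symm j) := by
  rw [Equiv.symm_apply_eq]; simp [permRight]

theorem incl0_permLeft {n : ℕ} (k : ℕ) (σ : Equiv.Perm (Fin n)) :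
    incl0 (permLeft k σ) = (incl0 σ).viaEmbedding (Fin.castAddEmb k).optionMap := by
  ext1 x
  rcases x with _ | x
  · exact ((incl0 σ).viaEmbedding_apply (Fin.castAddEmb k).optionMap none).symm
  · refine Fin.addCases (fun i => ?_) (fun j => ?_) x
    · refine Eq.trans ?_ ((incl0 σ).viaEmbedding_apply (Fin.castAddEmb k).optionMap (some i)).symm
      simp [incl0, permLeft]
    · rw [Equiv.Perm.viaEmbedding_apply_of_notMem]
      · simp [incl0, permLeft]
      · rintro ⟨_ | y, hy⟩
        · simp at hy
        · have := congrArg (Option.map Fin.val) hy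
          simp at this
          omega

theorem incl0_permRight (n : ℕ) {k : ℕ} (σ : Equiv.Perm (Fin k)) :
    incl0 (permRight n σ) = (incl0 σ).viaEmbedding (Fin.natAddEmb n).optionMap := by
  ext1 x
  rcases x with _ | x
  · exact ((incl0 σ).viaEmbedding_apply (Fin.natAddEmb n).optionMap none).symm
  · refine Fin.addCases (fun i => ?_) (fun j => ?_) x
    · rw [Equiv.Perm.viaEmbedding_apply_of_notMem]
      · simp [incl0, permRight]
      · rintro ⟨_ | y, hy⟩
        · simp at hy
        · have := congrArg (Option.map Fin.val) hy
          simp at this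
          omega
    · refine Eq.trans ?_ ((incl0 σ).viaEmbedding_apply (Fin.natAddEmb n).optionMap (some j)).symm
      simp [incl0, permRight]

theorem incl0_left_commute {n k : ℕ} (σ : Equiv.Perm (Fin n)) (β : S0 k) :
    Commute ((incl0 σ).viaEmbedding (Fin.castAddEmb k).optionMap)
      (β.viaEmbedding (Fin.natAddEmb n).optionMap) := by
  apply Equiv.Perm.Disjoint.commute
  rintro (_ | x)
  · exact Or.inl ((incl0 σ).viaEmbedding_apply (Fin.castAddEmb k).optionMap none)
  · refine Fin.addCases (fun i => Or.inr ?_) (fun j => Or.inl ?_) x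
    · apply Equiv.Perm.viaEmbedding_apply_of_notMem
      rintro ⟨_ | y, hy⟩
      · simp at hy
      · have := congrArg (Option.map Fin.val) hy
        simp at this
        omega
    · apply Equiv.Perm.viaEmbedding_apply_of_notMem
      rintro ⟨_ | y, hy⟩
      · simp at hy
      · have := congrArg (Option.map Fin.val) hy
        simp at this
        omega

theorem incl0_right_commute {n k : ℕ} (τ : Equiv.Perm (Fin k)) (α : S0 n) :
    Commute ((incl0 τ).viaEmbedding (Fin.natAddEmb n).optionMap)
      (α.viaEmbedding (Fin.castAddEmb k).optionMap) := by
  apply Equiv.Perm.Disjoint.commute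
  rintro (_ | x)
  · exact Or.inl ((incl0 τ).viaEmbedding_apply (Fin.natAddEmb n).optionMap none)
  · refine Fin.addCases (fun i => Or.inl ?_) (fun j => Or.inr ?_) x
    · apply Equiv.Perm.viaEmbedding_apply_of_notMem
      rintro ⟨_ | y, hy⟩
      · simp at hy
      · have := congrArg (Option.map Fin.val) hy
        simp at this
        omega
    · apply Equiv.Perm.viaEmbedding_apply_of_notMem
      rintro ⟨_ | y, hy⟩
      · simp at hy
      · have := congrArg (Option.map Fin.val) hy
        simp at this
        omega

theorem cup_conj_left {n k : ℕ} (σ : Equiv.Perm (Fin n)) (α : S0 n) (β : S0 k) :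
    cup (conj0 σ α) β = conj0 (permLeft k σ) (cup α β) := by
  have h := incl0_left_commute (k := k) σ β
  simp only [cup, conj0, incl0_permLeft, ← Equiv.Perm.viaEmbeddingHom_apply, map_mul, map_inv] at h ⊢
  simp only [← mul_assoc, h.eq]

theorem cup_conj_right {n k : ℕ} (τ : Equiv.Perm (Fin k)) (α : S0 n) (β : S0 k) :
    cup α (conj0 τ β) = conj0 (permRight n τ) (cup α β) := by
  have h := (incl0_right_commute (n := n) τ α).inv_left
  simp only [cup, conj0, incl0_permRight, ← Equiv.Perm.viaEmbeddingHom_apply, map_mul, map_inv] at h ⊢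
  simp only [mul_assoc, h.eq]

/-! ### Graded spaces `⨁ₙ ℂ[S₀(n)] ⊗ V n` over real vector spaces `V n` -/
section Graded
variable (V : ℕ → Type*) [∀ n, AddCommGroup (V n)] [∀ n, Module ℝ (V n)]

variable {V} in
theorem fibConj_aux (n : ℕ) (c : ℂ) (z : (S0 n →₀ ℂ) ⊗[ℝ] V n) :
    (TensorProduct.map (Finsupp.mapRange.linearMap Complex.conjAe.toLinearMap) LinearMap.id :
      (S0 n →₀ ℂ) ⊗[ℝ] V n →ₗ[ℝ] (S0 n →₀ ℂ) ⊗[ℝ] V n) (c • z) =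
    conj c • (TensorProduct.map (Finsupp.mapRange.linearMap Complex.conjAe.toLinearMap)
      LinearMap.id : (S0 n →₀ ℂ) ⊗[ℝ] V n →ₗ[ℝ] (S0 n →₀ ℂ) ⊗[ℝ] V n) z := by
  induction z using TensorProduct.induction_on with
  | zero => simp
  | add x y hx hy => rw [smul_add, map_add, map_add, smul_add, hx, hy]
  | tmul η F =>
    rw [TensorProduct.smul_tmul', TensorProduct.map_tmul, TensorProduct.map_tmul,
      TensorProduct.smul_tmul']
    congr 1
    ext a
    simp

/-- `ℂ[S₀(n)] ⊗ V n`, a complex vector space. -/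
def Fib (n : ℕ) : Type _ := (S0 n →₀ ℂ) ⊗[ℝ] V n

instance (n : ℕ) : AddCommGroup (Fib V n) := inferInstanceAs (AddCommGroup ((S0 n →₀ ℂ) ⊗[ℝ] V n))
instance (n : ℕ) : Module ℂ (Fib V n) := inferInstanceAs (Module ℂ ((S0 n →₀ ℂ) ⊗[ℝ] V n))

/-- `⨁ₙ ℂ[S₀(n)] ⊗ V n`. -/
abbrev Pre : Type _ := ⨁ n, Fib V n

variable {V}

/-- `F ↦ α ⊗ F` within one degree. -/
def fibTen {n : ℕ} (α : S0 n) : V n →ₗ[ℝ] Fib V n where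
  toFun F := (Finsupp.single α (1 : ℂ) ⊗ₜ[ℝ] F : (S0 n →₀ ℂ) ⊗[ℝ] V n)
  map_add' F G := TensorProduct.tmul_add _ _ _
  map_smul' r F := by
    change _ = (r : ℂ) • (Finsupp.single α (1 : ℂ) ⊗ₜ[ℝ] F : (S0 n →₀ ℂ) ⊗[ℝ] V n)
    rw [TensorProduct.smul_tmul', ← TensorProduct.smul_tmul]
    congr 1

/-- `F ↦ α ⊗ F`, as a real linear map. -/
def tenR {n : ℕ} (α : S0 n) : V n →ₗ[ℝ] Pre V :=
  (DirectSum.lof ℂ ℕ (Fib V) n).restrictScalars ℝ ∘ₗ fibTen α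

/-- The symbol `α ⊗ F`. -/
def ten {n : ℕ} (α : S0 n) (F : V n) : Pre V := DirectSum.lof ℂ ℕ (Fib V) n (fibTen α F)

/-- The linear map with `α ⊗ F ↦ f α F`, in one degree. -/
def fibLift {n : ℕ} {P : Type*} [AddCommGroup P] [Module ℂ P] [Module ℝ P] [IsScalarTower ℝ ℂ P]
    [SMulCommClass ℝ ℂ P] (f : S0 n → V n →ₗ[ℝ] P) : Fib V n →ₗ[ℂ] P :=
  (TensorProduct.AlgebraTensorModule.lift (Finsupp.linearCombination ℂ f) :
    (S0 n →₀ ℂ) ⊗[ℝ] V n →ₗ[ℂ] P)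

theorem fibLift_fibTen {n : ℕ} {P : Type*} [AddCommGroup P] [Module ℂ P] [Module ℝ P]
    [IsScalarTower ℝ ℂ P] [SMulCommClass ℝ ℂ P] (f : S0 n → V n →ₗ[ℝ] P) (α : S0 n) (F : V n) :
    fibLift f (fibTen α F) = f α F := by
  have : fibLift f (fibTen α F) =
    (TensorProduct.AlgebraTensorModule.lift (Finsupp.linearCombination ℂ f) :
    (S0 n →₀ ℂ) ⊗[ℝ] V n →ₗ[ℂ] P) (Finsupp.single α (1 : ℂ) ⊗ₜ[ℝ] F) := rfl
  rw [this]
  simp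

theorem fib_span (n : ℕ) :
    Submodule.span ℂ (Set.range fun p : S0 n × V n => (fibTen p.1 p.2 : Fib V n)) = ⊤ := by
  rw [eq_top_iff]
  rintro z -
  refine TensorProduct.induction_on (R := ℝ) (M := S0 n →₀ ℂ) (N := V n)
    (motive := fun z => (z : Fib V n) ∈ _) z (Submodule.zero_mem _) (fun η F => ?_)
    (fun x y hx hy => Submodule.add_mem _ hx hy)
  induction η using Finsupp.induction_linear with
  | zero => rw [TensorProduct.zero_tmul]; exact Submodule.zero_mem _
  | add f g hf hg => rw [TensorProduct.add_tmul]; exact Submodule.add_mem _ hf hg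
  | single α c =>
    have h : (Finsupp.single α c ⊗ₜ[ℝ] F : (S0 n →₀ ℂ) ⊗[ℝ] V n)
        = c • (Finsupp.single α (1 : ℂ) ⊗ₜ[ℝ] F : (S0 n →₀ ℂ) ⊗[ℝ] V n) := by
      rw [TensorProduct.smul_tmul']; simp
    have h' : (c • fibTen α F : Fib V n) ∈ Submodule.span ℂ
        (Set.range fun p : S0 n × V n => (fibTen p.1 p.2 : Fib V n)) :=
      Submodule.smul_mem _ _ (Submodule.subset_span ⟨(α, F), rfl⟩)
    exact Eq.mpr (congrArg (fun w : Fib V n => w ∈ Submodule.span ℂ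
        (Set.range fun p : S0 n × V n => (fibTen p.1 p.2 : Fib V n))) h) h'

theorem fib_ext {n : ℕ} {P : Type*} [AddCommGroup P] [Module ℂ P] {f g : Fib V n →ₗ[ℂ] P}
    (h : ∀ (α : S0 n) (F : V n), f (fibTen α F) = g (fibTen α F)) : f = g :=
  LinearMap.ext_on_range (fib_span n) fun p => h p.1 p.2

/-- The linear map with `α ⊗ F ↦ f n α F`. -/
def preLift {P : Type*} [AddCommGroup P] [Module ℂ P] [Module ℝ P] [IsScalarTower ℝ ℂ P]
    [SMulCommClass ℝ ℂ P] (f : ∀ n, S0 n → V n →ₗ[ℝ] P) : Pre V →ₗ[ℂ] P :=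
  DirectSum.toModule ℂ ℕ P fun n => fibLift (f n)

theorem preLift_ten {P : Type*} [AddCommGroup P] [Module ℂ P] [Module ℝ P] [IsScalarTower ℝ ℂ P]
    [SMulCommClass ℝ ℂ P] (f : ∀ n, S0 n → V n →ₗ[ℝ] P) {n : ℕ} (α : S0 n) (F : V n) :
    preLift f (ten α F) = f n α F := by
  rw [preLift, ten, DirectSum.toModule_lof, fibLift_fibTen]

theorem pre_induction {motive : Pre V → Prop} (zero : motive 0)
    (tensor : ∀ (n : ℕ) (α : S0 n) (F : V n), motive (ten α F))
    (smul : ∀ (c : ℂ) x, motive x → motive (c • x))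
    (add : ∀ x y, motive x → motive y → motive (x + y)) (x : Pre V) :
    motive x := by
  induction x using DirectSum.induction_on with
  | zero => exact zero
  | add x y hx hy => exact add x y hx hy
  | of n z =>
    have hz : z ∈ Submodule.span ℂ (Set.range fun p : S0 n × V n => (fibTen p.1 p.2 : Fib V n)) := by
      rw [fib_span]; trivial
    induction hz using Submodule.span_induction with
    | mem z hz => obtain ⟨p, rfl⟩ := hz; exact tensor n p.1 p.2
    | zero => rw [map_zero]; exact zero
    | add x y _ _ hx hy => rw [map_add]; exact add _ _ hx hy
    | smul c x _ hx =>
      have := smul c _ hx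
      rwa [← DirectSum.lof_eq_of ℂ, ← map_smul] at this

theorem pre_ext {P : Type*} [AddCommGroup P] [Module ℂ P] {f g : Pre V →ₗ[ℂ] P}
    (h : ∀ (n : ℕ) (α : S0 n) (F : V n), f (ten α F) = g (ten α F)) : f = g := by
  refine LinearMap.ext fun x => ?_
  induction x using pre_induction with
  | zero => simp
  | tensor n α F => exact h n α F
  | smul c x hx => simp [hx]
  | add x y hx hy => simp [hx, hy]

/-- The span of all `α ⊗ F - σ α σ⁻¹ ⊗ U_σ F`, `σ ∈ S(n)`; the quotient by it is the space of
coinvariants `⨁ₙ ℂ[S₀(n)] ⊗_s V n`. -/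
def symSub (U : ∀ n, Equiv.Perm (Fin n) → V n →ₗ[ℝ] V n) : Submodule ℂ (Pre V) :=
  Submodule.span ℂ {z | ∃ (n : ℕ) (σ : Equiv.Perm (Fin n)) (α : S0 n) (F : V n),
    z = ten α F - ten (conj0 σ α) (U n σ F)}

/-- Complex conjugation of the coefficients in one degree. -/
def fibConj (n : ℕ) : Fib V n →ₗ⋆[ℂ] Fib V n where
  toFun := (TensorProduct.map (Finsupp.mapRange.linearMap Complex.conjAe.toLinearMap)
    LinearMap.id : (S0 n →₀ ℂ) ⊗[ℝ] V n →ₗ[ℝ] (S0 n →₀ ℂ) ⊗[ℝ] V n)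
  map_add' := map_add (TensorProduct.map (Finsupp.mapRange.linearMap Complex.conjAe.toLinearMap)
    LinearMap.id : (S0 n →₀ ℂ) ⊗[ℝ] V n →ₗ[ℝ] (S0 n →₀ ℂ) ⊗[ℝ] V n)
  map_smul' c x := fibConj_aux n c x

theorem fibConj_fibTen {n : ℕ} (α : S0 n) (F : V n) : fibConj n (fibTen α F) = fibTen α F := by
  change (TensorProduct.map _ _) (Finsupp.single α (1 : ℂ) ⊗ₜ[ℝ] F : (S0 n →₀ ℂ) ⊗[ℝ] V n) =
    (Finsupp.single α (1 : ℂ) ⊗ₜ[ℝ] F : (S0 n →₀ ℂ) ⊗[ℝ] V n)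
  rw [TensorProduct.map_tmul]
  simp

/-- Complex conjugation of the coefficients: the conjugate-linear map fixing every symbol
`α ⊗ F`. -/
def preConj : Pre V →ₗ⋆[ℂ] Pre V where
  toFun := DirectSum.map fun n => (fibConj n : Fib V n →ₗ⋆[ℂ] Fib V n).toAddMonoidHom
  map_add' x y := map_add _ x y
  map_smul' c x := by
    induction x using DirectSum.induction_on with
    | zero => simp
    | add x y hx hy => rw [smul_add, map_add, map_add, smul_add, hx, hy]
    | of n z =>
      rw [← DirectSum.lof_eq_of ℂ, ← map_smul, DirectSum.lof_eq_of, DirectSum.lof_eq_of,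
        DirectSum.map_of, DirectSum.map_of, ← DirectSum.lof_eq_of ℂ, ← DirectSum.lof_eq_of ℂ,
        ← map_smul]
      congr 1
      exact (fibConj n).map_smulₛₗ c z

theorem preConj_lof {n : ℕ} (z : Fib V n) : preConj (DirectSum.lof ℂ ℕ (Fib V) n z) =
    DirectSum.lof ℂ ℕ (Fib V) n (fibConj n z) := by
  change DirectSum.map _ (DirectSum.lof ℂ ℕ (Fib V) n z) = _
  rw [DirectSum.lof_eq_of, DirectSum.map_of, DirectSum.lof_eq_of]
  rfl

theorem preConj_ten {n : ℕ} (α : S0 n) (F : V n) : preConj (ten α F) = ten α F := by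
  change DirectSum.map _ (DirectSum.lof ℂ ℕ (Fib V) n (fibTen α F)) = _
  rw [DirectSum.lof_eq_of, DirectSum.map_of, ten, DirectSum.lof_eq_of]
  congr 1
  exact fibConj_fibTen α F

end Graded
/-! ### The algebra of trace polynomials -/
section Algebraic
variable (H : Type*) [NormedAddCommGroup H] [InnerProductSpace ℝ H]

/-- The algebraic tensor power `H^{⊗ n}`. -/
abbrev AlgTensor (n : ℕ) : Type _ := ⨂[ℝ]^n H

/-- `U_σ (h₁ ⊗ ⋯ ⊗ hₙ) = h_{σ⁻¹(1)} ⊗ ⋯ ⊗ h_{σ⁻¹(n)}`. -/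
def algPerm (n : ℕ) (σ : Equiv.Perm (Fin n)) : AlgTensor H n →ₗ[ℝ] AlgTensor H n :=
  (PiTensorProduct.reindex ℝ (fun _ => H) σ).toLinearMap

/-- `⨁ₙ ℂ[S₀(n)] ⊗ H^{⊗ n}`, with algebraic tensor powers. -/
abbrev APre : Type _ := Pre (AlgTensor H)

/-- The algebra `TP(H)`, spanned by the symbols `T(α ⊗ F)` with `T(σ α σ⁻¹ ⊗ U_σ F) = T(α ⊗ F)` for
`σ ∈ S(n)`. -/
abbrev TP : Type _ := APre H ⧸ symSub (algPerm H)

variable {H}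

/-- `α ⊗ F ↦ T(α ⊗ F)`. -/
def toTP : APre H →ₗ[ℂ] TP H := (symSub (algPerm H)).mkQ

theorem toTP_sym {n : ℕ} (σ : Equiv.Perm (Fin n)) (α : S0 n) (F : AlgTensor H n) :
    toTP (ten (conj0 σ α) (algPerm H n σ F)) = toTP (ten α F) := by
  exact ((Submodule.Quotient.eq (symSub (algPerm H))).2
    (Submodule.subset_span ⟨n, σ, α, F, rfl⟩)).symm

/-- `(F, G) ↦ F ⊗ G`. -/
def tensorMul {n k : ℕ} : AlgTensor H n →ₗ[ℝ] AlgTensor H k →ₗ[ℝ] AlgTensor H (n + k) :=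
  (TensorProduct.mk ℝ (⨂[ℝ]^n H) (⨂[ℝ]^k H)).compr₂ TensorPower.mulEquiv.toLinearMap

theorem tensorMul_tprod {n k : ℕ} (f : Fin n → H) (g : Fin k → H) :
    tensorMul (PiTensorProduct.tprod ℝ f) (PiTensorProduct.tprod ℝ g) =
      PiTensorProduct.tprod ℝ (Fin.append f g) :=
  TensorPower.tprod_mul_tprod ℝ f g

/-- The product `(α ⊗ F)(β ⊗ G) = (α ∪ β) ⊗ (F ⊗ G)`. -/
def preMul : APre H →ₗ[ℂ] APre H →ₗ[ℂ] APre H :=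
  preLift fun _ α =>
    { toFun := fun F => preLift fun _ β => tenR (cup α β) ∘ₗ tensorMul F
      map_add' := fun F F' => pre_ext fun k β G => by
        simp [preLift_ten]
      map_smul' := fun r F => pre_ext fun k β G => by
        simp [preLift_ten] }

theorem preMul_ten {n k : ℕ} (α : S0 n) (β : S0 k) (F : AlgTensor H n) (G : AlgTensor H k) :
    preMul (ten α F) (ten β G) = ten (cup α β) (tensorMul F G) := by
  rw [preMul, preLift_ten]
  exact preLift_ten _ β G

/-- `α ⊗ F ↦ α⁻¹ ⊗ F`, linearly. -/
def preInv : APre H →ₗ[ℂ] APre H := preLift fun _ α => tenR α⁻¹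

theorem permLeft_tensorMul {n k : ℕ} (σ : Equiv.Perm (Fin n)) (F : AlgTensor H n)
    (G : AlgTensor H k) :
    tensorMul (algPerm H n σ F) G = algPerm H (n + k) (permLeft k σ) (tensorMul F G) := by
  have : tensorMul (k := k) ∘ₗ algPerm H n σ =
      tensorMul.compr₂ (algPerm H (n + k) (permLeft k σ)) := by
    refine PiTensorProduct.ext (MultilinearMap.ext fun f => ?_)
    refine PiTensorProduct.ext (MultilinearMap.ext fun g => ?_)
    simp only [LinearMap.compMultilinearMap_apply, LinearMap.comp_apply, LinearMap.compr₂_apply,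
      algPerm, LinearEquiv.coe_coe, PiTensorProduct.reindex_tprod, tensorMul_tprod]
    congr 1
    ext i
    refine Fin.addCases (fun i => ?_) (fun i => ?_) i <;> simp [permLeft_symm_left, permLeft_symm_right]
  exact LinearMap.congr_fun (LinearMap.congr_fun this F) G

theorem permRight_tensorMul {n k : ℕ} (σ : Equiv.Perm (Fin k)) (F : AlgTensor H n)
    (G : AlgTensor H k) :
    tensorMul F (algPerm H k σ G) = algPerm H (n + k) (permRight n σ) (tensorMul F G) := by
  have : tensorMul.compl₂ (algPerm H k σ) =
      tensorMul.compr₂ (algPerm H (n + k) (permRight n σ)) := by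
    refine PiTensorProduct.ext (MultilinearMap.ext fun f => ?_)
    refine PiTensorProduct.ext (MultilinearMap.ext fun g => ?_)
    simp only [LinearMap.compMultilinearMap_apply, LinearMap.compl₂_apply, LinearMap.compr₂_apply,
      algPerm, LinearEquiv.coe_coe, tensorMul_tprod]
    erw [PiTensorProduct.reindex_tprod, tensorMul_tprod, PiTensorProduct.reindex_tprod]
    congr 1
    ext i
    refine Fin.addCases (fun i => ?_) (fun i => ?_) i <;> simp [permRight_symm_left, permRight_symm_right]
  exact LinearMap.congr_fun (LinearMap.congr_fun this F) G

theorem toTP_mul_left : symSub (algPerm H) ≤ LinearMap.ker ((preMul (H := H)).compr₂ toTP) := by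
  refine Submodule.span_le.2 ?_
  rintro _ ⟨n, σ, α, F, rfl⟩
  refine pre_ext fun k β G => ?_
  simp only [map_sub, LinearMap.sub_apply, LinearMap.compr₂_apply, preMul_ten, cup_conj_left,
    permLeft_tensorMul, toTP_sym, sub_self, LinearMap.zero_apply]

theorem toTP_mul_right :
    symSub (algPerm H) ≤ LinearMap.ker ((symSub (algPerm H)).liftQ _ (toTP_mul_left (H := H))).flip := by
  refine Submodule.span_le.2 ?_
  rintro _ ⟨n, σ, α, F, rfl⟩
  refine LinearMap.mem_ker.2 (Submodule.linearMap_qext _ (pre_ext fun k β G => ?_))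
  simp only [LinearMap.comp_apply, map_sub, LinearMap.sub_apply, LinearMap.flip_apply,
    Submodule.mkQ_apply, Submodule.liftQ_apply, LinearMap.compr₂_apply, preMul_ten,
    cup_conj_right, permRight_tensorMul, toTP_sym, sub_self, LinearMap.zero_apply]

/-- The product `T(α ⊗ F) T(β ⊗ G) = T((α ∪ β) ⊗ (F ⊗ G))`. -/
def mulTP : TP H →ₗ[ℂ] TP H →ₗ[ℂ] TP H :=
  ((symSub (algPerm H)).liftQ _ toTP_mul_right).flip

instance : Mul (TP H) := ⟨fun x y => mulTP x y⟩
/-- The unit `T((0))`, `(0) ∈ S₀(0)`. -/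
instance : One (TP H) := ⟨toTP (ten (n := 0) 1 (PiTensorProduct.tprod ℝ Fin.elim0))⟩

theorem toTP_mul (x y : APre H) : toTP x * toTP y = toTP (preMul x y) := rfl

/-- The conjugate-linear involution `α ⊗ F ↦ α⁻¹ ⊗ F`. -/
def preStar : APre H →ₗ⋆[ℂ] APre H :=
  (preInv (H := H)).comp (preConj (V := AlgTensor H))

theorem preStar_ten {n : ℕ} (α : S0 n) (F : AlgTensor H n) : preStar (ten α F) = ten α⁻¹ F := by
  rw [preStar, LinearMap.comp_apply, preConj_ten, preInv, preLift_ten]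
  rfl

/-- `x ↦ T(x*)`. -/
def toTPStar : APre H →ₗ⋆[ℂ] TP H := (toTP (H := H)).comp (preStar (H := H))

theorem toTPStar_sym : symSub (algPerm H) ≤ LinearMap.ker (toTPStar (H := H)) := by
  refine Submodule.span_le.2 ?_
  rintro _ ⟨n, σ, α, F, rfl⟩
  have h : (conj0 σ α)⁻¹ = conj0 σ α⁻¹ := by simp [conj0, mul_assoc]
  simp only [SetLike.mem_coe, LinearMap.mem_ker, map_sub, toTPStar, LinearMap.comp_apply,
    preStar_ten, h, toTP_sym, sub_self]

/-- The conjugate-linear involution `T(α ⊗ F)* = T(α⁻¹ ⊗ F)`. -/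
def starTP : TP H →ₗ⋆[ℂ] TP H := (symSub (algPerm H)).liftQ toTPStar toTPStar_sym

instance : Star (TP H) := ⟨fun x => starTP x⟩

theorem star_toTP (x : APre H) : star (toTP x) = toTP (preStar x) := rfl

/-! ### Contractions, the Laplacian and the state -/
/-- The increasing enumeration of `{1, …, n + 2} ∖ {i, j}`. -/
def pairEmb {n : ℕ} (p : {p : Fin (n + 2) × Fin (n + 2) // p.1 < p.2}) : Fin n ↪o Fin (n + 2) :=
  Finset.orderEmbOfFin ({p.1.1, p.1.2}ᶜ : Finset (Fin (n + 2))) (by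
    rw [Finset.card_compl, Finset.card_pair p.2.ne, Fintype.card_fin]; rfl)

theorem pairEmb_range {n : ℕ} (p : {p : Fin (n + 2) × Fin (n + 2) // p.1 < p.2}) (x : Fin (n + 2)) :
    x ∈ Set.range (pairEmb p) ↔ x ≠ p.1.1 ∧ x ≠ p.1.2 := by
  simp [pairEmb, and_comm]

theorem pairEmb_ne_fst {n : ℕ} (p : {p : Fin (n + 2) × Fin (n + 2) // p.1 < p.2}) (k : Fin n) :
    pairEmb p k ≠ p.1.1 :=
  ((pairEmb_range p _).1 ⟨k, rfl⟩).1

theorem pairEmb_ne_snd {n : ℕ} (p : {p : Fin (n + 2) × Fin (n + 2) // p.1 < p.2}) (k : Fin n) :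
    pairEmb p k ≠ p.1.2 :=
  ((pairEmb_range p _).1 ⟨k, rfl⟩).2

theorem firstReturn_exists {X Y : Type*} [Finite X] (f : Y ↪ X) (α : Equiv.Perm X) (y : Y) :
    ∃ m : ℕ, 0 < m ∧ (α ^ m) (f y) ∈ Set.range f :=
  ⟨orderOf α, orderOf_pos α, by simp [pow_orderOf_eq_one]⟩

open Classical in
/-- The first of the points `α(y), α²(y), …` which lies in `Y`. -/
def firstReturn {X Y : Type*} [Finite X] (f : Y ↪ X) (α : Equiv.Perm X) (y : Y) : Y :=
  (Nat.find_spec (firstReturn_exists f α y)).2.choose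

open Classical in
theorem firstReturn_spec {X Y : Type*} [Finite X] (f : Y ↪ X) (α : Equiv.Perm X) (y : Y) :
    f (firstReturn f α y) = (α ^ Nat.find (firstReturn_exists f α y)) (f y) :=
  (Nat.find_spec (firstReturn_exists f α y)).2.choose_spec

theorem firstReturn_injective {X Y : Type*} [Finite X] (f : Y ↪ X) (α : Equiv.Perm X) :
    Function.Injective (firstReturn f α) := by
  classical
  have key : ∀ y y', firstReturn f α y = firstReturn f α y' →
      Nat.find (firstReturn_exists f α y) ≤ Nat.find (firstReturn_exists f α y') → y = y' := by
    intro y y' h hle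
    have h1 := congrArg f h
    rw [firstReturn_spec, firstReturn_spec] at h1
    obtain ⟨d, hd⟩ := Nat.exists_eq_add_of_le hle
    rw [hd, pow_add, Equiv.Perm.mul_apply, (α ^ _).injective.eq_iff] at h1
    rcases Nat.eq_zero_or_pos d with rfl | hpos
    · exact f.injective (by simpa using h1)
    · have := Nat.find_min' (firstReturn_exists f α y') ⟨hpos, ⟨y, h1⟩⟩
      have h2 := (Nat.find_spec (firstReturn_exists f α y)).1
      omega
  intro y y' h
  rcases le_total (Nat.find (firstReturn_exists f α y)) (Nat.find (firstReturn_exists f α y'))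
    with hle | hle
  · exact key y y' h hle
  · exact (key y' y h.symm hle).symm

/-- The restriction of `α` to the subset `Y`: the other points are deleted from the cycles of `α`. -/
def restrictPerm {X Y : Type*} [Finite X] (f : Y ↪ X) (α : Equiv.Perm X) : Equiv.Perm Y :=
  haveI : Finite Y := Finite.of_injective f f.injective
  Equiv.ofBijective (firstReturn f α) (Finite.injective_iff_bijective.1 (firstReturn_injective f α))

/-- `τ α`, for the transposition `τ = (i j)`. -/
def transMul {n : ℕ} (p : {p : Fin (n + 2) × Fin (n + 2) // p.1 < p.2}) (α : S0 (n + 2)) : S0 (n + 2) :=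
  Equiv.swap (some p.1.1) (some p.1.2) * α

/-- `(τ α)|_{{i, j}ᶜ}`, relabelled to a permutation of `{0, …, n}` preserving the order. -/
def contrPerm {n : ℕ} (p : {p : Fin (n + 2) × Fin (n + 2) // p.1 < p.2}) (α : S0 (n + 2)) : S0 n :=
  restrictPerm (pairEmb p).toEmbedding.optionMap (transMul p α)

/-- The number of cycles which do not contain `0`. -/
def cyc0 {n : ℕ} (α : S0 n) : ℤ := cyc α - 1

/-- The power of `q` in the contraction
`C_τ(α) = q ^ (cyc₀((τ α)|_{{i, j}ᶜ}) - cyc₀(τ α) + 1) (τ α)|_{{i, j}ᶜ}`. -/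
def contrWeight (q : ℝ) {n : ℕ} (p : {p : Fin (n + 2) × Fin (n + 2) // p.1 < p.2}) (α : S0 (n + 2)) : ℝ :=
  q ^ (cyc0 (contrPerm p α) - cyc0 (transMul p α) + 1)

/-- `(h₁, …, h_{n+2}) ↦ ⟨h_i, h_j⟩ h₁ ⊗ ⋯ ⊗ ĥ_i ⊗ ⋯ ⊗ ĥ_j ⊗ ⋯ ⊗ h_{n+2}`. -/
def contrMultilinear {n : ℕ} (p : {p : Fin (n + 2) × Fin (n + 2) // p.1 < p.2}) :
    MultilinearMap ℝ (fun _ : Fin (n + 2) => H) (AlgTensor H n) where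
  toFun h := (inner ℝ (h p.1.1) (h p.1.2)) • PiTensorProduct.tprod ℝ (fun k => h (pairEmb p k))
  map_update_add' := fun {_} h m x y => by
    by_cases h1 : m = p.1.1
    · subst h1
      simp [pairEmb_ne_fst, p.2.ne', inner_add_left, add_smul]
    by_cases h2 : m = p.1.2
    · subst h2
      simp [pairEmb_ne_snd, p.2.ne, inner_add_right, add_smul]
    obtain ⟨k, rfl⟩ := (pairEmb_range p m).2 ⟨h1, h2⟩
    have key (z : H) : (fun l => Function.update h (pairEmb p k) z (pairEmb p l)) =
        Function.update (fun l => h (pairEmb p l)) k z :=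
      Function.update_comp_eq_of_injective h (pairEmb p).injective k z
    simp only [key, MultilinearMap.map_update_add, smul_add, Function.update_of_ne (Ne.symm h1),
      Function.update_of_ne (Ne.symm h2)]
  map_update_smul' := fun {_} h m c x => by
    by_cases h1 : m = p.1.1
    · subst h1
      simp [pairEmb_ne_fst, p.2.ne', inner_smul_left, mul_smul]
    by_cases h2 : m = p.1.2
    · subst h2
      simp [pairEmb_ne_snd, p.2.ne, inner_smul_right, mul_smul]
    obtain ⟨k, rfl⟩ := (pairEmb_range p m).2 ⟨h1, h2⟩
    have key (z : H) : (fun l => Function.update h (pairEmb p k) z (pairEmb p l)) =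
        Function.update (fun l => h (pairEmb p l)) k z :=
      Function.update_comp_eq_of_injective h (pairEmb p).injective k z
    simp only [key, MultilinearMap.map_update_smul, Function.update_of_ne (Ne.symm h1),
      Function.update_of_ne (Ne.symm h2)]
    rw [smul_comm]

/-- The tensor contraction `C_τ`, `τ = (i j)`. -/
def contrTensor {n : ℕ} (p : {p : Fin (n + 2) × Fin (n + 2) // p.1 < p.2}) :
    AlgTensor H (n + 2) →ₗ[ℝ] AlgTensor H n :=
  PiTensorProduct.lift (contrMultilinear p)

/-- `F ↦ ∑_τ C_τ(α) ⊗ C_τ(F)`, the sum over all transpositions `τ` in `S(n)`. -/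
def lapDeg (q : ℝ) : ∀ n : ℕ, S0 n → AlgTensor H n →ₗ[ℝ] APre H
  | 0, _ => 0
  | 1, _ => 0
  | _ + 2, α => ∑ p, contrWeight q p α • (tenR (contrPerm p α) ∘ₗ contrTensor p)

/-- The Laplacian `L = ∑_τ C_τ`. -/
def lap (q : ℝ) : APre H →ₗ[ℂ] APre H := preLift (lapDeg q)

/-- `e^L = ∑_k L^k / k!`; as `L` lowers the degree by two, only the powers `k ≤ n` can be nonzero in
degree `n`. -/
def expLap (q : ℝ) : APre H →ₗ[ℂ] APre H :=
  DirectSum.toModule ℂ ℕ _ fun n => ∑ k ∈ Finset.range (n + 1),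
    ((Nat.factorial k : ℂ)⁻¹) • (lap q ^ k) ∘ₗ DirectSum.lof ℂ ℕ (Fib (AlgTensor H)) n

/-- The functional `φ`, evaluated on the sum of `T`-symbols `T(x)`: since `T(x) = I(e^L x)`, and `φ` is
`1` on `I((0))` and vanishes on the `I`-symbols of positive degree, this is the degree `0` component
of `e^L x`. -/
def phi (q : ℝ) : APre H →ₗ[ℂ] ℂ :=
  (fibLift fun _ => Complex.ofRealCLM.toLinearMap ∘ₗ (PiTensorProduct.isEmptyEquiv (R := ℝ) (s := fun _ : Fin 0 => H) (Fin 0)).toLinearMap) ∘ₗ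
    DirectSum.component ℂ ℕ (Fib (AlgTensor H)) 0 ∘ₗ expLap q
end Algebraic

/-! ### Hilbert space tensor powers -/
section Hilbert
variable (H : Type*) [NormedAddCommGroup H] [InnerProductSpace ℝ H]

/-- A copy of the algebraic tensor power that carries the Hilbert tensor norm. -/
def HTensor (n : ℕ) : Type _ := ⨂[ℝ]^n H

instance (n : ℕ) : AddCommGroup (HTensor H n) := inferInstanceAs (AddCommGroup (⨂[ℝ]^n H))
instance (n : ℕ) : Module ℝ (HTensor H n) := inferInstanceAs (Module ℝ (⨂[ℝ]^n H))

variable {H}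

/-- `⟨f₁ ⊗ ⋯ ⊗ fₙ, g₁ ⊗ ⋯ ⊗ gₙ⟩ = ∏ i, ⟨f_i, g_i⟩`. -/
def tensorInner {n : ℕ} : AlgTensor H n →ₗ[ℝ] AlgTensor H n →ₗ[ℝ] ℝ :=
  PiTensorProduct.dualDistrib ∘ₗ PiTensorProduct.map fun _ => innerₗ H

theorem tensorInner_tprod {n : ℕ} (f g : Fin n → H) :
    tensorInner (PiTensorProduct.tprod ℝ f) (PiTensorProduct.tprod ℝ g) = ∏ i, inner ℝ (f i) (g i) := by
  simp [tensorInner, PiTensorProduct.dualDistrib_apply]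

theorem tensorInner_comm {n : ℕ} (x y : AlgTensor H n) : tensorInner x y = tensorInner y x := by
  have : tensorInner (H := H) (n := n) = tensorInner.flip := by
    refine PiTensorProduct.ext (MultilinearMap.ext fun f => ?_)
    refine PiTensorProduct.ext (MultilinearMap.ext fun g => ?_)
    simp only [LinearMap.compMultilinearMap_apply, LinearMap.flip_apply, tensorInner_tprod]
    exact Finset.prod_congr rfl fun i _ => real_inner_comm _ _
  exact LinearMap.congr_fun (LinearMap.congr_fun this x) y

theorem tensorInner_posSemidef {n : ℕ} {ι : Type*} [Finite ι] (v : ι → Fin n → H)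
    (s : Finset (Fin n)) :
    (Matrix.of fun k l => ∏ i ∈ s, inner ℝ (v k i) (v l i) : Matrix ι ι ℝ).PosSemidef := by
  induction s using Finset.cons_induction with
  | empty =>
    have h := Matrix.posSemidef_gram ℝ (fun _ : ι => (1 : ℝ))
    have h' : (Matrix.of fun k l => ∏ i ∈ (∅ : Finset (Fin n)), inner ℝ (v k i) (v l i) :
        Matrix ι ι ℝ) = Matrix.gram ℝ (fun _ : ι => (1 : ℝ)) := by
      ext k l
      simp [Matrix.gram_apply]
    rw [h']
    exact h
  | cons a s ha ih =>
    have h := Matrix.posSemidef_gram ℝ (fun k : ι => v k a)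
    have h' : (Matrix.of fun k l => ∏ i ∈ Finset.cons a s ha, inner ℝ (v k i) (v l i) :
        Matrix ι ι ℝ) = (Matrix.gram ℝ (fun k : ι => v k a)).hadamard
          (Matrix.of fun k l => ∏ i ∈ s, inner ℝ (v k i) (v l i)) := by
      ext k l
      simp only [Matrix.of_apply, Finset.prod_cons, Matrix.hadamard_apply, Matrix.gram_apply]
    rw [h']
    exact h.hadamard ih

theorem tensorInner_nonneg {n : ℕ} (x : AlgTensor H n) : 0 ≤ tensorInner x x := by
  have hx : x ∈ Submodule.span ℝ
      (Set.range (PiTensorProduct.tprod ℝ (s := fun _ : Fin n => H))) := by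
    rw [PiTensorProduct.span_tprod_eq_top]; trivial
  obtain ⟨c, rfl⟩ := Finsupp.mem_span_range_iff_exists_finsupp.1 hx
  have h := (tensorInner_posSemidef (H := H) (n := n) (fun k : c.support => k.1)
    Finset.univ).dotProduct_mulVec_nonneg fun k => c k.1
  simp only [Finsupp.sum, map_sum, LinearMap.sum_apply, map_smul, LinearMap.smul_apply,
    tensorInner_tprod, smul_eq_mul]
  refine h.trans_eq ?_
  simp only [dotProduct, Matrix.mulVec, Matrix.of_apply, Pi.star_apply, star_trivial]
  rw [← Finset.sum_coe_sort c.support]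
  refine Finset.sum_congr rfl fun k _ => ?_
  rw [← Finset.sum_coe_sort c.support, Finset.mul_sum, Finset.mul_sum]
  refine Finset.sum_congr rfl fun l _ => ?_
  rw [Finset.prod_congr rfl fun i _ => real_inner_comm (k.1 i) (l.1 i)]
  ring

/-- The inner product of the algebraic tensor power. -/
@[reducible] def tensorCore (n : ℕ) : PreInnerProductSpace.Core ℝ (HTensor H n) where
  inner x y := tensorInner (H := H) (n := n) x y
  conj_inner_symm x y := tensorInner_comm _ _
  re_inner_nonneg x := tensorInner_nonneg _
  add_left x y z := by
    exact LinearMap.congr_fun ((tensorInner (H := H) (n := n)).map_add x y) z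
  smul_left x y r := by
    exact LinearMap.congr_fun ((tensorInner (H := H) (n := n)).map_smul r x) y

instance (n : ℕ) : SeminormedAddCommGroup (HTensor H n) :=
  @InnerProductSpace.Core.toSeminormedAddCommGroup ℝ _ _ _ _ (tensorCore n)
instance (n : ℕ) : InnerProductSpace ℝ (HTensor H n) := InnerProductSpace.ofCore (tensorCore n)

variable (H) in
/-- The Hilbert space tensor power, the completion of `H^{⊗ n}`. -/
abbrev HilbTensor (n : ℕ) : Type _ := UniformSpace.Completion (HTensor H n)

/-- The identity map. -/
def ofAlg (n : ℕ) : AlgTensor H n →ₗ[ℝ] HTensor H n := LinearMap.id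

/-- The identity map. -/
def ofHTensor (n : ℕ) : HTensor H n →ₗ[ℝ] AlgTensor H n := LinearMap.id

theorem inner_ofAlg {n : ℕ} (F G : AlgTensor H n) :
    inner ℝ (ofAlg n F) (ofAlg n G) = tensorInner F G := rfl

/-- The inclusion of the algebraic in the Hilbert tensor power. -/
def toHilb (n : ℕ) : AlgTensor H n →ₗ[ℝ] HilbTensor H n :=
  (UniformSpace.Completion.toComplL (𝕜 := ℝ) (E := HTensor H n)).toLinearMap ∘ₗ ofAlg n

theorem inner_toHilb {n : ℕ} (F G : AlgTensor H n) :
    inner ℝ (toHilb n F) (toHilb n G) = tensorInner F G :=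
  UniformSpace.Completion.inner_coe (𝕜 := ℝ) (ofAlg n F) (ofAlg n G)

theorem toHilb_dense (n : ℕ) : DenseRange (toHilb (H := H) n) :=
  UniformSpace.Completion.denseRange_coe (α := HTensor H n)

/-- The extension to the Hilbert tensor power of a linear map on the algebraic tensor power which
is a contraction for the Hilbert tensor norm. -/
def hilbExtend {n : ℕ} (T : AlgTensor H n →ₗ[ℝ] AlgTensor H n)
    (hT : ∀ F, tensorInner (T F) (T F) ≤ tensorInner F F) : HilbTensor H n →L[ℝ] HilbTensor H n :=
  ContinuousLinearMap.completion (LinearMap.mkContinuous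
    (ofAlg n ∘ₗ T ∘ₗ ofHTensor n) 1 fun F => by
      rw [one_mul]
      refine abs_le_of_sq_le_sq' ?_ (norm_nonneg _) |>.2
      rw [← real_inner_self_eq_norm_sq, ← real_inner_self_eq_norm_sq]
      exact hT (ofHTensor n F))

theorem hilbExtend_toHilb {n : ℕ} (T : AlgTensor H n →ₗ[ℝ] AlgTensor H n)
    (hT : ∀ F, tensorInner (T F) (T F) ≤ tensorInner F F) (F : AlgTensor H n) :
    hilbExtend T hT (toHilb n F) = toHilb n (T F) :=
  ContinuousLinearMap.completion_apply_coe _ (ofAlg n F)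

theorem algPerm_tprod {n : ℕ} (σ : Equiv.Perm (Fin n)) (h : Fin n → H) :
    algPerm H n σ (PiTensorProduct.tprod ℝ h) = PiTensorProduct.tprod ℝ fun i => h (σ.symm i) :=
  PiTensorProduct.reindex_tprod σ h

theorem algPerm_mul {n : ℕ} (σ τ : Equiv.Perm (Fin n)) (F : AlgTensor H n) :
    algPerm H n (σ * τ) F = algPerm H n σ (algPerm H n τ F) := by
  have : algPerm H n (σ * τ) = algPerm H n σ ∘ₗ algPerm H n τ := by
    refine PiTensorProduct.ext (MultilinearMap.ext fun f => ?_)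
    simp only [LinearMap.compMultilinearMap_apply, LinearMap.comp_apply, algPerm_tprod]
    rfl
  exact LinearMap.congr_fun this F

theorem tensorInner_algPerm {n : ℕ} (σ : Equiv.Perm (Fin n)) (F G : AlgTensor H n) :
    tensorInner (algPerm H n σ F) (algPerm H n σ G) = tensorInner F G := by
  have : tensorInner.compl₁₂ (algPerm H n σ) (algPerm H n σ) = tensorInner := by
    refine PiTensorProduct.ext (MultilinearMap.ext fun f => ?_)
    refine PiTensorProduct.ext (MultilinearMap.ext fun g => ?_)
    simp only [LinearMap.compMultilinearMap_apply, LinearMap.compl₁₂_apply, algPerm_tprod,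
      tensorInner_tprod]
    exact Equiv.prod_comp σ.symm fun i => inner ℝ (f i) (g i)
  exact LinearMap.congr_fun (LinearMap.congr_fun this F) G

/-- `U_σ` on the Hilbert tensor power. -/
def hilbPerm (n : ℕ) (σ : Equiv.Perm (Fin n)) : HilbTensor H n →L[ℝ] HilbTensor H n :=
  hilbExtend (algPerm H n σ) fun F => (tensorInner_algPerm σ F F).le

theorem hilbPerm_mul {n : ℕ} (σ τ : Equiv.Perm (Fin n)) (F : HilbTensor H n) :
    hilbPerm n (σ * τ) F = hilbPerm n σ (hilbPerm n τ F) := by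
  refine (toHilb_dense n).induction_on F (isClosed_eq (by fun_prop) (by fun_prop)) fun F => ?_
  simp only [hilbPerm, hilbExtend_toHilb, algPerm_mul]

theorem inner_hilbPerm {n : ℕ} (σ : Equiv.Perm (Fin n)) (F G : HilbTensor H n) :
    inner ℝ (hilbPerm n σ F) (hilbPerm n σ G) = inner ℝ F G := by
  refine (toHilb_dense n).induction_on₂ (isClosed_eq (by fun_prop) (by fun_prop)) (fun F G => ?_) F G
  simp only [hilbPerm, hilbExtend_toHilb, inner_toHilb, tensorInner_algPerm]

/-- `P_K^{⊗ n}`, where `P_K` is the orthogonal projection onto `K`. -/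
def algProj (K : Submodule ℝ H) [K.HasOrthogonalProjection] (n : ℕ) :
    AlgTensor H n →ₗ[ℝ] AlgTensor H n :=
  PiTensorProduct.map fun _ => (K.starProjection : H →L[ℝ] H).toLinearMap

theorem algProj_tprod (K : Submodule ℝ H) [K.HasOrthogonalProjection] {n : ℕ} (h : Fin n → H) :
    algProj K n (PiTensorProduct.tprod ℝ h) = PiTensorProduct.tprod ℝ fun i => K.starProjection (h i) :=
  PiTensorProduct.map_tprod _ _

theorem tensorInner_algProj (K : Submodule ℝ H) [K.HasOrthogonalProjection] {n : ℕ}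
    (F G : AlgTensor H n) :
    tensorInner (algProj K n F) (algProj K n G) = tensorInner F (algProj K n G) := by
  have : tensorInner.compl₁₂ (algProj K n) (algProj K n) = tensorInner.compl₂ (algProj K n) := by
    refine PiTensorProduct.ext (MultilinearMap.ext fun f => ?_)
    refine PiTensorProduct.ext (MultilinearMap.ext fun g => ?_)
    simp only [LinearMap.compMultilinearMap_apply, LinearMap.compl₁₂_apply, LinearMap.compl₂_apply,
      algProj_tprod, tensorInner_tprod]
    refine Finset.prod_congr rfl fun i _ => ?_
    rw [Submodule.inner_starProjection_left_eq_right]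
    congr 1
    exact Submodule.starProjection_eq_self_iff.2 (Submodule.starProjection_apply_mem _ _)
  exact LinearMap.congr_fun (LinearMap.congr_fun this F) G

theorem tensorInner_algProj_le (K : Submodule ℝ H) [K.HasOrthogonalProjection] {n : ℕ}
    (F : AlgTensor H n) : tensorInner (algProj K n F) (algProj K n F) ≤ tensorInner F F := by
  have h := tensorInner_nonneg (F - algProj K n F)
  have h1 := tensorInner_algProj K F F
  have h2 := tensorInner_comm F (algProj K n F)
  simp only [map_sub, LinearMap.sub_apply] at h
  linarith

/-- `P_K^{⊗ n}` on the Hilbert tensor power. -/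
def hilbProj (K : Submodule ℝ H) [K.HasOrthogonalProjection] (n : ℕ) :
    HilbTensor H n →L[ℝ] HilbTensor H n :=
  hilbExtend (algProj K n) fun F => tensorInner_algProj_le K F

theorem hilbProj_hilbPerm (K : Submodule ℝ H) [K.HasOrthogonalProjection] {n : ℕ}
    (σ : Equiv.Perm (Fin n)) (F : HilbTensor H n) :
    hilbProj K n (hilbPerm n σ F) = hilbPerm n σ (hilbProj K n F) := by
  refine (toHilb_dense n).induction_on F (isClosed_eq (by fun_prop) (by fun_prop)) fun F => ?_
  simp only [hilbProj, hilbPerm, hilbExtend_toHilb]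
  congr 1
  have : algProj K n ∘ₗ algPerm H n σ = algPerm H n σ ∘ₗ algProj K n := by
    refine PiTensorProduct.ext (MultilinearMap.ext fun f => ?_)
    simp only [LinearMap.compMultilinearMap_apply, LinearMap.comp_apply, algPerm_tprod,
      algProj_tprod]
  exact LinearMap.congr_fun this F

end Hilbert

/-! ### The character `χ_q` -/
theorem cyc_inv {X : Type*} (α : Equiv.Perm X) : cyc α⁻¹ = cyc α := by
  have : Equiv.Perm.SameCycle.setoid α⁻¹ = Equiv.Perm.SameCycle.setoid α :=
    Setoid.ext fun _ _ => Equiv.Perm.sameCycle_inv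
  rw [cyc, cyc, this]

theorem cyc_conj {X : Type*} (g α : Equiv.Perm X) : cyc (g * α * g⁻¹) = cyc α := by
  refine Nat.card_congr (Quotient.congr g⁻¹ fun x y => ?_)
  exact Equiv.Perm.sameCycle_conj

theorem chi_inv (q : ℝ) {n : ℕ} (α : S0 n) : chi q α⁻¹ = chi q α := by
  rw [chi, chi, cyc_inv]

theorem chi_conj (q : ℝ) {n : ℕ} (g α : S0 n) : chi q (g * α * g⁻¹) = chi q α := by
  rw [chi, chi, cyc_conj]

theorem card_fixed {X : Type*} (γ : Equiv.Perm X) (N : ℕ) [Finite X] :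
    Nat.card {u : X → Fin N // u ∘ γ = u} = N ^ cyc γ := by
  have h (u : X → Fin N) (hu : u ∘ γ = u) (x y : X) (hxy : γ.SameCycle x y) : u x = u y := by
    obtain ⟨i, rfl⟩ := hxy
    have hz (z : X) : u (γ z) = u z := congrFun hu z
    have hn (m : ℕ) (z : X) : u ((γ ^ m) z) = u z := by
      induction m with
      | zero => rfl
      | succ m ih => rw [pow_succ', Equiv.Perm.mul_apply, hz, ih]
    obtain ⟨m, rfl | rfl⟩ := i.eq_nat_or_neg
    · rw [zpow_natCast, hn]
    · rw [← hn m ((γ ^ (-(m : ℤ))) x), ← zpow_natCast, ← Equiv.Perm.mul_apply, ← zpow_add]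
      simp
  let e : {u : X → Fin N // u ∘ γ = u} ≃ (Quotient (Equiv.Perm.SameCycle.setoid γ) → Fin N) :=
    { toFun := fun u => Quotient.lift u.1 (h u.1 u.2)
      invFun := fun f => ⟨fun x => f (Quotient.mk _ x), funext fun x => congrArg f
        (Quotient.sound (Equiv.Perm.SameCycle.symm ⟨1, by simp⟩))⟩
      left_inv := fun u => rfl
      right_inv := fun f => funext fun c => by
        induction c using Quotient.inductionOn with
        | h x => rfl }
  rw [Nat.card_congr e, Nat.card_fun, cyc, Nat.card_fin]

theorem cyc_le {n : ℕ} (α : S0 n) : cyc α ≤ n + 1 := by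
  have := Nat.card_le_card_of_surjective (Quotient.mk (Equiv.Perm.SameCycle.setoid α)) Quotient.mk_surjective
  simpa [cyc] using this

open Classical in
theorem chi_eq_sum {n : ℕ} (N : ℕ) [NeZero N] (α β : S0 n) :
    chi (1 / N) (α * β⁻¹) = ((N : ℝ) ^ (n + 1))⁻¹ *
      ∑ u : Option (Fin n) → Fin N, ∑ w : Option (Fin n) → Fin N,
        (if u ∘ α = w then 1 else 0) * (if u ∘ β = w then 1 else 0) := by
  have h0 : (N : ℝ) ≠ 0 := Nat.cast_ne_zero.2 (NeZero.ne N)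
  have h1 (u : Option (Fin n) → Fin N) : (∑ w : Option (Fin n) → Fin N,
      (if u ∘ α = w then (1 : ℝ) else 0) * (if u ∘ β = w then 1 else 0)) =
      if u ∘ (α * β⁻¹ : S0 n) = u then 1 else 0 := by
    simp only [ite_mul, one_mul, zero_mul, Finset.sum_ite_eq, Finset.mem_univ, if_true]
    refine if_congr ?_ rfl rfl
    constructor
    · intro h
      ext x
      have := congrFun h (β⁻¹ x)
      simp at this
      simp [this]
    · intro h
      ext x
      have := congrFun h (β x)
      simp at this
      simp [this]
  have h2 : (∑ u : Option (Fin n) → Fin N, if u ∘ (α * β⁻¹ : S0 n) = u then (1 : ℝ) else 0) =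
      (N : ℝ) ^ cyc (α * β⁻¹) := by
    rw [Finset.sum_boole, ← Nat.cast_pow, ← card_fixed (α * β⁻¹) N, Nat.card_eq_fintype_card,
      Fintype.card_subtype]
  rw [Finset.sum_congr rfl fun u _ => h1 u, h2, chi, one_div, inv_pow,
    pow_sub₀ _ h0 (cyc_le _), mul_inv, inv_inv]

/-! ### The Fock space -/
section Fock
variable (H : Type*) [NormedAddCommGroup H] [InnerProductSpace ℝ H]

/-- `⨁ₙ ℂ[S₀(n)] ⊗ H^{⊗ n}`, with Hilbert tensor powers. -/
abbrev HPre : Type _ := Pre (HilbTensor H)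

/-- `U_σ` as a linear map. -/
def hilbPermₗ (n : ℕ) (σ : Equiv.Perm (Fin n)) : HilbTensor H n →ₗ[ℝ] HilbTensor H n :=
  (hilbPerm n σ).toLinearMap

/-- The space `⨁ₙ ℂ[S₀(n)] ⊗_s H^{⊗ n}` with Hilbert tensor powers, the completed version of `TP(H)`,
spanned by the symbols `I(α ⊗ F)`. -/
abbrev BarTP : Type _ := HPre H ⧸ symSub (hilbPermₗ H)

variable {H}

/-- `α ⊗ F ↦ I(α ⊗ F)`. -/
def toBar : HPre H →ₗ[ℂ] BarTP H := (symSub (hilbPermₗ H)).mkQ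

theorem toBar_sym {n : ℕ} (σ : Equiv.Perm (Fin n)) (α : S0 n) (F : HilbTensor H n) :
    toBar (ten (conj0 σ α) (hilbPermₗ H n σ F)) = toBar (ten α F) :=
  ((Submodule.Quotient.eq (symSub (hilbPermₗ H))).2
    (Submodule.subset_span ⟨n, σ, α, F, rfl⟩)).symm

/-- `∑_σ χ_q(α σ β⁻¹ σ⁻¹) ⟨F, U_σ G⟩`. -/
def kernelForm (q : ℝ) {n : ℕ} (α β : S0 n) : HilbTensor H n →ₗ[ℝ] HilbTensor H n →ₗ[ℝ] ℝ :=
  ∑ σ : Equiv.Perm (Fin n),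
    chi q (α * conj0 σ β⁻¹) • (innerₗ (HilbTensor H n)).compl₂ (hilbPermₗ H n σ)

theorem kernelForm_apply (q : ℝ) {n : ℕ} (α β : S0 n) (F G : HilbTensor H n) :
    kernelForm q α β F G =
      ∑ σ : Equiv.Perm (Fin n), chi q (α * conj0 σ β⁻¹) * inner ℝ F (hilbPerm n σ G) := by
  simp [kernelForm, LinearMap.sum_apply, hilbPermₗ]

theorem conj0_inv {n : ℕ} (σ : Equiv.Perm (Fin n)) (α : S0 n) : (conj0 σ α)⁻¹ = conj0 σ α⁻¹ := by
  simp [conj0, mul_assoc]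

theorem conj0_mul {n : ℕ} (σ τ : Equiv.Perm (Fin n)) (α : S0 n) :
    conj0 (σ * τ) α = conj0 σ (conj0 τ α) := by
  simp [conj0, incl0_mul, mul_assoc]

theorem hilbPerm_inv_left {n : ℕ} (σ : Equiv.Perm (Fin n)) (F G : HilbTensor H n) :
    inner ℝ (hilbPerm n σ F) G = inner ℝ F (hilbPerm n σ⁻¹ G) := by
  rw [← inner_hilbPerm σ F, ← hilbPerm_mul, mul_inv_cancel]
  congr 1
  refine (toHilb_dense n).induction_on G (isClosed_eq (by fun_prop) (by fun_prop)) fun G => ?_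
  simp only [hilbPerm, hilbExtend_toHilb]
  congr 1
  have : algPerm H n 1 = LinearMap.id := by
    refine PiTensorProduct.ext (MultilinearMap.ext fun f => ?_)
    simp only [LinearMap.compMultilinearMap_apply, algPerm_tprod]
    rfl
  rw [this]; rfl

theorem kernelForm_conj_right (q : ℝ) {n : ℕ} (τ : Equiv.Perm (Fin n)) (α β : S0 n)
    (F G : HilbTensor H n) :
    kernelForm q α (conj0 τ β) F (hilbPermₗ H n τ G) = kernelForm q α β F G := by
  rw [kernelForm_apply, kernelForm_apply]
  refine Fintype.sum_equiv (Equiv.mulRight τ) _ _ fun σ => ?_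
  rw [Equiv.coe_mulRight, conj0_mul, hilbPerm_mul, conj0_inv]
  rfl

theorem kernelForm_symm (q : ℝ) {n : ℕ} (α β : S0 n) (F G : HilbTensor H n) :
    kernelForm q α β F G = kernelForm q β α G F := by
  rw [kernelForm_apply, kernelForm_apply]
  refine Fintype.sum_equiv (Equiv.inv _) _ _ fun σ => ?_
  rw [Equiv.inv_apply, ← hilbPerm_inv_left, real_inner_comm]
  congr 1
  rw [← chi_inv, ← chi_conj q (incl0 σ) (β * _)]
  congr 1
  simp [conj0, mul_assoc, ← incl0_inv]

theorem kernelForm_conj_left (q : ℝ) {n : ℕ} (τ : Equiv.Perm (Fin n)) (α β : S0 n)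
    (F G : HilbTensor H n) :
    kernelForm q (conj0 τ α) β (hilbPermₗ H n τ F) G = kernelForm q α β F G := by
  rw [kernelForm_symm, kernelForm_conj_right, kernelForm_symm]

/-- The bilinear form with `(α ⊗ F, β ⊗ G) ↦ ∑_σ χ_q(α σ β⁻¹ σ⁻¹) ⟨F, U_σ G⟩`; different degrees are
orthogonal. -/
def preForm (q : ℝ) : HPre H →ₗ[ℂ] HPre H →ₗ[ℂ] ℂ :=
  preLift fun n α =>
    { toFun := fun F =>
        (fibLift fun β => Complex.ofRealCLM.toLinearMap ∘ₗ kernelForm q α β F) ∘ₗ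
          DirectSum.component ℂ ℕ (Fib (HilbTensor H)) n
      map_add' := fun F F' => pre_ext fun k β G => by
        by_cases h : k = n
        · subst h
          simp [ten, DirectSum.component.lof_self, fibLift_fibTen]
        · simp [ten, DirectSum.component.of, h]
      map_smul' := fun r F => pre_ext fun k β G => by
        by_cases h : k = n
        · subst h
          simp [ten, DirectSum.component.lof_self, fibLift_fibTen]
        · simp [ten, DirectSum.component.of, h] }

theorem preForm_ten (q : ℝ) {n : ℕ} (α β : S0 n) (F G : HilbTensor H n) :
    preForm q (ten α F) (ten β G) = (kernelForm q α β F G : ℂ) := by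
  rw [preForm, preLift_ten]
  simp [ten, DirectSum.component.lof_self, fibLift_fibTen]

theorem preForm_ten_ne (q : ℝ) {n k : ℕ} (h : n ≠ k) (α : S0 n) (β : S0 k) (F : HilbTensor H n)
    (G : HilbTensor H k) : preForm q (ten α F) (ten β G) = 0 := by
  rw [preForm, preLift_ten]
  simp [ten, DirectSum.component.of, h.symm]

theorem preForm_symm (q : ℝ) (x y : HPre H) : preForm q x y = preForm q y x := by
  have : preForm (H := H) q = (preForm q).flip := by
    refine pre_ext fun n α F => pre_ext fun k β G => ?_
    rw [LinearMap.flip_apply]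
    by_cases h : n = k
    · subst h
      rw [preForm_ten, preForm_ten, kernelForm_symm]
    · rw [preForm_ten_ne q h, preForm_ten_ne q (Ne.symm h)]
  exact LinearMap.congr_fun (LinearMap.congr_fun this x) y

theorem preForm_conj (q : ℝ) (x y : HPre H) :
    preForm q (preConj x) (preConj y) = conj (preForm q x y) := by
  induction x using pre_induction with
  | zero => simp
  | smul c x hx => simp [hx]
  | add x x' hx hx' => simp [hx, hx']
  | tensor n α F =>
    induction y using pre_induction with
    | zero => simp
    | smul c x hx => simp [hx]
    | add x x' hx hx' => simp [hx, hx']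
    | tensor k β G =>
      rw [preConj_ten, preConj_ten]
      by_cases h : n = k
      · subst h
        rw [preForm_ten, Complex.conj_ofReal]
      · rw [preForm_ten_ne q h, map_zero]

theorem preConj_preConj (x : HPre H) : preConj (preConj x) = x := by
  induction x using pre_induction with
  | zero => simp
  | smul c x hx => simp [hx]
  | add x x' hx hx' => simp [hx, hx']
  | tensor n α F => rw [preConj_ten, preConj_ten]

theorem sum_comm4 {R U : Type*} [Fintype R] [Fintype U] (f : R → R → U → U → ℝ) :
    ∑ r, ∑ s, ∑ u, ∑ w, f r s u w = ∑ u, ∑ w, ∑ r, ∑ s, f r s u w := by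
  have h1 (r : R) : ∑ s, ∑ u, ∑ w, f r s u w = ∑ u, ∑ s, ∑ w, f r s u w := Finset.sum_comm
  have h2 (u : U) : ∑ r, ∑ w, ∑ s, f r s u w = ∑ w, ∑ r, ∑ s, f r s u w := Finset.sum_comm
  have h3 (r : R) (u : U) : ∑ s, ∑ w, f r s u w = ∑ w, ∑ s, f r s u w := Finset.sum_comm
  simp_rw [h1]
  rw [Finset.sum_comm]
  simp_rw [h3, h2]

open Classical in
/-- Auxiliary vectors exhibiting the kernel form as a Gram matrix. -/
def gramVec (N : ℕ) {n : ℕ} (u w : Option (Fin n) → Fin N) (α : S0 n) (F : HilbTensor H n) :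
    HilbTensor H n :=
  ∑ ρ : Equiv.Perm (Fin n), (if u ∘ conj0 ρ α = w then (1 : ℝ) else 0) • hilbPerm n ρ F

theorem kernelForm_gram (N : ℕ) [NeZero N] {n : ℕ} (α β : S0 n) (F G : HilbTensor H n) :
    (Fintype.card (Equiv.Perm (Fin n)) : ℝ) * kernelForm (1 / N) α β F G =
      ∑ u : Option (Fin n) → Fin N, ∑ w : Option (Fin n) → Fin N,
        ((N : ℝ) ^ (n + 1))⁻¹ * inner ℝ (gramVec N u w α F) (gramVec N u w β G) := by
  classical
  have h1 : (Fintype.card (Equiv.Perm (Fin n)) : ℝ) * kernelForm (1 / N) α β F G =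
      ∑ ρ : Equiv.Perm (Fin n), kernelForm (1 / N) (conj0 ρ α) β (hilbPermₗ H n ρ F) G := by
    simp only [kernelForm_conj_left, Finset.sum_const, nsmul_eq_mul, Finset.card_univ]
  rw [h1]
  simp only [kernelForm_apply, ← conj0_inv, chi_eq_sum]
  have h2 (u w : Option (Fin n) → Fin N) :
      ((N : ℝ) ^ (n + 1))⁻¹ * inner ℝ (gramVec N u w α F) (gramVec N u w β G) =
      ∑ ρ : Equiv.Perm (Fin n), ∑ σ : Equiv.Perm (Fin n), ((N : ℝ) ^ (n + 1))⁻¹ *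
        ((if u ∘ conj0 ρ α = w then 1 else 0) * (if u ∘ conj0 σ β = w then 1 else 0)) *
        inner ℝ (hilbPerm n ρ F) (hilbPerm n σ G) := by
    simp only [gramVec, sum_inner, inner_sum, inner_smul_left, inner_smul_right, Finset.mul_sum]
    rw [Finset.sum_comm]
    refine Finset.sum_congr rfl fun ρ _ => Finset.sum_congr rfl fun σ _ => ?_
    simp only [RCLike.conj_to_real]
    ring
  simp only [h2]
  rw [← sum_comm4]
  refine Finset.sum_congr rfl fun ρ _ => Finset.sum_congr rfl fun σ _ => ?_
  simp only [Finset.mul_sum, Finset.sum_mul]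
  rfl

theorem kernelForm_psd (N : ℕ) [NeZero N] {n : ℕ} {ι : Type*} (s : Finset ι) (a : ι → ℝ)
    (α : ι → S0 n) (F : ι → HilbTensor H n) :
    0 ≤ ∑ k ∈ s, ∑ l ∈ s, a k * a l * kernelForm (1 / N) (α k) (α l) (F k) (F l) := by
  have hc : (0 : ℝ) < Fintype.card (Equiv.Perm (Fin n)) := by exact_mod_cast Fintype.card_pos
  refine nonneg_of_mul_nonneg_right ?_ hc
  have h : (Fintype.card (Equiv.Perm (Fin n)) : ℝ) *
      ∑ k ∈ s, ∑ l ∈ s, a k * a l * kernelForm (1 / N) (α k) (α l) (F k) (F l) =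
      ∑ u : Option (Fin n) → Fin N, ∑ w : Option (Fin n) → Fin N, ((N : ℝ) ^ (n + 1))⁻¹ *
        inner ℝ (∑ k ∈ s, a k • gramVec N u w (α k) (F k))
          (∑ k ∈ s, a k • gramVec N u w (α k) (F k)) := by
    have h1 (k l : ι) : (Fintype.card (Equiv.Perm (Fin n)) : ℝ) *
        (a k * a l * kernelForm (1 / N) (α k) (α l) (F k) (F l)) =
        ∑ u : Option (Fin n) → Fin N, ∑ w : Option (Fin n) → Fin N, a k * a l *
          (((N : ℝ) ^ (n + 1))⁻¹ *
            inner ℝ (gramVec N u w (α k) (F k)) (gramVec N u w (α l) (F l))) := by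
      rw [mul_left_comm, kernelForm_gram]
      simp only [Finset.mul_sum]
    simp only [Finset.mul_sum, h1]
    simp only [sum_inner, inner_sum, inner_smul_left, inner_smul_right, RCLike.conj_to_real,
      Finset.mul_sum]
    rw [Finset.sum_congr rfl fun k _ => Finset.sum_comm, Finset.sum_comm]
    refine Finset.sum_congr rfl fun u _ => ?_
    rw [Finset.sum_congr rfl fun k _ => Finset.sum_comm, Finset.sum_comm]
    refine Finset.sum_congr rfl fun w _ => ?_
    rw [Finset.sum_comm]
    refine Finset.sum_congr rfl fun k _ => Finset.sum_congr rfl fun l _ => ?_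
    ring
  rw [h]
  exact Finset.sum_nonneg fun u _ => Finset.sum_nonneg fun w _ =>
    mul_nonneg (by positivity) real_inner_self_nonneg

theorem preForm_nonneg (N : ℕ) [NeZero N] (x : HPre H) :
    0 ≤ (preForm (1 / N) x (preConj x)).re := by
  have hfib (n : ℕ) (z : Fib (HilbTensor H) n) :
      0 ≤ (preForm (1 / N) (DirectSum.lof ℂ ℕ (Fib (HilbTensor H)) n z)
        (preConj (DirectSum.lof ℂ ℕ (Fib (HilbTensor H)) n z))).re := by
    have hz : z ∈ Submodule.span ℂ
        (Set.range fun p : S0 n × HilbTensor H n => (fibTen p.1 p.2 : Fib (HilbTensor H) n)) := by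
      rw [fib_span]; trivial
    obtain ⟨c, rfl⟩ := Finsupp.mem_span_range_iff_exists_finsupp.1 hz
    have h : (preForm (1 / N) (DirectSum.lof ℂ ℕ (Fib (HilbTensor H)) n
          (c.sum fun i a => a • fibTen i.1 i.2))
        (preConj (DirectSum.lof ℂ ℕ (Fib (HilbTensor H)) n
          (c.sum fun i a => a • fibTen i.1 i.2)))) =
        ∑ k ∈ c.support, ∑ l ∈ c.support, c k * conj (c l) *
          (kernelForm (1 / N) k.1 l.1 k.2 l.2 : ℂ) := by
      have ht (p : S0 n × HilbTensor H n) :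
          DirectSum.lof ℂ ℕ (Fib (HilbTensor H)) n (fibTen p.1 p.2) = ten p.1 p.2 := rfl
      simp only [Finsupp.sum, map_sum, map_smul, LinearMap.map_smulₛₗ, LinearMap.sum_apply,
        LinearMap.smul_apply, ht, preConj_ten, preForm_ten, smul_eq_mul, Finset.mul_sum]
      rw [Finset.sum_comm]
      refine Finset.sum_congr rfl fun k _ => Finset.sum_congr rfl fun l _ => ?_
      ring
    rw [h, Complex.re_sum]
    simp only [Complex.re_sum]
    have h2 (k l : S0 n × HilbTensor H n) : (c k * conj (c l) *
          (kernelForm (1 / N) k.1 l.1 k.2 l.2 : ℂ)).re =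
        (c k).re * (c l).re * kernelForm (1 / N) k.1 l.1 k.2 l.2 +
        (c k).im * (c l).im * kernelForm (1 / N) k.1 l.1 k.2 l.2 := by
      simp [Complex.mul_re]
      ring
    simp only [h2, Finset.sum_add_distrib]
    exact add_nonneg (kernelForm_psd N c.support (fun k => (c k).re) (fun k => k.1) fun k => k.2)
      (kernelForm_psd N c.support (fun k => (c k).im) (fun k => k.1) fun k => k.2)
  have hne (n k : ℕ) (hnk : n ≠ k) (z : Fib (HilbTensor H) n) (w : Fib (HilbTensor H) k) :
      preForm (1 / N) (DirectSum.lof ℂ ℕ (Fib (HilbTensor H)) n z)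
        (DirectSum.lof ℂ ℕ (Fib (HilbTensor H)) k w) = 0 := by
    have h : (preForm (H := H) (1 / N)).compl₁₂ (DirectSum.lof ℂ ℕ (Fib (HilbTensor H)) n)
        (DirectSum.lof ℂ ℕ (Fib (HilbTensor H)) k) = 0 :=
      fib_ext fun α F => fib_ext fun β G => preForm_ten_ne _ hnk α β F G
    exact LinearMap.congr_fun (LinearMap.congr_fun h z) w
  classical
  have hx : x = ∑ n ∈ DFinsupp.support x, DirectSum.lof ℂ ℕ (Fib (HilbTensor H)) n (x n) :=
    (DirectSum.sum_support_of x).symm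
  have hsum : preForm (1 / N) x (preConj x) = ∑ n ∈ DFinsupp.support x,
      preForm (1 / N) (DirectSum.lof ℂ ℕ (Fib (HilbTensor H)) n (x n))
        (preConj (DirectSum.lof ℂ ℕ (Fib (HilbTensor H)) n (x n))) := by
    conv_lhs => rw [hx]
    simp only [map_sum, LinearMap.sum_apply]
    refine Finset.sum_congr rfl fun n hn => ?_
    refine Finset.sum_eq_single n (fun k _ hk => ?_) (fun h => (h hn).elim)
    rw [preConj_lof, hne _ _ hk]
  rw [hsum, Complex.re_sum]
  exact Finset.sum_nonneg fun n _ => hfib n _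

theorem preForm_sym (q : ℝ) : symSub (hilbPermₗ H) ≤ LinearMap.ker (preForm (H := H) q) := by
  refine Submodule.span_le.2 ?_
  rintro _ ⟨n, σ, α, F, rfl⟩
  refine LinearMap.mem_ker.2 (pre_ext fun k β G => ?_)
  rw [map_sub, LinearMap.sub_apply, LinearMap.zero_apply, sub_eq_zero]
  by_cases h : n = k
  · subst h
    rw [preForm_ten, preForm_ten, kernelForm_conj_left]
  · rw [preForm_ten_ne q h, preForm_ten_ne q h]

theorem preForm_sym_right (q : ℝ) : symSub (hilbPermₗ H) ≤
    LinearMap.ker ((symSub (hilbPermₗ H)).liftQ _ (preForm_sym (H := H) q)).flip := by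
  intro z hz
  refine LinearMap.mem_ker.2 (Submodule.linearMap_qext _ (LinearMap.ext fun x => ?_))
  have h := LinearMap.congr_fun (LinearMap.mem_ker.1 (preForm_sym q hz)) x
  rw [preForm_symm] at h
  exact h

/-- The bilinear form `preForm` on the quotient. -/
def barForm (q : ℝ) : BarTP H →ₗ[ℂ] BarTP H →ₗ[ℂ] ℂ :=
  ((symSub (hilbPermₗ H)).liftQ _ (preForm_sym_right q)).flip

theorem barForm_toBar (q : ℝ) (x y : HPre H) :
    barForm q (toBar x) (toBar y) = preForm q x y := rfl

/-- `x ↦ I(x̄)`. -/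
def toBarConj : HPre H →ₗ⋆[ℂ] BarTP H := (toBar (H := H)).comp (preConj (V := HilbTensor H))

theorem toBarConj_sym : symSub (hilbPermₗ H) ≤ LinearMap.ker (toBarConj (H := H)) := by
  refine Submodule.span_le.2 ?_
  rintro _ ⟨n, σ, α, F, rfl⟩
  simp only [SetLike.mem_coe, LinearMap.mem_ker, map_sub, toBarConj, LinearMap.comp_apply,
    preConj_ten, toBar_sym, sub_self]

/-- The complex conjugation of the coefficients, which fixes every `I(α ⊗ F)`. -/
def barConj : BarTP H →ₗ⋆[ℂ] BarTP H := (symSub (hilbPermₗ H)).liftQ toBarConj toBarConj_sym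

theorem barConj_toBar (x : HPre H) : barConj (toBar x) = toBar (preConj x) := rfl

/-- The form `⟨x, y⟩_q`, linear in `x`, with
`⟨α ⊗ F, β ⊗ G⟩_q = δ_{nk} ∑_σ χ_q(α σ β⁻¹ σ⁻¹) ⟨F, U_σ G⟩`. -/
def barInner (q : ℝ) (x y : BarTP H) : ℂ := barForm q x (barConj y)

theorem toBar_surjective : Function.Surjective (toBar (H := H)) := Submodule.mkQ_surjective _

variable (H) in
/-- `BarTP H` with the semi-inner product `⟨x, y⟩_{1/N}`. -/
def FockPre (_N : ℕ) : Type _ := BarTP H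

instance (N : ℕ) : AddCommGroup (FockPre H N) := inferInstanceAs (AddCommGroup (BarTP H))
instance (N : ℕ) : Module ℂ (FockPre H N) := inferInstanceAs (Module ℂ (BarTP H))

/-- The semi-inner product; in Mathlib's convention it is linear in the second argument, so that
`inner ℂ x y = ⟨y, x⟩_{1/N}`. -/
@[reducible] def fockCore (N : ℕ) [NeZero N] : PreInnerProductSpace.Core ℂ (FockPre H N) where
  inner x y := barInner (H := H) (1 / N) y x
  conj_inner_symm x y := by
    obtain ⟨x, rfl⟩ := toBar_surjective x
    obtain ⟨y, rfl⟩ := toBar_surjective y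
    simp only [barInner, barConj_toBar, barForm_toBar]
    rw [← preForm_conj, preConj_preConj, preForm_symm]
  re_inner_nonneg x := by
    obtain ⟨x, rfl⟩ := toBar_surjective x
    exact preForm_nonneg N x
  add_left x y z := by
    have h : barConj (H := H) (x + y) = barConj x + barConj y := map_add _ _ _
    change barForm _ _ (barConj (H := H) (x + y)) = _
    rw [h, map_add]
    rfl
  smul_left x y r := by
    have h : barConj (H := H) (r • x) = conj r • barConj x := LinearMap.map_smulₛₗ _ _ _
    change barForm _ _ (barConj (H := H) (r • x)) = _
    rw [h, map_smul]
    rfl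

instance (N : ℕ) [NeZero N] : SeminormedAddCommGroup (FockPre H N) :=
  @InnerProductSpace.Core.toSeminormedAddCommGroup ℂ _ _ _ _ (fockCore N)
instance (N : ℕ) [NeZero N] : InnerProductSpace ℂ (FockPre H N) :=
  InnerProductSpace.ofCore (fockCore N)

variable (H) in
/-- The Fock space `F_{1/N}(H)`: the Hausdorff completion of `BarTP H` for `⟨·, ·⟩_{1/N}`, that is, the
completion of the quotient of `BarTP H` by the kernel of this form. -/
abbrev Fock (N : ℕ) [NeZero N] : Type _ := UniformSpace.Completion (FockPre H N)

/-- The identity map. -/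
def ofBar (N : ℕ) : BarTP H →ₗ[ℂ] FockPre H N := LinearMap.id

/-- The canonical map from `BarTP H` to the Fock space. -/
def barToFock (N : ℕ) [NeZero N] : BarTP H →ₗ[ℂ] Fock H N :=
  (UniformSpace.Completion.toComplL (𝕜 := ℂ) (E := FockPre H N)).toLinearMap ∘ₗ ofBar N

theorem inner_barToFock (N : ℕ) [NeZero N] (x y : BarTP H) :
    inner ℂ (barToFock N x) (barToFock N y) = barInner (1 / N) y x :=
  UniformSpace.Completion.inner_coe (𝕜 := ℂ) (ofBar N x) (ofBar N y)

/-- The symbol `I(α ⊗ F)`. -/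
def symI {n : ℕ} (α : S0 n) (F : HilbTensor H n) : BarTP H := toBar (ten α F)

/-- The inclusion of `TP(H)` in `BarTP H`: the element `T(x)` is `I(e^L x)`. -/
def algToBar (q : ℝ) : APre H →ₗ[ℂ] BarTP H :=
  toBar ∘ₗ (preLift fun n α => tenR α ∘ₗ toHilb n) ∘ₗ expLap q

theorem preGamma_sym (K : Submodule ℝ H) [K.HasOrthogonalProjection] :
    symSub (hilbPermₗ H) ≤ LinearMap.ker (toBar ∘ₗ
      (preLift fun n α => tenR α ∘ₗ (hilbProj K n).toLinearMap : HPre H →ₗ[ℂ] HPre H)) := by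
  refine Submodule.span_le.2 ?_
  rintro _ ⟨n, σ, α, F, rfl⟩
  have h : hilbProj K n (hilbPermₗ H n σ F) = hilbPermₗ H n σ (hilbProj K n F) :=
    hilbProj_hilbPerm K σ F
  rw [SetLike.mem_coe, LinearMap.mem_ker, map_sub, LinearMap.comp_apply, LinearMap.comp_apply,
    preLift_ten, preLift_ten, LinearMap.comp_apply, LinearMap.comp_apply,
    ContinuousLinearMap.coe_coe, h, sub_eq_zero]
  exact (toBar_sym σ α (hilbProj K n F)).symm

/-- The algebraic conditional expectation `φ[· | K] = Γ(P_K)`,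
`I(α ⊗ F) ↦ I(α ⊗ P_K^{⊗ n} F)`. -/
def barGamma (K : Submodule ℝ H) [K.HasOrthogonalProjection] : BarTP H →ₗ[ℂ] BarTP H :=
  (symSub (hilbPermₗ H)).liftQ _ (preGamma_sym K)

theorem barGamma_symI (K : Submodule ℝ H) [K.HasOrthogonalProjection] {n : ℕ} (α : S0 n)
    (F : HilbTensor H n) : barGamma K (symI α F) = symI α (hilbProj K n F) :=
  congrArg toBar (preLift_ten _ α F)

/-- The square of the norm of `BarTP H` induced by the Hilbert tensor norms: `⟨z, z⟩_0`. -/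
def baseNormSq (z : BarTP H) : ℝ := (barInner 0 z z).re

/-- `m` and `s` are the extensions of the product and of the involution of `TP(H)` to `BarTP H`: on
`TP(H)` they are the given ones, and `I(α ⊗ F) I(β ⊗ G)` and `I(α ⊗ F)*` depend continuously on
`F` and `G` in the Hilbert tensor norms. -/
structure IsStarAlgExtension (q : ℝ) (m : BarTP H →ₗ[ℂ] BarTP H →ₗ[ℂ] BarTP H)
    (s : BarTP H →ₗ⋆[ℂ] BarTP H) : Prop where
  mul_alg : ∀ x y : APre H, m (algToBar q x) (algToBar q y) = algToBar q (preMul x y)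
  star_alg : ∀ x : APre H, s (algToBar q x) = algToBar q (preStar x)
  mul_bound : ∀ (n k : ℕ) (α : S0 n) (β : S0 k), ∃ C : ℝ,
    ∀ (F : HilbTensor H n) (G : HilbTensor H k),
      baseNormSq (m (symI α F) (symI β G)) ≤ C * (‖F‖ * ‖G‖) ^ 2
  star_bound : ∀ (n : ℕ) (α : S0 n), ∃ C : ℝ, ∀ F : HilbTensor H n,
    baseNormSq (s (symI α F)) ≤ C * ‖F‖ ^ 2

end Fock


/-! ### Gaussian Hermitian matrices -/
section RandomMatrix
variable {Ω : Type*} [MeasurableSpace Ω] {N : ℕ}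

/-- `b i j`, for `1 ≤ i, j ≤ N`, are independent standard Gaussian processes indexed by the real
Hilbert space `H`: each is a centered Gaussian process with covariance `⟨h, g⟩`. -/
structure IsStdGaussianFamily {H : Type*} [NormedAddCommGroup H] [InnerProductSpace ℝ H]
    (b : Fin N → Fin N → H → Ω → ℝ) (P : Measure Ω) : Prop where
  measurable : ∀ i j h, Measurable (b i j h)
  gaussian : ∀ i j, IsGaussianProcess (b i j) P
  centered : ∀ i j h, ∫ ω, b i j h ω ∂P = 0
  covariance : ∀ i j h g, ∫ ω, b i j h ω * b i j g ω ∂P = inner ℝ h g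
  indep : iIndepFun (fun (p : Fin N × Fin N) ω (h : H) => b p.1 p.2 h ω) P

/-- The Hermitian Gaussian process `X(h)`, a random `N × N` Hermitian matrix for each `h`. -/
def gaussMat {H : Type*} (b : Fin N → Fin N → H → Ω → ℝ) (h : H) (ω : Ω) :
    Matrix (Fin N) (Fin N) ℂ :=
  Matrix.of fun i j =>
    if i < j then ((b i j h ω : ℂ) + Complex.I * (b j i h ω : ℂ)) / (√(2 * N) : ℝ)
    else if i = j then (b i j h ω : ℂ) / (√N : ℝ)
    else ((b j i h ω : ℂ) - Complex.I * (b i j h ω : ℂ)) / (√(2 * N) : ℝ)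

/-- The product `x_{i} x_{α(i)} x_{α²(i)} ⋯` once along the cycle of `α` through `i`, where
`x_0 = 1`. -/
def cycleWord {n : ℕ} (α : S0 n) (x : Fin n → Matrix (Fin N) (Fin N) ℂ) (i : Option (Fin n)) :
    Matrix (Fin N) (Fin N) ℂ :=
  ((List.range (Function.minimalPeriod α i)).map fun k => ((α ^ k) i).elim 1 x).prod

open Classical in
/-- `Tr_α(x₁, …, xₙ)`: the product along the cycle of `0`, times the product over the other cycles
of the un-normalized traces of the products along these cycles. -/
def trAlpha {n : ℕ} (α : S0 n) (x : Fin n → Matrix (Fin N) (Fin N) ℂ) :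
    Matrix (Fin N) (Fin N) ℂ :=
  (∏ c : {c : Quotient (Equiv.Perm.SameCycle.setoid α) // c ≠ Quotient.mk _ none},
    (cycleWord α x c.1.out).trace) • cycleWord α x none

/-- Random matrices up to almost sure equality, with their pointwise `*`-algebra structure. -/
abbrev RandMat (N : ℕ) (P : Measure Ω) : Type _ := Ω →ₘ[P] Matrix (Fin N) (Fin N) ℂ

/-- The entry-wise expectation `(I ⊗ 𝔼)[Y]`. -/
def expMat {P : Measure Ω} (Y : RandMat N P) : Matrix (Fin N) (Fin N) ℂ :=
  Matrix.of fun i j => ∫ ω, Y ω i j ∂P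

/-- `N × N` matrices whose entries are polynomials in the formal entries of matrices `x^{(h)}`,
`h ∈ H`. -/
abbrev PolyMat (H : Type*) (N : ℕ) : Type _ :=
  Matrix (Fin N) (Fin N) (MvPolynomial (H × Fin N × Fin N) ℂ)

/-- The substitution `x^{(h)} ↦ U x^{(h)} U*` for all `h`. -/
def conjSubst {H : Type*} (U : Matrix (Fin N) (Fin N) ℂ) :
    MvPolynomial (H × Fin N × Fin N) ℂ →ₐ[ℂ] MvPolynomial (H × Fin N × Fin N) ℂ :=
  MvPolynomial.aeval fun v => (U.map MvPolynomial.C *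
    Matrix.of (fun i j => MvPolynomial.X (v.1, i, j)) *
      (star U).map MvPolynomial.C : PolyMat H N) v.2.1 v.2.2

/-- Equivariance: `Q(U x^{(h)} U* : h ∈ H) = U Q(x^{(h)} : h ∈ H) U*` for all unitary `U`. -/
def IsEquivariant {H : Type*} (Q : PolyMat H N) : Prop :=
  ∀ U ∈ Matrix.unitaryGroup (Fin N) ℂ,
    Q.map (conjSubst U) = U.map MvPolynomial.C * Q * (star U).map MvPolynomial.C

/-- The value `Q(X(h) : h ∈ H)`. -/
def evalMat {H : Type*} (b : Fin N → Fin N → H → Ω → ℝ) (Q : PolyMat H N) (ω : Ω) :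
    Matrix (Fin N) (Fin N) ℂ :=
  Q.map (MvPolynomial.eval fun v => gaussMat b v.1 ω v.2.1 v.2.2)

/-- The algebra of equivariant polynomial matrices in the process `X`. -/
def Aequiv {H : Type*} (b : Fin N → Fin N → H → Ω → ℝ) (P : Measure Ω) : Set (RandMat N P) :=
  {Y | ∃ Q : PolyMat H N, IsEquivariant Q ∧ Y =ᵐ[P] evalMat b Q}

/-- Square integrability of all entries. -/
def MemL2 {P : Measure Ω} (Y : RandMat N P) : Prop := ∀ i j, MemLp (fun ω => Y ω i j) 2 P

/-- The `L²` completion of `Aequiv b P`, realized as its closure in the square integrable random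
matrices. -/
def A2equiv {H : Type*} (b : Fin N → Fin N → H → Ω → ℝ) (P : Measure Ω) : Set (RandMat N P) :=
  {Y | MemL2 Y ∧ ∀ ε : ENNReal, 0 < ε → ∃ Z ∈ Aequiv b P, ∀ i j,
    eLpNorm (fun ω => Y ω i j - Z ω i j) 2 P < ε}

/-- The σ-algebra generated by (the entries of) `X(h)`, `h ∈ K`. -/
@[reducible] def sigmaX {H : Type*} (b : Fin N → Fin N → H → Ω → ℝ) (K : Set H) : MeasurableSpace Ω :=
  ⨆ h ∈ K, ⨆ i, ⨆ j, (inferInstance : MeasurableSpace ℂ).comap fun ω => gaussMat b h ω i j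

end RandomMatrix

end TracePoly

end

open TracePoly

set_option linter.unusedSectionVars false
set_option linter.unusedSimpArgs false

noncomputable section
namespace TracePoly

/-! ### Shortcuts for instances -/
namespace InstanceShortcuts
variable {H : Type*} [NormedAddCommGroup H] [InnerProductSpace ℝ H]

scoped instance : AddCommGroup (TP H) := inferInstance
scoped instance : AddCommMonoid (TP H) := inferInstance
scoped instance : Module ℝ (TP H) := inferInstance
scoped instance : SMul ℝ (TP H) := inferInstance
scoped instance : IsScalarTower ℝ ℂ (TP H) := inferInstance
scoped instance : SMulCommClass ℝ ℝ (TP H) := inferInstance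
scoped instance : AddCommGroup (BarTP H) := inferInstance
scoped instance : AddCommMonoid (BarTP H) := inferInstance
scoped instance : Module ℝ (BarTP H) := inferInstance
scoped instance : SMul ℝ (BarTP H) := inferInstance
scoped instance : IsScalarTower ℝ ℂ (BarTP H) := inferInstance
scoped instance : SMulCommClass ℂ ℝ (BarTP H) := inferInstance
scoped instance : SMulCommClass ℝ ℝ (BarTP H) := inferInstance

end InstanceShortcuts

open scoped InstanceShortcuts

/-! ### Restrictions of permutations -/
section Restrict
variable {X Y Z X' Y' : Type*} [Finite X] [Finite X']

theorem apply_pow_of_invariant {C : Type*} {f : Y ↪ X} {σ : Equiv.Perm X} {u : X → C}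
    (hu : ∀ x ∉ Set.range f, u (σ x) = u x) (x : X) (m : ℕ)
    (hm : ∀ l < m, (σ ^ l) x ∉ Set.range f) : u ((σ ^ m) x) = u x := by
  induction m with
  | zero => rfl
  | succ m ih =>
    rw [pow_succ', Equiv.Perm.mul_apply, hu _ (hm m m.lt_succ_self)]
    exact ih fun l hl => hm l (hl.trans m.lt_succ_self)

/-- A function which is invariant under `σ` off the range of `f` sees `σ` on the range of `f` only
through the restricted permutation. -/
theorem apply_restrictPerm {C : Type*} {f : Y ↪ X} {σ : Equiv.Perm X} {u : X → C}
    (hu : ∀ x ∉ Set.range f, u (σ x) = u x) (y : Y) :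
    u (σ (f y)) = u (f (restrictPerm f σ y)) := by
  classical
  have h1 : f (restrictPerm f σ y) = (σ ^ Nat.find (firstReturn_exists f σ y)) (f y) := by
    rw [← firstReturn_spec]; rfl
  obtain ⟨m, hm⟩ := Nat.exists_eq_add_of_lt (Nat.find_spec (firstReturn_exists f σ y)).1
  rw [h1, hm, zero_add, pow_succ, Equiv.Perm.mul_apply]
  refine (apply_pow_of_invariant hu _ m fun l hl hl' => ?_).symm
  have h2 := Nat.find_min (firstReturn_exists f σ y) (m := l + 1) (by omega)
  exact h2 ⟨by omega, by rwa [pow_succ, Equiv.Perm.mul_apply]⟩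

open Classical in
/-- The first of the points `x, σ x, σ² x, …` in the range of `f`, if there is one. -/
def firstHit (f : Y ↪ X) (σ : Equiv.Perm X) (x : X) : Option Y :=
  if h : ∃ m : ℕ, (σ ^ m) x ∈ Set.range f then some (Nat.find_spec h).choose else none

theorem firstHit_apply (f : Y ↪ X) (σ : Equiv.Perm X) (y : Y) : firstHit f σ (f y) = some y := by
  classical
  have h : ∃ m : ℕ, (σ ^ m) (f y) ∈ Set.range f := ⟨0, y, rfl⟩
  have h0 : Nat.find h = 0 := (Nat.find_eq_zero h).2 ⟨y, rfl⟩
  rw [firstHit, dif_pos h]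
  congr 1
  apply f.injective
  rw [(Nat.find_spec h).choose_spec, h0]
  rfl

theorem firstHit_invariant (f : Y ↪ X) (σ : Equiv.Perm X) (x : X) (hx : x ∉ Set.range f) :
    firstHit f σ (σ x) = firstHit f σ x := by
  classical
  have h3 (m : ℕ) : (σ ^ m) (σ x) = (σ ^ (m + 1)) x := by rw [pow_succ, Equiv.Perm.mul_apply]
  by_cases h : ∃ m : ℕ, (σ ^ m) x ∈ Set.range f
  · have h' : ∃ m : ℕ, (σ ^ m) (σ x) ∈ Set.range f := by
      obtain ⟨m, hm⟩ := h
      rcases m with _ | m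
      · exact (hx hm).elim
      · exact ⟨m, by rwa [h3]⟩
    have h1 : Nat.find h = Nat.find h' + 1 := by
      rw [Nat.find_eq_iff]
      refine ⟨by rw [← h3]; exact Nat.find_spec h', fun l hl hl' => ?_⟩
      rcases l with _ | l
      · exact hx hl'
      · exact Nat.find_min h' (by omega : l < _) (by rwa [h3])
    rw [firstHit, dif_pos h', firstHit, dif_pos h]
    congr 1
    apply f.injective
    rw [(Nat.find_spec h).choose_spec, (Nat.find_spec h').choose_spec, h1, h3]
  · have h' : ¬ ∃ m : ℕ, (σ ^ m) (σ x) ∈ Set.range f := by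
      rintro ⟨m, hm⟩
      exact h ⟨m + 1, by rwa [← h3]⟩
    rw [firstHit, dif_neg h', firstHit, dif_neg h]

theorem restrictPerm_unique {f : Y ↪ X} {σ : Equiv.Perm X} {ρ : Equiv.Perm Y}
    (h : ∀ u : X → Option Y, (∀ x ∉ Set.range f, u (σ x) = u x) → ∀ y, u (σ (f y)) = u (f (ρ y))) :
    restrictPerm f σ = ρ := by
  ext1 y
  have h1 := h _ (firstHit_invariant f σ) y
  rw [apply_restrictPerm (firstHit_invariant f σ), firstHit_apply, firstHit_apply] at h1
  exact Option.some_injective _ h1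

theorem restrictPerm_trans [Finite Y] (g : Z ↪ Y) (f : Y ↪ X) (σ : Equiv.Perm X) :
    restrictPerm (g.trans f) σ = restrictPerm g (restrictPerm f σ) := by
  refine restrictPerm_unique fun u hu z => ?_
  have hu1 : ∀ x ∉ Set.range f, u (σ x) = u x := fun x hx =>
    hu x fun ⟨z, hz⟩ => hx ⟨g z, hz⟩
  have h2 : ∀ y ∉ Set.range g, (u ∘ f) (restrictPerm f σ y) = (u ∘ f) y := fun y hy => by
    rw [Function.comp, ← apply_restrictPerm hu1]
    exact hu _ fun ⟨z, hz⟩ => hy ⟨z, f.injective hz⟩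
  have h3 := apply_restrictPerm h2 z
  simp only [Function.comp] at h3
  exact (apply_restrictPerm hu1 (g z)).trans h3

theorem restrictPerm_mul_left (f : Y ↪ X) (σ τ : Equiv.Perm X) (τ' : Equiv.Perm Y)
    (h1 : ∀ y, τ (f y) = f (τ' y)) (h2 : ∀ x ∉ Set.range f, τ x = x) :
    restrictPerm f (τ * σ) = τ' * restrictPerm f σ := by
  refine restrictPerm_unique fun u hu y => ?_
  have h3 : ∀ x ∉ Set.range f, (u ∘ τ) (σ x) = (u ∘ τ) x := fun x hx => by
    simpa [h2 x hx] using hu x hx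
  have h4 := apply_restrictPerm h3 y
  simpa [h1] using h4

theorem restrictPerm_conj (f : Y ↪ X) (σ κ : Equiv.Perm X) (h1 : ∀ y, κ (f y) = f y) :
    restrictPerm f (κ * σ * κ⁻¹) = restrictPerm f σ := by
  have h1' (y : Y) : κ⁻¹ (f y) = f y := by rw [Equiv.Perm.inv_eq_iff_eq, h1]
  refine restrictPerm_unique fun u hu y => ?_
  have h3 : ∀ x ∉ Set.range f, (u ∘ κ) (σ x) = (u ∘ κ) x := fun x hx => by
    have := hu (κ x) (fun ⟨y, hy⟩ => hx ⟨y, by rw [← h1 y] at hy; exact κ.injective hy⟩)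
    simpa using this
  rw [Equiv.Perm.mul_apply, Equiv.Perm.mul_apply, h1']
  simpa [h1] using apply_restrictPerm h3 y

theorem restrictPerm_inv (f : Y ↪ X) (σ : Equiv.Perm X) :
    restrictPerm f σ⁻¹ = (restrictPerm f σ)⁻¹ := by
  refine restrictPerm_unique fun u hu y => ?_
  have h3 : ∀ x ∉ Set.range f, (fun x => u (σ⁻¹ x)) (σ x) = (fun x => u (σ⁻¹ x)) x := fun x hx => by
    have := hu x hx
    simp_all
  simpa using (apply_restrictPerm (u := fun x => u (σ⁻¹ x)) h3 ((restrictPerm f σ)⁻¹ y)).symm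

theorem restrictPerm_equiv (f : Y ↪ X) (f' : Y' ↪ X') (eX : X ≃ X') (eY : Y ≃ Y')
    (h : ∀ y, f' (eY y) = eX (f y)) (σ : Equiv.Perm X) :
    restrictPerm f' (eX.permCongr σ) = eY.permCongr (restrictPerm f σ) := by
  refine restrictPerm_unique fun u hu y => ?_
  obtain ⟨y, rfl⟩ := eY.surjective y
  have h3 : ∀ x ∉ Set.range f, (u ∘ eX) (σ x) = (u ∘ eX) x := fun x hx => by
    have := hu (eX x) (fun ⟨y', hy⟩ => hx ⟨eY.symm y', eX.injective (by rw [← h]; simpa using hy)⟩)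
    simpa using this
  simpa [h] using apply_restrictPerm h3 y

theorem restrictPerm_of_equiv (f : Y ≃ X) (σ : Equiv.Perm X) :
    restrictPerm f.toEmbedding σ = f.symm.permCongr σ := by
  refine restrictPerm_unique fun u _ y => ?_
  simp

/-! ### Counting and summing over colourings -/

variable (N : ℕ) [NeZero N]

/-- The number of colourings that vanish on the range of `f` and are `σ`-invariant off it: this is
`N ^ k`, where `k` is the number of cycles of `σ` which miss the range of `f`. -/
def kerCard (f : Y ↪ X) (σ : Equiv.Perm X) : ℕ :=
  Nat.card {u : X → Fin N // (∀ y, u (f y) = 0) ∧ ∀ x ∉ Set.range f, u (σ x) = u x}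

theorem kerCard_eq_fiber (f : Y ↪ X) (σ : Equiv.Perm X) (v : Y → Fin N) :
    Nat.card {u : X → Fin N // u ∘ f = v ∧ ∀ x ∉ Set.range f, u (σ x) = u x} = kerCard N f σ := by
  let u₀ : X → Fin N := fun x => (firstHit f σ x).elim 0 v
  have h1 (y : Y) : u₀ (f y) = v y := by simp [u₀, firstHit_apply]
  have h2 (x : X) (hx : x ∉ Set.range f) : u₀ (σ x) = u₀ x := by
    simp [u₀, firstHit_invariant f σ x hx]
  refine Nat.card_congr ((Equiv.subRight u₀).subtypeEquiv fun u => ?_)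
  simp only [Equiv.subRight_apply, Pi.sub_apply, h1, sub_eq_zero, funext_iff, Function.comp]
  refine and_congr_right fun _ => forall₂_congr fun x hx => ?_
  rw [h2 x hx, sub_left_inj]

open Classical in
/-- Summation over the colours of the points outside of the range of `f`. -/
theorem sum_coloring [Fintype X] [Fintype Y] {R : Type*} [CommSemiring R] (f : Y ↪ X)
    (σ : Equiv.Perm X) (φ : (Y → Fin N) → (Y → Fin N) → R) :
    (∑ u : X → Fin N, if ∀ x ∉ Set.range f, u (σ x) = u x then φ (u ∘ f) (u ∘ σ ∘ f) else 0) =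
      kerCard N f σ * ∑ v : Y → Fin N, φ v (v ∘ restrictPerm f σ) := by
  rw [Finset.mul_sum, ← Finset.sum_fiberwise _ fun u : X → Fin N => u ∘ f]
  refine Finset.sum_congr rfl fun v _ => ?_
  have h : ∀ u ∈ ({u : X → Fin N | u ∘ f = v} : Finset (X → Fin N)),
      (if ∀ x ∉ Set.range f, u (σ x) = u x then φ (u ∘ f) (u ∘ σ ∘ f) else 0) =
      if ∀ x ∉ Set.range f, u (σ x) = u x then φ v (v ∘ restrictPerm f σ) else 0 := by
    intro u hu
    have hu' : u ∘ f = v := by simpa using hu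
    refine if_ctx_congr Iff.rfl (fun hu1 => ?_) fun _ => rfl
    rw [← hu']
    congr 1
    ext1 y
    exact apply_restrictPerm hu1 y
  rw [Finset.sum_congr rfl h, ← kerCard_eq_fiber N f σ v, Nat.card_eq_fintype_card,
    Fintype.card_subtype, ← Finset.sum_filter, Finset.filter_filter, Finset.sum_const, nsmul_eq_mul]

theorem pow_cyc_eq (f : Y ↪ X) (σ : Equiv.Perm X) :
    N ^ cyc σ = kerCard N f σ * N ^ cyc (restrictPerm f σ) := by
  classical
  have := Fintype.ofFinite X
  have : Finite Y := Finite.of_injective f f.injective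
  have := Fintype.ofFinite Y
  have h := sum_coloring (R := ℕ) N f σ fun v w => if w = v then 1 else 0
  rw [← card_fixed σ N, ← card_fixed (restrictPerm f σ) N]
  simp only [Nat.card_eq_fintype_card, Fintype.card_subtype, Finset.card_filter, Nat.cast_id] at h ⊢
  rw [← h]
  refine Finset.sum_congr rfl fun u _ => ?_
  rw [← ite_and]
  refine if_congr ⟨fun h => ⟨fun x _ => congrFun h x, ?_⟩, fun h => ?_⟩ rfl rfl
  · rw [← Function.comp_assoc, h]
  · ext1 x
    by_cases hx : x ∈ Set.range f
    · obtain ⟨y, rfl⟩ := hx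
      exact congrFun h.2 y
    · exact h.1 x hx

/-- The number of cycles that miss the range of `f` is the same if there is a bijection of the
invariant colourings vanishing there. -/
theorem cyc_sub_congr {f : Y ↪ X} {σ : Equiv.Perm X} {f' : Y' ↪ X'} {σ' : Equiv.Perm X'}
    (h : kerCard 2 f σ = kerCard 2 f' σ') :
    (cyc σ : ℤ) - cyc (restrictPerm f σ) = cyc σ' - cyc (restrictPerm f' σ') := by
  have h1 := pow_cyc_eq 2 f σ
  have h2 := pow_cyc_eq 2 f' σ'
  have h3 : 2 ^ (cyc σ + cyc (restrictPerm f' σ')) = 2 ^ (cyc σ' + cyc (restrictPerm f σ)) := by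
    rw [pow_add, pow_add, h1, h2, h]; ring
  have := Nat.pow_right_injective le_rfl h3
  omega

theorem cyc_sub_mul_left (f : Y ↪ X) (σ τ : Equiv.Perm X) (τ' : Equiv.Perm Y)
    (h1 : ∀ y, τ (f y) = f (τ' y)) (h2 : ∀ x ∉ Set.range f, τ x = x) :
    (cyc (τ * σ) : ℤ) - cyc (restrictPerm f (τ * σ)) = cyc σ - cyc (restrictPerm f σ) := by
  refine cyc_sub_congr (Nat.card_congr (Equiv.subtypeEquivRight fun u => ?_))
  refine and_congr_right fun hu => forall₂_congr fun x _ => ?_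
  have h3 (x : X) : u (τ x) = u x := by
    by_cases hx : x ∈ Set.range f
    · obtain ⟨y, rfl⟩ := hx
      rw [h1, hu, hu]
    · rw [h2 x hx]
  rw [Equiv.Perm.mul_apply, h3]

theorem cyc_permCongr (e : X ≃ X') (σ : Equiv.Perm X) : cyc (e.permCongr σ) = cyc σ := by
  refine Nat.card_congr (Quotient.congr e.symm fun x y => ?_)
  have h (i : ℤ) : (e.permCongr σ) ^ i = e.permCongr (σ ^ i) := (map_zpow e.permCongrHom σ i).symm
  change (∃ i : ℤ, ((e.permCongr σ) ^ i) x = y) ↔ ∃ i : ℤ, (σ ^ i) (e.symm x) = e.symm y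
  simp [h, Equiv.eq_symm_apply]

end Restrict

/-! ### Symbols indexed by arbitrary finite sets -/
section Symbols
variable {H : Type*} [NormedAddCommGroup H] [InnerProductSpace ℝ H]

/-- `T(α ⊗ ·)` as a multilinear map. -/
def symFin {n : ℕ} (α : S0 n) : MultilinearMap ℝ (fun _ : Fin n => H) (TP H) :=
  ((toTP (H := H)).restrictScalars ℝ ∘ₗ tenR α).compMultilinearMap (PiTensorProduct.tprod ℝ)

theorem symFin_apply {n : ℕ} (α : S0 n) (h : Fin n → H) :
    symFin α h = toTP (ten α (PiTensorProduct.tprod ℝ h)) := rfl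

theorem symFin_perm {n : ℕ} (σ : Equiv.Perm (Fin n)) (α : S0 n) (h : Fin n → H) :
    symFin (conj0 σ α) (fun i => h (σ.symm i)) = symFin α h := by
  rw [symFin_apply, symFin_apply, ← toTP_sym σ α, algPerm_tprod]

theorem TP_ext {P : Type*} [AddCommGroup P] [Module ℂ P] {f g : TP H →ₗ[ℂ] P}
    (h : ∀ (n : ℕ) (α : S0 n) (h : Fin n → H), f (symFin α h) = g (symFin α h)) : f = g := by
  refine Submodule.linearMap_qext _ (pre_ext fun n α F => ?_)
  have : ((f ∘ₗ toTP).restrictScalars ℝ ∘ₗ tenR α : AlgTensor H n →ₗ[ℝ] P) =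
      (g ∘ₗ toTP).restrictScalars ℝ ∘ₗ tenR α :=
    PiTensorProduct.ext (MultilinearMap.ext fun v => h n α v)
  exact LinearMap.congr_fun this F

theorem TP_induction {motive : TP H → Prop} (zero : motive 0)
    (tensor : ∀ (n : ℕ) (α : S0 n) (h : Fin n → H), motive (symFin α h))
    (smul : ∀ (c : ℂ) x, motive x → motive (c • x))
    (add : ∀ x y, motive x → motive y → motive (x + y)) (x : TP H) : motive x := by
  obtain ⟨x, rfl⟩ := Submodule.mkQ_surjective _ x
  induction x using pre_induction with
  | zero => rw [map_zero]; exact zero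
  | smul c x hx => rw [map_smul]; exact smul c _ hx
  | add x y hx hy => rw [map_add]; exact add _ _ hx hy
  | tensor n α F =>
    induction F using PiTensorProduct.induction_on with
    | smul_tprod r f =>
      have : (symSub (algPerm H)).mkQ (ten α (r • PiTensorProduct.tprod ℝ f)) =
          (r : ℂ) • symFin α f := by
        rw [symFin_apply]
        exact ((toTP (H := H)).restrictScalars ℝ ∘ₗ tenR α).map_smul r _
      rw [this]
      exact smul _ _ (tensor n α f)
    | add F G hF hG =>
      have : (symSub (algPerm H)).mkQ (ten α (F + G)) =
          (symSub (algPerm H)).mkQ (ten α F) + (symSub (algPerm H)).mkQ (ten α G) :=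
        ((toTP (H := H)).restrictScalars ℝ ∘ₗ tenR α).map_add F G
      rw [this]
      exact add _ _ hF hG

/-- Linear maps on `TP(H)` are invariant families of multilinear maps. -/
def liftTP {P : Type*} [AddCommGroup P] [Module ℂ P]
    (f : ∀ n, S0 n → MultilinearMap ℝ (fun _ : Fin n => H) P)
    (hf : ∀ n (σ : Equiv.Perm (Fin n)) (α : S0 n) (h : Fin n → H),
      f n (conj0 σ α) (fun i => h (σ.symm i)) = f n α h) : TP H →ₗ[ℂ] P :=
  (symSub (algPerm H)).liftQ (preLift fun n α => PiTensorProduct.lift (f n α)) (by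
    refine Submodule.span_le.2 ?_
    rintro _ ⟨n, σ, α, F, rfl⟩
    rw [SetLike.mem_coe, LinearMap.mem_ker, map_sub, preLift_ten, preLift_ten, sub_eq_zero]
    have : PiTensorProduct.lift (f n α) =
        PiTensorProduct.lift (f n (conj0 σ α)) ∘ₗ algPerm H n σ := by
      refine PiTensorProduct.ext (MultilinearMap.ext fun v => ?_)
      simp only [LinearMap.compMultilinearMap_apply, LinearMap.comp_apply, algPerm_tprod,
        PiTensorProduct.lift.tprod, hf]
    exact LinearMap.congr_fun this F)

theorem liftTP_symFin {P : Type*} [AddCommGroup P] [Module ℂ P]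
    (f : ∀ n, S0 n → MultilinearMap ℝ (fun _ : Fin n => H) P)
    (hf : ∀ n (σ : Equiv.Perm (Fin n)) (α : S0 n) (h : Fin n → H),
      f n (conj0 σ α) (fun i => h (σ.symm i)) = f n α h) {n : ℕ} (α : S0 n) (h : Fin n → H) :
    liftTP f hf (symFin α h) = f n α h := by
  have h1 (x : APre H) : liftTP f hf (toTP x) = preLift (fun n α => PiTensorProduct.lift (f n α)) x :=
    Submodule.liftQ_apply _ _ _
  rw [symFin_apply, h1, preLift_ten, PiTensorProduct.lift.tprod]

/-- `T(α ⊗ ·)` for a permutation `α` of `{0} ∪ ι`, where `ι` is a finite set. -/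
def sym {ι : Type*} [Finite ι] (α : Equiv.Perm (Option ι)) : MultilinearMap ℝ (fun _ : ι => H) (TP H) :=
  (symFin ((Finite.equivFin ι).optionCongr.permCongr α)).domDomCongr (Finite.equivFin ι).symm

theorem conj0_eq_permCongr {n : ℕ} (σ : Equiv.Perm (Fin n)) (α : S0 n) :
    conj0 σ α = σ.optionCongr.permCongr α := rfl

theorem permCongr_optionCongr_trans {ι κ μ : Type*} (e : ι ≃ κ) (f : κ ≃ μ)
    (α : Equiv.Perm (Option ι)) : (e.trans f).optionCongr.permCongr α =
      f.optionCongr.permCongr (e.optionCongr.permCongr α) := by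
  rw [Equiv.optionCongr_trans]; rfl

theorem sym_eq_symFin {ι : Type*} [Finite ι] {n : ℕ} (e : ι ≃ Fin n) (α : Equiv.Perm (Option ι))
    (h : ι → H) : sym α h = symFin (e.optionCongr.permCongr α) fun i => h (e.symm i) := by
  obtain rfl : n = Nat.card ι := by rw [Nat.card_congr e, Nat.card_fin]
  change symFin ((Finite.equivFin ι).optionCongr.permCongr α) (fun i => h ((Finite.equivFin ι).symm i)) = _
  rw [← symFin_perm ((Finite.equivFin ι).symm.trans e), conj0_eq_permCongr, ← permCongr_optionCongr_trans,
    ← Equiv.trans_assoc, Equiv.self_trans_symm, Equiv.refl_trans]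
  simp

theorem sym_fin {n : ℕ} (α : S0 n) (h : Fin n → H) : sym α h = symFin α h := by
  rw [sym_eq_symFin (Equiv.refl _), Equiv.optionCongr_refl]
  rfl

theorem sym_equiv {ι κ : Type*} [Finite ι] [Finite κ] (e : ι ≃ κ) (α : Equiv.Perm (Option ι))
    (h : ι → H) : sym (e.optionCongr.permCongr α) (fun i => h (e.symm i)) = sym α h := by
  rw [sym_eq_symFin (Finite.equivFin κ), sym_eq_symFin (e.trans (Finite.equivFin κ)),
    permCongr_optionCongr_trans]
  rfl

end Symbols

/-! ### Contracted symbols and the Laplacian of a bilinear form -/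
section Contraction
variable {H : Type*} [NormedAddCommGroup H] [InnerProductSpace ℝ H]

/-- `h ↦ B(h_i, h_j) G(h_k : k ≠ i, j)` -/
def pairMul {ι : Type*} [DecidableEq ι] {P : Type*} [AddCommGroup P] [Module ℝ P] {i j : ι}
    (hij : i ≠ j) (B : H →ₗ[ℝ] H →ₗ[ℝ] ℝ)
    (G : MultilinearMap ℝ (fun _ : {x : ι // x ≠ i ∧ x ≠ j} => H) P) :
    MultilinearMap ℝ (fun _ : ι => H) P :=
  MultilinearMap.mk' (fun h => B (h i) (h j) • G fun k => h k)
    (fun h m x y => by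
      by_cases h1 : m = i
      · subst h1
        have key (z : H) : (fun k : {x : ι // x ≠ m ∧ x ≠ j} => Function.update h m z k) =
          (fun k => h k.1) := funext fun k => Function.update_of_ne k.2.1 _ _
        simp [key, hij.symm, add_smul]
      by_cases h2 : m = j
      · subst h2
        have key (z : H) : (fun k : {x : ι // x ≠ i ∧ x ≠ m} => Function.update h m z k) =
          (fun k => h k.1) := funext fun k => Function.update_of_ne k.2.2 _ _
        simp [key, hij, add_smul]
      have key (z : H) : (fun k : {x : ι // x ≠ i ∧ x ≠ j} => Function.update h m z k) =
          Function.update (fun k : {x : ι // x ≠ i ∧ x ≠ j} => h k) ⟨m, h1, h2⟩ z :=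
        Function.update_comp_eq_of_injective h Subtype.val_injective (⟨m, h1, h2⟩ : {x : ι // x ≠ i ∧ x ≠ j}) z
      simp only [key, MultilinearMap.map_update_add, smul_add, Function.update_of_ne (Ne.symm h1),
        Function.update_of_ne (Ne.symm h2)])
    (fun h m c x => by
      by_cases h1 : m = i
      · subst h1
        have key (z : H) : (fun k : {x : ι // x ≠ m ∧ x ≠ j} => Function.update h m z k) =
          (fun k => h k.1) := funext fun k => Function.update_of_ne k.2.1 _ _
        simp [key, hij.symm, mul_smul]
      by_cases h2 : m = j
      · subst h2
        have key (z : H) : (fun k : {x : ι // x ≠ i ∧ x ≠ m} => Function.update h m z k) =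
          (fun k => h k.1) := funext fun k => Function.update_of_ne k.2.2 _ _
        simp [key, hij, mul_smul]
      have key (z : H) : (fun k : {x : ι // x ≠ i ∧ x ≠ j} => Function.update h m z k) =
          Function.update (fun k : {x : ι // x ≠ i ∧ x ≠ j} => h k) ⟨m, h1, h2⟩ z :=
        Function.update_comp_eq_of_injective h Subtype.val_injective (⟨m, h1, h2⟩ : {x : ι // x ≠ i ∧ x ≠ j}) z
      simp only [key, MultilinearMap.map_update_smul, Function.update_of_ne (Ne.symm h1),
        Function.update_of_ne (Ne.symm h2)]
      rw [smul_comm])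

variable {ι κ : Type*} [Finite ι] [Finite κ]

/-- The inclusion `{0} ∪ {x | p x} ⊆ {0} ∪ ι`. -/
def optSub (p : ι → Prop) : Option {x // p x} ↪ Option ι :=
  (Function.Embedding.subtype p).optionMap

/-- The exponent of `q` in the contraction with the pairing `τ` of the points outside of `p`. -/
def conWeight (q : ℝ) (p : ι → Prop) (τ : Equiv.Perm ι) (r : ℤ) (α : Equiv.Perm (Option ι)) : ℝ :=
  q ^ (r + cyc (restrictPerm (optSub p) (τ.optionCongr * α)) - cyc (τ.optionCongr * α))

/-- The contraction of `T(α ⊗ h)` with respect to a pairing `τ` with `r` pairs of the complement of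
`p`, without the inner products. -/
def conSym (q : ℝ) (p : ι → Prop) (τ : Equiv.Perm ι) (r : ℤ) (α : Equiv.Perm (Option ι)) :
    MultilinearMap ℝ (fun _ : {x // p x} => H) (TP H) :=
  conWeight q p τ r α • sym (restrictPerm (optSub p) (τ.optionCongr * α))

theorem optionCongr_permCongr {ι κ : Type*} (e : ι ≃ κ) (τ : Equiv.Perm ι) :
    (e.permCongr τ).optionCongr = e.optionCongr.permCongr τ.optionCongr := by
  rw [Equiv.permCongr_def, Equiv.permCongr_def, Equiv.optionCongr_trans, Equiv.optionCongr_trans]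
  rfl

theorem optionCongr_mul_permCongr {ι κ : Type*} (e : ι ≃ κ) (τ : Equiv.Perm ι) (α : Equiv.Perm (Option ι)) :
    (e.permCongr τ).optionCongr * e.optionCongr.permCongr α =
      e.optionCongr.permCongr (τ.optionCongr * α) := by
  rw [optionCongr_permCongr]
  exact (map_mul e.optionCongr.permCongrHom τ.optionCongr α).symm

theorem conWeight_equiv (e : ι ≃ κ) (q : ℝ) (p : ι → Prop) (p' : κ → Prop) (hp : ∀ x, p x ↔ p' (e x))
    (τ : Equiv.Perm ι) (r : ℤ) (α : Equiv.Perm (Option ι)) :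
    conWeight q p' (e.permCongr τ) r (e.optionCongr.permCongr α) = conWeight q p τ r α := by
  have h1 := optionCongr_mul_permCongr e τ α
  rw [conWeight, h1, restrictPerm_equiv (optSub p) (optSub p') e.optionCongr
    (e.subtypeEquiv hp).optionCongr (by rintro (_ | x) <;> rfl), cyc_permCongr, cyc_permCongr,
    conWeight]

theorem conSym_equiv (e : ι ≃ κ) (q : ℝ) (p : ι → Prop) (p' : κ → Prop) (hp : ∀ x, p x ↔ p' (e x))
    (τ : Equiv.Perm ι) (r : ℤ) (α : Equiv.Perm (Option ι)) (h : ι → H) :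
    conSym q p' (e.permCongr τ) r (e.optionCongr.permCongr α) (fun x => h (e.symm x)) =
      conSym q p τ r α (fun x => h x) := by
  have h1 := optionCongr_mul_permCongr e τ α
  rw [conSym, smul_apply, conWeight_equiv e q p p' hp, h1,
    restrictPerm_equiv (optSub p) (optSub p') e.optionCongr
    (e.subtypeEquiv hp).optionCongr (by rintro (_ | x) <;> rfl), conSym, smul_apply]
  congr 1
  rw [← sym_equiv (e.subtypeEquiv hp)]
  rfl

/-- The Laplacian `L_B` of a bilinear form `B`, on symbols. -/
def lapFin (q : ℝ) (B : H →ₗ[ℝ] H →ₗ[ℝ] ℝ) {ι : Type*} [Fintype ι] [DecidableEq ι]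
    (α : Equiv.Perm (Option ι)) : MultilinearMap ℝ (fun _ : ι => H) (TP H) :=
  (1 / 2 : ℝ) • ∑ i : ι, ∑ j : ι, if hij : i ≠ j then
    pairMul hij B (conSym q (fun x => x ≠ i ∧ x ≠ j) (Equiv.swap i j) 1 α) else 0

theorem lapFin_apply (q : ℝ) (B : H →ₗ[ℝ] H →ₗ[ℝ] ℝ) {ι : Type*} [Fintype ι] [DecidableEq ι]
    (α : Equiv.Perm (Option ι)) (h : ι → H) :
    lapFin q B α h = (1 / 2 : ℝ) • ∑ i : ι, ∑ j : ι, if i ≠ j then B (h i) (h j) •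
      conSym q (fun x => x ≠ i ∧ x ≠ j) (Equiv.swap i j) 1 α (fun x => h x) else 0 := by
  rw [lapFin, smul_apply, sum_apply]
  congr 1
  refine Finset.sum_congr rfl fun i _ => ?_
  rw [sum_apply]
  refine Finset.sum_congr rfl fun j _ => ?_
  by_cases hij : i = j
  · simp [hij]
  · rw [dif_pos hij, if_pos hij]
    rfl

theorem lapFin_equiv (q : ℝ) (B : H →ₗ[ℝ] H →ₗ[ℝ] ℝ) {ι κ : Type*} [Fintype ι] [Fintype κ]
    [DecidableEq ι] [DecidableEq κ]
    (e : ι ≃ κ) (α : Equiv.Perm (Option ι)) (h : ι → H) :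
    lapFin q B (e.optionCongr.permCongr α) (fun i => h (e.symm i)) = lapFin q B α h := by
  rw [lapFin_apply, lapFin_apply]
  congr 1
  refine (Fintype.sum_equiv e _ _ fun i => Fintype.sum_equiv e _ _ fun j => ?_).symm
  refine if_ctx_congr (by simp) (fun hij => ?_) fun _ => rfl
  have h1 : Equiv.swap (e i) (e j) = e.permCongr (Equiv.swap i j) := by
    ext1 x
    simp [Equiv.permCongr_apply, Equiv.swap_apply_def, apply_ite e, Equiv.symm_apply_eq]
  rw [h1, conSym_equiv e q (fun x => x ≠ i ∧ x ≠ j) _ (by simp) _ _ _ h]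
  simp

/-- The Laplacian `L_B` of a bilinear form `B`. -/
def lapT (q : ℝ) (B : H →ₗ[ℝ] H →ₗ[ℝ] ℝ) : TP H →ₗ[ℂ] TP H :=
  liftTP (fun _ α => lapFin q B α) fun _ σ α h => by
    rw [conj0_eq_permCongr, lapFin_equiv]

theorem lapT_symFin (q : ℝ) (B : H →ₗ[ℝ] H →ₗ[ℝ] ℝ) {n : ℕ} (α : S0 n) (h : Fin n → H) :
    lapT q B (symFin α h) = lapFin q B α h :=
  liftTP_symFin _ _ α h

theorem lapT_sym (q : ℝ) (B : H →ₗ[ℝ] H →ₗ[ℝ] ℝ) {ι : Type*} [Fintype ι] [DecidableEq ι]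
    (α : Equiv.Perm (Option ι)) (h : ι → H) :
    lapT q B (sym α h) = (1 / 2 : ℝ) • ∑ i : ι, ∑ j : ι, if i ≠ j then B (h i) (h j) •
      conSym q (fun x => x ≠ i ∧ x ≠ j) (Equiv.swap i j) 1 α (fun x => h x) else 0 := by
  rw [← lapFin_apply, sym_eq_symFin (Fintype.equivFin ι), lapT_symFin, lapFin_equiv]

end Contraction

section Contraction
variable {H : Type*} [NormedAddCommGroup H] [InnerProductSpace ℝ H]
variable {ι κ : Type*} [Finite ι] [Finite κ]

theorem optionCongr_mul {ι : Type*} (σ τ : Equiv.Perm ι) :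
    (σ * τ).optionCongr = σ.optionCongr * τ.optionCongr := by
  ext1 x; cases x <;> rfl

theorem conSym_conSym {q : ℝ} (hq : q ≠ 0) [DecidableEq ι] (p : ι → Prop) (τ : Equiv.Perm ι) (r : ℤ)
    (α : Equiv.Perm (Option ι)) (k l : {x // p x}) (h : ι → H) :
    conWeight q p τ r α • conSym q (fun x => x ≠ k ∧ x ≠ l) (Equiv.swap k l) 1
        (restrictPerm (optSub p) (τ.optionCongr * α)) (fun x => h x.1) =
      conSym q (fun x => p x ∧ x ≠ k ∧ x ≠ l) (Equiv.swap k.1 l.1 * τ) (r + 1) α (fun x => h x) := by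
  set σ := τ.optionCongr * α with hσ
  set β := restrictPerm (optSub p) σ with hβ
  have hs1 : ∀ y, (Equiv.swap k.1 l.1).optionCongr (optSub p y) =
      optSub p ((Equiv.swap k l).optionCongr y) := by
    rintro (_ | y)
    · rfl
    · change some (Equiv.swap k.1 l.1 y.1) = some (Equiv.swap k l y).1
      congr 1
      simp only [Equiv.swap_apply_def, ← Subtype.ext_iff]
      split_ifs <;> rfl
  have hs2 : ∀ x ∉ Set.range (optSub p), (Equiv.swap k.1 l.1).optionCongr x = x := by
    rintro (_ | x) hx
    · rfl
    · change some _ = some _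
      congr 1
      refine Equiv.swap_apply_of_ne_of_ne ?_ ?_
      · rintro rfl; exact hx ⟨some k, rfl⟩
      · rintro rfl; exact hx ⟨some l, rfl⟩
  have h1 := restrictPerm_mul_left (optSub p) σ _ _ hs1 hs2
  have h2 := cyc_sub_mul_left (optSub p) σ _ _ hs1 hs2
  have h3 : (Equiv.swap k.1 l.1 * τ).optionCongr * α = (Equiv.swap k.1 l.1).optionCongr * σ := by
    rw [hσ, ← mul_assoc]; congr 1; exact optionCongr_mul _ _
  let e : {y : {x // p x} // y ≠ k ∧ y ≠ l} ≃ {x // p x ∧ x ≠ k ∧ x ≠ l} :=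
    { toFun := fun y => ⟨y.1.1, y.1.2, fun h => y.2.1 (Subtype.ext h), fun h => y.2.2 (Subtype.ext h)⟩
      invFun := fun x => ⟨⟨x.1, x.2.1⟩, fun h => x.2.2.1 (congrArg Subtype.val h),
        fun h => x.2.2.2 (congrArg Subtype.val h)⟩
      left_inv := fun y => rfl
      right_inv := fun x => rfl }
  have h4 : restrictPerm (optSub fun x => p x ∧ x ≠ k ∧ x ≠ l) ((Equiv.swap k.1 l.1).optionCongr * σ) =
      e.optionCongr.permCongr (restrictPerm (optSub fun x => x ≠ k ∧ x ≠ l)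
        ((Equiv.swap k l).optionCongr * β)) := by
    rw [hβ, ← h1, ← restrictPerm_trans,
      ← restrictPerm_equiv _ (optSub fun x => p x ∧ x ≠ k ∧ x ≠ l) (Equiv.refl _) e.optionCongr (by rintro (_ | x) <;> rfl)]
    rfl
  rw [conSym, conSym, smul_apply, smul_apply, h3, h4, ← sym_equiv e, smul_smul]
  congr 1
  rw [conWeight, conWeight, conWeight, h3, h4, cyc_permCongr, ← hσ, ← hβ, ← zpow_add₀ hq]
  rw [h1, ← hβ] at h2
  congr 1
  omega

theorem lapT_real_smul (q : ℝ) (B : H →ₗ[ℝ] H →ₗ[ℝ] ℝ) (c : ℝ) (x : TP H) :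
    lapT q B (c • x) = c • lapT q B x :=
  (lapT q B).map_smul (c : ℂ) x

theorem lapT_conSym {q : ℝ} (hq : q ≠ 0) (B : H →ₗ[ℝ] H →ₗ[ℝ] ℝ) {ι : Type*} [Fintype ι] [DecidableEq ι]
    (p : ι → Prop) [DecidablePred p] (τ : Equiv.Perm ι) (r : ℤ) (α : Equiv.Perm (Option ι)) (h : ι → H) :
    lapT q B (conSym q p τ r α fun x => h x) = (1 / 2 : ℝ) • ∑ i : ι, ∑ j : ι,
      if i ≠ j ∧ p i ∧ p j then B (h i) (h j) •
        conSym q (fun x => p x ∧ x ≠ i ∧ x ≠ j) (Equiv.swap i j * τ) (r + 1) α (fun x => h x) else 0 := by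
  rw [conSym, smul_apply, lapT_real_smul, lapT_sym, smul_comm]
  congr 1
  rw [Finset.smul_sum]
  refine Fintype.sum_of_injective Subtype.val Subtype.val_injective _ _ (fun i hi => ?_) fun i => ?_
  · refine Finset.sum_eq_zero fun j _ => if_neg fun hh => hi ⟨⟨i, hh.2.1⟩, rfl⟩
  rw [Finset.smul_sum]
  refine Fintype.sum_of_injective Subtype.val Subtype.val_injective _ _ (fun j hj => ?_) fun j => ?_
  · exact if_neg fun hh => hj ⟨⟨j, hh.2.2⟩, rfl⟩
  rw [smul_ite, smul_zero]
  refine if_ctx_congr (by simp [Subtype.ext_iff, i.2, j.2]) (fun _ => ?_) fun _ => rfl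
  rw [smul_comm, conSym_conSym hq]

theorem restrictPerm_one_of_all {X Y : Type*} [Finite X] [Finite Y] (f : Y ≃ X) (σ : Equiv.Perm X) :
    cyc (restrictPerm f.toEmbedding σ) = cyc σ := by
  rw [restrictPerm_of_equiv, cyc_permCongr]

theorem conSym_all (q : ℝ) (p : ι → Prop) (hp : ∀ x, p x) (α : Equiv.Perm (Option ι)) (h : ι → H) :
    conSym q p 1 0 α (fun x => h x) = sym α h := by
  have h1 : (Equiv.optionCongr (1 : Equiv.Perm ι)) * α = α := by
    ext1 x; simp
  let e : {x // p x} ≃ ι := Equiv.subtypeUnivEquiv hp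
  have h2 : optSub p = e.optionCongr.toEmbedding := by ext1 x; rfl
  rw [conSym, smul_apply, conWeight, h1, h2, restrictPerm_one_of_all, restrictPerm_of_equiv,
    zero_add, sub_self, zpow_zero, one_smul]
  exact sym_equiv e.symm α h

theorem lapT_lapT_symFin {q : ℝ} (hq : q ≠ 0) (B B' : H →ₗ[ℝ] H →ₗ[ℝ] ℝ) {n : ℕ} (α : S0 n)
    (h : Fin n → H) :
    lapT q B (lapT q B' (symFin α h)) = (1 / 2 : ℝ) • (1 / 2 : ℝ) • ∑ i, ∑ j, ∑ k, ∑ l,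
      if (i ≠ j ∧ k ≠ l) ∧ (k ≠ i ∧ k ≠ j) ∧ (l ≠ i ∧ l ≠ j) then
        (B' (h i) (h j) * B (h k) (h l)) • conSym q (fun x => (x ≠ i ∧ x ≠ j) ∧ x ≠ k ∧ x ≠ l)
          (Equiv.swap k l * Equiv.swap i j) 2 α (fun x => h x) else 0 := by
  rw [← sym_fin, lapT_sym, lapT_real_smul, map_sum]
  congr 1
  rw [Finset.smul_sum]
  refine Finset.sum_congr rfl fun i _ => ?_
  rw [map_sum, Finset.smul_sum]
  refine Finset.sum_congr rfl fun j _ => ?_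
  by_cases hij : i = j
  · simp [hij]
  rw [if_pos hij, lapT_real_smul, lapT_conSym hq, smul_comm, Finset.smul_sum]
  congr 1
  refine Finset.sum_congr rfl fun k _ => ?_
  rw [Finset.smul_sum]
  refine Finset.sum_congr rfl fun l _ => ?_
  rw [smul_ite, smul_zero, smul_smul]
  refine if_congr (by simp [hij]) rfl rfl

theorem sum_swap_pairs {R M : Type*} [Fintype R] [AddCommMonoid M] (F : R → R → R → R → M) :
    ∑ i, ∑ j, ∑ k, ∑ l, F i j k l = ∑ i, ∑ j, ∑ k, ∑ l, F k l i j := by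
  calc _ = ∑ i, ∑ k, ∑ j, ∑ l, F i j k l := Finset.sum_congr rfl fun _ _ => Finset.sum_comm
    _ = ∑ k, ∑ i, ∑ l, ∑ j, F i j k l := by
      rw [Finset.sum_comm]
      exact Finset.sum_congr rfl fun _ _ => Finset.sum_congr rfl fun _ _ => Finset.sum_comm
    _ = _ := Finset.sum_congr rfl fun _ _ => Finset.sum_comm

theorem conSym_congr {q : ℝ} {p p' : ι → Prop} (hp : ∀ x, p x ↔ p' x) {τ τ' : Equiv.Perm ι} (hτ : τ = τ')
    (r : ℤ) (α : Equiv.Perm (Option ι)) (h : ι → H) :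
    conSym q p τ r α (fun x => h x) = conSym q p' τ' r α (fun x => h x) := by
  obtain rfl : p = p' := funext fun x => propext (hp x)
  rw [hτ]

theorem swap_commute {ι : Type*} [DecidableEq ι] {i j k l : ι} (h1 : k ≠ i) (h2 : k ≠ j) (h3 : l ≠ i)
    (h4 : l ≠ j) : Equiv.swap i j * Equiv.swap k l = Equiv.swap k l * Equiv.swap i j :=
  (Equiv.Perm.Disjoint.commute fun x => by
    by_cases hx : x = i ∨ x = j
    · right
      rcases hx with rfl | rfl
      · exact Equiv.swap_apply_of_ne_of_ne h1.symm h3.symm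
      · exact Equiv.swap_apply_of_ne_of_ne h2.symm h4.symm
    · rw [not_or] at hx
      exact Or.inl (Equiv.swap_apply_of_ne_of_ne hx.1 hx.2)).eq

theorem lapT_comm {q : ℝ} (hq : q ≠ 0) (B B' : H →ₗ[ℝ] H →ₗ[ℝ] ℝ) :
    Commute (lapT q B) (lapT q B') := by
  refine TP_ext fun n α h => ?_
  rw [Module.End.mul_apply, Module.End.mul_apply, lapT_lapT_symFin hq, lapT_lapT_symFin hq,
    sum_swap_pairs]
  refine congrArg (fun z : TP H => (1 / 2 : ℝ) • (1 / 2 : ℝ) • z) ?_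
  refine Finset.sum_congr rfl fun i _ => Finset.sum_congr rfl fun j _ =>
    Finset.sum_congr rfl fun k _ => Finset.sum_congr rfl fun l _ => ?_
  refine if_ctx_congr ?_ (fun hh => ?_) fun _ => rfl
  · constructor <;> rintro ⟨⟨h1, h2⟩, ⟨h3, h4⟩, h5, h6⟩ <;>
      exact ⟨⟨h2, h1⟩, ⟨h3.symm, h5.symm⟩, h4.symm, h6.symm⟩
  · rw [mul_comm (B' (h k) (h l))]
    exact congrArg _ (conSym_congr (fun x => and_comm)
      (swap_commute hh.2.1.1 hh.2.1.2 hh.2.2.1 hh.2.2.2) 2 α h)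

theorem lapT_pow_sym {q : ℝ} (B : H →ₗ[ℝ] H →ₗ[ℝ] ℝ) (n : ℕ) : ∀ {ι : Type} [Finite ι]
    (α : Equiv.Perm (Option ι)) (h : ι → H), Nat.card ι ≤ n → ((lapT q B) ^ (n + 1)) (sym α h) = 0 := by
  classical
  induction n with
  | zero =>
    intro ι _ α h hn
    have := Fintype.ofFinite ι
    have : IsEmpty ι := by rw [← Finite.card_eq_zero_iff]; omega
    rw [zero_add, pow_one, lapT_sym]
    simp
  | succ n ih =>
    intro ι _ α h hn
    have := Fintype.ofFinite ι
    rw [pow_succ, Module.End.mul_apply, lapT_sym]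
    have h0 (c : ℝ) (x : TP H) : (lapT q B ^ (n + 1)) (c • x) = c • (lapT q B ^ (n + 1)) x :=
      (lapT q B ^ (n + 1)).map_smul (c : ℂ) x
    rw [h0, map_sum]
    refine (congrArg _ (Finset.sum_eq_zero fun i _ => ?_)).trans (smul_zero _)
    rw [map_sum]
    refine Finset.sum_eq_zero fun j _ => ?_
    split_ifs with hij
    · rw [h0, conSym, smul_apply, h0, ih, smul_zero, smul_zero]
      have : Nat.card {x // x ≠ i ∧ x ≠ j} < Nat.card ι := by
        rw [Nat.card_eq_fintype_card, Nat.card_eq_fintype_card]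
        exact Fintype.card_subtype_lt (x := i) (by simp)
      omega
    · simp

theorem lapT_add (q : ℝ) (B B' : H →ₗ[ℝ] H →ₗ[ℝ] ℝ) : lapT q (B + B') = lapT q B + lapT q B' := by
  refine TP_ext fun n α h => ?_
  rw [LinearMap.add_apply, ← sym_fin, lapT_sym, lapT_sym, lapT_sym, ← smul_add, ← Finset.sum_add_distrib]
  congr 1
  refine Finset.sum_congr rfl fun i _ => ?_
  rw [← Finset.sum_add_distrib]
  refine Finset.sum_congr rfl fun j _ => ?_
  split_ifs
  · rw [LinearMap.add_apply, LinearMap.add_apply, add_smul]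
  · simp

theorem lapT_locallyNilpotent (q : ℝ) (B : H →ₗ[ℝ] H →ₗ[ℝ] ℝ) (x : TP H) :
    ∃ n, (lapT q B ^ n) x = 0 := by
  induction x using TP_induction with
  | zero => exact ⟨0, rfl⟩
  | tensor n α h => exact ⟨n + 1, by rw [← sym_fin]; exact lapT_pow_sym B n α h (by simp)⟩
  | smul c x hx => obtain ⟨n, hn⟩ := hx; exact ⟨n, by rw [map_smul, hn, smul_zero]⟩
  | add x y hx hy =>
    obtain ⟨n, hn⟩ := hx
    obtain ⟨k, hk⟩ := hy
    refine ⟨n + k, ?_⟩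
    have e1 : (lapT q B ^ (n + k)) x = 0 := by
      rw [add_comm, pow_add, Module.End.mul_apply, hn, map_zero]
    have e2 : (lapT q B ^ (n + k)) y = 0 := by rw [pow_add, Module.End.mul_apply, hk, map_zero]
    rw [map_add, e1, e2, add_zero]

end Contraction

/-! ### Exponentials of locally nilpotent endomorphisms -/
section Lexp
variable {M M' : Type*} [AddCommGroup M] [Module ℂ M] [AddCommGroup M'] [Module ℂ M']

theorem pow_apply_eq_zero_of_le {f : M →ₗ[ℂ] M} {x : M} {n k : ℕ} (h : (f ^ n) x = 0) (hk : n ≤ k) :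
    (f ^ k) x = 0 := by
  obtain ⟨d, rfl⟩ := Nat.exists_eq_add_of_le hk
  rw [add_comm, pow_add, Module.End.mul_apply, h, map_zero]

theorem sum_exp_congr {f : M →ₗ[ℂ] M} {x : M} {n k : ℕ} (h : (f ^ n) x = 0) (hk : n ≤ k) :
    ∑ l ∈ Finset.range k, ((Nat.factorial l : ℂ)⁻¹) • (f ^ l) x =
      ∑ l ∈ Finset.range n, ((Nat.factorial l : ℂ)⁻¹) • (f ^ l) x := by
  refine (Finset.sum_subset (Finset.range_mono hk) fun l _ hl => ?_).symm
  rw [pow_apply_eq_zero_of_le h (by simpa using hl), smul_zero]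

open Classical in
/-- The exponential of a locally nilpotent endomorphism. -/
def lexp (f : M →ₗ[ℂ] M) (hf : ∀ x, ∃ n, (f ^ n) x = 0) : M →ₗ[ℂ] M where
  toFun x := ∑ l ∈ Finset.range (Nat.find (hf x)), ((Nat.factorial l : ℂ)⁻¹) • (f ^ l) x
  map_add' x y := by
    have hx := Nat.find_spec (hf x)
    have hy := Nat.find_spec (hf y)
    have hxy := Nat.find_spec (hf (x + y))
    set a := Nat.find (hf x)
    set b := Nat.find (hf y)
    set c := Nat.find (hf (x + y))
    rw [← sum_exp_congr hx (by omega : a ≤ a + b + c), ← sum_exp_congr hy (by omega : b ≤ a + b + c),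
      ← sum_exp_congr hxy (by omega : c ≤ a + b + c), ← Finset.sum_add_distrib]
    simp only [map_add, smul_add]
  map_smul' r x := by
    have hx := Nat.find_spec (hf x)
    have hxy := Nat.find_spec (hf (r • x))
    set a := Nat.find (hf x)
    set c := Nat.find (hf (r • x))
    rw [← sum_exp_congr hx (by omega : a ≤ a + c), ← sum_exp_congr hxy (by omega : c ≤ a + c),
      Finset.smul_sum]
    simp only [map_smul, smul_comm r, RingHom.id_apply]

theorem lexp_eq_sum {f : M →ₗ[ℂ] M} (hf : ∀ x, ∃ n, (f ^ n) x = 0) {x : M} {n : ℕ} (h : (f ^ n) x = 0) :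
    lexp f hf x = ∑ l ∈ Finset.range n, ((Nat.factorial l : ℂ)⁻¹) • (f ^ l) x := by
  classical
  exact (sum_exp_congr (Nat.find_spec (hf x)) (Nat.find_min' (hf x) h)).symm

theorem lexp_intertwine {f : M →ₗ[ℂ] M} (hf : ∀ x, ∃ n, (f ^ n) x = 0) {f' : M' →ₗ[ℂ] M'}
    (hf' : ∀ x, ∃ n, (f' ^ n) x = 0) (φ : M →+ M') (hφ : ∀ (k : ℕ) x, φ ((Nat.factorial k : ℂ)⁻¹ • x) =
      (Nat.factorial k : ℂ)⁻¹ • φ x) (h : ∀ x, φ (f x) = f' (φ x)) (x : M) :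
    φ (lexp f hf x) = lexp f' hf' (φ x) := by
  have hp (n : ℕ) (x : M) : φ ((f ^ n) x) = (f' ^ n) (φ x) := by
    induction n with
    | zero => rfl
    | succ n ih => rw [pow_succ', pow_succ', Module.End.mul_apply, h, ih, Module.End.mul_apply]
  obtain ⟨n, hn⟩ := hf x
  rw [lexp_eq_sum hf hn, lexp_eq_sum hf' (n := n) (by rw [← hp, hn, map_zero]), map_sum]
  simp only [hφ, hp]

theorem lexp_intertwine_linear {f : M →ₗ[ℂ] M} (hf : ∀ x, ∃ n, (f ^ n) x = 0) {f' : M' →ₗ[ℂ] M'}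
    (hf' : ∀ x, ∃ n, (f' ^ n) x = 0) (φ : M →ₗ[ℂ] M') (h : ∀ x, φ (f x) = f' (φ x)) (x : M) :
    φ (lexp f hf x) = lexp f' hf' (φ x) :=
  lexp_intertwine hf hf' φ.toAddMonoidHom (fun _ _ => φ.map_smul _ _) h x

theorem lexp_add {f g : M →ₗ[ℂ] M} (hf : ∀ x, ∃ n, (f ^ n) x = 0) (hg : ∀ x, ∃ n, (g ^ n) x = 0)
    (hfg : ∀ x, ∃ n, ((f + g) ^ n) x = 0) (h : Commute f g) (x : M) :
    lexp (f + g) hfg x = lexp f hf (lexp g hg x) := by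
  obtain ⟨m, hm⟩ := hg x
  choose c hc using fun b => hf ((g ^ b) x)
  obtain ⟨d, hd⟩ := hfg x
  set n := (Finset.range m).sup c + m + d with hn
  have h0 (a b : ℕ) (hab : n ≤ a + b) : (f ^ a) ((g ^ b) x) = 0 := by
    by_cases hb : b < m
    · refine pow_apply_eq_zero_of_le (hc b) ?_
      have := Finset.le_sup (f := c) (Finset.mem_range.2 hb)
      omega
    · rw [pow_apply_eq_zero_of_le hm (not_lt.1 hb), map_zero]
  let t : ℕ × ℕ → M := fun p => (((Nat.factorial p.1 : ℂ)⁻¹) * ((Nat.factorial p.2 : ℂ)⁻¹)) •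
    (f ^ p.1) ((g ^ p.2) x)
  have h1 : lexp (f + g) hfg x = ∑ k ∈ Finset.range n, ∑ p ∈ Finset.HasAntidiagonal.antidiagonal k, t p := by
    rw [lexp_eq_sum hfg (pow_apply_eq_zero_of_le hd (by omega : d ≤ n))]
    refine Finset.sum_congr rfl fun k _ => ?_
    rw [h.add_pow', LinearMap.sum_apply, Finset.smul_sum]
    refine Finset.sum_congr rfl fun p hp => ?_
    rw [LinearMap.smul_apply, Module.End.mul_apply, ← Nat.cast_smul_eq_nsmul ℂ, smul_smul]
    simp only [t]
    congr 1
    have hk := Finset.HasAntidiagonal.mem_antidiagonal.1 hp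
    subst hk
    rw [Nat.cast_add_choose]
    have := Nat.factorial_ne_zero (p.1 + p.2)
    field_simp
  have h2 : lexp f hf (lexp g hg x) = ∑ p ∈ Finset.range n ×ˢ Finset.range n, t p := by
    rw [lexp_eq_sum hg (pow_apply_eq_zero_of_le hm (by omega : m ≤ n)), map_sum, Finset.sum_product_right]
    refine Finset.sum_congr rfl fun b _ => ?_
    rw [map_smul, lexp_eq_sum hf (n := n) (h0 n b (by omega)), Finset.smul_sum]
    refine Finset.sum_congr rfl fun a _ => ?_
    simp only [t, smul_smul, mul_comm]
  rw [h1, h2, ← Finset.sum_filter_add_sum_filter_not _ (fun p : ℕ × ℕ => p.1 + p.2 < n)]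
  have h3 : ∑ p ∈ Finset.range n ×ˢ Finset.range n with ¬ p.1 + p.2 < n, t p = 0 := by
    refine Finset.sum_eq_zero fun p hp => ?_
    simp only [t]
    rw [h0 _ _ (not_lt.1 (Finset.mem_filter.1 hp).2), smul_zero]
  rw [h3, add_zero, ← Finset.sum_fiberwise_of_maps_to (s := {p ∈ Finset.range n ×ˢ Finset.range n | p.1 + p.2 < n})
    (t := Finset.range n) (g := fun p => p.1 + p.2) (by simp)]
  refine Finset.sum_congr rfl fun k hk => Finset.sum_congr ?_ fun _ _ => rfl
  ext p
  simp only [Finset.mem_range, Finset.HasAntidiagonal.mem_antidiagonal, Finset.mem_filter, Finset.mem_product] at hk ⊢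
  omega

theorem lexp_congr {f g : M →ₗ[ℂ] M} (hf : ∀ x, ∃ n, (f ^ n) x = 0) (hg : ∀ x, ∃ n, (g ^ n) x = 0)
    (h : f = g) : lexp f hf = lexp g hg := by
  subst h; rfl

end Lexp

section ExpLap
variable {H : Type*} [NormedAddCommGroup H] [InnerProductSpace ℝ H]
variable {H' : Type*} [NormedAddCommGroup H'] [InnerProductSpace ℝ H']

/-- `e^{L_B}` -/
def expT (q : ℝ) (B : H →ₗ[ℝ] H →ₗ[ℝ] ℝ) : TP H →ₗ[ℂ] TP H := lexp (lapT q B) (lapT_locallyNilpotent q B)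

theorem expT_add {q : ℝ} (hq : q ≠ 0) (B B' : H →ₗ[ℝ] H →ₗ[ℝ] ℝ) (x : TP H) :
    expT q (B + B') x = expT q B (expT q B' x) := by
  rw [expT, expT, expT, ← lexp_add _ _ (fun x => by rw [← lapT_add]; exact lapT_locallyNilpotent q _ x)
    (lapT_comm hq B B')]
  exact LinearMap.congr_fun (lexp_congr _ _ (lapT_add q B B')) x

theorem expT_eq_self {q : ℝ} {B : H →ₗ[ℝ] H →ₗ[ℝ] ℝ} {x : TP H} (h : lapT q B x = 0) : expT q B x = x := by
  rw [expT, lexp_eq_sum _ (n := 1) (by simpa using h)]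
  simp

theorem expT_zero (q : ℝ) (x : TP H) : expT q 0 x = x := by
  refine expT_eq_self ?_
  have h := lapT_add q (0 : H →ₗ[ℝ] H →ₗ[ℝ] ℝ) 0
  rw [add_zero, left_eq_add] at h
  rw [h]; rfl

theorem expT_neg_cancel {q : ℝ} (hq : q ≠ 0) (B : H →ₗ[ℝ] H →ₗ[ℝ] ℝ) (x : TP H) :
    expT q B (expT q (-B) x) = x := by
  rw [← expT_add hq, show B + -B = 0 from LinearMap.ext₂ fun _ _ => add_neg_cancel _, expT_zero]

theorem expT_neg_cancel' {q : ℝ} (hq : q ≠ 0) (B : H →ₗ[ℝ] H →ₗ[ℝ] ℝ) (x : TP H) :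
    expT q (-B) (expT q B x) = x := by
  rw [← expT_add hq, show -B + B = 0 from LinearMap.ext₂ fun _ _ => neg_add_cancel _, expT_zero]

/-! ### Functoriality -/

/-- Second quantization of a linear map. -/
def gam (A : H →ₗ[ℝ] H') : TP H →ₗ[ℂ] TP H' :=
  liftTP (fun _ α => (symFin α).compLinearMap fun _ => A) fun _ σ α h => symFin_perm σ α fun i => A (h i)

theorem gam_symFin (A : H →ₗ[ℝ] H') {n : ℕ} (α : S0 n) (h : Fin n → H) :
    gam A (symFin α h) = symFin α fun i => A (h i) :=
  liftTP_symFin _ _ α h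

theorem gam_sym (A : H →ₗ[ℝ] H') {ι : Type*} [Finite ι] (α : Equiv.Perm (Option ι)) (h : ι → H) :
    gam A (sym α h) = sym α fun i => A (h i) := by
  rw [sym_eq_symFin (Finite.equivFin ι), sym_eq_symFin (Finite.equivFin ι), gam_symFin]

theorem gam_real_smul (A : H →ₗ[ℝ] H') (c : ℝ) (x : TP H) : gam A (c • x) = c • gam A x :=
  (gam A).map_smul (c : ℂ) x

theorem gam_comp {H'' : Type*} [NormedAddCommGroup H''] [InnerProductSpace ℝ H''] (A : H →ₗ[ℝ] H')
    (A' : H' →ₗ[ℝ] H'') (x : TP H) : gam A' (gam A x) = gam (A' ∘ₗ A) x := by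
  have : gam A' ∘ₗ gam A = gam (A' ∘ₗ A) := TP_ext fun n α h => by
    rw [LinearMap.comp_apply, gam_symFin, gam_symFin, gam_symFin]; rfl
  exact LinearMap.congr_fun this x

theorem gam_id (x : TP H) : gam LinearMap.id x = x := by
  have : gam (LinearMap.id : H →ₗ[ℝ] H) = LinearMap.id := TP_ext fun n α h => by
    rw [gam_symFin]; rfl
  rw [this]; rfl

theorem gam_lapT (q : ℝ) (A : H →ₗ[ℝ] H') (B : H →ₗ[ℝ] H →ₗ[ℝ] ℝ) (B' : H' →ₗ[ℝ] H' →ₗ[ℝ] ℝ)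
    (hB : ∀ a b, B' (A a) (A b) = B a b) (x : TP H) : gam A (lapT q B x) = lapT q B' (gam A x) := by
  have : gam A ∘ₗ lapT q B = lapT q B' ∘ₗ gam A := TP_ext fun n α h => by
    rw [LinearMap.comp_apply, LinearMap.comp_apply, gam_symFin, ← sym_fin, ← sym_fin, lapT_sym, lapT_sym,
      gam_real_smul, map_sum]
    congr 1
    refine Finset.sum_congr rfl fun i _ => ?_
    rw [map_sum]
    refine Finset.sum_congr rfl fun j _ => ?_
    split_ifs
    · rw [gam_real_smul, hB, conSym, conSym, smul_apply, smul_apply, gam_real_smul, gam_sym]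
    · rw [map_zero]
  exact LinearMap.congr_fun this x

theorem gam_expT (q : ℝ) (A : H →ₗ[ℝ] H') (B : H →ₗ[ℝ] H →ₗ[ℝ] ℝ) (B' : H' →ₗ[ℝ] H' →ₗ[ℝ] ℝ)
    (hB : ∀ a b, B' (A a) (A b) = B a b) (x : TP H) : gam A (expT q B x) = expT q B' (gam A x) :=
  lexp_intertwine_linear _ _ _ (gam_lapT q A B B' hB) x

/-! ### The coefficient of the unit -/

/-- The constant term of `T(α ⊗ h)`, in degree `n`. -/
def counitFin : ∀ n : ℕ, MultilinearMap ℝ (fun _ : Fin n => H) ℂ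
  | 0 => MultilinearMap.constOfIsEmpty ℝ _ 1
  | _ + 1 => 0

/-- The constant term. -/
def counit : TP H →ₗ[ℂ] ℂ :=
  liftTP (fun n _ => counitFin n) fun n σ α h => by cases n <;> rfl

theorem counit_symFin {n : ℕ} (α : S0 n) (h : Fin n → H) :
    counit (symFin α h) = if n = 0 then 1 else 0 := by
  rw [counit, liftTP_symFin]
  cases n <;> rfl

theorem counit_sym {ι : Type*} [Finite ι] (α : Equiv.Perm (Option ι)) (h : ι → H) :
    counit (sym α h) = if Nat.card ι = 0 then 1 else 0 := by
  rw [sym_eq_symFin (Finite.equivFin ι), counit_symFin]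

end ExpLap

/-! ### The product on symbols -/
section Cup
variable {ι κ μ : Type*}

/-- `α ∪ β` for permutations of `{0} ∪ ι` and `{0} ∪ κ`. -/
def cupSum (α : Equiv.Perm (Option ι)) (β : Equiv.Perm (Option κ)) : Equiv.Perm (Option (ι ⊕ κ)) :=
  β.viaEmbedding (Function.Embedding.inr (α := ι)).optionMap *
    α.viaEmbedding (Function.Embedding.inl (β := κ)).optionMap

theorem viaEmbedding_inl (α : Equiv.Perm (Option ι)) (x : Option ι) :
    α.viaEmbedding (Function.Embedding.inl (β := κ)).optionMap (x.map Sum.inl) = (α x).map Sum.inl :=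
  α.viaEmbedding_apply (Function.Embedding.inl (β := κ)).optionMap x

theorem viaEmbedding_inl_inr (α : Equiv.Perm (Option ι)) (k : κ) :
    α.viaEmbedding (Function.Embedding.inl (β := κ)).optionMap (some (Sum.inr k)) = some (Sum.inr k) := by
  refine Equiv.Perm.viaEmbedding_apply_of_notMem _ _ _ ?_
  rintro ⟨_ | y, hy⟩ <;> simp at hy

theorem viaEmbedding_inr (β : Equiv.Perm (Option κ)) (x : Option κ) :
    β.viaEmbedding (Function.Embedding.inr (α := ι)).optionMap (x.map Sum.inr) = (β x).map Sum.inr :=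
  β.viaEmbedding_apply (Function.Embedding.inr (α := ι)).optionMap x

theorem viaEmbedding_inr_inl (β : Equiv.Perm (Option κ)) (i : ι) :
    β.viaEmbedding (Function.Embedding.inr (α := ι)).optionMap (some (Sum.inl i)) = some (Sum.inl i) := by
  refine Equiv.Perm.viaEmbedding_apply_of_notMem _ _ _ ?_
  rintro ⟨_ | y, hy⟩ <;> simp at hy

/-- The point of `{0} ∪ ι ∪ κ` reached from a point of `{0} ∪ ι` by the second factor of `α ∪ β`. -/
def cupJoin (β : Equiv.Perm (Option κ)) (y : Option ι) : Option (ι ⊕ κ) :=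
  y.elim ((β none).map Sum.inr) fun i => some (Sum.inl i)

theorem cupSum_none (α : Equiv.Perm (Option ι)) (β : Equiv.Perm (Option κ)) :
    cupSum α β none = cupJoin β (α none) := by
  rw [cupSum, Equiv.Perm.mul_apply]
  refine (congrArg _ (viaEmbedding_inl α none)).trans ?_
  rcases α none with _ | i
  · exact viaEmbedding_inr β none
  · exact viaEmbedding_inr_inl β i

theorem cupSum_inl (α : Equiv.Perm (Option ι)) (β : Equiv.Perm (Option κ)) (i : ι) :
    cupSum α β (some (Sum.inl i)) = cupJoin β (α (some i)) := by
  rw [cupSum, Equiv.Perm.mul_apply]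
  refine (congrArg _ (viaEmbedding_inl α (some i))).trans ?_
  rcases α (some i) with _ | i
  · exact viaEmbedding_inr β none
  · exact viaEmbedding_inr_inl β i

theorem cupSum_inr (α : Equiv.Perm (Option ι)) (β : Equiv.Perm (Option κ)) (k : κ) :
    cupSum α β (some (Sum.inr k)) = (β (some k)).map Sum.inr := by
  rw [cupSum, Equiv.Perm.mul_apply, viaEmbedding_inl_inr]
  exact viaEmbedding_inr β (some k)

theorem cupSum_equiv {ι' κ' : Type*} (e : ι ≃ ι') (f : κ ≃ κ') (α : Equiv.Perm (Option ι))
    (β : Equiv.Perm (Option κ)) : (e.sumCongr f).optionCongr.permCongr (cupSum α β) =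
      cupSum (e.optionCongr.permCongr α) (f.optionCongr.permCongr β) := by
  have key (y : Option ι) : (e.sumCongr f).optionCongr (cupJoin β y) =
      cupJoin (f.optionCongr.permCongr β) (e.optionCongr y) := by
    rcases y with _ | y
    · change Option.map (e.sumCongr f) (Option.map Sum.inr (β none)) =
        Option.map Sum.inr (Option.map f (β none))
      rw [Option.map_map, Option.map_map]; rfl
    · rfl
  ext1 x
  rcases x with _ | x | x
  · change (e.sumCongr f).optionCongr (cupSum α β none) = _
    rw [cupSum_none, cupSum_none, key]; rfl
  · change (e.sumCongr f).optionCongr (cupSum α β (some (Sum.inl (e.symm x)))) = _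
    rw [cupSum_inl, cupSum_inl, key]; rfl
  · change (e.sumCongr f).optionCongr (cupSum α β (some (Sum.inr (f.symm x)))) = _
    rw [cupSum_inr, cupSum_inr]
    change Option.map (e.sumCongr f) (Option.map Sum.inr (β (some (f.symm x)))) =
        Option.map Sum.inr (Option.map f (β (some (f.symm x))))
    rw [Option.map_map, Option.map_map]; rfl

theorem cup_eq_cupSum {n k : ℕ} (α : S0 n) (β : S0 k) :
    cup α β = finSumFinEquiv.optionCongr.permCongr (cupSum α β) := by
  have h1 {X Y Z : Type} (f : X ↪ Y) (e : Y ≃ Z) (g : X ↪ Z) (h : ∀ x, g x = e (f x)) (σ : Equiv.Perm X) :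
      σ.viaEmbedding g = e.permCongr (σ.viaEmbedding f) := by
    ext1 z
    obtain ⟨y, rfl⟩ := e.surjective z
    rw [Equiv.permCongr_apply, Equiv.symm_apply_apply]
    by_cases hy : y ∈ Set.range f
    · obtain ⟨x, rfl⟩ := hy
      rw [← h, Equiv.Perm.viaEmbedding_apply, Equiv.Perm.viaEmbedding_apply, h]
    · rw [Equiv.Perm.viaEmbedding_apply_of_notMem _ _ _ hy, Equiv.Perm.viaEmbedding_apply_of_notMem]
      rintro ⟨x, hx⟩
      exact hy ⟨x, e.injective (by rw [← h, hx])⟩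
  rw [cup, cupSum, h1 (Function.Embedding.inr (α := Fin n)).optionMap finSumFinEquiv.optionCongr
    (Fin.natAddEmb n).optionMap (by rintro (_ | x) <;> rfl),
    h1 (Function.Embedding.inl (β := Fin k)).optionMap finSumFinEquiv.optionCongr
    (Fin.castAddEmb k).optionMap (by rintro (_ | x) <;> rfl)]
  exact (map_mul finSumFinEquiv.optionCongr.permCongrHom _ _).symm

theorem cupSum_inv (α : Equiv.Perm (Option ι)) (β : Equiv.Perm (Option κ)) :
    (Equiv.sumComm ι κ).optionCongr.permCongr (cupSum α β)⁻¹ = cupSum β⁻¹ α⁻¹ := by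
  have h : (Equiv.sumComm ι κ).optionCongr.permCongr (cupSum α β) * cupSum β⁻¹ α⁻¹ = 1 := by
    have key (y : Option ι) : Option.map Sum.swap (cupSum α β (Option.map Sum.inl y)) =
        Option.map Sum.swap (cupJoin β (α y)) := by
      rcases y with _ | y
      · exact congrArg _ (cupSum_none α β)
      · exact congrArg _ (cupSum_inl α β y)
    have hinv (y) : α (α⁻¹ y) = y := α.apply_symm_apply y
    have hinv' (y) : β (β⁻¹ y) = y := β.apply_symm_apply y
    have key2 (y : Option κ) : Option.map Sum.swap (cupSum α β (Option.map Sum.swap (cupJoin α⁻¹ y))) =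
        Option.map Sum.inl (β y) := by
      rcases y with _ | y
      · change Option.map Sum.swap (cupSum α β (Option.map Sum.swap (Option.map Sum.inr (α⁻¹ none)))) = _
        rw [Option.map_map]
        refine (key _).trans ?_
        rw [hinv]
        change Option.map Sum.swap (Option.map Sum.inr (β none)) = _
        rw [Option.map_map]; rfl
      · change Option.map Sum.swap (cupSum α β (some (Sum.inr y))) = _
        rw [cupSum_inr, Option.map_map]; rfl
    ext1 x
    change Option.map Sum.swap (cupSum α β (Option.map Sum.swap (cupSum β⁻¹ α⁻¹ x))) = x
    rcases x with _ | x | x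
    · rw [cupSum_none, key2, hinv']; rfl
    · rw [cupSum_inl, key2, hinv']; rfl
    · rw [cupSum_inr, Option.map_map]
      refine (key _).trans ?_
      rw [hinv]; rfl
  rw [← eq_inv_iff_mul_eq_one] at h
  change ((Equiv.sumComm ι κ).optionCongr.permCongr (cupSum α β))⁻¹ = _
  rw [h, inv_inv]

variable [Finite ι] [Finite κ]

theorem restrictPerm_cupSum {Y : Type*} (f : Y ↪ ι) (σ : Equiv.Perm (Option ι)) (β : Equiv.Perm (Option κ)) :
    restrictPerm (f.sumMap (Function.Embedding.refl κ)).optionMap (cupSum σ β) =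
      cupSum (restrictPerm f.optionMap σ) β := by
  have hF (y : Option Y) : (f.sumMap (Function.Embedding.refl κ)).optionMap (cupJoin β y) =
      cupJoin β (f.optionMap y) := by
    rcases y with _ | y
    · change Option.map _ (Option.map Sum.inr (β none)) = Option.map Sum.inr (β none)
      rw [Option.map_map]; rfl
    · rfl
  refine restrictPerm_unique fun u hu y => ?_
  have h1 : ∀ x ∉ Set.range f.optionMap, (fun x => u (cupJoin β x)) (σ x) = (fun x => u (cupJoin β x)) x := by
    rintro (_ | x) hx
    · exact (hx ⟨none, rfl⟩).elim
    · change u (cupJoin β (σ (some x))) = u (some (Sum.inl x))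
      rw [← cupSum_inl]
      refine hu (some (Sum.inl x)) ?_
      rintro ⟨_ | y | y, hy⟩
      · simp at hy
      · exact hx ⟨some y, by simpa using hy⟩
      · simp at hy
  rcases y with _ | y | y
  · have := apply_restrictPerm (u := fun x => u (cupJoin β x)) h1 none
    rw [cupSum_none (restrictPerm f.optionMap σ), hF, ← this]
    exact congrArg u (cupSum_none σ β)
  · have := apply_restrictPerm (u := fun x => u (cupJoin β x)) h1 (some y)
    rw [cupSum_inl (restrictPerm f.optionMap σ), hF, ← this]
    exact congrArg u (cupSum_inl σ β (f y))
  · rw [cupSum_inr (restrictPerm f.optionMap σ)]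
    refine congrArg u ((cupSum_inr σ β y).trans ?_)
    change _ = Option.map _ (Option.map Sum.inr _)
    rw [Option.map_map]; rfl

theorem kerCard_cupSum {Y : Type*} (f : Y ↪ ι) (σ : Equiv.Perm (Option ι)) (β : Equiv.Perm (Option κ)) :
    kerCard 2 (f.sumMap (Function.Embedding.refl κ)).optionMap (cupSum σ β) = kerCard 2 f.optionMap σ := by
  have hr (x : ι) : some (Sum.inl x) ∈ Set.range (f.sumMap (Function.Embedding.refl κ)).optionMap ↔
      some x ∈ Set.range f.optionMap := by
    constructor
    · rintro ⟨_ | y | y, hy⟩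
      · simp at hy
      · exact ⟨some y, by simpa using hy⟩
      · simp at hy
    · rintro ⟨_ | y, hy⟩
      · simp at hy
      · exact ⟨some (Sum.inl y), by simpa using hy⟩
  refine Nat.card_congr
    { toFun := fun u => ⟨fun x => u.1 (x.map Sum.inl), ?_, ?_⟩
      invFun := fun v => ⟨fun z => z.elim (v.1 none) (Sum.elim (fun i => v.1 (some i)) fun _ => 0), ?_, ?_⟩
      left_inv := ?_
      right_inv := ?_ }
  · rintro (_ | y)
    · exact u.2.1 none
    · exact u.2.1 (some (Sum.inl y))
  · rintro (_ | x) hx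
    · exact (hx ⟨none, rfl⟩).elim
    · have := u.2.2 (some (Sum.inl x)) (by rwa [hr])
      rw [cupSum_inl] at this
      refine Eq.trans ?_ this
      rcases σ (some x) with _ | y
      · refine (u.2.1 none).trans ?_
        rcases hb : β none with _ | b
        · simp only [cupJoin, Option.elim, hb]; exact (u.2.1 none).symm
        · simp only [cupJoin, Option.elim, hb]; exact (u.2.1 (some (Sum.inr b))).symm
      · rfl
  · rintro (_ | y | y)
    · exact v.2.1 none
    · exact v.2.1 (some y)
    · rfl
  · rintro (_ | x | x) hx
    · exact (hx ⟨none, rfl⟩).elim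
    · have := v.2.2 (some x) (by rwa [← hr])
      refine Eq.trans ?_ this
      rw [cupSum_inl]
      rcases σ (some x) with _ | y
      · have h0 : v.1 none = 0 := v.2.1 none
        rcases hb : β none with _ | b
        · simp [cupJoin, hb]
        · simp [cupJoin, hb, h0]
      · rfl
    · exact (hx ⟨some (Sum.inr x), rfl⟩).elim
  · intro u
    ext1
    funext z
    rcases z with _ | z | z
    · rfl
    · rfl
    · exact (u.2.1 (some (Sum.inr z))).symm
  · intro v
    ext1
    funext x
    rcases x with _ | x <;> rfl

end Cup

section MulStar
variable {H : Type*} [NormedAddCommGroup H] [InnerProductSpace ℝ H]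
variable {H' : Type*} [NormedAddCommGroup H'] [InnerProductSpace ℝ H']
variable {ι κ : Type*} [Finite ι] [Finite κ]

theorem mul_eq_mulTP (x y : TP H) : x * y = mulTP x y := rfl

theorem star_eq_starTP (x : TP H) : star x = starTP x := rfl

theorem starTP_real_smul (c : ℝ) (x : TP H) : starTP (c • x) = c • starTP x := by
  have := (starTP (H := H)).map_smulₛₗ (c : ℂ) x
  rw [Complex.conj_ofReal] at this
  exact this

theorem mulTP_real_smul_left (c : ℝ) (x y : TP H) : mulTP (c • x) y = c • mulTP x y :=
  LinearMap.map_smul₂ (mulTP (H := H)) (c : ℂ) x y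

theorem one_eq_symFin : (1 : TP H) = symFin (n := 0) 1 Fin.elim0 := rfl

theorem symFin_mul {n k : ℕ} (α : S0 n) (β : S0 k) (f : Fin n → H) (g : Fin k → H) :
    symFin α f * symFin β g = symFin (cup α β) (Fin.append f g) := by
  rw [symFin_apply, symFin_apply, toTP_mul, preMul_ten, tensorMul_tprod]; rfl

theorem sym_mul (α : Equiv.Perm (Option ι)) (β : Equiv.Perm (Option κ)) (f : ι → H) (g : κ → H) :
    sym α f * sym β g = sym (cupSum α β) (Sum.elim f g) := by
  rw [sym_eq_symFin (Finite.equivFin ι) α, sym_eq_symFin (Finite.equivFin κ) β, symFin_mul,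
    cup_eq_cupSum, ← cupSum_equiv, ← permCongr_optionCongr_trans,
    sym_eq_symFin (((Finite.equivFin ι).sumCongr (Finite.equivFin κ)).trans finSumFinEquiv)]
  congr 1
  funext i
  refine Fin.addCases (fun i => ?_) (fun i => ?_) i <;> simp

theorem star_sym (α : Equiv.Perm (Option ι)) (h : ι → H) : star (sym α h) = sym α⁻¹ h := by
  rw [sym_eq_symFin (Finite.equivFin ι), sym_eq_symFin (Finite.equivFin ι), symFin_apply, symFin_apply,
    star_toTP, preStar_ten]
  rfl

theorem TP_ext₂ {P : Type*} [AddCommGroup P] [Module ℂ P] {f g : TP H →ₗ[ℂ] TP H' →ₗ[ℂ] P}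
    (h : ∀ (n k : ℕ) (α : S0 n) (β : S0 k) (h : Fin n → H) (h' : Fin k → H'),
      f (symFin α h) (symFin β h') = g (symFin α h) (symFin β h')) : f = g :=
  TP_ext fun n α v => TP_ext fun k β w => h n k α β v w

theorem TP_ext_conj {P : Type*} [AddCommGroup P] [Module ℂ P] {f g : TP H →ₗ⋆[ℂ] P}
    (h : ∀ (n : ℕ) (α : S0 n) (h : Fin n → H), f (symFin α h) = g (symFin α h)) : f = g := by
  refine LinearMap.ext fun x => ?_
  induction x using TP_induction with
  | zero => simp
  | tensor n α v => exact h n α v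
  | smul c x hx => rw [map_smulₛₗ, map_smulₛₗ, hx]
  | add x y hx hy => rw [map_add, map_add, hx, hy]

theorem starTP_starTP (x : TP H) : starTP (starTP x) = x := by
  have : (starTP (H := H)).comp starTP = LinearMap.id := TP_ext fun n α v => by
    rw [LinearMap.comp_apply, ← star_eq_starTP, ← star_eq_starTP, ← sym_fin, star_sym, star_sym, inv_inv]
    rfl
  exact LinearMap.congr_fun this x

theorem starTP_mul (x y : TP H) : starTP (mulTP x y) = mulTP (starTP y) (starTP x) := by
  induction x using TP_induction with
  | zero => simp
  | smul c x hx => simp [hx]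
  | add x y hx hy => simp [hx, hy]
  | tensor n α f =>
    induction y using TP_induction with
    | zero => simp
    | smul c x hx => simp [hx]
    | add x y hx hy => simp [hx, hy]
    | tensor k β g =>
      rw [← mul_eq_mulTP, ← star_eq_starTP, ← mul_eq_mulTP, ← star_eq_starTP, ← star_eq_starTP, ← sym_fin,
        ← sym_fin, star_sym, star_sym, sym_mul, star_sym, sym_mul, ← cupSum_inv,
        ← sym_equiv (Equiv.sumComm (Fin n) (Fin k))]
      congr 1
      funext z
      rcases z with z | z <;> rfl

theorem gam_mulTP (A : H →ₗ[ℝ] H') (x y : TP H) : gam A (mulTP x y) = mulTP (gam A x) (gam A y) := by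
  have : mulTP.compr₂ (gam A) = mulTP.compl₁₂ (gam A) (gam A) := TP_ext₂ fun n k α β f g => by
    rw [LinearMap.compr₂_apply, LinearMap.compl₁₂_apply, gam_symFin, gam_symFin, ← mul_eq_mulTP,
      ← mul_eq_mulTP, ← sym_fin, ← sym_fin, ← sym_fin, ← sym_fin, sym_mul, sym_mul, gam_sym]
    congr 1
    funext z
    rcases z with z | z <;> rfl
  exact LinearMap.congr_fun (LinearMap.congr_fun this x) y

theorem gam_starTP (A : H →ₗ[ℝ] H') (x : TP H) : gam A (starTP x) = starTP (gam A x) := by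
  have : (gam A).comp starTP = starTP.comp (gam A) := TP_ext_conj fun n α f => by
    rw [LinearMap.comp_apply, LinearMap.comp_apply, gam_symFin, ← star_eq_starTP, ← star_eq_starTP,
      ← sym_fin, ← sym_fin, star_sym, star_sym, gam_sym]
  exact LinearMap.congr_fun this x

theorem conSym_inv (q : ℝ) (p : ι → Prop) (τ : Equiv.Perm ι) (hτ : τ * τ = 1) (hp : ∀ x, p x → τ x = x)
    (r : ℤ) (α : Equiv.Perm (Option ι)) (h : ι → H) :
    conSym q p τ r α⁻¹ (fun x => h x) = starTP (conSym q p τ r α fun x => h x) := by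
  have h1 : τ.optionCongr * τ.optionCongr = 1 := by
    rw [← optionCongr_mul, hτ]; ext1 x; simp
  have h2 : τ.optionCongr * α⁻¹ = τ.optionCongr * (τ.optionCongr * α)⁻¹ * τ.optionCongr⁻¹ := by
    rw [mul_inv_rev, inv_eq_of_mul_eq_one_left h1, mul_assoc, mul_assoc, h1, mul_one]
  have h3 : restrictPerm (optSub p) (τ.optionCongr * α⁻¹) =
      (restrictPerm (optSub p) (τ.optionCongr * α))⁻¹ := by
    rw [h2, restrictPerm_conj, restrictPerm_inv]
    rintro (_ | x)
    · rfl
    · exact congrArg some (hp x.1 x.2)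
  have h4 : conWeight q p τ r α⁻¹ = conWeight q p τ r α := by
    rw [conWeight, conWeight, h3, cyc_inv, h2, cyc_conj, cyc_inv]
  rw [conSym, conSym, smul_apply, smul_apply, starTP_real_smul, h4, ← star_eq_starTP, star_sym, h3]

theorem lapT_starTP (q : ℝ) (B : H →ₗ[ℝ] H →ₗ[ℝ] ℝ) (x : TP H) :
    starTP (lapT q B x) = lapT q B (starTP x) := by
  have : starTP.comp (lapT q B) = (lapT q B).comp starTP := TP_ext_conj fun n α f => by
    rw [LinearMap.comp_apply, LinearMap.comp_apply, ← star_eq_starTP (symFin α f), ← sym_fin, star_sym,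
      lapT_sym, lapT_sym, starTP_real_smul, map_sum]
    congr 1
    refine Finset.sum_congr rfl fun i _ => ?_
    rw [map_sum]
    refine Finset.sum_congr rfl fun j _ => ?_
    split_ifs with hij
    · rw [starTP_real_smul, conSym_inv q _ _ (Equiv.swap_mul_self i j)
        fun x hx => Equiv.swap_apply_of_ne_of_ne hx.1 hx.2]
    · rw [map_zero]
  exact LinearMap.congr_fun this x

theorem expT_starTP (q : ℝ) (B : H →ₗ[ℝ] H →ₗ[ℝ] ℝ) (x : TP H) :
    starTP (expT q B x) = expT q B (starTP x) :=
  lexp_intertwine _ _ (starTP (H := H)).toAddMonoidHom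
    (fun k x => ((starTP (H := H)).map_smulₛₗ _ _).trans (by simp)) (lapT_starTP q B) x

theorem optionCongr_sumCongr_mul_cupSum (τ : Equiv.Perm ι) (α : Equiv.Perm (Option ι))
    (β : Equiv.Perm (Option κ)) :
    (Equiv.sumCongr τ (Equiv.refl κ)).optionCongr * cupSum α β = cupSum (τ.optionCongr * α) β := by
  have key (y : Option ι) : (Equiv.sumCongr τ (Equiv.refl κ)).optionCongr (cupJoin β y) =
      cupJoin β (τ.optionCongr y) := by
    rcases y with _ | y
    · change Option.map _ (Option.map Sum.inr (β none)) = Option.map Sum.inr (β none)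
      rw [Option.map_map]; rfl
    · rfl
  ext1 x
  rw [Equiv.Perm.mul_apply]
  rcases x with _ | x | x
  · rw [cupSum_none, cupSum_none, key]; rfl
  · rw [cupSum_inl, cupSum_inl, key]; rfl
  · rw [cupSum_inr, cupSum_inr]
    change Option.map _ (Option.map Sum.inr (β (some x))) = Option.map Sum.inr (β (some x))
    rw [Option.map_map]; rfl

theorem conSym_cupSum (q : ℝ) (p : ι → Prop) (p' : ι ⊕ κ → Prop) (hl : ∀ x, p' (Sum.inl x) ↔ p x)
    (hr : ∀ x, p' (Sum.inr x)) (τ : Equiv.Perm ι) (r : ℤ)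
    (α : Equiv.Perm (Option ι)) (β : Equiv.Perm (Option κ)) (f : ι → H) (g : κ → H) :
    conSym q p' (Equiv.sumCongr τ (Equiv.refl κ)) r (cupSum α β) (fun x => Sum.elim f g x) =
      mulTP (conSym q p τ r α fun x => f x) (sym β g) := by
  let e : {x // p x} ⊕ κ ≃ {z // p' z} :=
    { toFun := Sum.elim (fun x => ⟨Sum.inl x.1, (hl _).2 x.2⟩) fun x => ⟨Sum.inr x, hr x⟩
      invFun := fun z => match z with
        | ⟨Sum.inl x, h⟩ => Sum.inl ⟨x, (hl x).1 h⟩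
        | ⟨Sum.inr x, _⟩ => Sum.inr x
      left_inv := by rintro (x | x) <;> rfl
      right_inv := by rintro ⟨x | x, h⟩ <;> rfl }
  set σ := τ.optionCongr * α with hσ
  have h1 := optionCongr_sumCongr_mul_cupSum τ α β
  rw [← hσ] at h1
  have h2 : restrictPerm (optSub p') (cupSum σ β) =
      e.optionCongr.permCongr (cupSum (restrictPerm (optSub p) σ) β) := by
    have h3 := restrictPerm_cupSum (Function.Embedding.subtype p) σ β
    change _ = cupSum (restrictPerm (optSub p) σ) β at h3
    rw [← h3, ← restrictPerm_equiv _ (optSub p') (Equiv.refl _) e.optionCongr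
      (by rintro (_ | x | x) <;> rfl)]
    rfl
  have h4 : conWeight q p' (Equiv.sumCongr τ (Equiv.refl κ)) r (cupSum α β) = conWeight q p τ r α := by
    have h5 := cyc_sub_congr (kerCard_cupSum (Function.Embedding.subtype p) σ β)
    rw [restrictPerm_cupSum (Function.Embedding.subtype p) σ β] at h5
    change _ = (cyc σ : ℤ) - cyc (restrictPerm (optSub p) σ) at h5
    rw [conWeight, conWeight, h1, h2, cyc_permCongr, ← hσ]
    congr 1
    change _ - (cyc (cupSum (restrictPerm (optSub p) σ) β) : ℤ) = _ at h5
    omega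
  rw [conSym, conSym, smul_apply, smul_apply, mulTP_real_smul_left, h4, ← mul_eq_mulTP, sym_mul, h1, h2,
    ← sym_equiv e]
  congr 2
  funext z
  rcases z with ⟨z | z, hz⟩ <;> rfl

theorem lapT_mul_left {q : ℝ} (B : H →ₗ[ℝ] H →ₗ[ℝ] ℝ) (A : H' →ₗ[ℝ] H)
    (h1 : ∀ a b, B (A a) b = 0) (h2 : ∀ a b, B b (A a) = 0) (x : TP H) (y : TP H') :
    lapT q B (mulTP x (gam A y)) = mulTP (lapT q B x) (gam A y) := by
  have : (mulTP.compl₂ (gam A)).compr₂ (lapT q B) = (mulTP.compl₂ (gam A)).comp (lapT q B) :=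
    TP_ext₂ fun n k α β f g => by
      rw [LinearMap.compr₂_apply, LinearMap.compl₂_apply, LinearMap.comp_apply, LinearMap.compl₂_apply,
        gam_symFin, ← sym_fin, ← sym_fin, ← mul_eq_mulTP, sym_mul, lapT_sym, lapT_sym,
        mulTP_real_smul_left, map_sum, LinearMap.sum_apply]
      congr 1
      rw [Fintype.sum_sum_type, add_eq_left.2]
      · refine Finset.sum_congr rfl fun i _ => ?_
        rw [Fintype.sum_sum_type, add_eq_left.2, map_sum, LinearMap.sum_apply]
        · refine Finset.sum_congr rfl fun j _ => ?_
          by_cases hij : i = j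
          · simp [hij]
          · rw [if_pos hij, if_pos (by simpa using hij), mulTP_real_smul_left,
              ← conSym_cupSum q (fun x => x ≠ i ∧ x ≠ j) (fun x => x ≠ Sum.inl i ∧ x ≠ Sum.inl j)
                (by simp) (by simp)]
            congr 1
            refine conSym_congr (fun _ => Iff.rfl) ?_ _ _ _
            ext1 z
            rcases z with z | z
            · simp [Equiv.swap_apply_def]
            · exact Equiv.swap_apply_of_ne_of_ne (by simp) (by simp)
        · exact Finset.sum_eq_zero fun j _ => by simp [h2]
      · exact Finset.sum_eq_zero fun i _ => Finset.sum_eq_zero fun j _ => by simp [h1]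
  exact LinearMap.congr_fun (LinearMap.congr_fun this x) y

theorem expT_mul_left {q : ℝ} (B : H →ₗ[ℝ] H →ₗ[ℝ] ℝ) (A : H' →ₗ[ℝ] H)
    (h1 : ∀ a b, B (A a) b = 0) (h2 : ∀ a b, B b (A a) = 0) (x : TP H) (y : TP H') :
    expT q B (mulTP x (gam A y)) = mulTP (expT q B x) (gam A y) :=
  (lexp_intertwine_linear (lapT_locallyNilpotent q B) (lapT_locallyNilpotent q B)
    (mulTP.flip (gam A y)) (fun x => (lapT_mul_left B A h1 h2 x y).symm) x).symm

theorem expT_mul_right {q : ℝ} (B : H →ₗ[ℝ] H →ₗ[ℝ] ℝ) (A : H' →ₗ[ℝ] H)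
    (h1 : ∀ a b, B (A a) b = 0) (h2 : ∀ a b, B b (A a) = 0) (x : TP H) (y : TP H') :
    expT q B (mulTP (gam A y) x) = mulTP (gam A y) (expT q B x) := by
  rw [← starTP_starTP (mulTP (gam A y) x), ← expT_starTP, starTP_mul, ← gam_starTP,
    expT_mul_left B A h1 h2, starTP_mul, gam_starTP, starTP_starTP, expT_starTP, starTP_starTP]

end MulStar

/-! ### The product in terms of the images under `e^L` -/
section Double
variable {H : Type*} [NormedAddCommGroup H] [InnerProductSpace ℝ H]

variable (H) in
/-- The inclusion of `H` as the first summand of `H ⊕ H`. -/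
abbrev dblL : H →ₗ[ℝ] WithLp 2 (H × H) :=
  (WithLp.linearEquiv 2 ℝ (H × H)).symm.toLinearMap ∘ₗ LinearMap.inl ℝ H H

variable (H) in
/-- The inclusion of `H` as the second summand of `H ⊕ H`. -/
abbrev dblR : H →ₗ[ℝ] WithLp 2 (H × H) :=
  (WithLp.linearEquiv 2 ℝ (H × H)).symm.toLinearMap ∘ₗ LinearMap.inr ℝ H H

variable (H) in
/-- The projection of `H ⊕ H` onto the first summand. -/
abbrev dblFst : WithLp 2 (H × H) →ₗ[ℝ] H :=
  LinearMap.fst ℝ H H ∘ₗ (WithLp.linearEquiv 2 ℝ (H × H)).toLinearMap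

variable (H) in
/-- The projection of `H ⊕ H` onto the second summand. -/
abbrev dblSnd : WithLp 2 (H × H) →ₗ[ℝ] H :=
  LinearMap.snd ℝ H H ∘ₗ (WithLp.linearEquiv 2 ℝ (H × H)).toLinearMap

variable (H) in
/-- The folding map `(a, b) ↦ a + b`. -/
abbrev dblSum : WithLp 2 (H × H) →ₗ[ℝ] H := dblFst H + dblSnd H

variable (H) in
/-- `((a, b), (c, d)) ↦ ⟨a, d⟩ + ⟨b, c⟩` -/
def crossForm : WithLp 2 (H × H) →ₗ[ℝ] WithLp 2 (H × H) →ₗ[ℝ] ℝ :=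
  (innerₗ H).compl₁₂ (dblFst H) (dblSnd H) + (innerₗ H).compl₁₂ (dblSnd H) (dblFst H)

/-- The product, on elements given by their images under `e^L`. -/
def crossMul (q : ℝ) (x y : TP H) : TP H :=
  gam (dblSum H) (expT q (crossForm H) (mulTP (gam (dblL H) x) (gam (dblR H) y)))

theorem expT_mul {q : ℝ} (hq : q ≠ 0) (x y : TP H) : expT q (innerₗ H) (mulTP x y) =
    crossMul q (expT q (innerₗ H) x) (expT q (innerₗ H) y) := by
  have hl : dblSum H ∘ₗ dblL H = LinearMap.id := by ext; simp
  have hr : dblSum H ∘ₗ dblR H = LinearMap.id := by ext; simp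
  have h0 : mulTP x y = gam (dblSum H) (mulTP (gam (dblL H) x) (gam (dblR H) y)) := by
    rw [gam_mulTP, gam_comp, gam_comp, hl, hr, gam_id, gam_id]
  have h1 : (innerₗ H).compl₁₂ (dblSum H) (dblSum H) = crossForm H +
      ((innerₗ H).compl₁₂ (dblFst H) (dblFst H) + (innerₗ H).compl₁₂ (dblSnd H) (dblSnd H)) := by
    refine LinearMap.ext₂ fun a b => ?_
    simp [crossForm, inner_add_right]
    ring
  rw [h0, ← gam_expT q _ ((innerₗ H).compl₁₂ (dblSum H) (dblSum H)) _ (fun _ _ => rfl), h1, expT_add hq,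
    expT_add hq, expT_mul_right _ _ (by simp) (by simp), ← gam_expT q (dblR H) (innerₗ H) _ (by simp),
    expT_mul_left _ _ (by simp) (by simp), ← gam_expT q (dblL H) (innerₗ H) _ (by simp)]
  rfl

end Double

section Cross
variable {H : Type*} [NormedAddCommGroup H] [InnerProductSpace ℝ H]
variable {ι κ : Type*} [Fintype ι] [Fintype κ] [DecidableEq ι] [DecidableEq κ]

/-- Involutions of `ι ∪ κ` which map every point to itself or to a point on the other side. -/
def IsCross (π : Equiv.Perm (ι ⊕ κ)) : Prop :=
  (∀ z, π (π z) = z) ∧ ∀ z, π z = z ∨ (π z).isLeft ≠ z.isLeft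

instance : DecidablePred (IsCross (ι := ι) (κ := κ)) := fun _ => inferInstanceAs (Decidable (_ ∧ _))

/-- The number of pairs. -/
def crossCard (π : Equiv.Perm (ι ⊕ κ)) : ℕ := (Finset.univ.filter fun i : ι => (π (Sum.inl i)).isRight).card

/-- The product of the inner products over all pairs. -/
def crossProd (f : ι → H) (g : κ → H) (π : Equiv.Perm (ι ⊕ κ)) : ℝ :=
  ∏ i : ι, Sum.elim (fun _ => 1) (fun j => inner ℝ (f i) (g j)) (π (Sum.inl i))

theorem swap_mul_of_fixed {X : Type*} [DecidableEq X] {π : Equiv.Perm X} {a b : X} (ha : π a = a)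
    (hb : π b = b) (z : X) : (Equiv.swap a b * π) z = if z = a then b else if z = b then a else π z := by
  rw [Equiv.Perm.mul_apply]
  split_ifs with h1 h2
  · rw [h1, ha, Equiv.swap_apply_left]
  · rw [h2, hb, Equiv.swap_apply_right]
  · refine Equiv.swap_apply_of_ne_of_ne (fun h => h1 ?_) fun h => h2 ?_
    · exact π.injective (h.trans ha.symm)
    · exact π.injective (h.trans hb.symm)

theorem swap_mul_of_swapped {X : Type*} [DecidableEq X] {π : Equiv.Perm X} {a b : X} (ha : π a = b)
    (hb : π b = a) (z : X) : (Equiv.swap a b * π) z = if z = a then a else if z = b then b else π z := by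
  rw [Equiv.Perm.mul_apply]
  split_ifs with h1 h2
  · rw [h1, ha, Equiv.swap_apply_right]
  · rw [h2, hb, Equiv.swap_apply_left]
  · refine Equiv.swap_apply_of_ne_of_ne (fun h => h2 ?_) fun h => h1 ?_
    · exact π.injective (h.trans hb.symm)
    · exact π.injective (h.trans ha.symm)

theorem isCross_swap_mul {π : Equiv.Perm (ι ⊕ κ)} {i : ι} {j : κ} (hπ : IsCross π)
    (hi : π (Sum.inl i) = Sum.inl i) (hj : π (Sum.inr j) = Sum.inr j) :
    IsCross (Equiv.swap (Sum.inl i) (Sum.inr j) * π) := by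
  have h := swap_mul_of_fixed hi hj
  obtain ⟨h1, h2⟩ := hπ
  have h3 (z) (hz : z ≠ Sum.inl i) : π z ≠ Sum.inl i := fun h => hz (π.injective (h.trans hi.symm))
  have h4 (z) (hz : z ≠ Sum.inr j) : π z ≠ Sum.inr j := fun h => hz (π.injective (h.trans hj.symm))
  refine ⟨fun z => ?_, fun z => ?_⟩
  · rw [h, h]
    by_cases hz : z = Sum.inl i
    · simp [hz]
    by_cases hz' : z = Sum.inr j
    · simp [hz']
    simp [hz, hz', h1, h3, h4]
  · rw [h]
    by_cases hz : z = Sum.inl i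
    · simp [hz]
    by_cases hz' : z = Sum.inr j
    · simp [hz']
    simpa [hz, hz'] using h2 z

theorem isCross_swap_mul' {π : Equiv.Perm (ι ⊕ κ)} {i : ι} {j : κ} (hπ : IsCross π)
    (hi : π (Sum.inl i) = Sum.inr j) : IsCross (Equiv.swap (Sum.inl i) (Sum.inr j) * π) := by
  obtain ⟨h1, h2⟩ := hπ
  have hj : π (Sum.inr j) = Sum.inl i := by rw [← hi, h1]
  have h := swap_mul_of_swapped hi hj
  have h3 (z) (hz : z ≠ Sum.inl i) : π z ≠ Sum.inr j := fun h => hz (π.injective (h.trans hi.symm))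
  have h4 (z) (hz : z ≠ Sum.inr j) : π z ≠ Sum.inl i := fun h => hz (π.injective (h.trans hj.symm))
  refine ⟨fun z => ?_, fun z => ?_⟩
  · rw [h, h]
    by_cases hz : z = Sum.inl i
    · simp [hz]
    by_cases hz' : z = Sum.inr j
    · simp [hz']
    simp [hz, hz', h1, h3, h4]
  · rw [h]
    by_cases hz : z = Sum.inl i
    · simp [hz]
    by_cases hz' : z = Sum.inr j
    · simp [hz']
    simpa [hz, hz'] using h2 z

theorem isCross_swap_mul_iff (π : Equiv.Perm (ι ⊕ κ)) (i : ι) (j : κ) :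
    (IsCross π ∧ π (Sum.inl i) = Sum.inl i ∧ π (Sum.inr j) = Sum.inr j) ↔
      IsCross (Equiv.swap (Sum.inl i) (Sum.inr j) * π) ∧
        (Equiv.swap (Sum.inl i) (Sum.inr j) * π) (Sum.inl i) = Sum.inr j := by
  constructor
  · rintro ⟨h1, h2, h3⟩
    exact ⟨isCross_swap_mul h1 h2 h3, by rw [Equiv.Perm.mul_apply, h2, Equiv.swap_apply_left]⟩
  · rintro ⟨h1, h2⟩
    have h3 := isCross_swap_mul' h1 h2
    have h4 : (Equiv.swap (Sum.inl i) (Sum.inr j) * π) (Sum.inr j) = Sum.inl i := by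
      have := h1.1 (Sum.inl i)
      rwa [h2] at this
    rw [← mul_assoc, Equiv.swap_mul_self, one_mul] at h3
    refine ⟨h3, ?_, ?_⟩
    · rw [Equiv.Perm.mul_apply, Equiv.swap_apply_eq_iff, Equiv.swap_apply_right] at h2
      exact h2
    · rw [Equiv.Perm.mul_apply, Equiv.swap_apply_eq_iff, Equiv.swap_apply_left] at h4
      exact h4

theorem crossCard_swap_mul {π : Equiv.Perm (ι ⊕ κ)} {i : ι} {j : κ}
    (hi : π (Sum.inl i) = Sum.inl i) (hj : π (Sum.inr j) = Sum.inr j) :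
    crossCard (Equiv.swap (Sum.inl i) (Sum.inr j) * π) = crossCard π + 1 := by
  rw [crossCard, crossCard, ← Finset.card_insert_of_notMem (a := i) (by simp [hi])]
  congr 1
  ext x
  simp only [Finset.mem_filter, Finset.mem_univ, true_and, Finset.mem_insert, swap_mul_of_fixed hi hj]
  by_cases hx : x = i <;> simp [hx]

theorem crossProd_swap_mul (f : ι → H) (g : κ → H) {π : Equiv.Perm (ι ⊕ κ)} {i : ι} {j : κ}
    (hi : π (Sum.inl i) = Sum.inl i) (hj : π (Sum.inr j) = Sum.inr j) :
    crossProd f g (Equiv.swap (Sum.inl i) (Sum.inr j) * π) = crossProd f g π * inner ℝ (f i) (g j) := by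
  rw [crossProd, crossProd, ← Finset.mul_prod_erase _ _ (Finset.mem_univ i),
    ← Finset.mul_prod_erase _ (fun i => Sum.elim _ _ (π (Sum.inl i))) (Finset.mem_univ i), hi,
    swap_mul_of_fixed hi hj, mul_comm]
  simp only [if_true, Sum.elim_inr, Sum.elim_inl, one_mul]
  congr 1
  refine Finset.prod_congr rfl fun x hx => ?_
  have hx : x ≠ i := Finset.ne_of_mem_erase hx
  rw [swap_mul_of_fixed hi hj]
  simp [hx]

/-- The contraction of `T(γ ⊗ h)` along the pairs of `π`. -/
def crossSym (q : ℝ) (γ : Equiv.Perm (Option (ι ⊕ κ))) (h : ι ⊕ κ → H) (π : Equiv.Perm (ι ⊕ κ)) : TP H :=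
  conSym q (fun z => π z = z) π (crossCard π) γ fun z => h z

/-- The labels `f` and `g` in the two summands of `H ⊕ H`. -/
def dblLabel (f : ι → H) (g : κ → H) : ι ⊕ κ → WithLp 2 (H × H) :=
  Sum.elim (fun i => dblL H (f i)) fun j => dblR H (g j)

theorem lapT_crossSym {q : ℝ} (hq : q ≠ 0) (γ : Equiv.Perm (Option (ι ⊕ κ))) (f : ι → H) (g : κ → H)
    (π : Equiv.Perm (ι ⊕ κ)) :
    lapT q (crossForm H) (crossSym q γ (dblLabel f g) π) =
      ∑ i, ∑ j, if π (Sum.inl i) = Sum.inl i ∧ π (Sum.inr j) = Sum.inr j then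
        inner ℝ (f i) (g j) • crossSym q γ (dblLabel f g) (Equiv.swap (Sum.inl i) (Sum.inr j) * π) else 0 := by
  have key (i : ι) (j : κ) (hi : π (Sum.inl i) = Sum.inl i) (hj : π (Sum.inr j) = Sum.inr j) :
      crossSym q γ (dblLabel f g) (Equiv.swap (Sum.inl i) (Sum.inr j) * π) =
        conSym q (fun z => π z = z ∧ z ≠ Sum.inl i ∧ z ≠ Sum.inr j)
          (Equiv.swap (Sum.inl i) (Sum.inr j) * π) (crossCard π + 1) γ fun z => dblLabel f g z := by
    rw [crossSym, crossCard_swap_mul hi hj, Nat.cast_add, Nat.cast_one]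
    refine conSym_congr (fun z => ?_) rfl _ _ _
    rw [swap_mul_of_fixed hi hj]
    by_cases h1 : z = Sum.inl i
    · simp [h1]
    by_cases h2 : z = Sum.inr j
    · simp [h2]
    simp [h1, h2]
  have key' (i : ι) (j : κ) (hi : π (Sum.inl i) = Sum.inl i) (hj : π (Sum.inr j) = Sum.inr j) :
      crossSym q γ (dblLabel f g) (Equiv.swap (Sum.inl i) (Sum.inr j) * π) =
        conSym q (fun z => π z = z ∧ z ≠ Sum.inr j ∧ z ≠ Sum.inl i)
          (Equiv.swap (Sum.inr j) (Sum.inl i) * π) (crossCard π + 1) γ fun z => dblLabel f g z := by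
    rw [key i j hi hj]
    exact conSym_congr (fun z => and_congr_right fun _ => and_comm) (by rw [Equiv.swap_comm]) _ _ _
  have e1 : lapT q (crossForm H) (crossSym q γ (dblLabel f g) π) = _ := lapT_conSym hq _ _ _ _ _ _
  rw [e1]
  set S := ∑ i, ∑ j, if π (Sum.inl i) = Sum.inl i ∧ π (Sum.inr j) = Sum.inr j then
        inner ℝ (f i) (g j) • crossSym q γ (dblLabel f g) (Equiv.swap (Sum.inl i) (Sum.inr j) * π) else 0
    with hS
  have h2 : (1 / 2 : ℝ) • (S + S) = S := by
    rw [← two_smul ℝ S, smul_smul]; norm_num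
  rw [← h2]
  congr 1
  rw [Fintype.sum_sum_type]
  congr 1
  · refine Finset.sum_congr rfl fun i _ => ?_
    rw [Fintype.sum_sum_type, add_eq_right.2]
    · refine Finset.sum_congr rfl fun j _ => ?_
      refine if_ctx_congr (by simp) (fun h => ?_) fun _ => rfl
      rw [key i j h.1 h.2]
      congr 1
      simp [dblLabel, crossForm]
    · exact Finset.sum_eq_zero fun j _ => by simp [dblLabel, crossForm]
  · refine Eq.trans ?_ (hS.trans Finset.sum_comm).symm
    refine Finset.sum_congr rfl fun j _ => ?_
    rw [Fintype.sum_sum_type, add_eq_left.2]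
    · refine Finset.sum_congr rfl fun i _ => ?_
      refine if_ctx_congr (by simp [and_comm]) (fun h => ?_) fun _ => rfl
      rw [key' i j h.1 h.2]
      congr 1
      simp [dblLabel, crossForm, real_inner_comm]
    · exact Finset.sum_eq_zero fun j _ => by simp [dblLabel, crossForm]

/-- The sum over all contractions with `r` pairs. -/
def crossSum (q : ℝ) (γ : Equiv.Perm (Option (ι ⊕ κ))) (f : ι → H) (g : κ → H) (r : ℕ) :
    TP (WithLp 2 (H × H)) :=
  ∑ π : Equiv.Perm (ι ⊕ κ), if IsCross π ∧ crossCard π = r then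
    crossProd f g π • crossSym q γ (dblLabel f g) π else 0

theorem lapT_crossSum {q : ℝ} (hq : q ≠ 0) (γ : Equiv.Perm (Option (ι ⊕ κ))) (f : ι → H) (g : κ → H) (r : ℕ) :
    lapT q (crossForm H) (crossSum q γ f g r) = (r + 1 : ℝ) • crossSum q γ f g (r + 1) := by
  have h1 : lapT q (crossForm H) (crossSum q γ f g r) = ∑ i, ∑ j, ∑ π : Equiv.Perm (ι ⊕ κ),
      if (IsCross π ∧ π (Sum.inl i) = Sum.inr j) ∧ crossCard π = r + 1 then
        crossProd f g π • crossSym q γ (dblLabel f g) π else 0 := by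
    have e1 : lapT q (crossForm H) (crossSum q γ f g r) = ∑ π : Equiv.Perm (ι ⊕ κ), ∑ i, ∑ j,
        if (IsCross π ∧ crossCard π = r) ∧ π (Sum.inl i) = Sum.inl i ∧ π (Sum.inr j) = Sum.inr j then
          (crossProd f g π * inner ℝ (f i) (g j)) •
            crossSym q γ (dblLabel f g) (Equiv.swap (Sum.inl i) (Sum.inr j) * π) else 0 := by
      rw [crossSum, map_sum]
      refine Finset.sum_congr rfl fun π _ => ?_
      split_ifs with h
      · rw [lapT_real_smul, lapT_crossSym hq, Finset.smul_sum]
        refine Finset.sum_congr rfl fun i _ => ?_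
        rw [Finset.smul_sum]
        refine Finset.sum_congr rfl fun j _ => ?_
        rw [smul_ite, smul_zero, smul_smul]
        simp [h]
      · simp [h]
    rw [e1, Finset.sum_comm]
    refine Finset.sum_congr rfl fun i _ => ?_
    rw [Finset.sum_comm]
    refine Finset.sum_congr rfl fun j _ => ?_
    refine Fintype.sum_equiv (Equiv.mulLeft (Equiv.swap (Sum.inl i) (Sum.inr j))) _ _ fun π => ?_
    rw [Equiv.coe_mulLeft]
    refine if_ctx_congr ?_ (fun h => ?_) fun _ => rfl
    · rw [← isCross_swap_mul_iff]
      constructor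
      · rintro ⟨⟨a, b⟩, c⟩
        exact ⟨⟨a, c⟩, by rw [crossCard_swap_mul c.1 c.2, b]⟩
      · rintro ⟨⟨a, b⟩, c⟩
        rw [crossCard_swap_mul b.1 b.2] at c
        exact ⟨⟨a, by omega⟩, b⟩
    · rw [← isCross_swap_mul_iff] at h
      rw [crossProd_swap_mul f g h.1.2.1 h.1.2.2]
  rw [h1, crossSum, Finset.smul_sum]
  have h2 (i : ι) : ∑ j, ∑ π : Equiv.Perm (ι ⊕ κ),
      (if (IsCross π ∧ π (Sum.inl i) = Sum.inr j) ∧ crossCard π = r + 1 then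
        crossProd f g π • crossSym q γ (dblLabel f g) π else 0) = ∑ π : Equiv.Perm (ι ⊕ κ),
      if (π (Sum.inl i)).isRight then (if IsCross π ∧ crossCard π = r + 1 then
        crossProd f g π • crossSym q γ (dblLabel f g) π else 0) else 0 := by
    rw [Finset.sum_comm]
    refine Finset.sum_congr rfl fun π _ => ?_
    rcases hπ : π (Sum.inl i) with x | x
    · simp
    · rw [Finset.sum_eq_single x]
      · simp
      · intro j _ hj
        simp [Ne.symm hj]
      · simp
  rw [Finset.sum_congr rfl fun i _ => h2 i, Finset.sum_comm]
  refine Finset.sum_congr rfl fun π _ => ?_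
  rw [← Finset.sum_filter, Finset.sum_const]
  change crossCard π • _ = _
  split_ifs with h
  · rw [h.2, ← Nat.cast_smul_eq_nsmul ℝ]
    push_cast
    rfl
  · simp

theorem crossSum_zero (q : ℝ) (γ : Equiv.Perm (Option (ι ⊕ κ))) (f : ι → H) (g : κ → H) :
    crossSum q γ f g 0 = sym γ (dblLabel f g) := by
  have h0 (π : Equiv.Perm (ι ⊕ κ)) : (IsCross π ∧ crossCard π = 0) ↔ π = 1 := by
    constructor
    · rintro ⟨⟨h1, h2⟩, h3⟩
      have hl (i : ι) : π (Sum.inl i) = Sum.inl i := by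
        rw [crossCard, Finset.card_eq_zero, Finset.filter_eq_empty_iff] at h3
        have h4 := h3 (Finset.mem_univ i)
        have h5 := h2 (Sum.inl i)
        rcases hz : π (Sum.inl i) with x | x
        · rw [hz] at h5; simpa using h5
        · rw [hz] at h4; simp at h4
      ext1 z
      rcases z with i | j
      · exact hl i
      · have h5 := h2 (Sum.inr j)
        rcases hz : π (Sum.inr j) with x | x
        · have := h1 (Sum.inr j)
          rw [hz, hl] at this
          simp at this
        · rw [hz] at h5; simpa using h5
    · rintro rfl
      refine ⟨⟨fun _ => rfl, fun _ => Or.inl rfl⟩, ?_⟩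
      rw [crossCard, Finset.card_eq_zero, Finset.filter_eq_empty_iff]
      simp
  rw [crossSum, Finset.sum_eq_single 1]
  · rw [if_pos ((h0 1).2 rfl), crossProd, crossSym, ((h0 1).2 rfl).2]
    simp only [Equiv.Perm.coe_one, id, Sum.elim_inl, Finset.prod_const_one, one_smul]
    exact conSym_all q _ (fun _ => rfl) γ _
  · intro π _ hπ
    rw [if_neg fun h => hπ ((h0 π).1 h)]
  · simp

theorem lapT_pow_crossSum {q : ℝ} (hq : q ≠ 0) (γ : Equiv.Perm (Option (ι ⊕ κ))) (f : ι → H) (g : κ → H) (k : ℕ) :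
    (lapT q (crossForm H) ^ k) (sym γ (dblLabel f g)) = (k.factorial : ℂ) • crossSum q γ f g k := by
  induction k with
  | zero => simp [crossSum_zero]
  | succ k ih =>
    rw [pow_succ', Module.End.mul_apply, ih, map_smul, lapT_crossSum hq, Nat.factorial_succ]
    change (k.factorial : ℂ) • (((k + 1 : ℝ) : ℂ) • crossSum q γ f g (k + 1)) = _
    rw [smul_smul]
    push_cast
    rw [mul_comm]

theorem crossCard_le (π : Equiv.Perm (ι ⊕ κ)) : crossCard π ≤ Fintype.card ι :=
  Finset.card_le_univ _

theorem expT_crossForm {q : ℝ} (hq : q ≠ 0) (γ : Equiv.Perm (Option (ι ⊕ κ))) (f : ι → H) (g : κ → H) :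
    expT q (crossForm H) (sym γ (dblLabel f g)) = ∑ π : Equiv.Perm (ι ⊕ κ),
      if IsCross π then crossProd f g π • crossSym q γ (dblLabel f g) π else 0 := by
  have h0 : (lapT q (crossForm H) ^ (Fintype.card ι + 1)) (sym γ (dblLabel f g)) = 0 := by
    rw [lapT_pow_crossSum hq, crossSum]
    refine (congrArg _ (Finset.sum_eq_zero fun π _ => if_neg fun h => ?_)).trans (smul_zero _)
    have := crossCard_le π
    omega
  rw [expT, lexp_eq_sum _ h0]
  have h1 (k : ℕ) : (k.factorial : ℂ)⁻¹ • (lapT q (crossForm H) ^ k) (sym γ (dblLabel f g)) =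
      crossSum q γ f g k := by
    rw [lapT_pow_crossSum hq, smul_smul, inv_mul_cancel₀ (Nat.cast_ne_zero.2 (Nat.factorial_ne_zero k)), one_smul]
  simp only [h1, crossSum]
  rw [Finset.sum_comm]
  refine Finset.sum_congr rfl fun π _ => ?_
  rw [Finset.sum_eq_single (crossCard π)]
  · simp
  · intro k _ hk
    rw [if_neg fun h => hk h.2.symm]
  · intro h
    exact (h (Finset.mem_range.2 (Nat.lt_succ_of_le (crossCard_le π)))).elim

theorem crossMul_sym {q : ℝ} (hq : q ≠ 0) (α : Equiv.Perm (Option ι)) (β : Equiv.Perm (Option κ))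
    (f : ι → H) (g : κ → H) : crossMul q (sym α f) (sym β g) = ∑ π : Equiv.Perm (ι ⊕ κ),
      if IsCross π then crossProd f g π • crossSym q (cupSum α β) (Sum.elim f g) π else 0 := by
  rw [crossMul, gam_sym, gam_sym, ← mul_eq_mulTP, sym_mul]
  have h1 := expT_crossForm hq (cupSum α β) f g
  rw [dblLabel] at h1
  rw [h1, map_sum]
  refine Finset.sum_congr rfl fun π _ => ?_
  split_ifs
  · rw [gam_real_smul, crossSym, crossSym, conSym, conSym, smul_apply, smul_apply, gam_real_smul, gam_sym]
    congr 3
    funext ⟨z, hz⟩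
    rcases z with z | z <;> simp
  · rw [map_zero]

/-- `crossMul` as a bilinear map. -/
def crossMulₗ (q : ℝ) : TP H →ₗ[ℂ] TP H →ₗ[ℂ] TP H :=
  (mulTP.compl₁₂ (gam (dblL H)) (gam (dblR H))).compr₂ (gam (dblSum H) ∘ₗ expT q (crossForm H))

theorem crossMulₗ_apply (q : ℝ) (x y : TP H) : crossMulₗ q x y = crossMul q x y := rfl

end Cross

/-! ### The Laplacian, the state and the embedding on `APre H` -/
section Relations
variable {H : Type*} [NormedAddCommGroup H] [InnerProductSpace ℝ H]

theorem APre_ext {P : Type*} [AddCommGroup P] [Module ℂ P] {f g : APre H →ₗ[ℂ] P}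
    (h : ∀ (n : ℕ) (α : S0 n) (h : Fin n → H), f (ten α (PiTensorProduct.tprod ℝ h)) =
      g (ten α (PiTensorProduct.tprod ℝ h))) : f = g := by
  refine pre_ext fun n α F => ?_
  have : (f.restrictScalars ℝ ∘ₗ tenR α : AlgTensor H n →ₗ[ℝ] P) = g.restrictScalars ℝ ∘ₗ tenR α :=
    PiTensorProduct.ext (MultilinearMap.ext fun v => h n α v)
  exact LinearMap.congr_fun this F

theorem sum_pairs {n : ℕ} {M : Type*} [AddCommGroup M] [Module ℝ M] (t : Fin n → Fin n → M)
    (ht : ∀ i j, i ≠ j → t i j = t j i) :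
    (1 / 2 : ℝ) • ∑ i, ∑ j, (if i ≠ j then t i j else 0) =
      ∑ p : {p : Fin n × Fin n // p.1 < p.2}, t p.1.1 p.1.2 := by
  set S := ∑ p : {p : Fin n × Fin n // p.1 < p.2}, t p.1.1 p.1.2 with hS
  have h1 : S = ∑ i, ∑ j, if i < j then t i j else 0 := by
    rw [hS, ← Fintype.sum_prod_type' (f := fun i j => if i < j then t i j else 0), ← Finset.sum_filter,
      Finset.sum_subtype (p := fun p : Fin n × Fin n => p.1 < p.2) _ (by simp)]
  have h2 : ∑ i, ∑ j, (if i ≠ j then t i j else 0) = S + S := by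
    have h3 : S = ∑ i, ∑ j, if j < i then t j i else 0 := h1.trans Finset.sum_comm
    conv_rhs => enter [1]; rw [h1]
    rw [h3, ← Finset.sum_add_distrib]
    refine Finset.sum_congr rfl fun i _ => ?_
    rw [← Finset.sum_add_distrib]
    refine Finset.sum_congr rfl fun j _ => ?_
    rcases lt_trichotomy i j with h | h | h
    · rw [if_pos h.ne, if_pos h, if_neg h.asymm, add_zero]
    · simp [h]
    · rw [if_pos h.ne', if_pos h, if_neg h.asymm, zero_add, ht i j h.ne']
  rw [h2, ← two_smul ℝ S, smul_smul]
  norm_num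

theorem conSym_pair (q : ℝ) {n : ℕ} (p : {p : Fin (n + 2) × Fin (n + 2) // p.1 < p.2}) (α : S0 (n + 2))
    (h : Fin (n + 2) → H) :
    conSym q (fun x => x ≠ p.1.1 ∧ x ≠ p.1.2) (Equiv.swap p.1.1 p.1.2) 1 α (fun x => h x) =
      contrWeight q p α • symFin (contrPerm p α) fun k => h (pairEmb p k) := by
  let e : Fin n ≃ {x // x ≠ p.1.1 ∧ x ≠ p.1.2} := Equiv.ofBijective
    (fun k => ⟨pairEmb p k, (pairEmb_range p _).1 ⟨k, rfl⟩⟩)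
    ⟨fun a b hab => (pairEmb p).injective (by simpa using hab),
      fun x => by
        obtain ⟨k, hk⟩ := (pairEmb_range p _).2 x.2
        exact ⟨k, Subtype.ext hk⟩⟩
  have h1 : (Equiv.swap p.1.1 p.1.2).optionCongr * α = transMul p α := by
    rw [transMul, Equiv.optionCongr_swap]
  have h2 : restrictPerm (optSub fun x => x ≠ p.1.1 ∧ x ≠ p.1.2) (transMul p α) =
      e.optionCongr.permCongr (contrPerm p α) := by
    rw [contrPerm, ← restrictPerm_equiv (pairEmb p).toEmbedding.optionMap
      (optSub fun x => x ≠ p.1.1 ∧ x ≠ p.1.2) (Equiv.refl _) e.optionCongr (by rintro (_ | x) <;> rfl)]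
    rfl
  rw [conSym, smul_apply, conWeight, contrWeight, h1, h2, cyc_permCongr, cyc0, cyc0, ← sym_fin, ← sym_equiv e]
  congr 2
  · ring
  · funext x
    obtain ⟨k, rfl⟩ := e.surjective x
    rw [Equiv.symm_apply_apply]
    rfl

theorem toTP_lap (q : ℝ) (x : APre H) : toTP (lap q x) = lapT q (innerₗ H) (toTP x) := by
  have : toTP ∘ₗ lap (H := H) q = lapT q (innerₗ H) ∘ₗ toTP := APre_ext fun n α h => by
    rw [LinearMap.comp_apply, LinearMap.comp_apply, ← symFin_apply, ← sym_fin, lapT_sym, lap, preLift_ten]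
    rcases n with _ | _ | n
    · simp [lapDeg]
    · rw [Finset.sum_eq_zero fun i _ => Finset.sum_eq_zero fun j _ => if_neg (not_not.2 (Subsingleton.elim (α := Fin 1) i j))]
      simp [lapDeg]
    · rw [sum_pairs fun i j => innerₗ H (h i) (h j) • conSym q (fun x => x ≠ i ∧ x ≠ j) (Equiv.swap i j) 1 α
        (fun x => h x)]
      · rw [lapDeg, LinearMap.sum_apply, map_sum]
        refine Finset.sum_congr rfl fun p _ => ?_
        rw [conSym_pair, LinearMap.smul_apply, LinearMap.comp_apply, contrTensor, PiTensorProduct.lift.tprod,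
          smul_comm]
        change (toTP (H := H)).restrictScalars ℝ (contrWeight q p α • tenR (contrPerm p α)
          (inner ℝ (h p.1.1) (h p.1.2) • PiTensorProduct.tprod ℝ fun k => h (pairEmb p k))) = _
        rw [map_smul, map_smul, map_smul]
        rfl
      · intro i j _
        congr 1
        · exact real_inner_comm _ _
        · exact conSym_congr (fun _ => and_comm) (Equiv.swap_comm i j) _ _ _
  exact LinearMap.congr_fun this x

theorem toTP_expLap (q : ℝ) (x : APre H) : toTP (expLap q x) = expT q (innerₗ H) (toTP x) := by
  have hp (k : ℕ) (x : APre H) : toTP ((lap q ^ k) x) = (lapT q (innerₗ H) ^ k) (toTP x) := by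
    induction k with
    | zero => rfl
    | succ k ih => rw [pow_succ', pow_succ', Module.End.mul_apply, toTP_lap, ih, Module.End.mul_apply]
  have : toTP ∘ₗ expLap (H := H) q = expT q (innerₗ H) ∘ₗ toTP := APre_ext fun n α h => by
    have h0 : (lapT q (innerₗ H) ^ (n + 1)) (toTP (ten α (PiTensorProduct.tprod ℝ h))) = 0 := by
      rw [← symFin_apply, ← sym_fin]
      exact lapT_pow_sym _ n α h (by simp)
    rw [LinearMap.comp_apply, LinearMap.comp_apply, expT, lexp_eq_sum _ h0, expLap, ten,
      DirectSum.toModule_lof, LinearMap.sum_apply, map_sum]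
    refine Finset.sum_congr rfl fun k _ => ?_
    rw [LinearMap.smul_apply, map_smul, LinearMap.comp_apply, hp]
  exact LinearMap.congr_fun this x

theorem phi_eq_counit (q : ℝ) (x : APre H) : phi q x = counit (expT q (innerₗ H) (toTP x)) := by
  have : (fibLift fun _ => Complex.ofRealCLM.toLinearMap ∘ₗ
      (PiTensorProduct.isEmptyEquiv (R := ℝ) (s := fun _ : Fin 0 => H) (Fin 0)).toLinearMap) ∘ₗ
      DirectSum.component ℂ ℕ (Fib (AlgTensor H)) 0 = counit ∘ₗ toTP := APre_ext fun n α h => by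
    rw [LinearMap.comp_apply counit, ← symFin_apply, counit_symFin]
    rcases n with _ | n
    · simp [ten, DirectSum.component.lof_self, fibLift_fibTen]
    · simp [ten, DirectSum.component.of]
  rw [← toTP_expLap]
  exact LinearMap.congr_fun this _

/-- The inclusion of `TP(H)` in `BarTP H`, `T(α ⊗ F) ↦ I(α ⊗ F)`. -/
def tpToBar : TP H →ₗ[ℂ] BarTP H :=
  (symSub (algPerm H)).liftQ (toBar ∘ₗ preLift fun n α => tenR α ∘ₗ toHilb n) (by
    refine Submodule.span_le.2 ?_
    rintro _ ⟨n, σ, α, F, rfl⟩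
    rw [SetLike.mem_coe, LinearMap.mem_ker, map_sub, LinearMap.comp_apply, LinearMap.comp_apply,
      preLift_ten, preLift_ten, sub_eq_zero]
    have h1 : toHilb n (algPerm H n σ F) = hilbPermₗ H n σ (toHilb n F) :=
      (hilbExtend_toHilb (algPerm H n σ) _ F).symm
    rw [LinearMap.comp_apply, LinearMap.comp_apply, h1]
    exact (toBar_sym σ α _).symm)

theorem tpToBar_toTP_ten {n : ℕ} (α : S0 n) (F : AlgTensor H n) :
    tpToBar (toTP (ten α F)) = symI α (toHilb n F) :=
  congrArg toBar (preLift_ten (fun n α => tenR α ∘ₗ toHilb n) α F)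

theorem tpToBar_symFin {n : ℕ} (α : S0 n) (h : Fin n → H) :
    tpToBar (symFin α h) = symI α (toHilb n (PiTensorProduct.tprod ℝ h)) := tpToBar_toTP_ten α _

theorem algToBar_eq (q : ℝ) (x : APre H) : algToBar q x = tpToBar (expT q (innerₗ H) (toTP x)) := by
  rw [← toTP_expLap]; rfl

theorem symI_conj {n : ℕ} (σ : Equiv.Perm (Fin n)) (α : S0 n) (F : HilbTensor H n) :
    symI (conj0 σ α) (hilbPerm n σ F) = symI α F := toBar_sym σ α F

/-- `F ↦ I(α ⊗ F)`, as a real linear map. -/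
def symIₗ {n : ℕ} (α : S0 n) : HilbTensor H n →ₗ[ℝ] BarTP H := (toBar (H := H)).restrictScalars ℝ ∘ₗ tenR α

theorem barTP_induction {motive : BarTP H → Prop} (zero : motive 0)
    (tensor : ∀ (n : ℕ) (α : S0 n) (F : HilbTensor H n), motive (symI α F))
    (smul : ∀ (c : ℂ) x, motive x → motive (c • x))
    (add : ∀ x y, motive x → motive y → motive (x + y)) (x : BarTP H) : motive x := by
  obtain ⟨x, rfl⟩ := toBar_surjective x
  induction x using pre_induction with
  | zero => rw [map_zero]; exact zero
  | smul c x hx => rw [map_smul]; exact smul c _ hx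
  | add x y hx hy => rw [map_add]; exact add _ _ hx hy
  | tensor n α F => exact tensor n α F

theorem barTP_ext {P : Type*} [AddCommGroup P] [Module ℂ P] {f g : BarTP H →ₗ[ℂ] P}
    (h : ∀ (n : ℕ) (α : S0 n) (F : HilbTensor H n), f (symI α F) = g (symI α F)) : f = g :=
  Submodule.linearMap_qext _ (pre_ext fun n α F => h n α F)

/-- Linear maps on `BarTP H` are invariant families of linear maps. -/
def liftBar {P : Type*} [AddCommGroup P] [Module ℂ P] (f : ∀ n, S0 n → HilbTensor H n →ₗ[ℝ] P)
    (hf : ∀ n (σ : Equiv.Perm (Fin n)) (α : S0 n) (F : HilbTensor H n),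
      f n (conj0 σ α) (hilbPerm n σ F) = f n α F) : BarTP H →ₗ[ℂ] P :=
  (symSub (hilbPermₗ H)).liftQ (preLift f) (by
    refine Submodule.span_le.2 ?_
    rintro _ ⟨n, σ, α, F, rfl⟩
    rw [SetLike.mem_coe, LinearMap.mem_ker, map_sub, preLift_ten, preLift_ten, sub_eq_zero]
    exact (hf n σ α F).symm)

theorem liftBar_symI {P : Type*} [AddCommGroup P] [Module ℂ P] (f : ∀ n, S0 n → HilbTensor H n →ₗ[ℝ] P)
    (hf : ∀ n (σ : Equiv.Perm (Fin n)) (α : S0 n) (F : HilbTensor H n),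
      f n (conj0 σ α) (hilbPerm n σ F) = f n α F) {n : ℕ} (α : S0 n) (F : HilbTensor H n) :
    liftBar f hf (symI α F) = f n α F :=
  preLift_ten f α F

end Relations

/-! ### The Hilbert norm of `BarTP H` -/
section BarNorm
variable {H : Type*} [NormedAddCommGroup H] [InnerProductSpace ℝ H]

theorem barForm_symI (q : ℝ) {n : ℕ} (α β : S0 n) (F G : HilbTensor H n) :
    barForm q (symI α F) (symI β G) = (kernelForm q α β F G : ℂ) := preForm_ten q α β F G

theorem barForm_symI_ne (q : ℝ) {n k : ℕ} (h : n ≠ k) (α : S0 n) (β : S0 k) (F : HilbTensor H n)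
    (G : HilbTensor H k) : barForm q (symI α F) (symI β G) = 0 := preForm_ten_ne q h α β F G

theorem barConj_symI {n : ℕ} (α : S0 n) (F : HilbTensor H n) : barConj (symI α F) = symI α F :=
  congrArg toBar (preConj_ten α F)

theorem barInner_add_right (q : ℝ) (x y z : BarTP H) : barInner q x (y + z) = barInner q x y + barInner q x z := by
  rw [barInner, map_add barConj, map_add]; rfl

theorem barInner_smul_right (q : ℝ) (c : ℂ) (x y : BarTP H) : barInner q x (c • y) = conj c * barInner q x y := by
  rw [barInner, map_smulₛₗ barConj, map_smul]; rfl

theorem barInner_add_left (q : ℝ) (x y z : BarTP H) : barInner q (x + y) z = barInner q x z + barInner q y z := by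
  rw [barInner, map_add]; rfl

theorem barInner_smul_left (q : ℝ) (c : ℂ) (x y : BarTP H) : barInner q (c • x) y = c * barInner q x y := by
  rw [barInner, map_smul]; rfl

theorem barInner_symI (q : ℝ) {n : ℕ} (α β : S0 n) (F G : HilbTensor H n) :
    barInner q (symI α F) (symI β G) = (kernelForm q α β F G : ℂ) := by
  rw [barInner, barConj_symI, barForm_symI]

theorem barInner_symI_ne (q : ℝ) {n k : ℕ} (h : n ≠ k) (α : S0 n) (β : S0 k) (F : HilbTensor H n)
    (G : HilbTensor H k) : barInner q (symI α F) (symI β G) = 0 := by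
  rw [barInner, barConj_symI, barForm_symI_ne q h]

theorem barInner_conj_symm (q : ℝ) (x y : BarTP H) : conj (barInner q x y) = barInner q y x := by
  obtain ⟨x, rfl⟩ := toBar_surjective x
  obtain ⟨y, rfl⟩ := toBar_surjective y
  simp only [barInner, barConj_toBar, barForm_toBar]
  rw [← preForm_conj, preConj_preConj, preForm_symm]

theorem continuous_barInner (x y : BarTP H) : Continuous fun q : ℝ => barInner q x y := by
  induction x using barTP_induction with
  | zero => simpa [barInner] using continuous_const
  | smul c x hx => simpa only [barInner_smul_left] using hx.const_mul c
  | add x x' hx hx' =>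
    simp only [barInner_add_left]
    exact hx.add hx'
  | tensor n α F =>
    induction y using barTP_induction with
    | zero => simpa [barInner] using continuous_const
    | smul c x hx => simpa only [barInner_smul_right] using hx.const_mul (conj c)
    | add x x' hx hx' =>
      simp only [barInner_add_right]
      exact hx.add hx'
    | tensor k β G =>
      by_cases h : n = k
      · subst h
        simp only [barInner_symI, kernelForm_apply, chi]
        fun_prop
      · simpa only [barInner_symI_ne _ h] using continuous_const

theorem baseNormSq_nonneg (x : BarTP H) : 0 ≤ baseNormSq x := by
  have h : Filter.Tendsto (fun n : ℕ => (barInner (1 / ((n + 1 : ℕ) : ℝ)) x x).re) Filter.atTop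
      (nhds (barInner 0 x x).re) := by
    refine (Complex.continuous_re.tendsto _).comp (((continuous_barInner x x).tendsto 0).comp ?_)
    simpa using tendsto_one_div_add_atTop_nhds_zero_nat (𝕜 := ℝ)
  refine ge_of_tendsto' h fun n => ?_
  obtain ⟨x, rfl⟩ := toBar_surjective x
  exact preForm_nonneg (n + 1) x

theorem chi_zero {n : ℕ} (α : S0 n) : chi 0 α = if α = 1 then 1 else 0 := by
  have h1 : cyc (1 : S0 n) = n + 1 := by
    have := card_fixed (1 : S0 n) 2
    rw [Nat.card_congr (Equiv.subtypeUnivEquiv (p := fun u : Option (Fin n) → Fin 2 => u ∘ (1 : S0 n) = u)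
      fun _ => rfl), Nat.card_fun] at this
    simp only [Nat.card_eq_fintype_card, Fintype.card_option, Fintype.card_fin] at this
    exact (Nat.pow_right_injective le_rfl this).symm
  split_ifs with h
  · rw [h, chi, h1]; simp
  · rw [chi, zero_pow]
    intro h2
    refine h ?_
    have h3 : cyc α = n + 1 := le_antisymm (cyc_le α) (by omega)
    rw [cyc] at h3
    have h4 : Function.Bijective (Quotient.mk (Equiv.Perm.SameCycle.setoid α)) := by
      have := Fintype.ofFinite (Quotient (Equiv.Perm.SameCycle.setoid α))
      rw [Fintype.bijective_iff_surjective_and_card]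
      refine ⟨Quotient.mk_surjective, ?_⟩
      rw [← Nat.card_eq_fintype_card, ← Nat.card_eq_fintype_card, h3]
      simp
    ext1 x
    exact h4.1 (Quotient.sound (Equiv.Perm.SameCycle.symm ⟨1, by simp⟩))

theorem kernelForm_zero {n : ℕ} (α β : S0 n) (F G : HilbTensor H n) :
    kernelForm 0 α β F G = ∑ σ : Equiv.Perm (Fin n), if α = conj0 σ β then inner ℝ F (hilbPerm n σ G) else 0 := by
  rw [kernelForm_apply]
  refine Finset.sum_congr rfl fun σ _ => ?_
  rw [chi_zero, ← conj0_inv]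
  simp only [mul_inv_eq_one, ite_mul, one_mul, zero_mul]

/-- The averaging map `I(α ⊗ F) ↦ (n!)⁻¹ ∑_σ σ α σ⁻¹ ⊗ U_σ F`. -/
def barAvg : BarTP H →ₗ[ℂ] HPre H :=
  liftBar (fun n α => (n.factorial : ℝ)⁻¹ • ∑ σ : Equiv.Perm (Fin n), tenR (conj0 σ α) ∘ₗ hilbPermₗ H n σ)
    fun n τ α F => by
      simp only [LinearMap.smul_apply, LinearMap.sum_apply, LinearMap.comp_apply]
      congr 1
      refine Fintype.sum_equiv (Equiv.mulRight τ) _ _ fun σ => ?_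
      rw [Equiv.coe_mulRight, conj0_mul]
      congr 1
      exact (hilbPerm_mul σ τ F).symm

theorem barAvg_symI {n : ℕ} (α : S0 n) (F : HilbTensor H n) : barAvg (symI α F) =
    (n.factorial : ℝ)⁻¹ • ∑ σ : Equiv.Perm (Fin n), ten (conj0 σ α) (hilbPerm n σ F) := by
  rw [barAvg, liftBar_symI, LinearMap.smul_apply, LinearMap.sum_apply]; rfl

theorem toBar_barAvg (x : BarTP H) : toBar (barAvg x) = x := by
  have : toBar ∘ₗ barAvg (H := H) = LinearMap.id := barTP_ext fun n α F => by
    have h0 (σ : Equiv.Perm (Fin n)) : toBar (ten (conj0 σ α) (hilbPerm n σ F)) = symI α F := symI_conj σ α F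
    rw [LinearMap.comp_apply, barAvg_symI]
    change (toBar (H := H)).restrictScalars ℝ _ = _
    rw [map_smul, map_sum]
    change (n.factorial : ℝ)⁻¹ • ∑ σ : Equiv.Perm (Fin n), toBar (ten (conj0 σ α) (hilbPerm n σ F)) = _
    simp only [h0]
    rw [Finset.sum_const, Finset.card_univ, Fintype.card_perm, Fintype.card_fin,
      ← Nat.cast_smul_eq_nsmul ℝ, smul_smul, inv_mul_cancel₀ (Nat.cast_ne_zero.2 n.factorial_ne_zero), one_smul]
    rfl
  exact LinearMap.congr_fun this x

/-- The coefficient of `α`, paired with `G`. -/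
def fibCoeff {n : ℕ} (β : S0 n) (G : HilbTensor H n) : Fib (HilbTensor H) n →ₗ[ℂ] ℂ :=
  open Classical in fibLift fun α => if α = β then Complex.ofRealCLM.toLinearMap ∘ₗ innerₗ _ G else 0

theorem fib_eq_sum {n : ℕ} (y : Fib (HilbTensor H) n) : ∃ R I : S0 n → HilbTensor H n,
    y = ∑ α, (fibTen α (R α) + Complex.I • fibTen α (I α)) := by
  classical
  have hy : y ∈ Submodule.span ℂ (Set.range fun p : S0 n × HilbTensor H n => (fibTen p.1 p.2 : Fib (HilbTensor H) n)) := by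
    rw [fib_span]; trivial
  have hre (r : ℝ) (α : S0 n) (F : HilbTensor H n) : fibTen α (r • F) = (r : ℂ) • (fibTen α F : Fib (HilbTensor H) n) :=
    (fibTen α : HilbTensor H n →ₗ[ℝ] Fib (HilbTensor H) n).map_smul r F
  induction hy using Submodule.span_induction with
  | zero => exact ⟨0, 0, by simp⟩
  | add x y _ _ hx hy =>
    obtain ⟨R, I, h1⟩ := hx
    obtain ⟨R', I', h2⟩ := hy
    refine ⟨R + R', I + I', ?_⟩
    rw [h1, h2, ← Finset.sum_add_distrib]
    refine Finset.sum_congr rfl fun α _ => ?_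
    simp only [Pi.add_apply, map_add, smul_add]
    abel
  | smul c x _ hx =>
    obtain ⟨R, I, h1⟩ := hx
    refine ⟨c.re • R - c.im • I, c.re • I + c.im • R, ?_⟩
    rw [h1, Finset.smul_sum]
    refine Finset.sum_congr rfl fun α _ => ?_
    simp only [Pi.add_apply, Pi.sub_apply, Pi.smul_apply, map_add, map_sub, hre]
    conv_lhs => rw [← Complex.re_add_im c]
    match_scalars
    all_goals first | ring1 | linear_combination (c.im : ℂ) * Complex.I_mul_I
  | mem z hz =>
    obtain ⟨⟨α, F⟩, rfl⟩ := hz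
    refine ⟨Pi.single α F, 0, ?_⟩
    rw [Finset.sum_eq_single α]
    · simp
    · intro β _ hβ
      simp [hβ]
    · simp

theorem fibCoeff_fibTen {n : ℕ} (α β : S0 n) (F G : HilbTensor H n) :
    fibCoeff β G (fibTen α F) = if α = β then (inner ℝ G F : ℂ) else 0 := by
  rw [fibCoeff, fibLift_fibTen]
  split_ifs <;> rfl

theorem fib_eq_zero {n : ℕ} (y : Fib (HilbTensor H) n) (h : ∀ β G, fibCoeff β G y = 0) : y = 0 := by
  obtain ⟨R, I, rfl⟩ := fib_eq_sum y
  have h1 (β : S0 n) (G : HilbTensor H n) : (inner ℝ G (R β) : ℂ) + Complex.I * inner ℝ G (I β) = 0 := by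
    have := h β G
    simpa [fibCoeff_fibTen, Finset.sum_add_distrib] using this
  have hR (β : S0 n) : R β = 0 := by
    have := congrArg Complex.re (h1 β (R β))
    simp only [Complex.add_re, Complex.add_im, Complex.ofReal_re, Complex.ofReal_im, Complex.mul_re,
      Complex.mul_im, Complex.I_re, Complex.I_im, zero_mul, mul_zero, sub_zero, add_zero, zero_add, one_mul,
      Complex.zero_re, Complex.zero_im] at this
    exact inner_self_eq_zero.1 this
  have hI (β : S0 n) : I β = 0 := by
    have := congrArg Complex.im (h1 β (I β))
    simp only [Complex.add_re, Complex.add_im, Complex.ofReal_re, Complex.ofReal_im, Complex.mul_re,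
      Complex.mul_im, Complex.I_re, Complex.I_im, zero_mul, mul_zero, sub_zero, add_zero, zero_add, one_mul,
      Complex.zero_re, Complex.zero_im] at this
    exact inner_self_eq_zero.1 this
  simp [hR, hI]

theorem fibCoeff_barAvg {n : ℕ} (β : S0 n) (G : HilbTensor H n) (x : BarTP H) :
    fibCoeff β G (DirectSum.component ℂ ℕ (Fib (HilbTensor H)) n (barAvg x)) =
      (n.factorial : ℂ)⁻¹ * barForm 0 x (symI β G) := by
  have : fibCoeff β G ∘ₗ DirectSum.component ℂ ℕ (Fib (HilbTensor H)) n ∘ₗ barAvg =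
      (n.factorial : ℂ)⁻¹ • (barForm 0).flip (symI β G) := barTP_ext fun k α F => by
    rw [LinearMap.comp_apply, LinearMap.comp_apply, barAvg_symI, LinearMap.smul_apply, LinearMap.flip_apply]
    have e1 (L : HPre H →ₗ[ℂ] ℂ) (c : ℝ) (z : HPre H) : L (c • z) = (c : ℂ) * L z := L.map_smul (c : ℂ) z
    change (fibCoeff β G ∘ₗ DirectSum.component ℂ ℕ (Fib (HilbTensor H)) n) _ = _
    rw [e1, map_sum]
    by_cases hk : k = n
    · subst hk
      rw [barForm_symI, kernelForm_symm, kernelForm_zero]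
      push_cast
      rw [smul_eq_mul]
      congr 1
      refine Finset.sum_congr rfl fun σ _ => ?_
      change fibCoeff β G (DirectSum.component ℂ ℕ _ k (ten (conj0 σ α) (hilbPerm k σ F))) = _
      rw [ten, DirectSum.component.lof_self, fibCoeff_fibTen]
      by_cases h : β = conj0 σ α
      · rw [if_pos h, if_pos h.symm]
      · rw [if_neg h, if_neg (Ne.symm h), Complex.ofReal_zero]
    · rw [barForm_symI_ne _ hk, smul_zero, Finset.sum_eq_zero, mul_zero]
      intro σ _
      change fibCoeff β G (DirectSum.component ℂ ℕ _ n (ten (conj0 σ α) (hilbPerm k σ F))) = _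
      rw [ten, DirectSum.component.of, dif_neg hk, map_zero]
  exact LinearMap.congr_fun this x

variable (H) in
/-- `BarTP H` with the Hilbert norm `⟨z, z⟩_0^{1/2}`. -/
def BarNormed : Type _ := BarTP H

instance : AddCommGroup (BarNormed H) := inferInstanceAs (AddCommGroup (BarTP H))
instance : Module ℂ (BarNormed H) := inferInstanceAs (Module ℂ (BarTP H))

/-- The semi-inner product `⟨·, ·⟩_0`. -/
@[reducible] def barPreCore : PreInnerProductSpace.Core ℂ (BarNormed H) where
  inner x y := barInner (H := H) 0 y x
  conj_inner_symm x y := barInner_conj_symm (H := H) 0 x y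
  re_inner_nonneg x := baseNormSq_nonneg (H := H) x
  add_left x y z := barInner_add_right (H := H) 0 z x y
  smul_left x y r := barInner_smul_right (H := H) 0 r y x

/-- The inner product `⟨·, ·⟩_0`. -/
@[reducible] def barCore : InnerProductSpace.Core ℂ (BarNormed H) where
  toCore := barPreCore
  definite x hx := by
    have h1 (y : BarTP H) : barInner (H := H) 0 x y = 0 := by
      have h2 := @InnerProductSpace.Core.inner_mul_inner_self_le ℂ (BarNormed H) _ _ _ barPreCore x y
      change ‖barInner (H := H) 0 y x‖ * ‖barInner (H := H) 0 x y‖ ≤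
        (barInner (H := H) 0 x x).re * (barInner (H := H) 0 y y).re at h2
      change barInner (H := H) 0 x x = 0 at hx
      rw [← barInner_conj_symm 0 x y, RCLike.norm_conj, hx, Complex.zero_re, zero_mul] at h2
      exact norm_eq_zero.1 (mul_self_eq_zero.1 (le_antisymm h2 (mul_self_nonneg _)))
    have h2 : barAvg (H := H) x = 0 := by
      refine DirectSum.ext_component ℂ fun n => ?_
      rw [map_zero]
      refine fib_eq_zero _ fun β G => ?_
      refine (fibCoeff_barAvg (H := H) β G x).trans ?_
      rw [← barConj_symI]
      exact (congrArg _ (h1 (symI β G))).trans (mul_zero _)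
    have h3 := toBar_barAvg (H := H) x
    rw [h2, map_zero] at h3
    exact h3.symm

instance : NormedAddCommGroup (BarNormed H) :=
  @InnerProductSpace.Core.toNormedAddCommGroup ℂ _ _ _ _ barCore
instance : InnerProductSpace ℂ (BarNormed H) := InnerProductSpace.ofCore barPreCore

/-- The identity map. -/
def toBarNormed : BarTP H →ₗ[ℂ] BarNormed H := LinearMap.id

theorem baseNormSq_eq (x : BarTP H) : baseNormSq x = ‖toBarNormed x‖ ^ 2 := by
  rw [← inner_self_eq_norm_sq (𝕜 := ℂ)]; rfl

/-- Linear maps into `BarTP H` which are bounded for the Hilbert tensor norms are determined by their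
values on the algebraic tensor powers. -/
theorem barTP_linear_ext {n : ℕ} {D D' : HilbTensor H n →ₗ[ℝ] BarTP H}
    (hD : ∃ C : ℝ, ∀ F, baseNormSq (D F) ≤ C * ‖F‖ ^ 2) (hD' : ∃ C : ℝ, ∀ F, baseNormSq (D' F) ≤ C * ‖F‖ ^ 2)
    (h : ∀ F : AlgTensor H n, D (toHilb n F) = D' (toHilb n F)) : D = D' := by
  have cont (D : HilbTensor H n →ₗ[ℝ] BarTP H) (hD : ∃ C : ℝ, ∀ F, baseNormSq (D F) ≤ C * ‖F‖ ^ 2) :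
      Continuous fun F => toBarNormed (D F) := by
    obtain ⟨C, hC⟩ := hD
    refine AddMonoidHomClass.continuous_of_bound
      ((toBarNormed (H := H)).toAddMonoidHom.comp D.toAddMonoidHom) (√(max C 0)) fun F => ?_
    refine abs_le_of_sq_le_sq' ?_ (by positivity) |>.2
    rw [mul_pow, Real.sq_sqrt (le_max_right _ _)]
    refine (baseNormSq_eq (D F)).symm.trans_le ((hC F).trans ?_)
    gcongr
    exact le_max_left _ _
  exact LinearMap.ext fun F => congrFun ((toHilb_dense n).equalizer (cont D hD) (cont D' hD')
    (funext h)) F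

theorem baseNormSq_symI_le {n : ℕ} (α : S0 n) (F : HilbTensor H n) :
    baseNormSq (symI α F) ≤ n.factorial * ‖F‖ ^ 2 := by
  have h1 (σ : Equiv.Perm (Fin n)) : ‖hilbPerm n σ F‖ = ‖F‖ := by
    rw [← sq_eq_sq₀ (norm_nonneg _) (norm_nonneg _), ← real_inner_self_eq_norm_sq, inner_hilbPerm,
      real_inner_self_eq_norm_sq]
  rw [baseNormSq, barInner_symI, Complex.ofReal_re, kernelForm_zero]
  refine (Finset.sum_le_card_nsmul _ _ (‖F‖ ^ 2) fun σ _ => ?_).trans_eq ?_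
  · split_ifs
    · refine (real_inner_le_norm _ _).trans_eq ?_
      rw [h1, sq]
    · positivity
  · rw [Finset.card_univ, Fintype.card_perm, Fintype.card_fin, nsmul_eq_mul]

end BarNorm

/-! ### Partial contractions of Hilbert space tensors -/
section CrossTensor
variable {H : Type*} [NormedAddCommGroup H] [InnerProductSpace ℝ H]
variable {ι κ : Type*} [Fintype ι] [Fintype κ] [DecidableEq ι] [DecidableEq κ]

theorem IsCross.inr_of_inl {π : Equiv.Perm (ι ⊕ κ)} (hπ : IsCross π) {i : ι} {j : κ}
    (h : π (Sum.inl i) = Sum.inr j) : π (Sum.inr j) = Sum.inl i := by rw [← h, hπ.1]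

theorem crossProd_update_fixed {π : Equiv.Perm (ι ⊕ κ)} (hπ : IsCross π) (h : ι ⊕ κ → H) {z : ι ⊕ κ}
    (hz : π z = z) (x : H) : crossProd (fun i => Function.update h z x (Sum.inl i))
      (fun j => Function.update h z x (Sum.inr j)) π =
        crossProd (fun i => h (Sum.inl i)) (fun j => h (Sum.inr j)) π := by
  refine Finset.prod_congr rfl fun i _ => ?_
  rcases hi : π (Sum.inl i) with i' | j
  · rfl
  · have h1 : Sum.inl i ≠ z := by rintro rfl; rw [hi] at hz; simp at hz
    have h2 : Sum.inr j ≠ z := by rintro rfl; rw [hπ.inr_of_inl hi] at hz; simp at hz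
    simp [h1, h2]

theorem crossProd_update_moved {π : Equiv.Perm (ι ⊕ κ)} (hπ : IsCross π) (h : ι ⊕ κ → H) {z : ι ⊕ κ}
    (hz : π z ≠ z) : ∃ φ : H →ₗ[ℝ] ℝ, ∀ x, crossProd (fun i => Function.update h z x (Sum.inl i))
      (fun j => Function.update h z x (Sum.inr j)) π = φ x := by
  obtain ⟨i₀, j₀, h0, hz'⟩ : ∃ i₀ j₀, π (Sum.inl i₀) = Sum.inr j₀ ∧ (z = Sum.inl i₀ ∨ z = Sum.inr j₀) := by
    have h2 := (hπ.2 z).resolve_left hz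
    rcases z with i | j
    · rcases hi : π (Sum.inl i) with i' | j
      · rw [hi] at h2; simp at h2
      · exact ⟨i, j, hi, Or.inl rfl⟩
    · rcases hj : π (Sum.inr j) with i | j'
      · exact ⟨i, j, by rw [← hj, hπ.1], Or.inr rfl⟩
      · rw [hj] at h2; simp at h2
  set c := ∏ i ∈ Finset.univ.erase i₀, Sum.elim (fun _ => 1)
    (fun j => inner ℝ (h (Sum.inl i)) (h (Sum.inr j))) (π (Sum.inl i)) with hc
  have hc' (x : H) : ∏ i ∈ Finset.univ.erase i₀, Sum.elim (fun _ => 1)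
    (fun j => inner ℝ (Function.update h z x (Sum.inl i)) (Function.update h z x (Sum.inr j)))
      (π (Sum.inl i)) = c := by
    refine Finset.prod_congr rfl fun i hi => ?_
    have hi : i ≠ i₀ := Finset.ne_of_mem_erase hi
    rcases hj : π (Sum.inl i) with i' | j
    · rfl
    · have hj' : j ≠ j₀ := by
        rintro rfl
        exact hi (Sum.inl_injective (π.injective (hj.trans h0.symm)))
      rcases hz' with rfl | rfl <;> simp [hi, hj']
  rcases hz' with rfl | rfl
  · refine ⟨c • (innerₗ H).flip (h (Sum.inr j₀)), fun x => ?_⟩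
    rw [crossProd, ← Finset.mul_prod_erase _ _ (Finset.mem_univ i₀), hc', h0]
    simp [mul_comm, real_inner_comm]
  · refine ⟨c • innerₗ H (h (Sum.inl i₀)), fun x => ?_⟩
    rw [crossProd, ← Finset.mul_prod_erase _ _ (Finset.mem_univ i₀), hc', h0]
    simp [mul_comm]

/-- Contraction of the pairs of `π`, followed by `G` on the remaining points. -/
def crossMultilinear {P : Type*} [AddCommGroup P] [Module ℝ P] (π : Equiv.Perm (ι ⊕ κ)) (hπ : IsCross π)
    (G : MultilinearMap ℝ (fun _ : {z // π z = z} => H) P) : MultilinearMap ℝ (fun _ : ι ⊕ κ => H) P :=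
  MultilinearMap.mk' (fun h => crossProd (fun i => h (Sum.inl i)) (fun j => h (Sum.inr j)) π • G fun z => h z)
    (fun h z x y => by
      by_cases hz : π z = z
      · have key (x : H) : (fun k : {z // π z = z} => Function.update h z x k) =
            Function.update (fun k : {z // π z = z} => h k) ⟨z, hz⟩ x :=
          Function.update_comp_eq_of_injective h Subtype.val_injective (⟨z, hz⟩ : {z // π z = z}) x
        simp only [crossProd_update_fixed hπ h hz, key, MultilinearMap.map_update_add, smul_add]
      · have key (x : H) : (fun k : {z // π z = z} => Function.update h z x k) = (fun k => h k.1) :=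
          funext fun k => Function.update_of_ne (fun hk => hz (by rw [← hk]; exact k.2)) _ _
        obtain ⟨φ, hφ⟩ := crossProd_update_moved hπ h hz
        simp only [hφ, key, map_add, add_smul])
    (fun h z c x => by
      by_cases hz : π z = z
      · have key (x : H) : (fun k : {z // π z = z} => Function.update h z x k) =
            Function.update (fun k : {z // π z = z} => h k) ⟨z, hz⟩ x :=
          Function.update_comp_eq_of_injective h Subtype.val_injective (⟨z, hz⟩ : {z // π z = z}) x
        simp only [crossProd_update_fixed hπ h hz, key, MultilinearMap.map_update_smul]
        rw [smul_comm]
      · have key (x : H) : (fun k : {z // π z = z} => Function.update h z x k) = (fun k => h k.1) :=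
          funext fun k => Function.update_of_ne (fun hk => hz (by rw [← hk]; exact k.2)) _ _
        obtain ⟨φ, hφ⟩ := crossProd_update_moved hπ h hz
        simp only [hφ, key, map_smul, smul_assoc])

/-- The contraction of `F ⊗ G` along the pairs of `π`. -/
def crossTen {n k : ℕ} (π : Equiv.Perm (Fin n ⊕ Fin k)) (hπ : IsCross π) :
    AlgTensor H n →ₗ[ℝ] AlgTensor H k →ₗ[ℝ] AlgTensor H (Fintype.card {z // π z = z}) :=
  tensorMul.compr₂ (PiTensorProduct.lift ((crossMultilinear π hπ ((PiTensorProduct.tprod ℝ).domDomCongr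
    (Fintype.equivFin {z // π z = z}).symm)).domDomCongr finSumFinEquiv))

theorem crossTen_tprod {n k : ℕ} (π : Equiv.Perm (Fin n ⊕ Fin k)) (hπ : IsCross π) (f : Fin n → H)
    (g : Fin k → H) : crossTen π hπ (PiTensorProduct.tprod ℝ f) (PiTensorProduct.tprod ℝ g) =
      crossProd f g π • PiTensorProduct.tprod ℝ
        (fun x => Sum.elim f g ((Fintype.equivFin {z // π z = z}).symm x).1) := by
  rw [crossTen, LinearMap.compr₂_apply, tensorMul_tprod, PiTensorProduct.lift.tprod]
  change crossProd (fun i => Fin.append f g (Fin.castAdd k i)) (fun j => Fin.append f g (Fin.natAdd n j)) π •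
    PiTensorProduct.tprod ℝ (fun x => Fin.append f g
      (finSumFinEquiv ((Fintype.equivFin {z // π z = z}).symm x).1)) = _
  simp only [Fin.append_left, Fin.append_right]
  congr 2
  funext x
  rcases ((Fintype.equivFin {z // π z = z}).symm x).1 with z | z <;> simp

/-! ### Orthonormal expansions of algebraic tensors -/

theorem exists_finite_support {n : ℕ} (F : AlgTensor H n) : ∃ V : Submodule ℝ H, FiniteDimensional ℝ V ∧
    F ∈ Submodule.span ℝ {x | ∃ f : Fin n → H, (∀ i, f i ∈ V) ∧ PiTensorProduct.tprod ℝ f = x} := by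
  induction F using PiTensorProduct.induction_on with
  | smul_tprod r f =>
    refine ⟨Submodule.span ℝ (Set.range f), FiniteDimensional.span_of_finite ℝ (Set.finite_range f), ?_⟩
    exact Submodule.smul_mem _ _ (Submodule.subset_span ⟨f, fun i => Submodule.subset_span ⟨i, rfl⟩, rfl⟩)
  | add F G hF hG =>
    obtain ⟨V, hV, h1⟩ := hF
    obtain ⟨W, hW, h2⟩ := hG
    refine ⟨V ⊔ W, inferInstance, Submodule.add_mem _ ?_ ?_⟩
    · refine Submodule.span_mono ?_ h1
      rintro _ ⟨f, hf, rfl⟩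
      exact ⟨f, fun i => Submodule.mem_sup_left (hf i), rfl⟩
    · refine Submodule.span_mono ?_ h2
      rintro _ ⟨f, hf, rfl⟩
      exact ⟨f, fun i => Submodule.mem_sup_right (hf i), rfl⟩

theorem exists_orthonormal_expansion {n k : ℕ} (F : AlgTensor H n) (G : AlgTensor H k) :
    ∃ (d : ℕ) (e : Fin d → H), Orthonormal ℝ e ∧
      (∃ a : (Fin n → Fin d) → ℝ, F = ∑ I, a I • PiTensorProduct.tprod ℝ fun i => e (I i)) ∧
      (∃ b : (Fin k → Fin d) → ℝ, G = ∑ I, b I • PiTensorProduct.tprod ℝ fun i => e (I i)) := by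
  obtain ⟨V, hV, h1⟩ := exists_finite_support F
  obtain ⟨W, hW, h2⟩ := exists_finite_support G
  let u := stdOrthonormalBasis ℝ (V ⊔ W : Submodule ℝ H)
  let e : Fin _ → H := fun i => (u i : H)
  have he (m : ℕ) (U : Submodule ℝ H) (hU : U ≤ V ⊔ W) (F : AlgTensor H m)
      (hF : F ∈ Submodule.span ℝ {x | ∃ f : Fin m → H, (∀ i, f i ∈ U) ∧ PiTensorProduct.tprod ℝ f = x}) :
      ∃ a : (Fin m → Fin _) → ℝ, F = ∑ I, a I • PiTensorProduct.tprod ℝ fun i => e (I i) := by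
    suffices h : F ∈ Submodule.span ℝ (Set.range fun I : Fin m → Fin _ =>
        PiTensorProduct.tprod ℝ fun i => e (I i)) by
      obtain ⟨c, hc⟩ := (Submodule.mem_span_range_iff_exists_fun ℝ).1 h
      exact ⟨c, hc.symm⟩
    refine Submodule.span_le.2 ?_ hF
    rintro _ ⟨f, hf, rfl⟩
    have h3 : f = fun i => ∑ l, (inner ℝ (u l) (⟨f i, hU (hf i)⟩ : (V ⊔ W : Submodule ℝ H))) • e l := by
      funext i
      have := congrArg (V ⊔ W : Submodule ℝ H).subtype (u.sum_repr' ⟨f i, hU (hf i)⟩)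
      rw [map_sum] at this
      exact this.symm
    rw [h3, MultilinearMap.map_sum]
    refine Submodule.sum_mem _ fun I _ => ?_
    rw [MultilinearMap.map_smul_univ]
    exact Submodule.smul_mem _ _ (Submodule.subset_span ⟨I, rfl⟩)
  refine ⟨_, e, ?_, he n V le_sup_left F h1, he k W le_sup_right G h2⟩
  exact u.orthonormal.comp_linearIsometry (V ⊔ W : Submodule ℝ H).subtypeₗᵢ

theorem tensorInner_orthonormal {n d : ℕ} {e : Fin d → H} (he : Orthonormal ℝ e) (I J : Fin n → Fin d) :
    tensorInner (PiTensorProduct.tprod ℝ fun i => e (I i)) (PiTensorProduct.tprod ℝ fun i => e (J i)) =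
      if I = J then 1 else 0 := by
  rw [tensorInner_tprod]
  simp only [orthonormal_iff_ite.1 he]
  split_ifs with h
  · simp [h]
  · obtain ⟨i, hi⟩ := Function.ne_iff.1 h
    exact Finset.prod_eq_zero (Finset.mem_univ i) (if_neg hi)

theorem tensorInner_expansion {n d : ℕ} {e : Fin d → H} (he : Orthonormal ℝ e) (a : (Fin n → Fin d) → ℝ) :
    tensorInner (∑ I, a I • PiTensorProduct.tprod ℝ fun i => e (I i))
      (∑ I, a I • PiTensorProduct.tprod ℝ fun i => e (I i)) = ∑ I, a I ^ 2 := by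
  simp only [map_sum, LinearMap.sum_apply, map_smul, LinearMap.smul_apply, tensorInner_orthonormal he, smul_eq_mul]
  simp [sq]

theorem crossProd_orthonormal {d : ℕ} {e : Fin d → H} (he : Orthonormal ℝ e) (π : Equiv.Perm (ι ⊕ κ))
    (I : ι → Fin d) (J : κ → Fin d) : crossProd (fun i => e (I i)) (fun j => e (J j)) π =
      if ∀ i j, π (Sum.inl i) = Sum.inr j → I i = J j then 1 else 0 := by
  split_ifs with h
  · refine Finset.prod_eq_one fun i _ => ?_
    rcases hi : π (Sum.inl i) with i' | j
    · rfl
    · simp [orthonormal_iff_ite.1 he, h i j hi]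
  · push Not at h
    obtain ⟨i, j, h1, h2⟩ := h
    refine Finset.prod_eq_zero (Finset.mem_univ i) ?_
    rw [h1]
    simp [orthonormal_iff_ite.1 he, h2]

/-- A sum of products is bounded, if two of the four indices determine the others. -/
theorem sum_mul_sum_le {A B : Type*} [Fintype A] [Fintype B] (a : A → ℝ) (b : B → ℝ)
    (p : A × B → A × B → Prop) [∀ x y, Decidable (p x y)] (hs : ∀ x y, p x y → p y x)
    (hp : ∀ x y x' y', p x y → p x' y' → x.1 = x'.1 → y.2 = y'.2 → x = x' ∧ y = y') :
    ∑ x : A × B, ∑ y : A × B, (if p x y then (a x.1 * b x.2) * (a y.1 * b y.2) else 0) ≤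
      (∑ i, a i ^ 2) * ∑ j, b j ^ 2 := by
  set S := ∑ x : A × B, ∑ y : A × B, if p x y then a x.1 ^ 2 * b y.2 ^ 2 else 0 with hS
  have h1 : ∑ x : A × B, ∑ y : A × B, (if p x y then (a x.1 * b x.2) * (a y.1 * b y.2) else 0) ≤
      (1 / 2) * (S + S) := by
    conv_rhs => enter [2, 2]; rw [hS, Finset.sum_comm]
    rw [hS, ← Finset.sum_add_distrib, Finset.mul_sum]
    refine Finset.sum_le_sum fun x _ => ?_
    rw [← Finset.sum_add_distrib, Finset.mul_sum]
    refine Finset.sum_le_sum fun y _ => ?_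
    by_cases h : p x y
    · rw [if_pos h, if_pos h, if_pos (hs _ _ h)]
      nlinarith [sq_nonneg (a x.1 * b y.2 - a y.1 * b x.2)]
    · rw [if_neg h, if_neg h, if_neg fun h' => h (hs _ _ h')]
      simp
  refine h1.trans ?_
  rw [← two_mul, ← mul_assoc, one_div, inv_mul_cancel₀ two_ne_zero, one_mul, hS, Finset.sum_mul_sum,
    ← Fintype.sum_prod_type', ← Fintype.sum_prod_type', ← Finset.sum_filter]
  classical
  have hi : Set.InjOn (fun z : (A × B) × (A × B) => (z.1.1, z.2.2))
      (Finset.univ.filter fun z : (A × B) × (A × B) => p z.1 z.2) := by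
    rintro ⟨x, y⟩ hz ⟨x', y'⟩ hz' h
    simp only [Finset.coe_filter, Finset.mem_univ, true_and, Set.mem_ofPred_eq] at hz hz'
    replace h : (x.1, y.2) = (x'.1, y'.2) := h
    rw [Prod.mk.injEq] at h
    have h2 := hp x y x' y' hz hz' h.1 h.2
    rw [h2.1, h2.2]
  rw [← Finset.sum_image (f := fun w : A × B => a w.1 ^ 2 * b w.2 ^ 2) hi]
  exact Finset.sum_le_sum_of_subset_of_nonneg (Finset.subset_univ _) fun w _ _ => by positivity

theorem crossTen_bound {n k : ℕ} (π : Equiv.Perm (Fin n ⊕ Fin k)) (hπ : IsCross π) (F : AlgTensor H n)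
    (G : AlgTensor H k) : tensorInner (crossTen π hπ F G) (crossTen π hπ F G) ≤
      tensorInner F F * tensorInner G G := by
  obtain ⟨d, e, he, ⟨a, rfl⟩, b, rfl⟩ := exists_orthonormal_expansion F G
  rw [tensorInner_expansion he, tensorInner_expansion he]
  let c (x : (Fin n → Fin d) × (Fin k → Fin d)) : Prop := ∀ i j, π (Sum.inl i) = Sum.inr j → x.1 i = x.2 j
  let w (x : (Fin n → Fin d) × (Fin k → Fin d)) : Fin (Fintype.card {z // π z = z}) → Fin d := fun l =>
    Sum.elim x.1 x.2 ((Fintype.equivFin {z // π z = z}).symm l).1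
  have h1 : crossTen π hπ (∑ I, a I • PiTensorProduct.tprod ℝ fun i => e (I i))
      (∑ I, b I • PiTensorProduct.tprod ℝ fun i => e (I i)) = ∑ x : (Fin n → Fin d) × (Fin k → Fin d),
        ((a x.1 * b x.2) * if c x then 1 else 0) • PiTensorProduct.tprod ℝ fun l => e (w x l) := by
    simp only [map_sum, LinearMap.sum_apply, map_smul, LinearMap.smul_apply, Finset.smul_sum]
    rw [Finset.sum_comm, ← Fintype.sum_prod_type'
      (f := fun I J => b J • a I • crossTen π hπ (PiTensorProduct.tprod ℝ fun i => e (I i))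
        (PiTensorProduct.tprod ℝ fun i => e (J i)))]
    refine Finset.sum_congr rfl fun x _ => ?_
    rw [crossTen_tprod, crossProd_orthonormal he, smul_smul, smul_smul, mul_comm (b x.2), mul_assoc, mul_assoc]
    have h3 : (fun l => Sum.elim (fun i => e (x.1 i)) (fun i => e (x.2 i))
        ((Fintype.equivFin {z // π z = z}).symm l).1) = fun l => e (w x l) := by
      funext l
      simp only [w]
      rcases ((Fintype.equivFin {z // π z = z}).symm l).1 with z | z <;> rfl
    rw [h3]
    congr
  have h2 : tensorInner (crossTen π hπ (∑ I, a I • PiTensorProduct.tprod ℝ fun i => e (I i))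
      (∑ I, b I • PiTensorProduct.tprod ℝ fun i => e (I i)))
        (crossTen π hπ (∑ I, a I • PiTensorProduct.tprod ℝ fun i => e (I i))
      (∑ I, b I • PiTensorProduct.tprod ℝ fun i => e (I i))) =
      ∑ x : (Fin n → Fin d) × (Fin k → Fin d), ∑ y : (Fin n → Fin d) × (Fin k → Fin d),
        if c x ∧ c y ∧ w x = w y then (a x.1 * b x.2) * (a y.1 * b y.2) else 0 := by
    rw [h1]
    simp only [map_sum, LinearMap.sum_apply, map_smul, LinearMap.smul_apply, tensorInner_orthonormal he, smul_eq_mul,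
      Finset.mul_sum]
    rw [Finset.sum_comm]
    refine Finset.sum_congr rfl fun x _ => Finset.sum_congr rfl fun y _ => ?_
    by_cases hx : c x <;> by_cases hy : c y <;> simp [hx, hy, mul_comm]
  rw [h2]
  refine sum_mul_sum_le a b (fun x y => c x ∧ c y ∧ w x = w y) (fun x y h => ⟨h.2.1, h.1, h.2.2.symm⟩) ?_
  have hw (x y) (h : w x = w y) (z) (hz : π z = z) : Sum.elim x.1 x.2 z = Sum.elim y.1 y.2 z := by
    have := congrFun h (Fintype.equivFin {z // π z = z} ⟨z, hz⟩)
    simpa [w] using this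
  rintro ⟨I, J⟩ ⟨I', J'⟩ ⟨I₂, J₂⟩ ⟨I₂', J₂'⟩ ⟨a1, a2, a3⟩ ⟨b1, b2, b3⟩ h1 h2
  dsimp only at h1 h2
  subst h1 h2
  have h3 : J = J₂ := by
    funext j
    rcases hπ.2 (Sum.inr j) with hj | hj
    · exact (hw _ _ a3 _ hj).trans (hw _ _ b3 _ hj).symm
    · rcases hj' : π (Sum.inr j) with i | i
      · have hi : π (Sum.inl i) = Sum.inr j := by rw [← hj', hπ.1]
        exact (a1 i j hi).symm.trans (b1 i j hi)
      · rw [hj'] at hj; simp at hj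
  have h4 : I' = I₂' := by
    funext i
    rcases hπ.2 (Sum.inl i) with hi | hi
    · exact (hw _ _ a3 _ hi).symm.trans (hw _ _ b3 _ hi)
    · rcases hi' : π (Sum.inl i) with j | j
      · rw [hi'] at hi; simp at hi
      · exact (a2 i j hi').trans (b2 i j hi').symm
  rw [h3, h4]
  exact ⟨rfl, rfl⟩

/-! ### Extension of bounded bilinear maps to the Hilbert tensor powers -/

variable (H) in
/-- The inclusion of the normed algebraic tensor power in its completion. -/
def compl (n : ℕ) : HTensor H n →L[ℝ] HilbTensor H n := UniformSpace.Completion.toComplL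

/-- The bilinear map on Hilbert tensor powers extending `T`. -/
def hilbExtend₂ {n k : ℕ} {M : Type*} [NormedAddCommGroup M] [NormedSpace ℝ M] [CompleteSpace M]
    (T : HTensor H n →L[ℝ] HTensor H k →L[ℝ] M) : HilbTensor H n →L[ℝ] HilbTensor H k →L[ℝ] M :=
  ((T.extend (compl H n)).flip.extend (compl H k)).flip

theorem hilbExtend₂_compl {n k : ℕ} {M : Type*} [NormedAddCommGroup M] [NormedSpace ℝ M] [CompleteSpace M]
    (T : HTensor H n →L[ℝ] HTensor H k →L[ℝ] M) (F : HTensor H n) (G : HTensor H k) :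
    hilbExtend₂ T (compl H n F) (compl H k G) = T F G := by
  have h (n : ℕ) : DenseRange (compl H n) := UniformSpace.Completion.denseRange_coe
  have h' (n : ℕ) : IsUniformInducing (compl H n) := UniformSpace.Completion.isUniformInducing_coe _
  rw [hilbExtend₂, ContinuousLinearMap.flip_apply, ContinuousLinearMap.extend_eq _ (h k) (h' k),
    ContinuousLinearMap.flip_apply, ContinuousLinearMap.extend_eq _ (h n) (h' n)]

/-- The contraction along `π` on Hilbert tensor powers. -/
def crossHilb {n k : ℕ} (π : Equiv.Perm (Fin n ⊕ Fin k)) (hπ : IsCross π) :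
    HilbTensor H n →L[ℝ] HilbTensor H k →L[ℝ] HilbTensor H (Fintype.card {z // π z = z}) :=
  hilbExtend₂ (LinearMap.mkContinuous₂ (((crossTen π hπ).compl₁₂ (ofHTensor n) (ofHTensor k)).compr₂ (toHilb _)) 1
    fun F G => by
      rw [one_mul]
      refine abs_le_of_sq_le_sq' ?_ (by positivity) |>.2
      rw [mul_pow, ← real_inner_self_eq_norm_sq, ← real_inner_self_eq_norm_sq, ← real_inner_self_eq_norm_sq]
      exact (inner_toHilb _ _).trans_le (crossTen_bound π hπ (ofHTensor n F) (ofHTensor k G)))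

theorem crossHilb_toHilb {n k : ℕ} (π : Equiv.Perm (Fin n ⊕ Fin k)) (hπ : IsCross π) (F : AlgTensor H n)
    (G : AlgTensor H k) : crossHilb π hπ (toHilb n F) (toHilb k G) = toHilb _ (crossTen π hπ F G) :=
  hilbExtend₂_compl _ (ofAlg n F) (ofAlg k G)

theorem crossHilb_bound {n k : ℕ} (π : Equiv.Perm (Fin n ⊕ Fin k)) (hπ : IsCross π) (F : HilbTensor H n)
    (G : HilbTensor H k) : ‖crossHilb π hπ F G‖ ≤ ‖F‖ * ‖G‖ := by
  refine (toHilb_dense n).induction_on F (isClosed_le ((crossHilb π hπ).flip G).continuous.norm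
    (continuous_norm.mul continuous_const)) fun F => ?_
  refine (toHilb_dense k).induction_on G (isClosed_le (crossHilb π hπ _).continuous.norm
    (continuous_const.mul continuous_norm)) fun G => ?_
  rw [crossHilb_toHilb]
  refine abs_le_of_sq_le_sq' ?_ (by positivity) |>.2
  rw [mul_pow, ← real_inner_self_eq_norm_sq, ← real_inner_self_eq_norm_sq, ← real_inner_self_eq_norm_sq,
    inner_toHilb, inner_toHilb, inner_toHilb]
  exact crossTen_bound π hπ F G

end CrossTensor

/-! ### The product and the involution of `BarTP H` -/
section BarMul
variable {H : Type*} [NormedAddCommGroup H] [InnerProductSpace ℝ H]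

theorem norm_hilbPerm {n : ℕ} (σ : Equiv.Perm (Fin n)) (F : HilbTensor H n) : ‖hilbPerm n σ F‖ = ‖F‖ := by
  rw [← sq_eq_sq₀ (norm_nonneg _) (norm_nonneg _), ← real_inner_self_eq_norm_sq, inner_hilbPerm,
    real_inner_self_eq_norm_sq]

theorem hilbPerm_toHilb {n : ℕ} (σ : Equiv.Perm (Fin n)) (F : AlgTensor H n) :
    hilbPerm n σ (toHilb n F) = toHilb n (algPerm H n σ F) := hilbExtend_toHilb (algPerm H n σ) _ F

/-- Boundedness of bilinear maps into `BarTP H`. -/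
def BilBounded {n k : ℕ} (D : HilbTensor H n →ₗ[ℝ] HilbTensor H k →ₗ[ℝ] BarTP H) : Prop :=
  ∃ C : ℝ, ∀ F G, baseNormSq (D F G) ≤ C * (‖F‖ * ‖G‖) ^ 2

theorem bilBounded_ext {n k : ℕ} {D D' : HilbTensor H n →ₗ[ℝ] HilbTensor H k →ₗ[ℝ] BarTP H}
    (hD : BilBounded D) (hD' : BilBounded D') (h : ∀ F G, D (toHilb n F) (toHilb k G) = D' (toHilb n F) (toHilb k G)) :
    D = D' := by
  have r (D : HilbTensor H n →ₗ[ℝ] HilbTensor H k →ₗ[ℝ] BarTP H) (hD : BilBounded D) (F : HilbTensor H n) :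
      ∃ C : ℝ, ∀ G, baseNormSq (D F G) ≤ C * ‖G‖ ^ 2 := by
    obtain ⟨C, hC⟩ := hD
    exact ⟨C * ‖F‖ ^ 2, fun G => (hC F G).trans_eq (by ring)⟩
  have l (D : HilbTensor H n →ₗ[ℝ] HilbTensor H k →ₗ[ℝ] BarTP H) (hD : BilBounded D) (G : HilbTensor H k) :
      ∃ C : ℝ, ∀ F, baseNormSq (D.flip G F) ≤ C * ‖F‖ ^ 2 := by
    obtain ⟨C, hC⟩ := hD
    exact ⟨C * ‖G‖ ^ 2, fun F => (hC F G).trans_eq (by ring)⟩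
  have h1 (F : AlgTensor H n) : D (toHilb n F) = D' (toHilb n F) :=
    barTP_linear_ext (r D hD _) (r D' hD' _) (h F)
  have h2 (G : HilbTensor H k) : D.flip G = D'.flip G :=
    barTP_linear_ext (l D hD _) (l D' hD' _) fun F => LinearMap.congr_fun (h1 F) G
  exact LinearMap.ext₂ fun F G => LinearMap.congr_fun (h2 G) F

theorem baseNormSq_real_smul (c : ℝ) (x : BarTP H) : baseNormSq (c • x) = c ^ 2 * baseNormSq x := by
  rw [baseNormSq_eq, baseNormSq_eq]
  have : toBarNormed (c • x) = (c : ℂ) • toBarNormed x := toBarNormed.map_smul (c : ℂ) x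
  rw [this, norm_smul, mul_pow, Complex.norm_real, Real.norm_eq_abs, sq_abs]

theorem BilBounded.zero {n k : ℕ} : BilBounded (0 : HilbTensor H n →ₗ[ℝ] HilbTensor H k →ₗ[ℝ] BarTP H) :=
  ⟨0, fun F G => by
    rw [LinearMap.zero_apply, LinearMap.zero_apply, baseNormSq_eq, map_zero, norm_zero]
    simp⟩

theorem BilBounded.add {n k : ℕ} {D D' : HilbTensor H n →ₗ[ℝ] HilbTensor H k →ₗ[ℝ] BarTP H}
    (hD : BilBounded D) (hD' : BilBounded D') : BilBounded (D + D') := by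
  obtain ⟨C, hC⟩ := hD
  obtain ⟨C', hC'⟩ := hD'
  refine ⟨2 * (C + C'), fun F G => ?_⟩
  rw [LinearMap.add_apply, LinearMap.add_apply, baseNormSq_eq, map_add]
  have h1 := hC F G
  have h2 := hC' F G
  rw [baseNormSq_eq] at h1 h2
  have h3 := norm_add_le (toBarNormed (D F G)) (toBarNormed (D' F G))
  have h4 := norm_nonneg (toBarNormed (D F G) + toBarNormed (D' F G))
  nlinarith [sq_nonneg (‖toBarNormed (D F G)‖ - ‖toBarNormed (D' F G)‖)]

theorem BilBounded.sum {n k : ℕ} {A : Type*} (s : Finset A)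
    {D : A → HilbTensor H n →ₗ[ℝ] HilbTensor H k →ₗ[ℝ] BarTP H} (hD : ∀ a, BilBounded (D a)) :
    BilBounded (∑ a ∈ s, D a) :=
  Finset.sum_induction _ BilBounded (fun _ _ h h' => h.add h') .zero fun a _ => hD a

/-- The permutation underlying the contraction of `α ∪ β` along `π`, relabelled. -/
def crossPerm {n k : ℕ} (α : S0 n) (β : S0 k) (π : Equiv.Perm (Fin n ⊕ Fin k)) :
    S0 (Fintype.card {z // π z = z}) :=
  (Fintype.equivFin {z // π z = z}).optionCongr.permCongr
    (restrictPerm (optSub fun z => π z = z) (π.optionCongr * cupSum α β))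

/-- The summand of the product of `I(α ⊗ F)` and `I(β ⊗ G)` given by `π`. -/
def barMulTerm (q : ℝ) {n k : ℕ} (α : S0 n) (β : S0 k) (π : Equiv.Perm (Fin n ⊕ Fin k)) (hπ : IsCross π) :
    HilbTensor H n →ₗ[ℝ] HilbTensor H k →ₗ[ℝ] BarTP H :=
  conWeight q (fun z => π z = z) π (crossCard π) (cupSum α β) •
    (ContinuousLinearMap.coeLM ℝ ∘ₗ (crossHilb π hπ).toLinearMap).compr₂ (symIₗ (crossPerm α β π))

theorem barMulTerm_apply (q : ℝ) {n k : ℕ} (α : S0 n) (β : S0 k) (π : Equiv.Perm (Fin n ⊕ Fin k))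
    (hπ : IsCross π) (F : HilbTensor H n) (G : HilbTensor H k) : barMulTerm q α β π hπ F G =
      conWeight q (fun z => π z = z) π (crossCard π) (cupSum α β) • symI (crossPerm α β π) (crossHilb π hπ F G) :=
  rfl

/-- The product of `I(α ⊗ F)` and `I(β ⊗ G)`. -/
def barMulFib (q : ℝ) {n k : ℕ} (α : S0 n) (β : S0 k) : HilbTensor H n →ₗ[ℝ] HilbTensor H k →ₗ[ℝ] BarTP H :=
  ∑ π : Equiv.Perm (Fin n ⊕ Fin k), if hπ : IsCross π then barMulTerm q α β π hπ else 0

theorem barMulFib_bounded (q : ℝ) {n k : ℕ} (α : S0 n) (β : S0 k) : BilBounded (H := H) (barMulFib q α β) := by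
  refine BilBounded.sum _ fun π => ?_
  split_ifs with hπ
  · set c := conWeight q (fun z => π z = z) π (crossCard π) (cupSum α β)
    refine ⟨c ^ 2 * (Fintype.card {z // π z = z}).factorial, fun F G => ?_⟩
    rw [barMulTerm_apply, baseNormSq_real_smul, mul_assoc]
    refine mul_le_mul_of_nonneg_left ((baseNormSq_symI_le _ _).trans ?_) (sq_nonneg _)
    gcongr
    exact crossHilb_bound π hπ F G
  · exact .zero

theorem barMulFib_toHilb {q : ℝ} (hq : q ≠ 0) {n k : ℕ} (α : S0 n) (β : S0 k) (F : AlgTensor H n) (G : AlgTensor H k) :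
    barMulFib q α β (toHilb n F) (toHilb k G) = tpToBar (crossMul q (toTP (ten α F)) (toTP (ten β G))) := by
  have : (barMulFib q α β).compl₁₂ (toHilb (H := H) n) (toHilb k) =
      ((((crossMulₗ q).compr₂ tpToBar).restrictScalars₁₂ ℝ ℝ).compl₁₂
        ((toTP (H := H)).restrictScalars ℝ ∘ₗ tenR α) ((toTP (H := H)).restrictScalars ℝ ∘ₗ tenR β)) := by
    refine PiTensorProduct.ext (MultilinearMap.ext fun f => PiTensorProduct.ext (MultilinearMap.ext fun g => ?_))
    change barMulFib q α β (toHilb n (PiTensorProduct.tprod ℝ f)) (toHilb k (PiTensorProduct.tprod ℝ g)) =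
      tpToBar (crossMul q (symFin α f) (symFin β g))
    rw [← sym_fin, ← sym_fin, crossMul_sym hq, barMulFib, LinearMap.sum_apply, LinearMap.sum_apply, map_sum]
    refine Finset.sum_congr rfl fun π _ => ?_
    split_ifs with hπ
    · have h1 (c : ℝ) (x : TP H) : tpToBar (c • x) = c • tpToBar x := tpToBar.map_smul (c : ℂ) x
      have h2 {m : ℕ} (γ : S0 m) (c : ℝ) (F : HilbTensor H m) : symI γ (c • F) = c • symI γ F := (symIₗ γ).map_smul c F
      rw [barMulTerm_apply, crossHilb_toHilb, crossTen_tprod, map_smul, h2, h1, crossSym, conSym, smul_apply, h1,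
        smul_comm, sym_eq_symFin (Fintype.equivFin {z // π z = z}), tpToBar_symFin]
      rfl
    · simp
  exact LinearMap.congr_fun (LinearMap.congr_fun this F) G

theorem barMulFib_conj_right {q : ℝ} (hq : q ≠ 0) {n k : ℕ} (α : S0 n) (β : S0 k) (σ : Equiv.Perm (Fin k))
    (F : HilbTensor H n) (G : HilbTensor H k) :
    barMulFib q α (conj0 σ β) F (hilbPerm k σ G) = barMulFib q α β F G := by
  have : (barMulFib q α (conj0 σ β)).compl₂ (hilbPermₗ H k σ) = barMulFib q α β := by
    refine bilBounded_ext ?_ (barMulFib_bounded q α β) fun F G => ?_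
    · obtain ⟨C, hC⟩ := barMulFib_bounded (H := H) q α (conj0 σ β)
      exact ⟨C, fun F G => (hC F _).trans_eq (by rw [hilbPermₗ, ContinuousLinearMap.coe_coe, norm_hilbPerm])⟩
    · change barMulFib q α (conj0 σ β) _ (hilbPerm k σ (toHilb k G)) = _
      rw [hilbPerm_toHilb, barMulFib_toHilb hq, barMulFib_toHilb hq, toTP_sym]
  exact LinearMap.congr_fun (LinearMap.congr_fun this F) G

theorem barMulFib_conj_left {q : ℝ} (hq : q ≠ 0) {n k : ℕ} (α : S0 n) (β : S0 k) (σ : Equiv.Perm (Fin n))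
    (F : HilbTensor H n) (G : HilbTensor H k) :
    barMulFib q (conj0 σ α) β (hilbPerm n σ F) G = barMulFib q α β F G := by
  have : (barMulFib q (conj0 σ α) β).comp (hilbPermₗ H n σ) = barMulFib q α β := by
    refine bilBounded_ext ?_ (barMulFib_bounded q α β) fun F G => ?_
    · obtain ⟨C, hC⟩ := barMulFib_bounded (H := H) q (conj0 σ α) β
      exact ⟨C, fun F G => (hC _ G).trans_eq (by rw [hilbPermₗ, ContinuousLinearMap.coe_coe, norm_hilbPerm])⟩
    · change barMulFib q (conj0 σ α) β (hilbPerm n σ (toHilb n F)) _ = _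
      rw [hilbPerm_toHilb, barMulFib_toHilb hq, barMulFib_toHilb hq, toTP_sym]
  exact LinearMap.congr_fun (LinearMap.congr_fun this F) G

/-- The left multiplication with `I(α ⊗ F)`. -/
def barMulLeft {q : ℝ} (hq : q ≠ 0) {n : ℕ} (α : S0 n) (F : HilbTensor H n) : BarTP H →ₗ[ℂ] BarTP H :=
  liftBar (fun _ β => barMulFib q α β F) fun _ σ β G => barMulFib_conj_right hq α β σ F G

theorem barMulLeft_symI {q : ℝ} (hq : q ≠ 0) {n k : ℕ} (α : S0 n) (β : S0 k) (F : HilbTensor H n) (G : HilbTensor H k) :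
    barMulLeft hq α F (symI β G) = barMulFib q α β F G :=
  liftBar_symI _ _ β G

/-- `F ↦ barMulLeft hq α F` as a linear map. -/
def barMulLeftₗ {q : ℝ} (hq : q ≠ 0) {n : ℕ} (α : S0 n) : HilbTensor H n →ₗ[ℝ] (BarTP H →ₗ[ℂ] BarTP H) where
  toFun F := barMulLeft hq α F
  map_add' F F' := barTP_ext fun k β G => by
    rw [LinearMap.add_apply, barMulLeft_symI, barMulLeft_symI, barMulLeft_symI, map_add, LinearMap.add_apply]
  map_smul' r F := barTP_ext fun k β G => by
    have h (r : ℝ) (L : BarTP H →ₗ[ℂ] BarTP H) (x : BarTP H) : (r • L) x = r • L x := rfl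
    rw [RingHom.id_apply, h, barMulLeft_symI, barMulLeft_symI, map_smul, LinearMap.smul_apply]

/-- The product of `BarTP H`. -/
def barMul (q : ℝ) (hq : q ≠ 0) : BarTP H →ₗ[ℂ] BarTP H →ₗ[ℂ] BarTP H :=
  liftBar (fun _ α => barMulLeftₗ hq α) fun _ σ α F => barTP_ext fun k β G => by
    change barMulLeft hq _ _ _ = barMulLeft hq _ _ _
    rw [barMulLeft_symI, barMulLeft_symI, barMulFib_conj_left hq]

theorem barMul_symI (q : ℝ) (hq : q ≠ 0) {n k : ℕ} (α : S0 n) (β : S0 k) (F : HilbTensor H n) (G : HilbTensor H k) :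
    barMul q hq (symI α F) (symI β G) = barMulFib q α β F G := by
  rw [barMul, liftBar_symI]
  exact barMulLeft_symI hq α β F G

theorem barMul_tpToBar (q : ℝ) (hq : q ≠ 0) (x y : TP H) :
    barMul q hq (tpToBar x) (tpToBar y) = tpToBar (crossMul q x y) := by
  have : (barMul q hq).compl₁₂ (tpToBar (H := H)) tpToBar = (crossMulₗ q).compr₂ tpToBar := TP_ext₂ fun n k α β f g => by
    change barMul q hq (tpToBar (symFin α f)) (tpToBar (symFin β g)) = tpToBar (crossMul q (symFin α f) (symFin β g))
    rw [tpToBar_symFin, tpToBar_symFin, barMul_symI, barMulFib_toHilb hq]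
    rfl
  exact LinearMap.congr_fun (LinearMap.congr_fun this x) y

/-- The linear map `I(α ⊗ F) ↦ I(α⁻¹ ⊗ F)`. -/
def barInv : BarTP H →ₗ[ℂ] BarTP H :=
  liftBar (fun _ α => symIₗ α⁻¹) fun _ σ α F => by rw [conj0_inv]; exact symI_conj σ α⁻¹ F

/-- The involution of `BarTP H`. -/
def barStar : BarTP H →ₗ⋆[ℂ] BarTP H := (barInv (H := H)).comp (barConj (H := H))

theorem barStar_symI {n : ℕ} (α : S0 n) (F : HilbTensor H n) : barStar (symI α F) = symI α⁻¹ F := by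
  rw [barStar, LinearMap.comp_apply, barConj_symI, barInv, liftBar_symI]; rfl

theorem barStar_tpToBar (x : TP H) : barStar (tpToBar x) = tpToBar (starTP x) := by
  have : (barStar (H := H)).comp tpToBar = tpToBar.comp starTP := TP_ext_conj fun n α f => by
    rw [LinearMap.comp_apply, LinearMap.comp_apply, ← star_eq_starTP, ← sym_fin α, star_sym, sym_fin, sym_fin,
      tpToBar_symFin, tpToBar_symFin, barStar_symI]
  exact LinearMap.congr_fun this x

theorem isStarAlgExtension_bar (q : ℝ) (hq : q ≠ 0) : IsStarAlgExtension (H := H) q (barMul q hq) barStar where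
  mul_alg x y := by
    rw [algToBar_eq, algToBar_eq, algToBar_eq, barMul_tpToBar, ← expT_mul hq]
    rfl
  star_alg x := by
    rw [algToBar_eq, algToBar_eq, barStar_tpToBar, expT_starTP]
    rfl
  mul_bound n k α β := by
    obtain ⟨C, hC⟩ := barMulFib_bounded (H := H) q α β
    exact ⟨C, fun F G => by rw [barMul_symI]; exact hC F G⟩
  star_bound n α := ⟨n.factorial, fun F => by rw [barStar_symI]; exact baseNormSq_symI_le _ _⟩

theorem exists_algToBar_eq {q : ℝ} (hq : q ≠ 0) (x : TP H) : ∃ y : APre H, algToBar q y = tpToBar x := by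
  obtain ⟨y, hy⟩ := Submodule.mkQ_surjective _ (expT q (-innerₗ H) x)
  have hy' : toTP y = expT q (-innerₗ H) x := hy
  exact ⟨y, by rw [algToBar_eq, hy', expT_neg_cancel hq]⟩

theorem isStarAlgExtension_unique {q : ℝ} (hq : q ≠ 0) {m m' : BarTP H →ₗ[ℂ] BarTP H →ₗ[ℂ] BarTP H}
    {s s' : BarTP H →ₗ⋆[ℂ] BarTP H} (h : IsStarAlgExtension q m s) (h' : IsStarAlgExtension q m' s') :
    m' = m ∧ s' = s := by
  constructor
  · refine barTP_ext fun n α F => barTP_ext fun k β G => ?_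
    have : ((m'.restrictScalars₁₂ ℝ ℝ).compl₁₂ (symIₗ (H := H) α) (symIₗ β)) =
        ((m.restrictScalars₁₂ ℝ ℝ).compl₁₂ (symIₗ (H := H) α) (symIₗ β)) := by
      refine bilBounded_ext (h'.mul_bound n k α β) (h.mul_bound n k α β) fun F G => ?_
      change m' (symI α (toHilb n F)) (symI β (toHilb k G)) = m (symI α (toHilb n F)) (symI β (toHilb k G))
      rw [← tpToBar_toTP_ten, ← tpToBar_toTP_ten]
      obtain ⟨x, hx⟩ := exists_algToBar_eq hq (toTP (ten α F))
      obtain ⟨y, hy⟩ := exists_algToBar_eq hq (toTP (ten β G))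
      rw [← hx, ← hy, h.mul_alg, h'.mul_alg]
    exact LinearMap.congr_fun (LinearMap.congr_fun this F) G
  · have key (n : ℕ) (α : S0 n) (F : HilbTensor H n) : s' (symI α F) = s (symI α F) := by
      let S (s : BarTP H →ₗ⋆[ℂ] BarTP H) : HilbTensor H n →ₗ[ℝ] BarTP H :=
        { toFun := fun F => s (symI α F)
          map_add' := fun F G => by
            rw [← map_add]
            exact congrArg s ((symIₗ α).map_add F G)
          map_smul' := fun c F => by
            refine (congrArg s ((symIₗ α).map_smul c F)).trans ((s.map_smulₛₗ (c : ℂ) (symI α F)).trans ?_)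
            rw [Complex.conj_ofReal]
            rfl }
      have : S s' = S s := by
        refine barTP_linear_ext (h'.star_bound n α) (h.star_bound n α) fun F => ?_
        change s' (symI α (toHilb n F)) = s (symI α (toHilb n F))
        rw [← tpToBar_toTP_ten]
        obtain ⟨x, hx⟩ := exists_algToBar_eq hq (toTP (ten α F))
        rw [← hx, h.star_alg, h'.star_alg]
      exact LinearMap.congr_fun this F
    refine LinearMap.ext fun x => ?_
    induction x using barTP_induction with
    | zero => simp
    | tensor n α F => exact key n α F
    | smul c x hx => rw [map_smulₛₗ, map_smulₛₗ, hx]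
    | add x y hx hy => rw [map_add, map_add, hx, hy]

end BarMul

section StateSum
variable {R : Type*} [CommRing R] {N : ℕ} {X : Type*} [Fintype X] [DecidableEq X]

/-- The sum over all colourings `u` of the points of `∏ₓ yₓ(u(x), u(σ(x)))`. -/
def stateSum (σ : Equiv.Perm X) (y : X → Matrix (Fin N) (Fin N) R) : R :=
  ∑ u : X → Fin N, ∏ x, y x (u x) (u (σ x))

/-- The product of the matrices along the cycle of `x`. -/
def wordAt (σ : Equiv.Perm X) (y : X → Matrix (Fin N) (Fin N) R) (x : X) :
    Matrix (Fin N) (Fin N) R :=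
  ((List.range (Function.minimalPeriod σ x)).map fun k => y ((σ ^ k) x)).prod

theorem list_prod_apply (m : ℕ) (A : ℕ → Matrix (Fin N) (Fin N) R) (i j : Fin N) :
    ((List.range (m + 1)).map A).prod i j =
      ∑ v : Fin m → Fin N, ∏ k : Fin (m + 1),
        A k ((Fin.cons i v : Fin (m + 1) → Fin N) k) ((Fin.snoc v j : Fin (m + 1) → Fin N) k) := by
  induction m generalizing i A with
  | zero => simp [Fin.snoc]
  | succ m ih =>
    rw [List.range_succ_eq_map, List.map_cons, List.prod_cons, List.map_map, Matrix.mul_apply,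
      ← (Fin.consEquiv fun _ : Fin (m + 1) => Fin N).sum_comp, Fintype.sum_prod_type]
    refine Finset.sum_congr rfl fun l _ => ?_
    rw [ih, Finset.mul_sum]
    refine Finset.sum_congr rfl fun v _ => ?_
    rw [Fin.prod_univ_succ (n := m + 1)]
    congr 1
    simp [Fin.consEquiv, ← Fin.cons_snoc_eq_snoc_cons]

theorem trace_list_prod (m : ℕ) (A : ℕ → Matrix (Fin N) (Fin N) R) :
    ((List.range (m + 1)).map A).prod.trace =
      ∑ v : Fin (m + 1) → Fin N, ∏ k : Fin (m + 1), A k (v k) (v (k + 1)) := by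
  rw [Matrix.trace, ← (Fin.consEquiv fun _ : Fin (m + 1) => Fin N).sum_comp,
    Fintype.sum_prod_type]
  refine Finset.sum_congr rfl fun i _ => ?_
  rw [Matrix.diag_apply, list_prod_apply]
  refine Finset.sum_congr rfl fun v _ => Finset.prod_congr rfl fun k _ => ?_
  congr 1
  induction k using Fin.lastCases with
  | last => simp [Fin.consEquiv]
  | cast k => simp [Fin.consEquiv]

/-- The points of the cycle of `x`. -/
theorem bijective_cycle (σ : Equiv.Perm X) (x : X) :
    Function.Bijective fun k : Fin (Function.minimalPeriod σ x) =>
      (⟨(σ ^ (k : ℕ)) x, Quotient.sound (s := Equiv.Perm.SameCycle.setoid σ)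
        (Equiv.Perm.SameCycle.symm ⟨k, by simp⟩)⟩ :
        {z // (Quotient.mk (Equiv.Perm.SameCycle.setoid σ) z) = Quotient.mk _ x}) := by
  constructor
  · intro k l h
    have h' : (σ ^ (k : ℕ)) x = (σ ^ (l : ℕ)) x := congrArg Subtype.val h
    rw [← Equiv.Perm.iterate_eq_pow, ← Equiv.Perm.iterate_eq_pow] at h'
    exact Fin.ext (Function.iterate_injOn_Iio_minimalPeriod k.2 l.2 h')
  · rintro ⟨z, hz⟩
    have hs : Equiv.Perm.SameCycle σ x z := Equiv.Perm.SameCycle.symm (Quotient.exact hz)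
    obtain ⟨m, hm⟩ := hs.exists_nat_pow_eq
    have hpos : 0 < Function.minimalPeriod σ x :=
      Function.minimalPeriod_pos_of_mem_periodicPts
        ((Function.Injective.mem_periodicPts σ.injective x))
    refine ⟨⟨m % Function.minimalPeriod σ x, Nat.mod_lt _ hpos⟩, Subtype.ext ?_⟩
    change (σ ^ (m % Function.minimalPeriod σ x)) x = z
    rw [← Equiv.Perm.iterate_eq_pow, Function.iterate_mod_minimalPeriod_eq,
      Equiv.Perm.iterate_eq_pow, hm]

open Classical in
theorem trace_wordAt (σ : Equiv.Perm X) (y : X → Matrix (Fin N) (Fin N) R) (x : X) :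
    (wordAt σ y x).trace =
      ∑ v : {z // (Quotient.mk (Equiv.Perm.SameCycle.setoid σ) z) = Quotient.mk _ x} → Fin N,
        ∏ z, y z.1 (v z) (v ⟨σ z.1, (Quotient.sound (s := Equiv.Perm.SameCycle.setoid σ)
          (Equiv.Perm.SameCycle.symm ⟨1, by simp⟩)).trans z.2⟩) := by
  have hpos : 0 < Function.minimalPeriod σ x :=
    Function.minimalPeriod_pos_of_mem_periodicPts (Function.Injective.mem_periodicPts σ.injective x)
  obtain ⟨m, hm⟩ := Nat.exists_eq_succ_of_ne_zero hpos.ne'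
  let e : Fin (m + 1) ≃ {z // (Quotient.mk (Equiv.Perm.SameCycle.setoid σ) z) = Quotient.mk _ x} :=
    (finCongr hm.symm).trans (Equiv.ofBijective _ (bijective_cycle σ x))
  have he (k : Fin (m + 1)) : (e k).1 = (σ ^ (k : ℕ)) x := rfl
  rw [wordAt, hm, trace_list_prod, ← (e.symm.arrowCongr (Equiv.refl (Fin N))).sum_comp]
  refine Finset.sum_congr rfl fun v _ => ?_
  rw [← e.prod_comp]
  refine Finset.prod_congr rfl fun k _ => ?_
  simp only [Equiv.arrowCongr_apply, Equiv.symm_symm, Equiv.coe_refl, Function.comp_apply, id_eq, he]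
  congr 2
  refine Subtype.ext ?_
  change (σ ^ ((k + 1 : Fin (m + 1)) : ℕ)) x = σ ((σ ^ (k : ℕ)) x)
  rw [← Equiv.Perm.mul_apply, ← pow_succ', Fin.val_add]
  have : (((k : ℕ) + ((1 : Fin (m + 1)) : ℕ)) % (m + 1)) = ((k : ℕ) + 1) % (m + 1) := by
    rw [Fin.val_one', Nat.add_mod_mod]
  have h2 := Function.iterate_mod_minimalPeriod_eq (f := σ) (x := x) (n := (k : ℕ) + 1)
  rw [hm] at h2
  rw [this, ← Equiv.Perm.iterate_eq_pow, ← Equiv.Perm.iterate_eq_pow]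
  exact h2

open Classical in
/-- A state sum is the product over the cycles of the traces of the words along them. -/
theorem stateSum_eq_prod (σ : Equiv.Perm X) (y : X → Matrix (Fin N) (Fin N) R)
    (rep : Quotient (Equiv.Perm.SameCycle.setoid σ) → X) (hrep : ∀ c, Quotient.mk _ (rep c) = c) :
    stateSum σ y = ∏ c, (wordAt σ y (rep c)).trace := by
  have hc (c : Quotient (Equiv.Perm.SameCycle.setoid σ)) : (wordAt σ y (rep c)).trace =
      ∑ v : {z // (Quotient.mk (Equiv.Perm.SameCycle.setoid σ) z) = c} → Fin N,
        ∏ z, y z.1 (v z) (v ⟨σ z.1, (Quotient.sound (s := Equiv.Perm.SameCycle.setoid σ)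
          (Equiv.Perm.SameCycle.symm ⟨1, by simp⟩)).trans z.2⟩) := by
    rw [trace_wordAt]
    have h (d) (hd : d = c) : (∑ v : {z // (Quotient.mk (Equiv.Perm.SameCycle.setoid σ) z) = d} → Fin N,
        ∏ z, y z.1 (v z) (v ⟨σ z.1, (Quotient.sound (s := Equiv.Perm.SameCycle.setoid σ)
          (Equiv.Perm.SameCycle.symm ⟨1, by simp⟩)).trans z.2⟩)) =
        ∑ v : {z // (Quotient.mk (Equiv.Perm.SameCycle.setoid σ) z) = c} → Fin N,
        ∏ z, y z.1 (v z) (v ⟨σ z.1, (Quotient.sound (s := Equiv.Perm.SameCycle.setoid σ)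
          (Equiv.Perm.SameCycle.symm ⟨1, by simp⟩)).trans z.2⟩) := by
      subst hd; rfl
    exact h _ (hrep c)
  simp only [hc]
  rw [Finset.prod_univ_sum, Fintype.piFinset_univ, stateSum]
  let e : ((c : Quotient (Equiv.Perm.SameCycle.setoid σ)) →
      {z // (Quotient.mk (Equiv.Perm.SameCycle.setoid σ) z) = c} → Fin N) ≃ (X → Fin N) :=
    { toFun := fun p x => p _ ⟨x, rfl⟩
      invFun := fun u c z => u z.1
      left_inv := fun p => by ext c ⟨z, rfl⟩; rfl
      right_inv := fun u => rfl }
  rw [← e.sum_comp]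
  refine Finset.sum_congr rfl fun p _ => ?_
  rw [← Fintype.prod_fiberwise fun x => Quotient.mk (Equiv.Perm.SameCycle.setoid σ) x]
  refine Finset.prod_congr rfl fun c _ => Finset.prod_congr rfl ?_
  rintro ⟨z, rfl⟩ -
  change y z (p _ _) (p _ _) = _
  congr 1
  have h (d) (hd : d = Quotient.mk (Equiv.Perm.SameCycle.setoid σ) z)
      (h1 : Quotient.mk (Equiv.Perm.SameCycle.setoid σ) (σ z) = d) :
      p d ⟨σ z, h1⟩ = p _ ⟨σ z, h1.trans hd⟩ := by subst hd; rfl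
  exact h _ (Quotient.sound (s := Equiv.Perm.SameCycle.setoid σ)
    (Equiv.Perm.SameCycle.symm ⟨1, by simp⟩)) rfl

/-- The product over the cycles avoiding `x₀` of the traces of the words along them. -/
def loopProd (σ : Equiv.Perm X) (x₀ : X) (y : X → Matrix (Fin N) (Fin N) R) : R := by
  classical exact
  ∏ c : {c : Quotient (Equiv.Perm.SameCycle.setoid σ) // c ≠ Quotient.mk _ x₀},
    (wordAt σ y c.1.out).trace

open Classical in
theorem stateSum_eq_mul (σ : Equiv.Perm X) (x₀ : X) (y : X → Matrix (Fin N) (Fin N) R) :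
    stateSum σ y = (wordAt σ y x₀).trace * loopProd σ x₀ y := by
  rw [stateSum_eq_prod σ y (fun c => if c = Quotient.mk _ x₀ then x₀ else c.out)
    (fun c => by split_ifs with h; exacts [h.symm, Quotient.out_eq c]), loopProd,
    Fintype.prod_eq_mul_prod_subtype_ne _ (Quotient.mk (Equiv.Perm.SameCycle.setoid σ) x₀)]
  rw [if_pos rfl]
  congr 1
  exact Finset.prod_congr rfl fun c _ => by rw [if_neg c.2]

theorem wordAt_congr (σ : Equiv.Perm X) {y y' : X → Matrix (Fin N) (Fin N) R} (x : X)
    (h : ∀ k, y ((σ ^ k) x) = y' ((σ ^ k) x)) : wordAt σ y x = wordAt σ y' x := by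
  simp only [wordAt, h]

theorem loopProd_congr (σ : Equiv.Perm X) (x₀ : X) {y y' : X → Matrix (Fin N) (Fin N) R}
    (h : ∀ x ≠ x₀, y x = y' x) : loopProd σ x₀ y = loopProd σ x₀ y' := by
  classical
  refine Finset.prod_congr rfl fun c _ => ?_
  rw [wordAt_congr σ (y' := y') _ fun k => h _ fun hk => c.2 ?_]
  refine c.1.out_eq.symm.trans ?_
  exact Quotient.sound (s := Equiv.Perm.SameCycle.setoid σ) ⟨k, by simp [hk]⟩

theorem wordAt_update (σ : Equiv.Perm X) (x₀ : X) (y : X → Matrix (Fin N) (Fin N) R)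
    (z : Matrix (Fin N) (Fin N) R) :
    wordAt σ (Function.update y x₀ z) x₀ = z * wordAt σ (Function.update y x₀ 1) x₀ := by
  have hpos : 0 < Function.minimalPeriod σ x₀ :=
    Function.minimalPeriod_pos_of_mem_periodicPts (Function.Injective.mem_periodicPts σ.injective x₀)
  obtain ⟨m, hm⟩ := Nat.exists_eq_succ_of_ne_zero hpos.ne'
  rw [wordAt, wordAt, hm, List.range_succ_eq_map, List.map_cons, List.map_cons, List.prod_cons,
    List.prod_cons, List.map_map, List.map_map]
  have h0 (w : Matrix (Fin N) (Fin N) R) : Function.update y x₀ w ((σ ^ 0) x₀) = w :=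
    Function.update_self ..
  rw [h0, h0, one_mul]
  congr 2
  refine List.map_congr_left fun k hk => ?_
  have hne : (σ ^ (k + 1)) x₀ ≠ x₀ := by
    intro h
    rw [← Equiv.Perm.iterate_eq_pow] at h
    have h1 := Function.IsPeriodicPt.minimalPeriod_le (Nat.succ_pos k) h
    have h2 := List.mem_range.1 hk
    omega
  simp only [Function.comp_apply, Function.update_of_ne hne]

theorem wordAt_conj (σ : Equiv.Perm X) (y : X → Matrix (Fin N) (Fin N) R)
    {U V : Matrix (Fin N) (Fin N) R} (hUV : U * V = 1) (x : X) :
    wordAt σ (fun z => U * y z * V) x = U * wordAt σ y x * V := by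
  have hVU : V * U = 1 := mul_eq_one_comm.1 hUV
  rw [wordAt, wordAt]
  induction List.range (Function.minimalPeriod σ x) with
  | nil => simp [hUV]
  | cons k l ih =>
    rw [List.map_cons, List.prod_cons, ih, List.map_cons, List.prod_cons]
    simp only [mul_assoc, ← mul_assoc V U, hVU, one_mul]

theorem loopProd_conj (σ : Equiv.Perm X) (x₀ : X) (y : X → Matrix (Fin N) (Fin N) R)
    {U V : Matrix (Fin N) (Fin N) R} (hUV : U * V = 1) :
    loopProd σ x₀ (fun z => U * y z * V) = loopProd σ x₀ y := by
  classical
  refine Finset.prod_congr rfl fun c _ => ?_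
  rw [wordAt_conj σ y hUV, Matrix.trace_mul_comm, ← mul_assoc, mul_eq_one_comm.1 hUV, one_mul]

end StateSum

section TraceMonomial
variable {R : Type*} [CommRing R] {N : ℕ} {ι κ : Type*} [Fintype ι] [DecidableEq ι] [Fintype κ]
  [DecidableEq κ]

/-- The trace monomial of a permutation, as a state sum. -/
def trS (α : Equiv.Perm (Option ι)) (y : ι → Matrix (Fin N) (Fin N) R) :
    Matrix (Fin N) (Fin N) R :=
  Matrix.of fun a c => stateSum α fun o => o.elim (Matrix.single c a 1) y

theorem elim_eq_update (z : Matrix (Fin N) (Fin N) R) (y : ι → Matrix (Fin N) (Fin N) R) :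
    (fun o : Option ι => o.elim z y) =
      Function.update (fun o : Option ι => o.elim 1 y) none z := by
  funext o
  cases o <;> simp

theorem trS_eq (α : Equiv.Perm (Option ι)) (y : ι → Matrix (Fin N) (Fin N) R) :
    trS α y = loopProd α none (fun o => o.elim 1 y) • wordAt α (fun o => o.elim 1 y) none := by
  ext a c
  rw [trS, Matrix.of_apply, stateSum_eq_mul α none, elim_eq_update, wordAt_update,
    Matrix.trace_single_mul, ← elim_eq_update, ← elim_eq_update]
  rw [one_smul, mul_comm, Matrix.smul_apply, smul_eq_mul]
  congr 1
  exact loopProd_congr _ _ fun x hx => by cases x <;> simp_all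

theorem trAlpha_eq_trS {n : ℕ} (α : S0 n) (x : Fin n → Matrix (Fin N) (Fin N) ℂ) :
    trAlpha α x = trS α x := by
  classical
  rw [trS_eq]
  rfl

theorem trS_conj (α : Equiv.Perm (Option ι)) (y : ι → Matrix (Fin N) (Fin N) R)
    {U V : Matrix (Fin N) (Fin N) R} (hUV : U * V = 1) :
    trS α (fun k => U * y k * V) = U * trS α y * V := by
  have h : (fun o : Option ι => o.elim 1 fun k => U * y k * V) =
      fun o => U * (fun o : Option ι => o.elim 1 y) o * V := by
    funext o
    cases o <;> simp [hUV]
  rw [trS_eq, trS_eq, h, loopProd_conj _ _ _ hUV, wordAt_conj _ _ hUV, Matrix.mul_smul,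
    Matrix.smul_mul]

theorem trS_apply (α : Equiv.Perm (Option ι)) (y : ι → Matrix (Fin N) (Fin N) R) (a c : Fin N) :
    trS α y a c = ∑ u : Option ι → Fin N, if u none = c ∧ u (α none) = a then
      ∏ k, y k (u (some k)) (u (α (some k))) else 0 := by
  rw [trS, Matrix.of_apply, stateSum]
  refine Finset.sum_congr rfl fun u _ => ?_
  rw [Fintype.prod_option]
  simp only [Option.elim_none, Option.elim_some, Matrix.single_apply, eq_comm (a := c),
    eq_comm (a := a)]
  split_ifs <;> simp

theorem trS_map {R' : Type*} [CommRing R'] (f : R →+* R') (α : Equiv.Perm (Option ι))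
    (y : ι → Matrix (Fin N) (Fin N) R) : (trS α y).map f = trS α fun k => (y k).map f := by
  ext a c
  simp only [Matrix.map_apply, trS_apply, map_sum, apply_ite f, map_prod, map_zero]

theorem trS_equiv (e : ι ≃ κ) (α : Equiv.Perm (Option ι)) (y : κ → Matrix (Fin N) (Fin N) R) :
    trS (e.optionCongr.permCongr α) y = trS α fun k => y (e k) := by
  ext a c
  rw [trS_apply, trS_apply, ← (e.optionCongr.arrowCongr (Equiv.refl (Fin N))).sum_comp]
  refine Finset.sum_congr rfl fun u _ => ?_
  rw [← e.prod_comp]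
  have h (o : Option ι) : e.optionCongr.symm (Option.map e o) = o :=
    e.optionCongr.symm_apply_apply o
  have h' (x : ι) : e.optionCongr.symm (some (e x)) = some x := h (some x)
  have h'' : e.optionCongr.symm (none : Option κ) = none := h none
  simp [Equiv.permCongr_apply, h, h', h'']

end TraceMonomial

section TraceMonomialAlgebra
variable {R : Type*} [CommRing R] {N : ℕ} {ι κ : Type*} [Fintype ι] [DecidableEq ι] [Fintype κ]
  [DecidableEq κ]

/-- `trS` as a multilinear map. -/
def trSMulti (R : Type*) [CommRing R] (N : ℕ) {ι : Type*} [Fintype ι] [DecidableEq ι]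
    (α : Equiv.Perm (Option ι)) :
    MultilinearMap R (fun _ : ι => Matrix (Fin N) (Fin N) R) (Matrix (Fin N) (Fin N) R) :=
  MultilinearMap.mk' (fun y => trS α y)
    (fun y k x z => by
      ext a c
      simp only [Matrix.add_apply, trS_apply, ← Finset.sum_add_distrib]
      refine Finset.sum_congr rfl fun u _ => ?_
      split_ifs
      · rw [← Finset.mul_prod_erase _ _ (Finset.mem_univ k), ← Finset.mul_prod_erase _ _ (Finset.mem_univ k),
          ← Finset.mul_prod_erase _ _ (Finset.mem_univ k)]
        simp only [Function.update_self, Matrix.add_apply, add_mul]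
        congr 2 <;>
        exact Finset.prod_congr rfl fun l hl => by
          simp only [Function.update_of_ne (Finset.ne_of_mem_erase hl)]
      · rw [add_zero])
    (fun y k r x => by
      ext a c
      simp only [Matrix.smul_apply, trS_apply, Finset.smul_sum]
      refine Finset.sum_congr rfl fun u _ => ?_
      split_ifs
      · rw [← Finset.mul_prod_erase _ _ (Finset.mem_univ k), ← Finset.mul_prod_erase _ _ (Finset.mem_univ k)]
        simp only [Function.update_self, Matrix.smul_apply, smul_eq_mul, mul_assoc]
        congr 2
        exact Finset.prod_congr rfl fun l hl => by
          simp only [Function.update_of_ne (Finset.ne_of_mem_erase hl)]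
      · rw [smul_zero])

theorem trS_mul (α : Equiv.Perm (Option ι)) (β : Equiv.Perm (Option κ))
    (f : ι → Matrix (Fin N) (Fin N) R) (g : κ → Matrix (Fin N) (Fin N) R) :
    trS (cupSum α β) (Sum.elim f g) = trS α f * trS β g := by
  let eo (ι : Type _) : (Fin N × (ι → Fin N)) ≃ (Option ι → Fin N) :=
    { toFun := fun p o => o.elim p.1 p.2
      invFun := fun u => (u none, fun i => u (some i))
      left_inv := fun p => rfl
      right_inv := fun u => by funext o; cases o <;> rfl }
  let e : ((Option κ → Fin N) × (ι → Fin N)) ≃ (Option (ι ⊕ κ) → Fin N) :=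
    { toFun := fun p o => o.elim (p.1 none) (Sum.elim p.2 fun k => p.1 (some k))
      invFun := fun w => (fun o => w (o.map Sum.inr), fun i => w (some (Sum.inl i)))
      left_inv := fun p => by ext o <;> [(cases o <;> rfl); rfl]
      right_inv := fun w => by funext o; rcases o with _ | (i | k) <;> rfl }
  have hr (p : (Option κ → Fin N) × (ι → Fin N)) (o : Option κ) : e p (o.map Sum.inr) = p.1 o := by
    cases o <;> rfl
  have hj (p : (Option κ → Fin N) × (ι → Fin N)) (y : Option ι) :
      e p (cupJoin β y) = y.elim (p.1 (β none)) p.2 := by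
    cases y
    · exact hr p (β none)
    · rfl
  ext a c
  rw [trS_apply, Matrix.mul_apply, ← e.sum_comp, Fintype.sum_prod_type]
  simp only [trS_apply, Finset.sum_mul_sum]
  symm
  have h1 (d : Fin N) (u : Option ι → Fin N) (v : Option κ → Fin N) :
      ((if u none = d ∧ u (α none) = a then ∏ k, f k (u (some k)) (u (α (some k))) else 0) *
        if v none = c ∧ v (β none) = d then ∏ k, g k (v (some k)) (v (β (some k))) else 0) =
      if d = v (β none) then (if u none = d ∧ u (α none) = a ∧ v none = c then
        (∏ k, f k (u (some k)) (u (α (some k)))) * ∏ k, g k (v (some k)) (v (β (some k))) else 0) else 0 := by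
    rw [ite_zero_mul_ite_zero, ← ite_and]
    exact if_congr (by rw [eq_comm (a := d)]; tauto) rfl rfl
  simp only [h1]
  have h2 (d : Fin N) : ∑ u : Option ι → Fin N, ∑ v : Option κ → Fin N,
      (if d = v (β none) then (if u none = d ∧ u (α none) = a ∧ v none = c then
        (∏ k, f k (u (some k)) (u (α (some k)))) * ∏ k, g k (v (some k)) (v (β (some k))) else 0) else 0) =
      ∑ v : Option κ → Fin N, if d = v (β none) then ∑ u : Option ι → Fin N,
        (if u none = d ∧ u (α none) = a ∧ v none = c then
        (∏ k, f k (u (some k)) (u (α (some k)))) * ∏ k, g k (v (some k)) (v (β (some k))) else 0) else 0 := by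
    rw [Finset.sum_comm]
    refine Finset.sum_congr rfl fun v _ => ?_
    split_ifs <;> simp
  simp only [h2]
  rw [Finset.sum_comm]
  refine Finset.sum_congr rfl fun v _ => ?_
  rw [Finset.sum_ite_eq' Finset.univ, if_pos (Finset.mem_univ _), ← (eo ι).sum_comp,
    Fintype.sum_prod_type, Finset.sum_eq_single (v (β none))]
  · refine Finset.sum_congr rfl fun u _ => ?_
    rw [cupSum_none, hj, Fintype.prod_sum_type]
    simp only [cupSum_inl, cupSum_inr, hj, hr, Sum.elim_inl, Sum.elim_inr]
    have h4 : e (v, u) none = v none := rfl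
    have h3 : (eo ι) (v (β none), u) none = v (β none) := rfl
    have h5 (o : Option ι) : (eo ι) (v (β none), u) o = o.elim (v (β none)) u := rfl
    simp only [h3, h4, true_and, h5, Option.elim_some]
    exact if_congr and_comm rfl rfl
  · intro d _ hd
    exact Finset.sum_eq_zero fun u _ => if_neg fun h => hd h.1
  · simp

theorem trS_star [StarRing R] (α : Equiv.Perm (Option ι)) (y : ι → Matrix (Fin N) (Fin N) R) :
    star (trS α y) = trS α⁻¹ fun k => star (y k) := by
  ext a c
  rw [Matrix.star_apply, trS_apply, trS_apply, star_sum,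
    ← (α.arrowCongr (Equiv.refl (Fin N))).sum_comp]
  refine Finset.sum_congr rfl fun u _ => ?_
  have h (o : Option ι) : (α.arrowCongr (Equiv.refl (Fin N))) u o = u (α⁻¹ o) := rfl
  have h' (o : Option ι) : α⁻¹ (α o) = o := α.symm_apply_apply o
  simp only [h, h', Matrix.star_apply, apply_ite star, star_prod, star_zero]
  exact if_congr and_comm rfl rfl

theorem trS_of_isEmpty [IsEmpty ι] (α : Equiv.Perm (Option ι)) (y : ι → Matrix (Fin N) (Fin N) R) :
    trS α y = 1 := by
  obtain rfl : α = 1 := Subsingleton.elim _ _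
  ext a c
  rw [trS_apply, ← (Equiv.funUnique (Option ι) (Fin N)).symm.sum_comp, Matrix.one_apply]
  have h (i : Fin N) (o : Option ι) : (Equiv.funUnique (Option ι) (Fin N)).symm i o = i := rfl
  simp only [h, Finset.univ_eq_empty, Finset.prod_empty, ite_and]
  rw [Finset.sum_ite_eq' Finset.univ c, if_pos (Finset.mem_univ _)]
  exact if_congr eq_comm rfl rfl

theorem mem_range_optSub (p : ι → Prop) (x : ι) : some x ∈ Set.range (optSub p) ↔ p x := by
  constructor
  · rintro ⟨_ | y, hy⟩
    · cases hy
    · obtain rfl : y.1 = x := Option.some_injective _ hy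
      exact y.2
  · exact fun h => ⟨some ⟨x, h⟩, rfl⟩

theorem none_mem_range_optSub (p : ι → Prop) : none ∈ Set.range (optSub p) := ⟨none, rfl⟩

theorem kerCard_eq_zpow [NeZero N] {X Y : Type*} [Finite X] (f : Y ↪ X) (σ : Equiv.Perm X) :
    (kerCard N f σ : ℂ) = (N : ℂ) ^ ((cyc σ : ℤ) - cyc (restrictPerm f σ)) := by
  have h0 : (N : ℂ) ≠ 0 := Nat.cast_ne_zero.2 (NeZero.ne N)
  have h : (N : ℂ) ^ cyc σ = kerCard N f σ * (N : ℂ) ^ cyc (restrictPerm f σ) := by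
    exact_mod_cast pow_cyc_eq N f σ
  rw [zpow_sub₀ h0, zpow_natCast, zpow_natCast, h, mul_div_cancel_right₀ _ (pow_ne_zero _ h0)]

/-- Contraction of a pair of points in a state sum. -/
theorem sum_contract [NeZero N] (α : Equiv.Perm (Option ι)) {i j : ι} (hij : i ≠ j) (a c : Fin N)
    (T : ({x // x ≠ i ∧ x ≠ j} → Fin N) → ({x // x ≠ i ∧ x ≠ j} → Fin N) → ℂ) :
    (∑ u : Option ι → Fin N, if u none = c ∧ u (α none) = a then
      if u (some i) = u (α (some j)) ∧ u (α (some i)) = u (some j) then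
        (1 / N : ℂ) * T (fun x => u (some x)) (fun x => u (α (some x))) else 0 else 0) =
    (conWeight (1 / N) (fun x => x ≠ i ∧ x ≠ j) (Equiv.swap i j) 1 α : ℝ) *
      ∑ v : Option {x // x ≠ i ∧ x ≠ j} → Fin N, if v none = c ∧
        v (restrictPerm (optSub fun x => x ≠ i ∧ x ≠ j) ((Equiv.swap i j).optionCongr * α) none) = a then
        T (fun x => v (some x)) (fun x => v
          (restrictPerm (optSub fun x => x ≠ i ∧ x ≠ j) ((Equiv.swap i j).optionCongr * α) (some x)))
        else 0 := by
  have h0 : (N : ℂ) ≠ 0 := Nat.cast_ne_zero.2 (NeZero.ne N)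
  set f := optSub fun x => x ≠ i ∧ x ≠ j with hf
  set τ : Equiv.Perm (Option ι) := (Equiv.swap i j).optionCongr with hτ
  have hτf (y) : τ (f y) = f y := by
    rcases y with _ | ⟨x, h1, h2⟩
    · rfl
    · exact congrArg some (Equiv.swap_apply_of_ne_of_ne h1 h2)
  have hτi : τ (some i) = some j := congrArg some (Equiv.swap_apply_left i j)
  have hτj : τ (some j) = some i := congrArg some (Equiv.swap_apply_right i j)
  have hττ : τ * τ = 1 := by
    ext1 x
    rcases x with _ | x
    · rfl
    · exact congrArg some (Equiv.Perm.congr_fun (Equiv.swap_mul_self i j) x)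
  have hτinv : τ⁻¹ = τ := inv_eq_of_mul_eq_one_left hττ
  have hconj : τ * (τ * α) * τ⁻¹ = α * τ := by
    rw [hτinv, ← mul_assoc τ τ, hττ, one_mul]
  have hρ : restrictPerm f (α * τ) = restrictPerm f (τ * α) := by
    rw [← hconj, restrictPerm_conj f _ τ hτf]
  have hcyc : cyc (α * τ) = cyc (τ * α) := by
    rw [← hconj]
    exact cyc_permCongr τ (τ * α)
  have h1 := sum_coloring N f (α * τ) fun r s : Option {x // x ≠ i ∧ x ≠ j} → Fin N =>
    if r none = c ∧ s none = a then (1 / N : ℂ) * T (fun x => r (some x)) (fun x => s (some x)) else 0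
  rw [hρ, kerCard_eq_zpow, hρ, hcyc] at h1
  have hL (u : Option ι → Fin N) : (∀ x ∉ Set.range f, u ((α * τ) x) = u x) ↔
      u (some i) = u (α (some j)) ∧ u (α (some i)) = u (some j) := by
    constructor
    · intro h
      have hi := h (some i) (by rw [hf, mem_range_optSub]; simp)
      have hj := h (some j) (by rw [hf, mem_range_optSub]; simp)
      rw [Equiv.Perm.mul_apply, hτi] at hi
      rw [Equiv.Perm.mul_apply, hτj] at hj
      exact ⟨hi.symm, hj⟩
    · rintro ⟨hi, hj⟩ (_ | x) hx
      · exact (hx (none_mem_range_optSub _)).elim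
      · rw [hf, mem_range_optSub, not_and_or, not_not, not_not] at hx
        rcases hx with rfl | rfl
        · rw [Equiv.Perm.mul_apply, hτi, hi]
        · rw [Equiv.Perm.mul_apply, hτj, hj]
  have hR (u : Option ι → Fin N) (y) : (u ∘ (α * τ) ∘ f) y = u (α (f y)) := by
    simp only [Function.comp_apply, Equiv.Perm.mul_apply, hτf]
  refine Eq.trans (Finset.sum_congr (Finset.ext fun _ => by simp) fun u _ => ?_) (h1.trans ?_)
  · by_cases hB : u (some i) = u (α (some j)) ∧ u (α (some i)) = u (some j)
    · rw [if_pos hB, if_pos ((hL u).2 hB)]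
      simp only [hR]
      rfl
    · rw [if_neg hB, if_neg (mt (hL u).1 hB), ite_self]
  · rw [conWeight, one_div (N : ℝ), inv_zpow', Complex.ofReal_zpow, Complex.ofReal_natCast, Finset.mul_sum,
      Finset.mul_sum]
    refine Finset.sum_congr (Finset.ext fun _ => by simp) fun v _ => ?_
    simp only [Function.comp_apply]
    split_ifs
    · rw [← mul_assoc, one_div, ← zpow_neg_one, ← zpow_add₀ h0]
      congr 2
      rw [hf]
      ring
    · simp

end TraceMonomialAlgebra

section Evaluation
variable {H H' : Type*} [NormedAddCommGroup H] [InnerProductSpace ℝ H] [NormedAddCommGroup H']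
  [InnerProductSpace ℝ H'] {N : ℕ} {R R' : Type*} [CommRing R] [Algebra ℂ R] [CommRing R'] [Algebra ℂ R']

/-- The value of trace polynomials at a linear family of matrices. -/
def evalTP (Y : H →ₗ[ℝ] Matrix (Fin N) (Fin N) R) : TP H →ₗ[ℂ] Matrix (Fin N) (Fin N) R :=
  liftTP (fun _ α => ((trSMulti R N α).restrictScalars ℝ).compLinearMap fun _ => Y)
    fun n σ α h => by
      change trS (conj0 σ α) (fun i => Y (h (σ.symm i))) = trS α fun i => Y (h i)
      rw [conj0_eq_permCongr, trS_equiv]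
      simp

theorem evalTP_symFin (Y : H →ₗ[ℝ] Matrix (Fin N) (Fin N) R) {n : ℕ} (α : S0 n) (h : Fin n → H) :
    evalTP Y (symFin α h) = trS α fun k => Y (h k) :=
  liftTP_symFin _ _ α h

theorem evalTP_sym (Y : H →ₗ[ℝ] Matrix (Fin N) (Fin N) R) {ι : Type*} [Fintype ι] [DecidableEq ι]
    (α : Equiv.Perm (Option ι)) (h : ι → H) : evalTP Y (sym α h) = trS α fun k => Y (h k) := by
  rw [sym_eq_symFin (Fintype.equivFin ι), evalTP_symFin, trS_equiv]
  simp

theorem evalTP_one (Y : H →ₗ[ℝ] Matrix (Fin N) (Fin N) R) : evalTP Y (1 : TP H) = 1 := by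
  rw [one_eq_symFin, evalTP_symFin, trS_of_isEmpty]

theorem evalTP_mul (Y : H →ₗ[ℝ] Matrix (Fin N) (Fin N) R) (x y : TP H) :
    evalTP Y (mulTP x y) = evalTP Y x * evalTP Y y := by
  have : (mulTP (H := H)).compr₂ (evalTP Y) =
      (LinearMap.mul ℂ (Matrix (Fin N) (Fin N) R)).compl₁₂ (evalTP Y) (evalTP Y) := by
    refine TP_ext₂ fun n k α β f g => ?_
    rw [LinearMap.compr₂_apply, LinearMap.compl₁₂_apply, LinearMap.mul_apply', ← sym_fin, ← sym_fin,
      ← mul_eq_mulTP, sym_mul, evalTP_sym, evalTP_sym, evalTP_sym, ← trS_mul]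
    congr 1
    funext x
    cases x <;> rfl
  exact LinearMap.congr_fun (LinearMap.congr_fun this x) y

theorem evalTP_star (Y : H →ₗ[ℝ] Matrix (Fin N) (Fin N) ℂ) (hY : ∀ h, star (Y h) = Y h) (x : TP H) :
    evalTP Y (starTP x) = star (evalTP Y x) := by
  induction x using TP_induction with
  | zero => simp
  | tensor n α h =>
    rw [← sym_fin, ← star_eq_starTP, star_sym, evalTP_sym, evalTP_sym, trS_star]
    simp only [hY]
  | smul c x hx => rw [map_smulₛₗ, map_smul, map_smul, star_smul, hx]; rfl
  | add x y hx hy => rw [map_add, map_add, map_add, star_add, hx, hy]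

theorem evalTP_gam (Y : H' →ₗ[ℝ] Matrix (Fin N) (Fin N) R) (A : H →ₗ[ℝ] H') (x : TP H) :
    evalTP Y (gam A x) = evalTP (Y ∘ₗ A) x := by
  have : evalTP Y ∘ₗ gam A = evalTP (Y ∘ₗ A) := TP_ext fun n α h => by
    rw [LinearMap.comp_apply, gam_symFin, evalTP_symFin, evalTP_symFin]; rfl
  exact LinearMap.congr_fun this x

theorem evalTP_map (Y : H →ₗ[ℝ] Matrix (Fin N) (Fin N) R) (Y' : H →ₗ[ℝ] Matrix (Fin N) (Fin N) R')
    (f : R →ₐ[ℂ] R') (hf : ∀ h, (Y h).map f = Y' h) (x : TP H) : (evalTP Y x).map f = evalTP Y' x := by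
  induction x using TP_induction with
  | zero => simp
  | tensor n α h =>
    rw [evalTP_symFin, evalTP_symFin]
    refine (trS_map (f : R →+* R') α _).trans ?_
    congr 1
    funext k
    exact hf _
  | smul c x hx =>
    rw [map_smul, map_smul, ← hx]
    ext i j
    simp
  | add x y hx hy =>
    rw [map_add, map_add, ← hx, ← hy]
    ext i j
    simp

end Evaluation

section SubsetSums
open Polynomial

theorem sum_powersetCard_succ {ι M : Type*} [DecidableEq ι] [AddCommMonoid M] (m : ℕ) (T : Finset ι)
    (g : Finset ι → ι → M) : ∑ S ∈ T.powersetCard (m + 1), ∑ i ∈ S, g S i =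
      ∑ i ∈ T, ∑ S ∈ (T.erase i).powersetCard m, g (insert i S) i := by
  rw [Finset.sum_sigma', Finset.sum_sigma']
  refine Finset.sum_bij' (fun p _ => ⟨p.2, p.1.erase p.2⟩) (fun p _ => ⟨insert p.1 p.2, p.1⟩) ?_ ?_ ?_ ?_ ?_
  · rintro ⟨S, i⟩ h
    simp only [Finset.mem_sigma, Finset.mem_powersetCard] at h ⊢
    exact ⟨h.1.1 h.2, Finset.erase_subset_erase _ h.1.1, by rw [Finset.card_erase_of_mem h.2, h.1.2]; rfl⟩
  · rintro ⟨i, S⟩ h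
    simp only [Finset.mem_sigma, Finset.mem_powersetCard] at h ⊢
    have hi : i ∉ S := fun hi => Finset.notMem_erase i T (h.2.1 hi)
    exact ⟨⟨Finset.insert_subset h.1 (h.2.1.trans (Finset.erase_subset _ _)),
      by rw [Finset.card_insert_of_notMem hi, h.2.2]⟩, Finset.mem_insert_self _ _⟩
  · rintro ⟨S, i⟩ h
    simp only [Finset.mem_sigma] at h
    simp only [Finset.insert_erase h.2]
  · rintro ⟨i, S⟩ h
    simp only [Finset.mem_sigma, Finset.mem_powersetCard] at h ⊢
    have hi : i ∉ S := fun hi => Finset.notMem_erase i T (h.2.1 hi)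
    simp only [Finset.erase_insert hi]
  · rintro ⟨S, i⟩ h
    simp only [Finset.mem_sigma] at h
    simp only [Finset.insert_erase h.2]

theorem coeff_prod_linear {ι : Type*} [DecidableEq ι] (T : Finset ι) (a z : ι → ℂ) (m : ℕ) :
    (∏ k ∈ T, (C (a k) + X * C (z k))).coeff m =
      ∑ S ∈ T.powersetCard m, (∏ k ∈ S, z k) * ∏ k ∈ T \ S, a k := by
  have h : ∏ k ∈ T, (C (a k) + X * C (z k)) =
      ∑ S ∈ T.powerset, C ((∏ k ∈ S, z k) * ∏ k ∈ T \ S, a k) * X ^ S.card := by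
    simp_rw [add_comm (C (a _))]
    rw [Finset.prod_add]
    refine Finset.sum_congr rfl fun S _ => ?_
    rw [Finset.prod_mul_distrib, Finset.prod_const, C_mul, map_prod, map_prod]
    ring
  rw [h, finsetSum_coeff, Finset.powersetCard_eq_filter, Finset.sum_filter]
  refine Finset.sum_congr rfl fun S _ => ?_
  rw [coeff_C_mul_X_pow]
  exact if_congr eq_comm rfl rfl

end SubsetSums

section Heat
open Polynomial
variable {H : Type*} [NormedAddCommGroup H] [InnerProductSpace ℝ H] {N : ℕ}
  {Ω : Type*} [MeasurableSpace Ω]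

/-- A random linear family of matrices whose entries have all moments and satisfy the Wick recursion
for the covariance `B / N`. -/
structure IsMatrixWick (B : H →ₗ[ℝ] H →ₗ[ℝ] ℝ) (Z : Ω → H →ₗ[ℝ] Matrix (Fin N) (Fin N) ℂ)
    (P : Measure Ω) : Prop where
  integrable : ∀ {ι : Type} (S : Finset ι) (h : ι → H) (r s : ι → Fin N),
    Integrable (fun ω => ∏ k ∈ S, Z ω (h k) (r k) (s k)) P
  wick : ∀ {ι : Type} [DecidableEq ι] (S : Finset ι) (h : ι → H) (r s : ι → Fin N),
    (S.card : ℂ) * ∫ ω, ∏ k ∈ S, Z ω (h k) (r k) (s k) ∂P =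
      ∑ i ∈ S, ∑ j ∈ S.erase i, (if r i = s j ∧ s i = r j then (1 / N : ℂ) * B (h i) (h j) else 0) *
        ∫ ω, ∏ k ∈ (S.erase i).erase j, Z ω (h k) (r k) (s k) ∂P

variable {B : H →ₗ[ℝ] H →ₗ[ℝ] ℝ} {Z : Ω → H →ₗ[ℝ] Matrix (Fin N) (Fin N) ℂ} {P : Measure Ω}

/-- The family `A + X Z` of matrices of polynomials. -/
def shiftFamily (A Z : H →ₗ[ℝ] Matrix (Fin N) (Fin N) ℂ) : H →ₗ[ℝ] Matrix (Fin N) (Fin N) ℂ[X] where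
  toFun h := Matrix.of fun i j => C (A h i j) + X * C (Z h i j)
  map_add' h g := by
    ext1 i j
    simp only [map_add, Matrix.add_apply, Matrix.of_apply]
    ring
  map_smul' c h := by
    have key (z w : ℂ) : C (c • z) + X * C (c • w) = c • (C z + X * C w : ℂ[X]) := by
      rw [Complex.real_smul, Complex.real_smul, C_mul, C_mul]
      change _ = ((c : ℂ)) • (C z + X * C w : ℂ[X])
      rw [smul_eq_C_mul]
      ring
    ext1 i j
    rw [map_smul, map_smul]
    exact key _ _

theorem evalTP_shiftFamily_coeff (A Z : H →ₗ[ℝ] Matrix (Fin N) (Fin N) ℂ) {ι : Type*} [Fintype ι]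
    [DecidableEq ι] (α : Equiv.Perm (Option ι)) (h : ι → H) (m : ℕ) (a c : Fin N) :
    (evalTP (shiftFamily A Z) (sym α h) a c).coeff m = ∑ u : Option ι → Fin N,
      if u none = c ∧ u (α none) = a then
        (∏ k, (C (A (h k) (u (some k)) (u (α (some k)))) +
          X * C (Z (h k) (u (some k)) (u (α (some k)))))).coeff m else 0 := by
  rw [evalTP_sym, trS_apply, finsetSum_coeff]
  refine Finset.sum_congr rfl fun u _ => ?_
  split_ifs
  · rfl
  · rw [coeff_zero]

theorem integrable_coeff_prod (hZ : IsMatrixWick B Z P) {ι : Type} [DecidableEq ι] (T : Finset ι)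
    (h : ι → H) (r s : ι → Fin N) (a : ι → ℂ) (m : ℕ) :
    Integrable (fun ω => (∏ k ∈ T, (C (a k) + X * C (Z ω (h k) (r k) (s k)))).coeff m) P := by
  simp only [coeff_prod_linear]
  exact integrable_finsetSum _ fun S _ => (hZ.integrable S h r s).mul_const _

theorem integral_coeff_prod (hZ : IsMatrixWick B Z P) {ι : Type} [DecidableEq ι] (T : Finset ι)
    (h : ι → H) (r s : ι → Fin N) (a : ι → ℂ) (m : ℕ) :
    ∫ ω, (∏ k ∈ T, (C (a k) + X * C (Z ω (h k) (r k) (s k)))).coeff m ∂P =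
      ∑ S ∈ T.powersetCard m, (∫ ω, ∏ k ∈ S, Z ω (h k) (r k) (s k) ∂P) * ∏ k ∈ T \ S, a k := by
  simp only [coeff_prod_linear]
  rw [integral_finsetSum _ fun S _ => (hZ.integrable S h r s).mul_const _]
  exact Finset.sum_congr rfl fun S _ => integral_mul_const _ _

theorem integral_coeff_prod_one (hZ : IsMatrixWick B Z P) {ι : Type} [DecidableEq ι] (T : Finset ι)
    (h : ι → H) (r s : ι → Fin N) (a : ι → ℂ) :
    ∫ ω, (∏ k ∈ T, (C (a k) + X * C (Z ω (h k) (r k) (s k)))).coeff 1 ∂P = 0 := by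
  rw [integral_coeff_prod hZ]
  refine Finset.sum_eq_zero fun S hS => ?_
  have hc := (Finset.mem_powersetCard.1 hS).2
  obtain ⟨i, rfl⟩ := Finset.card_eq_one.1 hc
  have := hZ.wick {i} h r s
  rw [hc, Nat.cast_one, one_mul, Finset.sum_singleton] at this
  rw [this]
  simp

theorem integral_coeff_prod_add_two (hZ : IsMatrixWick B Z P) {ι : Type} [DecidableEq ι] (T : Finset ι)
    (h : ι → H) (r s : ι → Fin N) (a : ι → ℂ) (m : ℕ) :
    ((m + 2 : ℕ) : ℂ) * ∫ ω, (∏ k ∈ T, (C (a k) + X * C (Z ω (h k) (r k) (s k)))).coeff (m + 2) ∂P =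
      ∑ i ∈ T, ∑ j ∈ T.erase i, (if r i = s j ∧ s i = r j then (1 / N : ℂ) * B (h i) (h j) else 0) *
        ∫ ω, (∏ k ∈ (T.erase i).erase j, (C (a k) + X * C (Z ω (h k) (r k) (s k)))).coeff m ∂P := by
  simp only [integral_coeff_prod hZ]
  rw [Finset.mul_sum]
  have h1 (S) (hS : S ∈ T.powersetCard (m + 2)) : ((m + 2 : ℕ) : ℂ) *
      ((∫ ω, ∏ k ∈ S, Z ω (h k) (r k) (s k) ∂P) * ∏ k ∈ T \ S, a k) =
      ∑ i ∈ S, ∑ j ∈ S.erase i, (if r i = s j ∧ s i = r j then (1 / N : ℂ) * B (h i) (h j) else 0) *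
        (∫ ω, ∏ k ∈ (S.erase i).erase j, Z ω (h k) (r k) (s k) ∂P) * ∏ k ∈ T \ S, a k := by
    rw [← mul_assoc]
    conv_lhs => rw [← (Finset.mem_powersetCard.1 hS).2]
    rw [hZ.wick S h r s, Finset.sum_mul]
    exact Finset.sum_congr rfl fun i _ => Finset.sum_mul _ _ _
  rw [Finset.sum_congr rfl h1, sum_powersetCard_succ]
  refine Finset.sum_congr rfl fun i _ => ?_
  have h2 (S) (hS : S ∈ (T.erase i).powersetCard (m + 1)) :
      ∑ j ∈ (insert i S).erase i, (if r i = s j ∧ s i = r j then (1 / N : ℂ) * B (h i) (h j) else 0) *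
        (∫ ω, ∏ k ∈ ((insert i S).erase i).erase j, Z ω (h k) (r k) (s k) ∂P) * ∏ k ∈ T \ insert i S, a k =
      ∑ j ∈ S, (if r i = s j ∧ s i = r j then (1 / N : ℂ) * B (h i) (h j) else 0) *
        (∫ ω, ∏ k ∈ S.erase j, Z ω (h k) (r k) (s k) ∂P) * ∏ k ∈ T \ insert i S, a k := by
    have hi : i ∉ S := fun hi => Finset.notMem_erase i T ((Finset.mem_powersetCard.1 hS).1 hi)
    rw [Finset.erase_insert hi]
  rw [Finset.sum_congr rfl h2, sum_powersetCard_succ]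
  refine Finset.sum_congr rfl fun j _ => ?_
  rw [Finset.mul_sum]
  refine Finset.sum_congr rfl fun S hS => ?_
  have hj : j ∉ S := fun hj => Finset.notMem_erase j _ ((Finset.mem_powersetCard.1 hS).1 hj)
  rw [Finset.erase_insert hj, mul_assoc]
  congr 3
  ext k
  simp only [Finset.mem_sdiff, Finset.mem_insert, Finset.mem_erase]
  tauto

theorem integrable_evalTP_coeff (hZ : IsMatrixWick B Z P) (A : H →ₗ[ℝ] Matrix (Fin N) (Fin N) ℂ) (m : ℕ)
    (a c : Fin N) (x : TP H) : Integrable (fun ω => (evalTP (shiftFamily A (Z ω)) x a c).coeff m) P := by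
  induction x using TP_induction with
  | zero => simp
  | tensor n α h =>
    simp only [← sym_fin, evalTP_shiftFamily_coeff]
    refine integrable_finsetSum _ fun u _ => ?_
    split_ifs
    · exact integrable_coeff_prod hZ _ h (fun k => u (some k)) (fun k => u (α (some k))) _ m
    · exact integrable_zero _ _ _
  | smul z x hx => simpa using hx.const_mul z
  | add x y hx hy =>
    simp only [map_add, Matrix.add_apply, coeff_add]
    exact hx.add hy

/-- The expectation of the component of degree `m` in `Z` of `x(A + Z)`. -/
def heatPart (hZ : IsMatrixWick B Z P) (A : H →ₗ[ℝ] Matrix (Fin N) (Fin N) ℂ) (m : ℕ) (a c : Fin N) :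
    TP H →ₗ[ℂ] ℂ where
  toFun x := ∫ ω, (evalTP (shiftFamily A (Z ω)) x a c).coeff m ∂P
  map_add' x y := by
    rw [← integral_add (integrable_evalTP_coeff hZ A m a c x) (integrable_evalTP_coeff hZ A m a c y)]
    simp
  map_smul' z x := by
    rw [RingHom.id_apply, smul_eq_mul, ← integral_const_mul]
    simp

theorem heatPart_sym (hZ : IsMatrixWick B Z P) (A : H →ₗ[ℝ] Matrix (Fin N) (Fin N) ℂ) (m : ℕ)
    (a c : Fin N) {ι : Type} [Fintype ι] [DecidableEq ι] (α : Equiv.Perm (Option ι)) (h : ι → H) :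
    heatPart hZ A m a c (sym α h) = ∑ u : Option ι → Fin N, if u none = c ∧ u (α none) = a then
      ∫ ω, (∏ k, (C (A (h k) (u (some k)) (u (α (some k)))) +
          X * C (Z ω (h k) (u (some k)) (u (α (some k)))))).coeff m ∂P else 0 := by
  change ∫ ω, (evalTP (shiftFamily A (Z ω)) (sym α h) a c).coeff m ∂P = _
  simp only [evalTP_shiftFamily_coeff]
  rw [integral_finsetSum]
  · refine Finset.sum_congr rfl fun u _ => ?_
    split_ifs
    · rfl
    · exact integral_zero _ _
  · intro u _
    split_ifs
    · exact integrable_coeff_prod hZ _ h (fun k => u (some k)) (fun k => u (α (some k))) _ m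
    · exact integrable_zero _ _ _

theorem heatPart_one (hZ : IsMatrixWick B Z P) (A : H →ₗ[ℝ] Matrix (Fin N) (Fin N) ℂ) (a c : Fin N)
    (x : TP H) : heatPart hZ A 1 a c x = 0 := by
  refine LinearMap.congr_fun (g := 0) (TP_ext fun n α h => ?_) x
  rw [← sym_fin, heatPart_sym, LinearMap.zero_apply]
  refine Finset.sum_eq_zero fun u _ => ?_
  rw [integral_coeff_prod_one hZ _ h (fun k => u (some k)) (fun k => u (α (some k))), ite_self]

theorem heatPart_add_two [NeZero N] (hZ : IsMatrixWick B Z P) (A : H →ₗ[ℝ] Matrix (Fin N) (Fin N) ℂ)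
    (m : ℕ) (a c : Fin N) (x : TP H) :
    ((m + 2 : ℕ) : ℂ) * heatPart hZ A (m + 2) a c x = 2 * heatPart hZ A m a c (lapT (1 / N) B x) := by
  refine LinearMap.congr_fun (f := ((m + 2 : ℕ) : ℂ) • heatPart hZ A (m + 2) a c)
    (g := (2 : ℂ) • heatPart hZ A m a c ∘ₗ lapT (1 / N) B) (TP_ext fun n α h => ?_) x
  rw [LinearMap.smul_apply, LinearMap.smul_apply, LinearMap.comp_apply, ← sym_fin, lapT_sym,
    heatPart_sym, smul_eq_mul, smul_eq_mul, Finset.mul_sum]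
  have hreal (t : ℝ) (y : TP H) : heatPart hZ A m a c (t • y) = (t : ℂ) * heatPart hZ A m a c y :=
    (heatPart hZ A m a c).map_smul (t : ℂ) y
  have h1 (u : Option (Fin n) → Fin N) : ((m + 2 : ℕ) : ℂ) * (if u none = c ∧ u (α none) = a then
      ∫ ω, (∏ k, (C (A (h k) (u (some k)) (u (α (some k)))) +
          X * C (Z ω (h k) (u (some k)) (u (α (some k)))))).coeff (m + 2) ∂P else 0) =
      ∑ i, ∑ j, if i ≠ j then (B (h i) (h j) : ℂ) * (if u none = c ∧ u (α none) = a then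
        if u (some i) = u (α (some j)) ∧ u (α (some i)) = u (some j) then
        (1 / N : ℂ) * ∫ ω, (∏ k : {x // x ≠ i ∧ x ≠ j}, (C (A (h k) (u (some k)) (u (α (some k)))) +
          X * C (Z ω (h k) (u (some k)) (u (α (some k)))))).coeff m ∂P else 0 else 0) else 0 := by
    by_cases hu : u none = c ∧ u (α none) = a
    · simp only [if_pos hu]
      rw [integral_coeff_prod_add_two hZ _ h (fun k => u (some k)) (fun k => u (α (some k)))]
      refine Finset.sum_congr rfl fun i _ => ?_
      rw [← Finset.filter_ne, Finset.sum_filter]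
      refine Finset.sum_congr rfl fun j _ => ?_
      split_ifs with hij hc
      · have hs (ω : Ω) := Finset.prod_subtype (((Finset.univ : Finset (Fin n)).filter (i ≠ ·)).erase j)
          (p := fun x => x ≠ i ∧ x ≠ j) (F := inferInstance) (fun x => by simp [and_comm, eq_comm])
          fun k => (C (A (h k) (u (some k)) (u (α (some k)))) +
          X * C (Z ω (h k) (u (some k)) (u (α (some k)))))
        simp only [hs]
        ring
      · simp
      · rfl
    · simp only [if_neg hu, mul_zero, ite_self, Finset.sum_const_zero]
  simp only [h1]
  rw [hreal, ← mul_assoc, show (2 : ℂ) * ((1 / 2 : ℝ) : ℂ) = 1 by norm_num, one_mul, map_sum,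
    Finset.sum_comm]
  refine Finset.sum_congr rfl fun i _ => ?_
  rw [map_sum, Finset.sum_comm]
  refine Finset.sum_congr rfl fun j _ => ?_
  by_cases hij : i ≠ j
  · simp only [if_pos hij]
    rw [← Finset.mul_sum, hreal, conSym, smul_apply, hreal, heatPart_sym]
    exact congrArg _ (sum_contract α hij a c fun r s => ∫ ω, (∏ k : {x // x ≠ i ∧ x ≠ j}, (C (A (h k) (r k) (s k)) +
          X * C (Z ω (h k) (r k) (s k)))).coeff m ∂P)
  · simp only [if_neg hij, Finset.sum_const_zero, map_zero]

theorem heatPart_two_mul [NeZero N] (hZ : IsMatrixWick B Z P) (A : H →ₗ[ℝ] Matrix (Fin N) (Fin N) ℂ)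
    (r : ℕ) (a c : Fin N) (x : TP H) : heatPart hZ A (2 * r) a c x =
      ((Nat.factorial r : ℂ)⁻¹) * heatPart hZ A 0 a c ((lapT (1 / N) B ^ r) x) := by
  induction r generalizing x with
  | zero => simp
  | succ r ih =>
    have h := heatPart_add_two hZ A (2 * r) a c x
    rw [ih, ← Module.End.mul_apply, ← pow_succ] at h
    have hr : ((r : ℂ) + 1) ≠ 0 := Nat.cast_add_one_ne_zero r
    have h2 : ((2 * r + 2 : ℕ) : ℂ) = 2 * ((r : ℂ) + 1) := by push_cast; ring
    rw [h2, mul_assoc] at h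
    have h3 := mul_left_cancel₀ two_ne_zero h
    rw [show 2 * (r + 1) = 2 * r + 2 by ring, Nat.factorial_succ, Nat.cast_mul, mul_inv, mul_assoc, ← h3]
    push_cast
    rw [inv_mul_cancel_left₀ hr]

theorem heatPart_two_mul_add_one [NeZero N] (hZ : IsMatrixWick B Z P)
    (A : H →ₗ[ℝ] Matrix (Fin N) (Fin N) ℂ) (r : ℕ) (a c : Fin N) (x : TP H) :
    heatPart hZ A (2 * r + 1) a c x = 0 := by
  induction r generalizing x with
  | zero => exact heatPart_one hZ A a c x
  | succ r ih =>
    have h := heatPart_add_two hZ A (2 * r + 1) a c x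
    rw [ih, mul_zero] at h
    exact (mul_eq_zero.1 h).resolve_left (Nat.cast_ne_zero.2 (by omega))

theorem heatPart_zero [IsProbabilityMeasure P] (hZ : IsMatrixWick B Z P)
    (A : H →ₗ[ℝ] Matrix (Fin N) (Fin N) ℂ) (a c : Fin N) (x : TP H) :
    heatPart hZ A 0 a c x = evalTP A x a c := by
  have h (ω : Ω) : (evalTP (shiftFamily A (Z ω)) x a c).coeff 0 = evalTP A x a c := by
    have := evalTP_map (shiftFamily A (Z ω)) A (Polynomial.aeval (0 : ℂ)) (fun h => by
      ext i j; simp [shiftFamily]) x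
    rw [← this, Matrix.map_apply, coeff_zero_eq_aeval_zero]
  change ∫ ω, (evalTP (shiftFamily A (Z ω)) x a c).coeff 0 ∂P = _
  simp [h]

theorem natDegree_evalTP_shiftFamily (Z : Ω → H →ₗ[ℝ] Matrix (Fin N) (Fin N) ℂ)
    (A : H →ₗ[ℝ] Matrix (Fin N) (Fin N) ℂ) (a c : Fin N) (x : TP H) :
    ∃ M, ∀ ω, (evalTP (shiftFamily A (Z ω)) x a c).natDegree ≤ M := by
  induction x using TP_induction with
  | zero => exact ⟨0, by simp⟩
  | tensor n α h =>
    refine ⟨n, fun ω => ?_⟩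
    rw [evalTP_symFin, trS_apply]
    refine natDegree_sum_le_of_forall_le _ _ fun u _ => ?_
    split_ifs
    · refine (natDegree_prod_le _ _).trans ((Finset.sum_le_card_nsmul _ _ 1 fun k _ => ?_).trans (by simp))
      change (C _ + X * C _ : ℂ[X]).natDegree ≤ 1
      compute_degree
    · simp
  | smul z x hx =>
    obtain ⟨M, hM⟩ := hx
    refine ⟨M, fun ω => ?_⟩
    rw [map_smul]
    exact (natDegree_smul_le _ _).trans (hM ω)
  | add x y hx hy =>
    obtain ⟨M, hM⟩ := hx
    obtain ⟨M', hM'⟩ := hy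
    refine ⟨max M M', fun ω => ?_⟩
    rw [map_add]
    exact (natDegree_add_le _ _).trans (max_le_max (hM ω) (hM' ω))

/-- The expectation of `x(A + Z)` is `(e^L x)(A)`, with the contraction operator `L` of the
covariance of `Z`. -/
theorem integral_evalTP_add [NeZero N] [IsProbabilityMeasure P] (hZ : IsMatrixWick B Z P)
    (A : H →ₗ[ℝ] Matrix (Fin N) (Fin N) ℂ) (a c : Fin N) (x : TP H) :
    Integrable (fun ω => evalTP (A + Z ω) x a c) P ∧
      ∫ ω, evalTP (A + Z ω) x a c ∂P = evalTP A (expT (1 / N) B x) a c := by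
  have h1 (ω : Ω) : evalTP (A + Z ω) x a c = (evalTP (shiftFamily A (Z ω)) x a c).eval 1 := by
    have := evalTP_map (shiftFamily A (Z ω)) (A + Z ω) (Polynomial.aeval (1 : ℂ)) (fun h => by
      ext i j; simp [shiftFamily]) x
    rw [← this, Matrix.map_apply, Polynomial.coe_aeval_eq_eval]
  obtain ⟨M, hM⟩ := natDegree_evalTP_shiftFamily Z A a c x
  obtain ⟨n, hn⟩ := lapT_locallyNilpotent (1 / N) B x
  have h2 (ω : Ω) : evalTP (A + Z ω) x a c =
      ∑ m ∈ Finset.range (2 * (n + M + 1)), (evalTP (shiftFamily A (Z ω)) x a c).coeff m := by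
    rw [h1, eval_eq_sum_range' (n := 2 * (n + M + 1)) (by have := hM ω; omega)]
    simp
  have hi (m : ℕ) := integrable_evalTP_coeff hZ A m a c x
  have h3 (K : ℕ) : ∑ m ∈ Finset.range (2 * K), heatPart hZ A m a c x =
      ∑ r ∈ Finset.range K, heatPart hZ A (2 * r) a c x := by
    induction K with
    | zero => simp
    | succ K ih =>
      rw [show 2 * (K + 1) = 2 * K + 1 + 1 by ring, Finset.sum_range_succ, Finset.sum_range_succ, ih,
        heatPart_two_mul_add_one, add_zero, Finset.sum_range_succ]
  simp only [h2]
  refine ⟨integrable_finsetSum _ fun m _ => hi m, ?_⟩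
  rw [integral_finsetSum _ fun m _ => hi m]
  refine (h3 _).trans ?_
  rw [expT, lexp_eq_sum (lapT_locallyNilpotent (1 / N) B) (n := n + M + 1)
    (pow_apply_eq_zero_of_le hn (by omega)), map_sum, Matrix.sum_apply]
  refine Finset.sum_congr rfl fun r _ => ?_
  rw [heatPart_two_mul, heatPart_zero, map_smul]
  rfl

end Heat

section Moments
variable {Ω : Type*} [MeasurableSpace Ω] {P : Measure Ω} [IsProbabilityMeasure P]

/-- All moments are finite. -/
def AllMoments (P : Measure Ω) (f : Ω → ℂ) : Prop := ∀ n : ℕ, MemLp f n P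

theorem AllMoments.mul {f g : Ω → ℂ} (hf : AllMoments P f) (hg : AllMoments P g) :
    AllMoments P fun ω => f ω * g ω := by
  intro n
  have : ENNReal.HolderTriple (2 * n : ℕ) (2 * n : ℕ) (n : ℕ) := ⟨by
    push_cast
    rw [ENNReal.mul_inv (by simp) (by simp), ← add_mul, ENNReal.inv_two_add_inv_two, one_mul]⟩
  exact (hg (2 * n)).mul (hf (2 * n))

theorem AllMoments.add {f g : Ω → ℂ} (hf : AllMoments P f) (hg : AllMoments P g) :
    AllMoments P fun ω => f ω + g ω := fun n => (hf n).add (hg n)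

theorem allMoments_const (c : ℂ) : AllMoments P fun _ => c := fun _ => memLp_const c

theorem AllMoments.prod {ι : Type*} (S : Finset ι) {f : ι → Ω → ℂ} (hf : ∀ i, AllMoments P (f i)) :
    AllMoments P fun ω => ∏ i ∈ S, f i ω := by
  classical
  induction S using Finset.induction_on with
  | empty => simpa using allMoments_const 1
  | insert i S hi ih => simpa only [Finset.prod_insert hi] using (hf i).mul ih

theorem AllMoments.sum {ι : Type*} (S : Finset ι) {f : ι → Ω → ℂ} (hf : ∀ i, AllMoments P (f i)) :
    AllMoments P fun ω => ∑ i ∈ S, f i ω := fun n => memLp_finsetSum S fun i _ => hf i n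

theorem AllMoments.integrable {f : Ω → ℂ} (hf : AllMoments P f) : Integrable f P :=
  memLp_one_iff_integrable.1 (by simpa using hf 1)

theorem integrable_pow_mul_gaussian (n : ℕ) : Integrable fun x : ℝ => x ^ n * Real.exp (-x ^ 2 / 2) := by
  have h := integrable_rpow_mul_exp_neg_mul_sq (b := 1 / 2) (by norm_num) (s := n)
    (by have : (0 : ℝ) ≤ n := n.cast_nonneg
        linarith)
  refine h.congr (Filter.Eventually.of_forall fun x => ?_)
  simp only [Real.rpow_natCast]
  congr 2
  ring

/-- Integration by parts for the standard Gaussian measure. -/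
theorem integral_pow_succ_gaussianReal (n : ℕ) :
    ∫ x, x ^ (n + 1) ∂gaussianReal 0 1 = n * ∫ x, x ^ (n - 1) ∂gaussianReal 0 1 := by
  rw [integral_gaussianReal_eq_integral_smul one_ne_zero, integral_gaussianReal_eq_integral_smul one_ne_zero]
  have h (m : ℕ) : ∫ x : ℝ, gaussianPDFReal 0 1 x • x ^ m =
      (√(2 * Real.pi))⁻¹ * ∫ x : ℝ, x ^ m * Real.exp (-x ^ 2 / 2) := by
    rw [← integral_const_mul]
    refine integral_congr_ae (Filter.Eventually.of_forall fun x => ?_)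
    simp [gaussianPDFReal]
    ring
  rw [h, h, mul_left_comm]
  congr 1
  have hv (x : ℝ) : HasDerivAt (fun x : ℝ => -Real.exp (-x ^ 2 / 2)) (x * Real.exp (-x ^ 2 / 2)) x := by
    have h1 : HasDerivAt (fun x : ℝ => -x ^ 2 / 2) (-x) x := by
      refine ((hasDerivAt_pow 2 x).neg.div_const 2).congr_deriv ?_
      norm_num
      ring
    convert! h1.exp.neg using 1
    ring
  have hi := integral_mul_deriv_eq_deriv_mul_of_integrable (u := fun x : ℝ => x ^ n)
    (u' := fun x => n * x ^ (n - 1)) (v := fun x : ℝ => -Real.exp (-x ^ 2 / 2))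
    (v' := fun x => x * Real.exp (-x ^ 2 / 2)) (fun x _ => hasDerivAt_pow n x) (fun x _ => hv x)
    ((integrable_pow_mul_gaussian (n + 1)).congr (Filter.Eventually.of_forall fun x => by
      simp only [Pi.mul_apply]; ring))
    (((integrable_pow_mul_gaussian (n - 1)).const_mul (-(n : ℝ))).congr
      (Filter.Eventually.of_forall fun x => by simp only [Pi.mul_apply]; ring))
    ((integrable_pow_mul_gaussian n).neg.congr (Filter.Eventually.of_forall fun x => by
      simp only [Pi.mul_apply, Pi.neg_apply]; ring))
  rw [← integral_const_mul, ← integral_neg] at *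
  refine Eq.trans (integral_congr_ae (Filter.Eventually.of_forall fun x => ?_))
    (hi.trans (integral_congr_ae (Filter.Eventually.of_forall fun x => ?_)))
  · simp only []; ring
  · simp only []; ring

/-- The moments of the standard Gaussian measure. -/
def gaussMoment (n : ℕ) : ℂ := ((∫ x, x ^ n ∂gaussianReal 0 1 : ℝ) : ℂ)

theorem gaussMoment_succ (n : ℕ) : gaussMoment (n + 1) = n * gaussMoment (n - 1) := by
  rw [gaussMoment, integral_pow_succ_gaussianReal, gaussMoment]
  push_cast
  rfl

/-- Independent standard Gaussian variables. -/
structure IsStdGaussianVec {A : Type*} (ξ : A → Ω → ℝ) (P : Measure Ω) : Prop where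
  measurable : ∀ a, Measurable (ξ a)
  law : ∀ a, P.map (ξ a) = gaussianReal 0 1
  indep : iIndepFun ξ P

variable {A : Type*} {ξ : A → Ω → ℝ}

theorem IsStdGaussianVec.allMoments (hξ : IsStdGaussianVec ξ P) (a : A) :
    AllMoments P fun ω => (ξ a ω : ℂ) := by
  intro n
  have h : MemLp (id : ℝ → ℝ) n (P.map (ξ a)) := by
    rw [hξ.law a]
    exact memLp_id_gaussianReal' _ (ENNReal.natCast_ne_top n)
  exact ((memLp_map_measure_iff aestronglyMeasurable_id (hξ.measurable a).aemeasurable).1 h).ofReal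

theorem allMoments_eval (f : MvPolynomial A ℂ) {v : A → Ω → ℂ} (hv : ∀ a, AllMoments P (v a)) :
    AllMoments P fun ω => MvPolynomial.eval (fun a => v a ω) f := by
  induction f using MvPolynomial.induction_on with
  | C c => simpa using allMoments_const c
  | add p q hp hq => simpa using hp.add hq
  | mul_X p a hp => simpa using hp.mul (hv a)

/-- The expectation of a polynomial. -/
def polyExp (P : Measure Ω) (ξ : A → Ω → ℝ) (f : MvPolynomial A ℂ) : ℂ :=
  ∫ ω, MvPolynomial.eval (fun a => (ξ a ω : ℂ)) f ∂P

theorem polyExp_add (hξ : IsStdGaussianVec ξ P) (f g : MvPolynomial A ℂ) :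
    polyExp P ξ (f + g) = polyExp P ξ f + polyExp P ξ g := by
  simp only [polyExp, map_add]
  exact integral_add (allMoments_eval f hξ.allMoments).integrable (allMoments_eval g hξ.allMoments).integrable

theorem polyExp_C_mul (c : ℂ) (f : MvPolynomial A ℂ) :
    polyExp P ξ (MvPolynomial.C c * f) = c * polyExp P ξ f := by
  simp only [polyExp, map_mul, MvPolynomial.eval_C]
  exact integral_const_mul _ _

theorem polyExp_sum (hξ : IsStdGaussianVec ξ P) {ι : Type*} (S : Finset ι) (f : ι → MvPolynomial A ℂ) :
    polyExp P ξ (∑ i ∈ S, f i) = ∑ i ∈ S, polyExp P ξ (f i) := by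
  classical
  induction S using Finset.induction_on with
  | empty => simp [polyExp]
  | insert i S hi ih => rw [Finset.sum_insert hi, Finset.sum_insert hi, polyExp_add hξ, ih]

theorem polyExp_monomial [Fintype A] (hξ : IsStdGaussianVec ξ P) (m : A →₀ ℕ) (c : ℂ) :
    polyExp P ξ (MvPolynomial.monomial m c) = c * ∏ a, gaussMoment (m a) := by
  have h := hξ.indep.integral_fun_prod_comp (𝕜 := ℂ) (f := fun a (x : ℝ) => (x : ℂ) ^ m a)
    (fun a => (hξ.measurable a).aemeasurable) (fun a => by fun_prop)
  simp only [polyExp, MvPolynomial.eval_monomial]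
  rw [integral_const_mul]
  congr 1
  refine Eq.trans ?_ (h.trans (Finset.prod_congr rfl fun a _ => ?_))
  · refine integral_congr_ae (Filter.Eventually.of_forall fun ω => ?_)
    exact Finsupp.prod_fintype _ _ fun _ => pow_zero _
  · rw [gaussMoment, ← hξ.law a, integral_map (hξ.measurable a).aemeasurable (by fun_prop),
      ← integral_complex_ofReal]
    simp

/-- Gaussian integration by parts. -/
theorem polyExp_X_mul [Fintype A] (hξ : IsStdGaussianVec ξ P) (a : A) (f : MvPolynomial A ℂ) :
    polyExp P ξ (MvPolynomial.X a * f) = polyExp P ξ (MvPolynomial.pderiv a f) := by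
  classical
  induction f using MvPolynomial.induction_on' with
  | add p q hp hq => rw [mul_add, polyExp_add hξ, map_add, polyExp_add hξ, hp, hq]
  | monomial m c =>
    rw [MvPolynomial.X, MvPolynomial.monomial_mul, one_mul, MvPolynomial.pderiv_monomial,
      polyExp_monomial hξ, polyExp_monomial hξ, ← Finset.mul_prod_erase _ _ (Finset.mem_univ a),
      ← Finset.mul_prod_erase Finset.univ (fun b => gaussMoment ((m - Finsupp.single a 1 : A →₀ ℕ) b))
        (Finset.mem_univ a)]
    have h1 : ((Finsupp.single a 1 + m : A →₀ ℕ) a) = m a + 1 := by simp [add_comm]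
    have h2 : (m - Finsupp.single a 1 : A →₀ ℕ) a = m a - 1 := by simp
    rw [h1, h2, gaussMoment_succ, mul_assoc, mul_assoc]
    congr 3
    refine Finset.prod_congr rfl fun b hb => ?_
    have hb' := Finset.ne_of_mem_erase hb
    simp [Finsupp.single_eq_of_ne hb']

/-- A linear form in the variables. -/
def linForm [Fintype A] (γ : A → ℂ) : MvPolynomial A ℂ := ∑ a, MvPolynomial.C (γ a) * MvPolynomial.X a

theorem pderiv_linForm [Fintype A] [DecidableEq A] (γ : A → ℂ) (a : A) :
    MvPolynomial.pderiv a (linForm γ) = MvPolynomial.C (γ a) := by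
  rw [linForm, map_sum, Finset.sum_eq_single a]
  · simp
  · intro b _ hb
    simp [MvPolynomial.pderiv_X_of_ne hb]
  · simp

theorem derivation_prod {R M ι : Type*} [CommRing R] [CommRing M] [Algebra R M] [DecidableEq ι]
    (D : Derivation R M M) (S : Finset ι) (f : ι → M) :
    D (∏ k ∈ S, f k) = ∑ j ∈ S, D (f j) * ∏ k ∈ S.erase j, f k := by
  induction S using Finset.induction_on with
  | empty => simp
  | insert i S hi ih =>
    rw [Finset.prod_insert hi, D.leibniz, Finset.sum_insert hi, Finset.erase_insert hi, ih, smul_eq_mul,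
      smul_eq_mul, add_comm, Finset.mul_sum]
    congr 1
    · ring
    · refine Finset.sum_congr rfl fun j hj => ?_
      have hij : i ≠ j := fun h => hi (h ▸ hj)
      rw [Finset.erase_insert_of_ne hij, Finset.prod_insert (fun h => hi (Finset.mem_of_mem_erase h))]
      ring

/-- The Wick recursion for linear forms in independent standard Gaussian variables. -/
theorem polyExp_wick [Fintype A] (hξ : IsStdGaussianVec ξ P) {ι : Type*} [DecidableEq ι] (S : Finset ι)
    (γ : ι → A → ℂ) : (S.card : ℂ) * polyExp P ξ (∏ k ∈ S, linForm (γ k)) =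
      ∑ i ∈ S, ∑ j ∈ S.erase i, (∑ a, γ i a * γ j a) *
        polyExp P ξ (∏ k ∈ (S.erase i).erase j, linForm (γ k)) := by
  classical
  have h1 (i) (hi : i ∈ S) : polyExp P ξ (∏ k ∈ S, linForm (γ k)) =
      ∑ j ∈ S.erase i, (∑ a, γ i a * γ j a) *
        polyExp P ξ (∏ k ∈ (S.erase i).erase j, linForm (γ k)) := by
    rw [← Finset.mul_prod_erase _ _ hi, linForm, Finset.sum_mul, polyExp_sum hξ]
    simp only [mul_assoc, polyExp_C_mul, polyExp_X_mul hξ, derivation_prod, pderiv_linForm,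
      polyExp_sum hξ, Finset.mul_sum, Finset.sum_mul]
    exact Finset.sum_comm
  rw [← nsmul_eq_mul, ← Finset.sum_const]
  exact Finset.sum_congr rfl h1

end Moments

section HermitianMatrices
variable {N : ℕ}

/-- The Hermitian matrix with given real coordinates. -/
def hermMat (c : Fin N → Fin N → ℝ) : Matrix (Fin N) (Fin N) ℂ :=
  Matrix.of fun i j =>
    if i < j then ((c i j : ℂ) + Complex.I * (c j i : ℂ)) / (√(2 * N) : ℝ)
    else if i = j then (c i j : ℂ) / (√N : ℝ)
    else ((c j i : ℂ) - Complex.I * (c i j : ℂ)) / (√(2 * N) : ℝ)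

theorem gaussMat_eq_hermMat {H Ω : Type*} [MeasurableSpace Ω] (b : Fin N → Fin N → H → Ω → ℝ) (h : H)
    (ω : Ω) : gaussMat b h ω = hermMat fun i j => b i j h ω := rfl

theorem star_hermMat (c : Fin N → Fin N → ℝ) : star (hermMat c) = hermMat c := by
  ext i j
  rw [Matrix.star_apply, hermMat, Matrix.of_apply, Matrix.of_apply]
  rcases lt_trichotomy i j with h | rfl | h
  · simp [h, h.not_gt, h.ne, h.ne', sub_eq_add_neg]
  · simp
  · simp [h, h.not_gt, h.ne, h.ne', sub_eq_add_neg]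

/-- The two coefficients of the `(i, j)` entry of `hermMat`. -/
def hermCoef (N : ℕ) (i j : Fin N) : ℂ × ℂ :=
  if i < j then (((√(2 * N) : ℝ) : ℂ)⁻¹, Complex.I * ((√(2 * N) : ℝ) : ℂ)⁻¹)
  else if i = j then (((√N : ℝ) : ℂ)⁻¹, 0)
  else (-Complex.I * ((√(2 * N) : ℝ) : ℂ)⁻¹, ((√(2 * N) : ℝ) : ℂ)⁻¹)

/-- The coefficients of the `(i, j)` entry of `hermMat` in terms of the coordinates. -/
def gaussCoef (i j : Fin N) (p : Fin N × Fin N) : ℂ :=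
  (if p = (i, j) then (hermCoef N i j).1 else 0) + if p = (j, i) then (hermCoef N i j).2 else 0

theorem hermMat_apply (c : Fin N → Fin N → ℝ) (i j : Fin N) :
    hermMat c i j = ∑ p : Fin N × Fin N, gaussCoef i j p * (c p.1 p.2 : ℂ) := by
  simp only [gaussCoef, add_mul, ite_mul, zero_mul, Finset.sum_add_distrib, Finset.sum_ite_eq',
    Finset.mem_univ, if_true]
  rw [hermMat, Matrix.of_apply, hermCoef]
  split_ifs <;> simp only [div_eq_mul_inv] <;> ring

theorem sum_gaussCoef_mul [NeZero N] (i j k l : Fin N) :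
    ∑ p, gaussCoef i j p * gaussCoef k l p = if i = l ∧ j = k then (1 / N : ℂ) else 0 := by
  have h1 : ∑ p, gaussCoef i j p * gaussCoef k l p =
      (if i = k ∧ j = l then (hermCoef N i j).1 * (hermCoef N k l).1 +
        (hermCoef N i j).2 * (hermCoef N k l).2 else 0) +
      (if i = l ∧ j = k then (hermCoef N i j).1 * (hermCoef N k l).2 +
        (hermCoef N i j).2 * (hermCoef N k l).1 else 0) := by
    conv_lhs => enter [2, p]; rw [gaussCoef]
    simp only [add_mul, ite_mul, zero_mul, Finset.sum_add_distrib, Finset.sum_ite_eq', Finset.mem_univ,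
      if_true, gaussCoef, Prod.mk.injEq]
    by_cases h : i = k ∧ j = l <;> by_cases h' : i = l ∧ j = k
    · simp only [h, h', and_self, and_comm, if_true]
      obtain ⟨rfl, rfl⟩ := h
      obtain ⟨rfl, -⟩ := h'
      simp
      ring
    · simp only [if_pos h, if_neg h', if_pos h.symm, if_neg (fun h2 : j = k ∧ i = l => h' h2.symm)]
      ring
    · simp only [if_neg h, if_pos h', if_pos h'.symm, if_neg (fun h2 : j = l ∧ i = k => h h2.symm)]
      ring
    · simp only [if_neg h, if_neg h', if_neg (fun h2 : j = l ∧ i = k => h h2.symm),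
        if_neg (fun h2 : j = k ∧ i = l => h' h2.symm)]
      ring
  have hN : (0 : ℝ) < N := Nat.cast_pos.2 (NeZero.pos N)
  have hs : (((√(2 * N) : ℝ) : ℂ)⁻¹) * (((√(2 * N) : ℝ) : ℂ)⁻¹) = 1 / (2 * N) := by
    rw [← mul_inv, ← Complex.ofReal_mul, Real.mul_self_sqrt (by positivity)]
    push_cast
    rw [one_div]
  have hs' : (((√N : ℝ) : ℂ)⁻¹) * (((√N : ℝ) : ℂ)⁻¹) = 1 / N := by
    rw [← mul_inv, ← Complex.ofReal_mul, Real.mul_self_sqrt (by positivity)]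
    push_cast
    rw [one_div]
  have hN' : (N : ℂ) ≠ 0 := Nat.cast_ne_zero.2 (NeZero.ne N)
  have hI := Complex.I_mul_I
  rw [h1]
  rcases lt_trichotomy i j with h | rfl | h
  · have e1 : hermCoef N i j = (((√(2 * N) : ℝ) : ℂ)⁻¹, Complex.I * ((√(2 * N) : ℝ) : ℂ)⁻¹) := if_pos h
    have e2 : hermCoef N j i = (-Complex.I * ((√(2 * N) : ℝ) : ℂ)⁻¹, ((√(2 * N) : ℝ) : ℂ)⁻¹) := by
      rw [hermCoef, if_neg h.not_gt, if_neg h.ne']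
    have z1 : (if i = k ∧ j = l then (hermCoef N i j).1 * (hermCoef N k l).1 +
        (hermCoef N i j).2 * (hermCoef N k l).2 else 0) = 0 := by
      split_ifs with h2
      · obtain ⟨rfl, rfl⟩ := h2
        rw [e1]
        linear_combination ((((√(2 * N) : ℝ) : ℂ)⁻¹) * (((√(2 * N) : ℝ) : ℂ)⁻¹)) * hI
      · rfl
    rw [z1, zero_add]
    refine if_ctx_congr Iff.rfl (fun h2 => ?_) fun _ => rfl
    obtain ⟨rfl, rfl⟩ := h2
    rw [e1, e2]
    have : (1 : ℂ) / N = 2 * (1 / (2 * N)) := by field_simp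
    rw [this, ← hs]
    linear_combination (-(((√(2 * N) : ℝ) : ℂ)⁻¹) * (((√(2 * N) : ℝ) : ℂ)⁻¹)) * hI
  · have e1 : hermCoef N i i = (((√N : ℝ) : ℂ)⁻¹, 0) := by
      rw [hermCoef, if_neg (lt_irrefl i), if_pos rfl]
    by_cases hk : i = k ∧ i = l
    · obtain ⟨rfl, rfl⟩ := hk
      simp only [and_self, if_true, e1]
      rw [hs']
      ring
    · rw [if_neg hk, if_neg (fun h2 => hk h2.symm), if_neg (fun h2 => hk h2.symm), add_zero]
  · have e1 : hermCoef N j i = (((√(2 * N) : ℝ) : ℂ)⁻¹, Complex.I * ((√(2 * N) : ℝ) : ℂ)⁻¹) := if_pos h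
    have e2 : hermCoef N i j = (-Complex.I * ((√(2 * N) : ℝ) : ℂ)⁻¹, ((√(2 * N) : ℝ) : ℂ)⁻¹) := by
      rw [hermCoef, if_neg h.not_gt, if_neg h.ne']
    have z1 : (if i = k ∧ j = l then (hermCoef N i j).1 * (hermCoef N k l).1 +
        (hermCoef N i j).2 * (hermCoef N k l).2 else 0) = 0 := by
      split_ifs with h2
      · obtain ⟨rfl, rfl⟩ := h2
        rw [e2]
        linear_combination ((((√(2 * N) : ℝ) : ℂ)⁻¹) * (((√(2 * N) : ℝ) : ℂ)⁻¹)) * hI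
      · rfl
    rw [z1, zero_add]
    refine if_ctx_congr Iff.rfl (fun h2 => ?_) fun _ => rfl
    obtain ⟨rfl, rfl⟩ := h2
    rw [e1, e2]
    have : (1 : ℂ) / N = 2 * (1 / (2 * N)) := by field_simp
    rw [this, ← hs]
    linear_combination (-(((√(2 * N) : ℝ) : ℂ)⁻¹) * (((√(2 * N) : ℝ) : ℂ)⁻¹)) * hI

end HermitianMatrices

section Linearization
variable {H : Type*} [NormedAddCommGroup H] [InnerProductSpace ℝ H] {N : ℕ} {Ω : Type*} [MeasurableSpace Ω]
  {P : Measure Ω} {b : Fin N → Fin N → H → Ω → ℝ}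

/-- A version of the process which depends linearly on `h` at every point. -/
def linProc (b : Fin N → Fin N → H → Ω → ℝ) (i j : Fin N) (ω : Ω) : H →ₗ[ℝ] ℝ :=
  (Module.Basis.ofVectorSpace ℝ H).constr ℝ fun e => b i j (Module.Basis.ofVectorSpace ℝ H e) ω

theorem measurable_linProc (hb : IsStdGaussianFamily b P) (i j : Fin N) (h : H) :
    Measurable fun ω => linProc b i j ω h := by
  simp only [linProc, Module.Basis.constr_apply, Finsupp.sum]
  exact Finset.measurable_sum _ fun e _ => (hb.measurable i j _).const_mul _

variable [IsProbabilityMeasure P]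

theorem linProc_ae_eq (hb : IsStdGaussianFamily b P) (i j : Fin N) (h : H) :
    (fun ω => linProc b i j ω h) =ᵐ[P] b i j h := by
  have hL (h : H) : MemLp (b i j h) 2 P := ((hb.gaussian i j).hasGaussianLaw_eval h).memLp_two
  let U : H → Lp ℝ 2 P := fun h => (hL h).toLp
  have hU (h g : H) : inner ℝ (U h) (U g) = inner ℝ h g := by
    rw [L2.inner_def, ← hb.covariance i j h g]
    refine integral_congr_ae ?_
    filter_upwards [(hL h).coeFn_toLp, (hL g).coeFn_toLp] with ω h1 h2
    rw [h1, h2, real_inner_comm]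
    rfl
  have hadd (h g : H) : U (h + g) = U h + U g := by
    rw [← sub_eq_zero, ← inner_self_eq_zero (𝕜 := ℝ)]
    simp only [inner_sub_left, inner_sub_right, inner_add_left, inner_add_right, hU]
    ring
  have hsmul (c : ℝ) (h : H) : U (c • h) = c • U h := by
    rw [← sub_eq_zero, ← inner_self_eq_zero (𝕜 := ℝ)]
    simp only [inner_sub_left, inner_sub_right, real_inner_smul_left, real_inner_smul_right, hU]
    ring
  have hae (h : H) : U h =ᵐ[P] b i j h := (hL h).coeFn_toLp
  have hmem : h ∈ Submodule.span ℝ (Set.range (Module.Basis.ofVectorSpace ℝ H)) := by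
    rw [Module.Basis.span_eq]; trivial
  induction hmem using Submodule.span_induction with
  | mem x hx =>
    obtain ⟨e, rfl⟩ := hx
    simp only [linProc, Module.Basis.constr_basis]
    rfl
  | zero =>
    have h0 : U 0 = 0 := by simpa using hsmul 0 0
    filter_upwards [hae 0, Lp.coeFn_zero ℝ 2 P] with ω h1 h2
    rw [← h1, h0, h2, map_zero]
    rfl
  | add x y _ _ hx hy =>
    filter_upwards [hx, hy, hae (x + y), hae x, hae y, Lp.coeFn_add (U x) (U y)] with ω h1 h2 h3 h4 h5 h6
    rw [map_add, h1, h2, ← h3, hadd, h6, Pi.add_apply, h4, h5]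
  | smul c x _ hx =>
    filter_upwards [hx, hae (c • x), hae x, Lp.coeFn_smul c (U x)] with ω h1 h2 h3 h4
    rw [map_smul, h1, ← h2, hsmul, h4, Pi.smul_apply, h3]

/-- The processes `b i j` are jointly Gaussian. -/
theorem isGaussianProcess_all (hb : IsStdGaussianFamily b P) :
    IsGaussianProcess (fun (t : (Fin N × Fin N) × H) ω => b t.1.1 t.1.2 t.2 ω) P where
  hasGaussianLaw I := by
    classical
    let J := I.image Prod.snd
    have h1 (p : Fin N × Fin N) : HasGaussianLaw (fun ω => J.restrict (b p.1 p.2 · ω)) P :=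
      (hb.gaussian p.1 p.2).hasGaussianLaw J
    have h2 : iIndepFun (fun (p : Fin N × Fin N) ω => J.restrict (b p.1 p.2 · ω)) P :=
      hb.indep.comp (fun _ f => J.restrict f) fun _ => Finset.measurable_restrict J
    let L : ((Fin N × Fin N) → J → ℝ) →L[ℝ] (I → ℝ) := ContinuousLinearMap.pi fun t =>
      (ContinuousLinearMap.proj (⟨t.1.2, Finset.mem_image_of_mem _ t.2⟩ : J)).comp
        (ContinuousLinearMap.proj (R := ℝ) (φ := fun _ : Fin N × Fin N => J → ℝ) t.1.1)
    exact (iIndepFun.hasGaussianLaw h1 h2).map_fun L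

theorem covariance_all (hb : IsStdGaussianFamily b P) (p p' : Fin N × Fin N) (h g : H) :
    cov[b p.1 p.2 h, b p'.1 p'.2 g; P] = if p = p' then inner ℝ h g else 0 := by
  have hL (p : Fin N × Fin N) (h : H) : MemLp (b p.1 p.2 h) 2 P :=
    ((hb.gaussian p.1 p.2).hasGaussianLaw_eval h).memLp_two
  split_ifs with hp
  · subst hp
    rw [covariance_eq_sub (hL _ _) (hL _ _), hb.centered, zero_mul, sub_zero]
    exact hb.covariance _ _ _ _
  · exact ((hb.indep.indepFun hp).comp (measurable_pi_apply h) (measurable_pi_apply g)).covariance_eq_zero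
      (hL _ _) (hL _ _)

theorem isStdGaussianVec_linProc (hb : IsStdGaussianFamily b P) {d : ℕ} {e : Fin d → H}
    (he : Orthonormal ℝ e) : IsStdGaussianVec
      (fun (t : (Fin N × Fin N) × Fin d) ω => linProc b t.1.1 t.1.2 ω (e t.2)) P where
  measurable t := measurable_linProc hb _ _ _
  law t := by
    rw [Measure.map_congr (linProc_ae_eq hb _ _ _),
      ((hb.gaussian t.1.1 t.1.2).hasGaussianLaw_eval (e t.2)).map_eq_gaussianReal, hb.centered,
      ← covariance_self (hb.measurable _ _ _).aemeasurable, covariance_all hb t.1 t.1, if_pos rfl,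
      real_inner_self_eq_norm_sq, he.1]
    simp
  indep := by
    have hG : IsGaussianProcess (fun (t : (Fin N × Fin N) × Fin d) ω => b t.1.1 t.1.2 (e t.2) ω) P :=
      (isGaussianProcess_all hb).comp_right fun t : (Fin N × Fin N) × Fin d => (t.1, e t.2)
    have h1 : HasGaussianLaw (fun ω (t : (Fin N × Fin N) × Fin d) => b t.1.1 t.1.2 (e t.2) ω) P := by
      let L : (↥(Finset.univ : Finset ((Fin N × Fin N) × Fin d)) → ℝ) →L[ℝ]
          ((Fin N × Fin N) × Fin d → ℝ) := ContinuousLinearMap.pi fun t =>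
            ContinuousLinearMap.proj (⟨t, Finset.mem_univ t⟩ : ↥(Finset.univ : Finset _))
      exact (hG.hasGaussianLaw Finset.univ).map_fun L
    have h2 := h1.iIndepFun_of_covariance_eq_zero fun t t' htt => by
      rw [covariance_all hb t.1 t'.1]
      split_ifs with hp
      · exact he.2 fun h => htt (Prod.ext hp h)
      · rfl
    exact h2.congr fun t => (linProc_ae_eq hb _ _ _).symm

/-- A version of `X` which is linear at every point. -/
def linMat (b : Fin N → Fin N → H → Ω → ℝ) (ω : Ω) : H →ₗ[ℝ] Matrix (Fin N) (Fin N) ℂ where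
  toFun h := hermMat fun i j => linProc b i j ω h
  map_add' h g := by
    ext i j
    rw [Matrix.add_apply, hermMat_apply, hermMat_apply, hermMat_apply, ← Finset.sum_add_distrib]
    refine Finset.sum_congr rfl fun p _ => ?_
    rw [map_add]
    push_cast
    ring
  map_smul' c h := by
    ext i j
    rw [RingHom.id_apply, Matrix.smul_apply, hermMat_apply, hermMat_apply, Finset.smul_sum]
    refine Finset.sum_congr rfl fun p _ => ?_
    rw [map_smul, smul_eq_mul, Complex.real_smul]
    push_cast
    ring

theorem linMat_apply (ω : Ω) (h : H) (i j : Fin N) :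
    linMat b ω h i j = ∑ p : Fin N × Fin N, gaussCoef i j p * (linProc b p.1 p.2 ω h : ℂ) :=
  hermMat_apply _ i j

theorem star_linMat (ω : Ω) (h : H) : star (linMat b ω h) = linMat b ω h := star_hermMat _

theorem linMat_ae_eq (hb : IsStdGaussianFamily b P) (h : H) :
    (fun ω => linMat b ω h) =ᵐ[P] fun ω => gaussMat b h ω := by
  have : ∀ᵐ ω ∂P, ∀ i j, linProc b i j ω h = b i j h ω :=
    Filter.eventually_all.2 fun i => Filter.eventually_all.2 fun j => linProc_ae_eq hb i j h
  filter_upwards [this] with ω hω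
  rw [gaussMat_eq_hermMat]
  exact congrArg hermMat (funext fun i => funext fun j => hω i j)

theorem measurable_linMat (hb : IsStdGaussianFamily b P) (h : H) (i j : Fin N) :
    Measurable fun ω => linMat b ω h i j := by
  simp only [linMat_apply]
  exact Finset.measurable_sum _ fun p _ =>
    (Complex.measurable_ofReal.comp (measurable_linProc hb p.1 p.2 h)).const_mul _

theorem allMoments_linMat (hb : IsStdGaussianFamily b P) (h : H) (i j : Fin N) :
    AllMoments P fun ω => linMat b ω h i j := by
  simp only [linMat_apply]
  refine AllMoments.sum _ fun p => (allMoments_const _).mul fun n => ?_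
  have h1 : MemLp (fun ω => linProc b p.1 p.2 ω h) n P :=
    (((hb.gaussian p.1 p.2).hasGaussianLaw_eval h).memLp (ENNReal.natCast_ne_top n)).ae_eq
      (linProc_ae_eq hb _ _ _).symm
  exact h1.ofReal

theorem isMatrixWick_linMat [NeZero N] (hb : IsStdGaussianFamily b P) :
    IsMatrixWick (innerₗ H) (linMat b) P where
  integrable S h r s := (AllMoments.prod S fun k => allMoments_linMat hb (h k) (r k) (s k)).integrable
  wick {ι} _ S h r s := by
    classical
    let V : Submodule ℝ H := Submodule.span ℝ ((S.image h : Finset H) : Set H)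
    let u := stdOrthonormalBasis ℝ V
    let e : Fin _ → H := fun a => (u a : H)
    have he : Orthonormal ℝ e := u.orthonormal.comp_linearIsometry V.subtypeₗᵢ
    have hexp (k) (hk : k ∈ S) : h k = ∑ a, inner ℝ (e a) (h k) • e a := by
      have hv : h k ∈ V := Submodule.subset_span (Finset.mem_coe.2 (Finset.mem_image_of_mem h hk))
      have h1 := congrArg V.subtype (u.sum_repr' ⟨h k, hv⟩)
      rw [map_sum] at h1
      exact h1.symm
    let ξ : (Fin N × Fin N) × Fin _ → Ω → ℝ := fun t ω => linProc b t.1.1 t.1.2 ω (e t.2)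
    have hξ : IsStdGaussianVec ξ P := isStdGaussianVec_linProc hb he
    let γ : ι → (Fin N × Fin N) × Fin _ → ℂ := fun k t =>
      gaussCoef (r k) (s k) t.1 * ((inner ℝ (e t.2) (h k) : ℝ) : ℂ)
    have hZ (ω : Ω) (k) (hk : k ∈ S) : linMat b ω (h k) (r k) (s k) =
        MvPolynomial.eval (fun t => (ξ t ω : ℂ)) (linForm (γ k)) := by
      rw [linMat_apply, linForm, map_sum]
      refine Eq.trans ?_ (Fintype.sum_prod_type _).symm
      refine Finset.sum_congr rfl fun p _ => ?_
      conv_lhs => rw [hexp k hk]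
      rw [map_sum (linProc b p.1 p.2 ω)]
      simp only [map_smul, smul_eq_mul, map_mul, MvPolynomial.eval_C, MvPolynomial.eval_X, γ, ξ]
      push_cast
      rw [Finset.mul_sum]
      exact Finset.sum_congr rfl fun a _ => (mul_assoc _ _ _).symm
    have hprod (T : Finset ι) (hT : T ⊆ S) : ∫ ω, ∏ k ∈ T, linMat b ω (h k) (r k) (s k) ∂P =
        polyExp P ξ (∏ k ∈ T, linForm (γ k)) := by
      refine integral_congr_ae (Filter.Eventually.of_forall fun ω => ?_)
      simp only [map_prod]
      exact Finset.prod_congr rfl fun k hk => hZ ω k (hT hk)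
    rw [hprod S subset_rfl, polyExp_wick hξ]
    refine Finset.sum_congr rfl fun i hi => Finset.sum_congr rfl fun j hj => ?_
    rw [hprod _ ((Finset.erase_subset _ _).trans (Finset.erase_subset _ _))]
    congr 1
    have hin : (inner ℝ (h i) (h j) : ℝ) = ∑ a, inner ℝ (e a) (h i) * inner ℝ (e a) (h j) := by
      conv_lhs => rw [hexp i hi]
      rw [sum_inner]
      simp only [real_inner_smul_left]
    rw [Fintype.sum_prod_type]
    have h2 : ∑ p, ∑ a, γ i (p, a) * γ j (p, a) =
        (∑ p, gaussCoef (r i) (s i) p * gaussCoef (r j) (s j) p) * ((inner ℝ (h i) (h j) : ℝ) : ℂ) := by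
      rw [hin, Finset.sum_mul]
      refine Finset.sum_congr rfl fun p _ => ?_
      push_cast
      rw [Finset.mul_sum]
      refine Finset.sum_congr rfl fun a _ => ?_
      simp only [γ]
      ring
    rw [h2, sum_gaussCoef_mul, ite_mul, zero_mul]
    rfl

end Linearization

section CondExp
variable {H : Type*} [NormedAddCommGroup H] [InnerProductSpace ℝ H] {N : ℕ}
  {Ω : Type*} {mΩ : MeasurableSpace Ω} {P : Measure Ω} [IsProbabilityMeasure P]
  {b : Fin N → Fin N → H → Ω → ℝ}

theorem measurable_gaussMat_of {m : MeasurableSpace Ω} {h : H} (hm : ∀ i j, Measurable[m] (b i j h))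
    (i j : Fin N) : Measurable[m] fun ω => gaussMat b h ω i j := by
  simp only [gaussMat_eq_hermMat, hermMat_apply]
  exact Finset.measurable_sum _ fun p _ =>
    (Complex.measurable_ofReal.comp (hm p.1 p.2)).const_mul _

theorem measurable_gaussMat_sigmaX {K : Set H} {h : H} (hh : h ∈ K) (i j : Fin N) :
    Measurable[sigmaX b K] fun ω => gaussMat b h ω i j :=
  Measurable.mono (comap_measurable _)
    (le_iSup₂_of_le h hh (le_iSup_of_le i (le_iSup_of_le j le_rfl))) le_rfl

theorem sigmaX_le_of {K : Set H} {m : MeasurableSpace Ω}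
    (hm : ∀ h ∈ K, ∀ i j, Measurable[m] (b i j h)) : sigmaX b K ≤ m :=
  iSup₂_le fun h hh => iSup_le fun i => iSup_le fun j =>
    (measurable_gaussMat_of (hm h hh) i j).comap_le

theorem sigmaX_le (hb : IsStdGaussianFamily b P) (K : Set H) : sigmaX b K ≤ mΩ :=
  sigmaX_le_of fun h _ i j => hb.measurable i j h

theorem indep_sigmaX (hb : IsStdGaussianFamily b P) (K : Submodule ℝ H) :
    Indep (sigmaX b (Kᗮ : Submodule ℝ H)) (sigmaX b K) P := by
  let X (V : Submodule ℝ H) (t : (Fin N × Fin N) × V) (ω : Ω) : ℝ := b t.1.1 t.1.2 t.2 ω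
  have hmX (V : Submodule ℝ H) (t) : Measurable (X V t) := hb.measurable _ _ _
  have hle (V : Submodule ℝ H) : sigmaX b V ≤ MeasurableSpace.comap (fun ω t => X V t ω) inferInstance :=
    sigmaX_le_of fun h hh i j =>
      (measurable_pi_apply (((i, j), ⟨h, hh⟩) : (Fin N × Fin N) × V)).comp
        (comap_measurable (fun ω t => X V t ω))
  have hG : IsGaussianProcess (Sum.elim (X Kᗮ) (X K)) P := by
    have := (isGaussianProcess_all hb).comp_right
      (Sum.elim (fun t => (t.1, (t.2 : H))) (fun t => (t.1, (t.2 : H))) :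
        ((Fin N × Fin N) × (Kᗮ : Submodule ℝ H)) ⊕ ((Fin N × Fin N) × K) → (Fin N × Fin N) × H)
    have heq : Sum.elim (X Kᗮ) (X K) = (fun (t : (Fin N × Fin N) × H) ω => b t.1.1 t.1.2 t.2 ω) ∘
        Sum.elim (fun t => (t.1, (t.2 : H))) (fun t => (t.1, (t.2 : H))) := by
      funext t
      rcases t with t | t <;> rfl
    rw [heq]
    exact this
  have hI := hG.indepFun_of_covariance_eq_zero (fun t => (hmX _ t).aemeasurable)
    (fun t => (hmX _ t).aemeasurable) fun s t => by
      refine (covariance_all hb s.1 t.1 s.2 t.2).trans ?_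
      split_ifs
      · exact K.inner_left_of_mem_orthogonal t.2.2 s.2.2
      · rfl
  rw [IndepFun_iff_Indep] at hI
  exact indep_of_indep_of_le_left (indep_of_indep_of_le_right hI (hle K)) (hle Kᗮ)

variable (K : Submodule ℝ H) [K.HasOrthogonalProjection]

/-- The orthogonal projection onto `K`, as a linear map. -/
def projOn : H →ₗ[ℝ] H := (K.starProjection).toLinearMap

/-- The orthogonal projection onto the complement of `K`, as a linear map. -/
def projOff : H →ₗ[ℝ] H := LinearMap.id - projOn K

theorem projOn_mem (h : H) : projOn K h ∈ K := K.starProjection_apply_mem h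

theorem projOff_mem (h : H) : projOff K h ∈ Kᗮ := K.sub_starProjection_mem_orthogonal h

theorem projOn_add_projOff (h : H) : projOn K h + projOff K h = h := by
  simp [projOff]

/-- The covariance of the component of the process orthogonal to `K`. -/
def offForm : H →ₗ[ℝ] H →ₗ[ℝ] ℝ := (innerₗ H).compl₁₂ (projOff K) (projOff K)

theorem inner_eq_projOn_add_projOff (h g : H) :
    inner ℝ h g = inner ℝ (projOn K h) (projOn K g) + offForm K h g := by
  conv_lhs => rw [← projOn_add_projOff K h, ← projOn_add_projOff K g]
  rw [inner_add_left, inner_add_right, inner_add_right,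
    K.inner_right_of_mem_orthogonal (projOn_mem K h) (projOff_mem K g),
    K.inner_left_of_mem_orthogonal (projOn_mem K g) (projOff_mem K h)]
  simp [offForm]

theorem IsMatrixWick.comp {B : H →ₗ[ℝ] H →ₗ[ℝ] ℝ} {Z : Ω → H →ₗ[ℝ] Matrix (Fin N) (Fin N) ℂ}
    (hZ : IsMatrixWick B Z P) (A : H →ₗ[ℝ] H) :
    IsMatrixWick (B.compl₁₂ A A) (fun ω => Z ω ∘ₗ A) P where
  integrable S h r s := hZ.integrable S (fun k => A (h k)) r s
  wick S h r s := hZ.wick S (fun k => A (h k)) r s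

theorem condExp_prod_linMat (hb : IsStdGaussianFamily b P) {n : ℕ} (h : Fin n → H)
    (r s : Fin n → Fin N) :
    P[fun ω => ∏ k, linMat b ω (h k) (r k) (s k) | sigmaX b K] =ᵐ[P]
      fun ω => ∫ ω', ∏ k, (linMat b ω (projOn K (h k)) (r k) (s k) +
        linMat b ω' (projOff K (h k)) (r k) (s k)) ∂P := by
  classical
  let A (S : Finset (Fin n)) (ω : Ω) : ℂ := ∏ k ∈ S, linMat b ω (projOn K (h k)) (r k) (s k)
  let Z (S : Finset (Fin n)) (ω : Ω) : ℂ := ∏ k ∈ S, linMat b ω (projOff K (h k)) (r k) (s k)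
  have hA (S) : AllMoments P (A S) := AllMoments.prod S fun k => allMoments_linMat hb _ _ _
  have hZ (S) : AllMoments P (Z S) := AllMoments.prod S fun k => allMoments_linMat hb _ _ _
  have hZ' (S) : Z S =ᵐ[P] fun ω => ∏ k ∈ S, gaussMat b (projOff K (h k)) ω (r k) (s k) := by
    filter_upwards [Filter.eventually_all.2 fun k => linMat_ae_eq hb (projOff K (h k))] with ω hω
    exact Finset.prod_congr rfl fun k _ => by rw [hω k]
  have hA' (S) : A S =ᵐ[P] fun ω => ∏ k ∈ S, gaussMat b (projOn K (h k)) ω (r k) (s k) := by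
    filter_upwards [Filter.eventually_all.2 fun k => linMat_ae_eq hb (projOn K (h k))] with ω hω
    exact Finset.prod_congr rfl fun k _ => by rw [hω k]
  have hAm (S) : AEStronglyMeasurable[sigmaX b K] (A S) P :=
    ⟨_, (Finset.measurable_prod S fun k _ =>
      measurable_gaussMat_sigmaX (projOn_mem K (h k)) _ _).stronglyMeasurable, hA' S⟩
  have hZc (S) : P[Z S | sigmaX b K] =ᵐ[P] fun _ => ∫ ω, Z S ω ∂P := by
    refine (condExp_congr_ae (hZ' S)).trans ?_
    rw [integral_congr_ae (hZ' S)]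
    exact condExp_indep_eq (sigmaX_le hb _) (sigmaX_le hb _)
      (Finset.measurable_prod S fun k _ =>
        measurable_gaussMat_sigmaX (projOff_mem K (h k)) _ _).stronglyMeasurable (indep_sigmaX hb K)
  have hterm (S T) : P[fun ω => A S ω * Z T ω | sigmaX b K] =ᵐ[P]
      fun ω => A S ω * ∫ ω', Z T ω' ∂P := by
    refine (condExp_bilin_of_aestronglyMeasurable_left (ContinuousLinearMap.mul ℝ ℂ) (hAm S)
      ((hA S).mul (hZ T)).integrable (hZ T).integrable).trans ?_
    filter_upwards [hZc T] with ω hω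
    rw [hω]; rfl
  have hL : (fun ω => ∏ k, linMat b ω (h k) (r k) (s k)) =
      ∑ S ∈ (Finset.univ : Finset (Fin n)).powerset, fun ω => A S ω * Z (Finset.univ \ S) ω := by
    ext ω
    rw [Finset.sum_apply, ← Finset.prod_add]
    refine Finset.prod_congr rfl fun k _ => ?_
    rw [← Matrix.add_apply, ← map_add, projOn_add_projOff]
  have hR (ω : Ω) : ∫ ω', ∏ k, (linMat b ω (projOn K (h k)) (r k) (s k) +
        linMat b ω' (projOff K (h k)) (r k) (s k)) ∂P =
      ∑ S ∈ (Finset.univ : Finset (Fin n)).powerset, A S ω * ∫ ω', Z (Finset.univ \ S) ω' ∂P := by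
    simp only [Finset.prod_add]
    rw [integral_finsetSum _ fun S _ => (hZ _).integrable.const_mul _]
    exact Finset.sum_congr rfl fun S _ => integral_const_mul _ _
  rw [hL]
  refine (condExp_finsetSum (fun S _ => ((hA S).mul (hZ _)).integrable) _).trans ?_
  have hall : ∀ᵐ ω ∂P, ∀ S : Finset (Fin n), P[fun ω => A S ω * Z (Finset.univ \ S) ω | sigmaX b K] ω =
      A S ω * ∫ ω', Z (Finset.univ \ S) ω' ∂P :=
    Filter.eventually_all.2 fun S => hterm S _
  filter_upwards [hall] with ω hω
  rw [hR, Finset.sum_apply]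
  exact Finset.sum_congr rfl fun S _ => hω S

theorem measurable_evalTP_linMat (hb : IsStdGaussianFamily b P) (x : TP H) (i j : Fin N) :
    Measurable fun ω => evalTP (linMat b ω) x i j := by
  induction x using TP_induction with
  | zero => simp
  | tensor n α h =>
    simp only [evalTP_symFin, trS_apply]
    refine Finset.measurable_sum _ fun u _ => ?_
    split_ifs
    · exact Finset.measurable_prod _ fun k _ => measurable_linMat hb _ _ _
    · exact measurable_const
  | smul z x hx =>
    simp only [map_smul, Matrix.smul_apply]
    exact hx.const_smul z
  | add x y hx hy =>
    simp only [map_add, Matrix.add_apply]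
    exact hx.add hy

theorem allMoments_evalTP_linMat (hb : IsStdGaussianFamily b P) (x : TP H) (i j : Fin N) :
    AllMoments P fun ω => evalTP (linMat b ω) x i j := by
  induction x using TP_induction with
  | zero => simpa using allMoments_const 0
  | tensor n α h =>
    simp only [evalTP_symFin, trS_apply]
    refine AllMoments.sum _ fun u => ?_
    split_ifs
    · exact AllMoments.prod _ fun k => allMoments_linMat hb _ _ _
    · exact allMoments_const 0
  | smul z x hx =>
    simp only [map_smul, Matrix.smul_apply, smul_eq_mul]
    exact (allMoments_const z).mul hx
  | add x y hx hy =>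
    simp only [map_add, Matrix.add_apply]
    exact hx.add hy

theorem condExp_evalTP_linMat [NeZero N] (hb : IsStdGaussianFamily b P) (x : TP H) (i j : Fin N) :
    P[fun ω => evalTP (linMat b ω) x i j | sigmaX b K] =ᵐ[P]
      fun ω => evalTP (linMat b ω) (gam (projOn K) (expT (1 / N) (offForm K) x)) i j := by
  have hint (x : TP H) : Integrable (fun ω => evalTP (linMat b ω) x i j) P :=
    (allMoments_evalTP_linMat hb x i j).integrable
  induction x using TP_induction with
  | zero =>
    simp only [map_zero, Matrix.zero_apply]
    exact Filter.EventuallyEq.of_eq (condExp_zero)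
  | tensor n α h =>
    have hW : IsMatrixWick (offForm K) (fun ω => linMat b ω ∘ₗ projOff K) P :=
      (isMatrixWick_linMat hb).comp (projOff K)
    have hR (ω : Ω) : evalTP (linMat b ω) (gam (projOn K) (expT (1 / N) (offForm K) (symFin α h))) i j =
        ∑ u : Option (Fin n) → Fin N, if u none = j ∧ u (α none) = i then
          ∫ ω', ∏ k, (linMat b ω (projOn K (h k)) (u (some k)) (u (α (some k))) +
            linMat b ω' (projOff K (h k)) (u (some k)) (u (α (some k)))) ∂P else 0 := by
      rw [evalTP_gam, ← (integral_evalTP_add hW (linMat b ω ∘ₗ projOn K) i j _).2]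
      simp only [evalTP_symFin, trS_apply]
      rw [integral_finsetSum]
      · refine Finset.sum_congr rfl fun u _ => ?_
        split_ifs
        · rfl
        · exact integral_zero _ _
      · intro u _
        split_ifs
        · exact (AllMoments.prod _ fun k => (allMoments_const _).add
            (allMoments_linMat hb _ _ _)).integrable
        · exact integrable_zero _ _ _
    simp only [hR]
    have hL : (fun ω => evalTP (linMat b ω) (symFin α h) i j) =
        ∑ u : Option (Fin n) → Fin N, fun ω => if u none = j ∧ u (α none) = i then
          ∏ k, linMat b ω (h k) (u (some k)) (u (α (some k))) else 0 := by
      ext ω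
      rw [evalTP_symFin, trS_apply, Finset.sum_apply]
    have hi (u : Option (Fin n) → Fin N) : Integrable (fun ω => if u none = j ∧ u (α none) = i then
          ∏ k, linMat b ω (h k) (u (some k)) (u (α (some k))) else 0) P := by
      split_ifs
      · exact (AllMoments.prod _ fun k => allMoments_linMat hb _ _ _).integrable
      · exact integrable_zero _ _ _
    rw [hL]
    refine (condExp_finsetSum (fun u _ => hi u) _).trans ?_
    have hall : ∀ᵐ ω ∂P, ∀ u : Option (Fin n) → Fin N,
        P[fun ω => if u none = j ∧ u (α none) = i then
          ∏ k, linMat b ω (h k) (u (some k)) (u (α (some k))) else 0 | sigmaX b K] ω =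
        if u none = j ∧ u (α none) = i then
          ∫ ω', ∏ k, (linMat b ω (projOn K (h k)) (u (some k)) (u (α (some k))) +
            linMat b ω' (projOff K (h k)) (u (some k)) (u (α (some k)))) ∂P else 0 := by
      refine Filter.eventually_all.2 fun u => ?_
      split_ifs
      · exact condExp_prod_linMat K hb h (fun k => u (some k)) fun k => u (α (some k))
      · exact Filter.EventuallyEq.of_eq condExp_zero
    filter_upwards [hall] with ω hω
    rw [Finset.sum_apply]
    exact Finset.sum_congr rfl fun u _ => hω u
  | smul z x hx =>
    have h1 : (fun ω => evalTP (linMat b ω) (z • x) i j) =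
        z • fun ω => evalTP (linMat b ω) x i j := by ext ω; simp
    rw [h1]
    refine (condExp_smul z _ _).trans ?_
    filter_upwards [hx] with ω hω
    rw [Pi.smul_apply, hω]
    simp
  | add x y hx hy =>
    have h1 : (fun ω => evalTP (linMat b ω) (x + y) i j) =
        (fun ω => evalTP (linMat b ω) x i j) + fun ω => evalTP (linMat b ω) y i j := by ext ω; simp
    rw [h1]
    refine (condExp_add (hint x) (hint y) _).trans ?_
    filter_upwards [hx, hy] with ω hω hω'
    rw [Pi.add_apply, hω, hω']
    simp

theorem condExp_evalTP_expT_neg [NeZero N] (hb : IsStdGaussianFamily b P) (x : TP H) (i j : Fin N) :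
    P[fun ω => evalTP (linMat b ω) (expT (1 / N) (-innerₗ H) x) i j | sigmaX b K] =ᵐ[P]
      fun ω => evalTP (linMat b ω) (expT (1 / N) (-innerₗ H) (gam (projOn K) x)) i j := by
  have hN : (1 / N : ℝ) ≠ 0 := by simp [NeZero.ne N]
  refine (condExp_evalTP_linMat K hb _ i j).trans (Filter.EventuallyEq.of_eq ?_)
  rw [← expT_add hN, gam_expT (1 / N) (projOn K) _ (-innerₗ H)]
  intro h g
  have := inner_eq_projOn_add_projOff K h g
  simp only [LinearMap.neg_apply, LinearMap.add_apply, innerₗ_apply_apply]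
  linarith

theorem evalTP_zero_eq_counit (x : TP H) :
    evalTP (0 : H →ₗ[ℝ] Matrix (Fin N) (Fin N) ℂ) x = counit x • 1 := by
  have : evalTP (0 : H →ₗ[ℝ] Matrix (Fin N) (Fin N) ℂ) =
      (counit (H := H)).smulRight (1 : Matrix (Fin N) (Fin N) ℂ) := TP_ext fun n α h => by
    rw [LinearMap.smulRight_apply, counit_symFin, evalTP_symFin]
    rcases n with _ | n
    · rw [trS_of_isEmpty]; simp
    · ext a c
      rw [trS_apply]
      simp
  exact LinearMap.congr_fun this x

theorem integral_evalTP_linMat [NeZero N] (hb : IsStdGaussianFamily b P) (x : TP H) (i j : Fin N) :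
    ∫ ω, evalTP (linMat b ω) x i j ∂P =
      (counit (expT (1 / N) (innerₗ H) x) • (1 : Matrix (Fin N) (Fin N) ℂ)) i j := by
  have := (integral_evalTP_add (isMatrixWick_linMat hb) 0 i j x).2
  simp only [zero_add] at this
  rw [this, evalTP_zero_eq_counit]

end CondExp

section FullPairing
variable {H : Type*} [NormedAddCommGroup H] [InnerProductSpace ℝ H] {ι κ : Type*}

/-- The involution of `ι ∪ κ` which interchanges `i` and `e i`. -/
def crossOf (e : ι ≃ κ) : Equiv.Perm (ι ⊕ κ) := (e.sumCongr e.symm).trans (Equiv.sumComm κ ι)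

@[simp] theorem crossOf_inl (e : ι ≃ κ) (i : ι) : crossOf e (Sum.inl i) = Sum.inr (e i) := rfl

@[simp] theorem crossOf_inr (e : ι ≃ κ) (j : κ) : crossOf e (Sum.inr j) = Sum.inl (e.symm j) := rfl

theorem restrictPerm_crossOf [Finite ι] [Finite κ] (e : ι ≃ κ) (α : Equiv.Perm (Option ι))
    (β : Equiv.Perm (Option κ)) :
    restrictPerm (Function.Embedding.inl (α := ι) (β := κ)).optionMap ((crossOf e).optionCongr * cupSum α β) =
      e.symm.optionCongr.permCongr β * α := by
  refine restrictPerm_unique fun u hu y => ?_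
  have hr (j : κ) : u (((crossOf e).optionCongr * cupSum α β) (some (Sum.inr j))) = u (some (Sum.inr j)) :=
    hu _ fun ⟨y, hy⟩ => by rcases y with _ | y <;> simp at hy
  have hr' (j : κ) : u (some (Sum.inr j)) = u (((β (some j)).map e.symm).map Sum.inl) := by
    rw [← hr, Equiv.Perm.mul_apply, cupSum_inr]
    rcases β (some j) with _ | k <;> rfl
  have hj (z : Option ι) : u ((crossOf e).optionCongr (cupJoin β z)) =
      u (((e.symm.optionCongr.permCongr β) z).map Sum.inl) := by
    rcases z with _ | i
    · refine congrArg u ?_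
      change (((β none).map Sum.inr).map (crossOf e)) = (((β none).map e.symm).map Sum.inl)
      rw [Option.map_map, Option.map_map]; rfl
    · exact hr' (e i)
  rcases y with _ | i
  · change u ((crossOf e).optionCongr (cupSum α β none)) = _
    rw [cupSum_none, hj]; rfl
  · change u ((crossOf e).optionCongr (cupSum α β (some (Sum.inl i)))) = _
    rw [cupSum_inl, hj]; rfl

theorem cyc_crossOf [Finite ι] [Finite κ] (e : ι ≃ κ) (α : Equiv.Perm (Option ι))
    (β : Equiv.Perm (Option κ)) :
    cyc ((crossOf e).optionCongr * cupSum α β) = cyc (e.symm.optionCongr.permCongr β * α) := by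
  have h1 := pow_cyc_eq 2 (Function.Embedding.inl (α := ι) (β := κ)).optionMap
    ((crossOf e).optionCongr * cupSum α β)
  rw [restrictPerm_crossOf] at h1
  have h2 : kerCard 2 (Function.Embedding.inl (α := ι) (β := κ)).optionMap
      ((crossOf e).optionCongr * cupSum α β) = 1 := by
    rw [kerCard, Nat.card_eq_one_iff_unique]
    refine ⟨⟨fun u v => ?_⟩, ⟨⟨fun _ => 0, fun _ => rfl, fun _ _ => rfl⟩⟩⟩
    have key (u : {u : Option (ι ⊕ κ) → Fin 2 //
        (∀ y, u ((Function.Embedding.inl (α := ι) (β := κ)).optionMap y) = 0) ∧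
        ∀ x ∉ Set.range (Function.Embedding.inl (α := ι) (β := κ)).optionMap,
          u (((crossOf e).optionCongr * cupSum α β) x) = u x}) (x) : u.1 x = 0 := by
      rcases x with _ | i | j
      · exact u.2.1 none
      · exact u.2.1 (some i)
      · rw [← u.2.2 (some (Sum.inr j)) fun ⟨y, hy⟩ => by rcases y with _ | y <;> simp at hy,
          Equiv.Perm.mul_apply, cupSum_inr]
        rcases β (some j) with _ | k
        · exact u.2.1 none
        · exact u.2.1 (some (e.symm k))
    exact Subtype.ext (funext fun x => (key u x).trans (key v x).symm)
  rw [h2, one_mul] at h1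
  exact Nat.pow_right_injective le_rfl h1

theorem cyc_of_subsingleton {X : Type*} [Subsingleton X] [Nonempty X] (σ : Equiv.Perm X) : cyc σ = 1 := by
  rw [cyc, Nat.card_eq_one_iff_unique]
  exact ⟨inferInstance, ⟨Quotient.mk _ (Classical.arbitrary X)⟩⟩

theorem counit_real_smul (c : ℝ) (x : TP H) : counit (c • x) = c * counit x :=
  (counit (H := H)).map_smul (c : ℂ) x

variable [Fintype ι] [DecidableEq ι] [Fintype κ] [DecidableEq κ]

theorem isCross_crossOf (e : ι ≃ κ) : IsCross (crossOf e) := by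
  refine ⟨fun z => ?_, fun z => Or.inr ?_⟩ <;> rcases z with z | z <;> simp

theorem exists_eq_crossOf {π : Equiv.Perm (ι ⊕ κ)} (hπ : IsCross π) (h : ∀ z, π z ≠ z) :
    ∃ e : ι ≃ κ, crossOf e = π := by
  have hl (i : ι) : ∃ j, π (Sum.inl i) = Sum.inr j := by
    have := (hπ.2 (Sum.inl i)).resolve_left (h _)
    rcases hx : π (Sum.inl i) with x | x
    · simp [hx] at this
    · exact ⟨x, rfl⟩
  have hr (j : κ) : ∃ i, π (Sum.inr j) = Sum.inl i := by
    have := (hπ.2 (Sum.inr j)).resolve_left (h _)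
    rcases hx : π (Sum.inr j) with x | x
    · exact ⟨x, rfl⟩
    · simp [hx] at this
  choose f hf using hl
  choose g hg using hr
  refine ⟨⟨f, g, fun i => ?_, fun j => ?_⟩, ?_⟩
  · have := hπ.1 (Sum.inl i)
    rw [hf, hg] at this
    exact Sum.inl_injective this
  · have := hπ.1 (Sum.inr j)
    rw [hg, hf] at this
    exact Sum.inr_injective this
  · ext1 z
    rcases z with z | z
    · exact (hf z).symm
    · exact (hg z).symm

theorem crossOf_injective : Function.Injective (crossOf : (ι ≃ κ) → _) := fun e e' h => by
  ext i
  exact Sum.inr_injective (Equiv.congr_fun h (Sum.inl i))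

theorem counit_crossSym (q : ℝ) (γ : Equiv.Perm (Option (ι ⊕ κ))) (h : ι ⊕ κ → H)
    {π : Equiv.Perm (ι ⊕ κ)} (hπ : ∀ z, π z ≠ z) :
    counit (crossSym q γ h π) = ((q ^ ((crossCard π : ℤ) + 1 - cyc (π.optionCongr * γ)) : ℝ) : ℂ) := by
  have : IsEmpty {z // π z = z} := ⟨fun z => hπ z.1 z.2⟩
  rw [crossSym, conSym, smul_apply, conWeight, cyc_of_subsingleton, counit_real_smul, counit_sym,
    Nat.card_of_isEmpty, if_pos rfl, mul_one, Nat.cast_one]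

theorem counit_crossSym_of_fixed (q : ℝ) (γ : Equiv.Perm (Option (ι ⊕ κ))) (h : ι ⊕ κ → H)
    {π : Equiv.Perm (ι ⊕ κ)} {z : ι ⊕ κ} (hπ : π z = z) : counit (crossSym q γ h π) = 0 := by
  have : Nonempty {z // π z = z} := ⟨⟨z, hπ⟩⟩
  rw [crossSym, conSym, smul_apply, conWeight, counit_real_smul, counit_sym,
    if_neg Nat.card_pos.ne', mul_zero]

theorem counit_crossMul_sym {q : ℝ} (hq : q ≠ 0) (α : Equiv.Perm (Option ι)) (β : Equiv.Perm (Option κ))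
    (f : ι → H) (g : κ → H) : counit (crossMul q (sym α f) (sym β g)) =
      ∑ e : ι ≃ κ, (((∏ i, inner ℝ (f i) (g (e i))) *
        q ^ ((Fintype.card ι : ℤ) + 1 - cyc (e.symm.optionCongr.permCongr β * α)) : ℝ) : ℂ) := by
  rw [crossMul_sym hq, map_sum]
  symm
  refine Finset.sum_of_injOn crossOf crossOf_injective.injOn (fun _ _ => Finset.mem_univ _) ?_ ?_
  · intro π _ hπ
    split_ifs with hc
    · obtain ⟨z, hz⟩ : ∃ z, π z = z := by
        by_contra! hne
        obtain ⟨e, rfl⟩ := exists_eq_crossOf hc hne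
        exact hπ ⟨e, Finset.mem_coe.2 (Finset.mem_univ _), rfl⟩
      rw [counit_real_smul, counit_crossSym_of_fixed q _ _ hz, mul_zero]
    · exact map_zero _
  · intro e _
    rw [if_pos (isCross_crossOf e)]
    rw [counit_real_smul, counit_crossSym, cyc_crossOf, Complex.ofReal_mul]
    · congr 4
      simp [crossCard]
    · intro z
      rcases z with z | z <;> simp

theorem counit_crossMul_star {q : ℝ} (hq : q ≠ 0) (x y : TP H) :
    counit (crossMul q (starTP x) y) = barInner q (tpToBar y) (tpToBar x) := by
  simp only [← crossMulₗ_apply]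
  induction x using TP_induction with
  | zero => simp [barInner]
  | smul c x hx =>
    rw [map_smulₛₗ, map_smul, LinearMap.smul_apply, map_smul, hx, map_smul, barInner_smul_right]; rfl
  | add x x' hx hx' =>
    rw [map_add, map_add, LinearMap.add_apply, map_add, hx, hx', map_add, barInner_add_right]
  | tensor n α f =>
    induction y using TP_induction with
    | zero => simp [barInner]
    | smul c y hy => rw [map_smul, map_smul, hy, map_smul, barInner_smul_left]; rfl
    | add y y' hy hy' => rw [map_add, map_add, hy, hy', map_add, barInner_add_left]
    | tensor k β g =>
      have hs : starTP (symFin α f) = sym α⁻¹ f := by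
        rw [← star_eq_starTP, ← sym_fin, star_sym]
      rw [hs, ← sym_fin β, crossMulₗ_apply, counit_crossMul_sym hq, sym_fin, tpToBar_symFin,
        tpToBar_symFin]
      by_cases hn : k = n
      · subst hn
        rw [barInner_symI, kernelForm_apply, Complex.ofReal_sum]
        refine Finset.sum_congr rfl fun e _ => ?_
        congr 1
        rw [mul_comm]
        congr 1
        · have hc : cyc (e.symm.optionCongr.permCongr β * α⁻¹) = cyc (β * conj0 e α⁻¹) := by
            rw [← cyc_permCongr e.optionCongr]
            congr 1
            ext1 z
            simp [conj0_eq_permCongr, Equiv.permCongr_apply]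
          rw [hc, chi, Fintype.card_fin, ← zpow_natCast, Nat.cast_sub (cyc_le _)]
          push_cast
          rfl
        · rw [hilbPerm_toHilb, inner_toHilb, algPerm_tprod, tensorInner_tprod]
          refine (Equiv.prod_comp e _).symm.trans ?_ |>.symm
          refine Finset.prod_congr rfl fun i _ => ?_
          rw [Equiv.symm_apply_apply, real_inner_comm]
      · rw [barInner_symI_ne q hn]
        refine Finset.sum_eq_zero fun e _ => ?_
        exact absurd (by simpa using (Fintype.card_congr e).symm) hn

end FullPairing

section SchurWeyl
open scoped ComplexOrder
variable {I : Type*} [Fintype I] [DecidableEq I] {N : ℕ}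

/-- The tensor power `M ⊗ ⋯ ⊗ M`, with factors indexed by `I`. -/
def kronPow {R : Type*} [CommRing R] (I : Type*) [Fintype I] (M : Matrix (Fin N) (Fin N) R) :
    Matrix (I → Fin N) (I → Fin N) R :=
  Matrix.of fun s t => ∏ k, M (s k) (t k)

theorem kronPow_apply {R : Type*} [CommRing R] (M : Matrix (Fin N) (Fin N) R) (s t : I → Fin N) :
    kronPow I M s t = ∏ k, M (s k) (t k) := rfl

theorem kronPow_mul {R : Type*} [CommRing R] (M L : Matrix (Fin N) (Fin N) R) :
    kronPow I (M * L) = kronPow I M * kronPow I L := by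
  ext s t
  simp only [kronPow_apply, Matrix.mul_apply, Finset.prod_univ_sum, Finset.prod_mul_distrib,
    Fintype.piFinset_univ]

theorem kronPow_one {R : Type*} [CommRing R] :
    kronPow I (1 : Matrix (Fin N) (Fin N) R) = 1 := by
  ext s t
  rw [kronPow_apply, Matrix.one_apply]
  split_ifs with h
  · subst h
    exact Finset.prod_eq_one fun k _ => Matrix.one_apply_eq _
  · obtain ⟨k, hk⟩ := Function.ne_iff.1 h
    exact Finset.prod_eq_zero (Finset.mem_univ k) (Matrix.one_apply_ne hk)

theorem kronPow_diagonal {R : Type*} [CommRing R] (d : Fin N → R) :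
    kronPow I (Matrix.diagonal d) = Matrix.diagonal fun s => ∏ k, d (s k) := by
  ext s t
  rw [kronPow_apply, Matrix.diagonal_apply]
  split_ifs with h
  · simp [h]
  · obtain ⟨k, hk⟩ := Function.ne_iff.1 h
    exact Finset.prod_eq_zero (Finset.mem_univ k) (Matrix.diagonal_apply_ne _ hk)

/-- The matrix which permutes the tensor factors. -/
def permMat (N : ℕ) {I : Type*} [DecidableEq I] [Fintype I] (α : Equiv.Perm I) :
    Matrix (I → Fin N) (I → Fin N) ℂ :=
  Matrix.of fun s t => if t = s ∘ α then 1 else 0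

theorem permMat_apply (α : Equiv.Perm I) (s t : I → Fin N) :
    permMat N α s t = if t = s ∘ α then 1 else 0 := rfl

theorem permMat_mul (α β : Equiv.Perm I) : permMat N α * permMat N β = permMat N (α * β) := by
  ext s t
  simp only [Matrix.mul_apply, permMat_apply, ite_mul, one_mul, zero_mul, Finset.sum_ite_eq',
    Finset.mem_univ, if_true]
  rfl

theorem permMat_one : permMat N (1 : Equiv.Perm I) = 1 := by
  ext s t
  rw [permMat_apply, Matrix.one_apply]
  exact if_congr eq_comm rfl rfl

/-- The span of the matrices permuting the tensor factors. -/
def permSpan (N : ℕ) (I : Type*) [DecidableEq I] [Fintype I] :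
    Submodule ℂ (Matrix (I → Fin N) (I → Fin N) ℂ) :=
  Submodule.span ℂ (Set.range (permMat N))

theorem permSpan_mul {A B : Matrix (I → Fin N) (I → Fin N) ℂ} (hA : A ∈ permSpan N I)
    (hB : B ∈ permSpan N I) : A * B ∈ permSpan N I := by
  induction hA using Submodule.span_induction with
  | mem A hA =>
    obtain ⟨α, rfl⟩ := hA
    induction hB using Submodule.span_induction with
    | mem B hB =>
      obtain ⟨β, rfl⟩ := hB
      rw [permMat_mul]
      exact Submodule.subset_span ⟨_, rfl⟩
    | zero => rw [mul_zero]; exact Submodule.zero_mem _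
    | add B B' _ _ h h' => rw [mul_add]; exact Submodule.add_mem _ h h'
    | smul c B _ h => rw [mul_smul_comm]; exact Submodule.smul_mem _ _ h
  | zero => rw [zero_mul]; exact Submodule.zero_mem _
  | add A A' _ _ h h' => rw [add_mul]; exact Submodule.add_mem _ h h'
  | smul c A _ h => rw [smul_mul_assoc]; exact Submodule.smul_mem _ _ h

theorem diagonal_mem_unitaryGroup {d : Fin N → ℂ} (hd : ∀ a, ‖d a‖ = 1) :
    Matrix.diagonal d ∈ Matrix.unitaryGroup (Fin N) ℂ := by
  rw [Matrix.mem_unitaryGroup_iff, Matrix.star_eq_conjTranspose, Matrix.diagonal_conjTranspose,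
    Matrix.diagonal_mul_diagonal, ← Matrix.diagonal_one]
  congr 1
  ext a
  rw [Pi.star_apply, Complex.star_def, Complex.mul_conj, Complex.normSq_eq_norm_sq, hd]
  simp

theorem infinite_norm_eq_one : {z : ℂ | ‖z‖ = 1}.Infinite := by
  have : Infinite (Set.Ioc (-Real.pi) Real.pi) :=
    Set.infinite_coe_iff.2 (Set.Ioc_infinite (by linarith [Real.pi_pos]))
  have : Infinite Circle := Circle.argEquiv.infinite_iff.2 this
  have h : Set.Infinite (Set.range fun x : Circle => (x : ℂ)) :=
    Set.infinite_range_of_injective Subtype.val_injective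
  refine h.mono ?_
  rintro _ ⟨x, rfl⟩
  exact x.norm_coe

variable {A : Matrix (I → Fin N) (I → Fin N) ℂ}

theorem commute_kronPow_diagonal (hA : ∀ d : Fin N → ℂ, (∀ a, ‖d a‖ = 1) →
    Commute (kronPow I (Matrix.diagonal d)) A) (d : Fin N → ℂ) :
    Commute (kronPow I (Matrix.diagonal d)) A := by
  have hE (d : Fin N → ℂ) (s t : I → Fin N) :
      (kronPow I (Matrix.diagonal d) * A) s t = MvPolynomial.eval d
        ((∏ k, MvPolynomial.X (s k)) * MvPolynomial.C (A s t)) := by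
    rw [kronPow_diagonal, Matrix.diagonal_mul]; simp
  have hE' (d : Fin N → ℂ) (s t : I → Fin N) :
      (A * kronPow I (Matrix.diagonal d)) s t = MvPolynomial.eval d
        (MvPolynomial.C (A s t) * ∏ k, MvPolynomial.X (t k)) := by
    rw [kronPow_diagonal, Matrix.mul_diagonal]; simp
  ext s t
  rw [hE, hE']
  congr 1
  refine MvPolynomial.funext_set (fun _ => {z : ℂ | ‖z‖ = 1}) (fun _ => infinite_norm_eq_one) ?_
  intro d hd
  rw [← hE, ← hE', (hA d fun a => hd a trivial).eq]

theorem commute_kronPow_of_isHermitian (hA : ∀ U ∈ Matrix.unitaryGroup (Fin N) ℂ, Commute (kronPow I U) A)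
    {M : Matrix (Fin N) (Fin N) ℂ} (hM : M.IsHermitian) : Commute (kronPow I M) A := by
  have h1 : ∃ V ∈ Matrix.unitaryGroup (Fin N) ℂ, ∃ d : Fin N → ℂ, M = V * Matrix.diagonal d * star V := by
    refine ⟨hM.eigenvectorUnitary, hM.eigenvectorUnitary.2, RCLike.ofReal ∘ hM.eigenvalues, ?_⟩
    have := hM.spectral_theorem
    rwa [Unitary.conjStarAlgAut_apply] at this
  obtain ⟨V, hV, d, rfl⟩ := h1
  have hV1 := Matrix.mem_unitaryGroup_iff.1 hV
  have hV2 := Matrix.mem_unitaryGroup_iff'.1 hV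
  have hVs : star V ∈ Matrix.unitaryGroup (Fin N) ℂ := Unitary.star_mem hV
  have hK1 : kronPow I V * kronPow I (star V) = 1 := by rw [← kronPow_mul, hV1, kronPow_one]
  have hK2 : kronPow I (star V) * kronPow I V = 1 := by rw [← kronPow_mul, hV2, kronPow_one]
  have hd : Commute (kronPow I (Matrix.diagonal d)) A :=
    commute_kronPow_diagonal (fun d hd => hA _ (diagonal_mem_unitaryGroup hd)) d
  rw [kronPow_mul, kronPow_mul]
  exact ((hA V hV).mul_left hd).mul_left (hA _ hVs)

theorem commute_kronPow_of_unitary (hA : ∀ U ∈ Matrix.unitaryGroup (Fin N) ℂ, Commute (kronPow I U) A)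
    (M : Matrix (Fin N) (Fin N) ℂ) : Commute (kronPow I M) A := by
  let p (x : Polynomial ℂ) : Matrix (Fin N) (Fin N) (Polynomial ℂ) :=
    (realPart M : Matrix (Fin N) (Fin N) ℂ).map Polynomial.C +
      x • (imaginaryPart M : Matrix (Fin N) (Fin N) ℂ).map Polynomial.C
  let M' (z : ℂ) : Matrix (Fin N) (Fin N) ℂ := realPart M + z • (imaginaryPart M : Matrix (Fin N) (Fin N) ℂ)
  have hp (z : ℂ) (s t : I → Fin N) : kronPow I (M' z) s t = (kronPow I (p Polynomial.X) s t).eval z := by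
    simp only [kronPow_apply, M', p, Polynomial.eval_prod]
    exact Finset.prod_congr rfl fun k _ => by simp; exact mul_comm _ _
  have hL (z : ℂ) (s t : I → Fin N) : (kronPow I (M' z) * A) s t =
      ((kronPow I (p Polynomial.X) * A.map Polynomial.C) s t).eval z := by
    simp [Matrix.mul_apply, hp, Polynomial.eval_finsetSum]
  have hR (z : ℂ) (s t : I → Fin N) : (A * kronPow I (M' z)) s t =
      ((A.map Polynomial.C * kronPow I (p Polynomial.X)) s t).eval z := by
    simp [Matrix.mul_apply, hp, Polynomial.eval_finsetSum]
  have hM : M = M' Complex.I := (realPart_add_I_smul_imaginaryPart M).symm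
  rw [hM]
  ext s t
  rw [hL, hR]
  congr 1
  refine Polynomial.eq_of_infinite_eval_eq _ _ ?_
  refine (Set.infinite_range_of_injective Complex.ofReal_injective).mono ?_
  rintro _ ⟨x, rfl⟩
  rw [Set.mem_ofPred_eq, ← hL, ← hR]
  have hH : (M' x).IsHermitian := by
    refine Matrix.IsHermitian.add (realPart M).2 ?_
    rw [Matrix.IsHermitian, Matrix.conjTranspose_smul, Complex.star_def, Complex.conj_ofReal]
    congr 1
    exact (imaginaryPart M).2
  rw [(commute_kronPow_of_isHermitian hA hH).eq]

/-- The symmetrization of the product of the matrix units `(i k, j k)`. -/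
def symUnit (i j : I → Fin N) : Matrix (I → Fin N) (I → Fin N) ℂ :=
  ∑ σ : Equiv.Perm I, Matrix.single (i ∘ σ) (j ∘ σ) 1

theorem sum_single_eq_iff_bijective (φ : I → I) :
    ∑ l, Finsupp.single (φ l) 1 = ∑ k : I, (Finsupp.single k 1 : I →₀ ℕ) ↔ Function.Bijective φ := by
  constructor
  · intro h
    refine (Finite.surjective_iff_bijective).1 fun k => ?_
    have h1 := DFunLike.congr_fun h k
    by_contra! hk
    simp only [Finsupp.finsetSum_apply, Finsupp.single_apply] at h1
    simp [hk] at h1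
  · intro h
    exact (Equiv.ofBijective φ h).sum_comp fun k => Finsupp.single k 1

theorem commute_symUnit (hA : ∀ M, Commute (kronPow I M) A) (i j : I → Fin N) :
    Commute (symUnit i j) A := by
  let p : Matrix (Fin N) (Fin N) (MvPolynomial I ℂ) :=
    Matrix.of fun a c => ∑ k, MvPolynomial.X k * MvPolynomial.C (if i k = a ∧ j k = c then 1 else 0)
  have hcoeff (s t : I → Fin N) : (kronPow I p s t).coeff (∑ k, Finsupp.single k 1) = symUnit i j s t := by
    have h1 : kronPow I p s t = ∑ φ : I → I, MvPolynomial.monomial (∑ l, Finsupp.single (φ l) 1)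
        (if s = i ∘ φ ∧ t = j ∘ φ then (1 : ℂ) else 0) := by
      simp only [kronPow_apply, p, Matrix.of_apply, Finset.prod_univ_sum, Fintype.piFinset_univ]
      refine Finset.sum_congr rfl fun φ _ => ?_
      have hm (c : ℂ) (m : I →₀ ℕ) : MvPolynomial.monomial m c =
          MvPolynomial.C c * MvPolynomial.monomial m 1 := by rw [MvPolynomial.C_mul_monomial, mul_one]
      rw [Finset.prod_mul_distrib, ← map_prod, mul_comm, hm, MvPolynomial.monomial_sum_one]
      congr 2
      split_ifs with h
      · refine Finset.prod_eq_one fun l _ => if_pos ⟨?_, ?_⟩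
        · rw [h.1]; rfl
        · rw [h.2]; rfl
      · simp only [funext_iff, ← forall_and, not_forall, Function.comp] at h
        obtain ⟨l, hl⟩ := h
        refine Finset.prod_eq_zero (Finset.mem_univ l) (if_neg fun h' => hl ⟨h'.1.symm, h'.2.symm⟩)
    rw [h1, MvPolynomial.coeff_sum, symUnit, Matrix.sum_apply]
    simp only [MvPolynomial.coeff_monomial, sum_single_eq_iff_bijective]
    symm
    refine Finset.sum_of_injOn (fun σ : Equiv.Perm I => (σ : I → I)) DFunLike.coe_injective.injOn
      (fun _ _ => Finset.mem_coe.2 (Finset.mem_univ _)) ?_ ?_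
    · intro φ _ hφ
      rw [if_neg]
      intro h
      exact hφ ⟨Equiv.ofBijective φ h, by simp, rfl⟩
    · intro σ _
      rw [if_pos σ.bijective, Matrix.single_apply]
      exact if_congr (and_congr eq_comm eq_comm) rfl rfl
  have hp : kronPow I p * A.map MvPolynomial.C = A.map MvPolynomial.C * kronPow I p := by
    ext1 s t
    refine MvPolynomial.funext fun x => ?_
    have h1 (s t : I → Fin N) : MvPolynomial.eval x (kronPow I p s t) =
        kronPow I (p.map (MvPolynomial.eval x)) s t := by
      simp only [kronPow_apply, map_prod, Matrix.map_apply]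
    have h2 := congrFun (congrFun (hA (p.map (MvPolynomial.eval x))).eq s) t
    simpa only [Matrix.mul_apply, map_sum, map_mul, Matrix.map_apply, MvPolynomial.eval_C, h1] using h2
  ext s t
  have h := congrArg (MvPolynomial.coeff (∑ k, Finsupp.single k 1)) (congrFun (congrFun hp s) t)
  simp only [Matrix.mul_apply, MvPolynomial.coeff_sum, Matrix.map_apply, mul_comm _ (MvPolynomial.C _),
    MvPolynomial.coeff_C_mul, hcoeff] at h
  rw [Matrix.mul_apply, Matrix.mul_apply, ← h]
  exact Finset.sum_congr rfl fun r _ => mul_comm _ _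

theorem sum_symUnit_mul_mul (A : Matrix (I → Fin N) (I → Fin N) ℂ) :
    ∑ i : I → Fin N, ∑ j : I → Fin N, symUnit i j * A * symUnit j i ∈ permSpan N I := by
  have h1 (i j : I → Fin N) : symUnit i j * A * symUnit j i =
      ∑ σ : Equiv.Perm I, ∑ τ : Equiv.Perm I, A (j ∘ σ) (j ∘ τ) • Matrix.single (i ∘ σ) (i ∘ τ) 1 := by
    rw [symUnit, symUnit, Finset.sum_mul, Finset.sum_mul_sum]
    refine Finset.sum_congr rfl fun σ _ => Finset.sum_congr rfl fun τ _ => ?_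
    rw [Matrix.single_mul_mul_single, Matrix.smul_single]
    simp
  have h2 (σ τ : Equiv.Perm I) : ∑ i : I → Fin N, Matrix.single (i ∘ σ) (i ∘ τ) (1 : ℂ) =
      permMat N (σ⁻¹ * τ) := by
    ext s t
    rw [Matrix.sum_apply, permMat_apply, Finset.sum_eq_single (s ∘ σ.symm)]
    · rw [Matrix.single_apply]
      refine if_congr ?_ rfl rfl
      have : (s ∘ σ.symm) ∘ σ = s := by ext k; simp
      rw [this, eq_self_iff_true, true_and, eq_comm]
      rfl
    · intro i _ hi
      rw [Matrix.single_apply, if_neg]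
      rintro ⟨h, -⟩
      apply hi
      rw [← h]
      ext k; simp
    · simp
  simp only [h1]
  have h3 : ∑ i : I → Fin N, ∑ j : I → Fin N, ∑ σ : Equiv.Perm I, ∑ τ : Equiv.Perm I,
      A (j ∘ σ) (j ∘ τ) • Matrix.single (i ∘ σ) (i ∘ τ) (1 : ℂ) =
      ∑ j : I → Fin N, ∑ σ : Equiv.Perm I, ∑ τ : Equiv.Perm I, A (j ∘ σ) (j ∘ τ) • permMat N (σ⁻¹ * τ) := by
    rw [Finset.sum_comm]
    refine Finset.sum_congr rfl fun j _ => ?_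
    rw [Finset.sum_comm]
    refine Finset.sum_congr rfl fun σ _ => ?_
    rw [Finset.sum_comm]
    refine Finset.sum_congr rfl fun τ _ => ?_
    rw [← Finset.smul_sum, h2]
  rw [h3]
  exact Submodule.sum_mem _ fun j _ => Submodule.sum_mem _ fun σ _ => Submodule.sum_mem _ fun τ _ =>
    Submodule.smul_mem _ _ (Submodule.subset_span ⟨_, rfl⟩)

theorem conjTranspose_symUnit (i j : I → Fin N) : (symUnit i j).conjTranspose = symUnit j i := by
  rw [symUnit, Matrix.conjTranspose_sum]
  exact Finset.sum_congr rfl fun σ _ => by rw [Matrix.conjTranspose_single, star_one]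

theorem eq_zero_of_symUnit_mul {B : Matrix (I → Fin N) (I → Fin N) ℂ}
    (hB : ∀ i, symUnit i i * B = 0) : B = 0 := by
  ext i t
  have h := congrFun (congrFun (hB i) i) t
  rw [symUnit, Finset.sum_mul, Matrix.sum_apply] at h
  have h1 (σ : Equiv.Perm I) : (Matrix.single (i ∘ σ) (i ∘ σ) (1 : ℂ) * B) i t =
      if i ∘ σ = i then B i t else 0 := by
    split_ifs with h
    · rw [h, Matrix.single_mul_apply_same, one_mul]
    · exact Matrix.single_mul_apply_of_ne _ _ _ _ _ (fun h' => h h'.symm) _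
  simp only [h1, ← Finset.sum_filter, Finset.sum_const, nsmul_eq_mul] at h
  refine (mul_eq_zero.1 h).resolve_left (Nat.cast_ne_zero.2 (Finset.card_ne_zero_of_mem (a := 1) ?_))
  simp

/-- Matrices which commute with the tensor powers of all unitaries are linear combinations of
permutations of the tensor factors. -/
theorem mem_permSpan_of_commute (hA : ∀ U ∈ Matrix.unitaryGroup (Fin N) ℂ, Commute (kronPow I U) A) :
    A ∈ permSpan N I := by
  have hC (i j : I → Fin N) : Commute (symUnit i j) A :=
    commute_symUnit (commute_kronPow_of_unitary hA) i j
  let W : Matrix (I → Fin N) (I → Fin N) ℂ := ∑ i : I → Fin N, ∑ j : I → Fin N, symUnit i j * symUnit j i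
  have hW : W ∈ permSpan N I := by simpa only [mul_one] using sum_symUnit_mul_mul (N := N) (I := I) 1
  have hAW : A * W ∈ permSpan N I := by
    have : A * W = ∑ i : I → Fin N, ∑ j : I → Fin N, symUnit i j * A * symUnit j i := by
      simp only [W, Finset.mul_sum]
      refine Finset.sum_congr rfl fun i _ => Finset.sum_congr rfl fun j _ => ?_
      rw [(hC i j).eq, mul_assoc]
    rw [this]
    exact sum_symUnit_mul_mul A
  have hinj (B : Matrix (I → Fin N) (I → Fin N) ℂ) (hB : W * B = 0) : B = 0 := by
    have h1 : (∑ i : I → Fin N, ∑ j : I → Fin N,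
        ((symUnit j i * B).conjTranspose * (symUnit j i * B)).trace) = 0 := by
      have h2 : (B.conjTranspose * (W * B)).trace = 0 := by rw [hB, mul_zero, Matrix.trace_zero]
      rw [← h2]
      simp only [W, Finset.sum_mul, Finset.mul_sum, Matrix.trace_sum]
      refine Finset.sum_congr rfl fun i _ => Finset.sum_congr rfl fun j _ => ?_
      rw [Matrix.conjTranspose_mul, conjTranspose_symUnit]
      simp only [mul_assoc]
    have hnn (X : Matrix (I → Fin N) (I → Fin N) ℂ) : 0 ≤ (X.conjTranspose * X).trace :=
      (Matrix.posSemidef_conjTranspose_mul_self X).trace_nonneg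
    refine eq_zero_of_symUnit_mul fun i => ?_
    have h3 := (Finset.sum_eq_zero_iff_of_nonneg fun i _ => Finset.sum_nonneg fun j _ => hnn _).1 h1 i
      (Finset.mem_univ _)
    have h4 := (Finset.sum_eq_zero_iff_of_nonneg fun j _ => hnn _).1 h3 i (Finset.mem_univ _)
    exact Matrix.trace_conjTranspose_mul_self_eq_zero_iff.1 h4
  let L : permSpan N I →ₗ[ℂ] permSpan N I :=
    ((LinearMap.mulLeft ℂ W).comp (permSpan N I).subtype).codRestrict _ fun B => permSpan_mul hW B.2
  have hL : Function.Injective L := by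
    rw [← LinearMap.ker_eq_bot, LinearMap.ker_eq_bot']
    intro B hB
    exact Subtype.ext (hinj B (congrArg Subtype.val hB))
  obtain ⟨W', hW'⟩ := (LinearMap.injective_iff_surjective.1 hL) ⟨1, Submodule.subset_span ⟨1, permMat_one⟩⟩
  have h1 : W * W' = 1 := congrArg Subtype.val hW'
  rw [← mul_one A, ← h1, ← mul_assoc]
  exact permSpan_mul hAW W'.2

end SchurWeyl

section UnitaryMean
variable {N : ℕ}

theorem isCompact_unitaryGroup : IsCompact (Matrix.unitaryGroup (Fin N) ℂ : Set (Matrix (Fin N) (Fin N) ℂ)) := by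
  have h1 : IsCompact (Set.univ.pi fun _ : Fin N => Set.univ.pi fun _ : Fin N =>
      Metric.closedBall (0 : ℂ) 1) :=
    isCompact_univ_pi fun _ => isCompact_univ_pi fun _ => isCompact_closedBall _ _
  have hcl : IsClosed (Matrix.unitaryGroup (Fin N) ℂ : Set (Matrix (Fin N) (Fin N) ℂ)) := by
    have : (Matrix.unitaryGroup (Fin N) ℂ : Set (Matrix (Fin N) (Fin N) ℂ)) = {U | U * star U = 1} :=
      Set.ext fun U => Matrix.mem_unitaryGroup_iff
    rw [this]
    exact isClosed_eq (by fun_prop) continuous_const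
  refine h1.of_isClosed_subset hcl fun U hU => ?_
  intro i _ j _
  simpa using entry_norm_bound_of_unitary hU i j

instance : CompactSpace (Matrix.unitaryGroup (Fin N) ℂ) :=
  isCompact_iff_compactSpace.1 isCompact_unitaryGroup

/-- The invariant mean on the unitary group. -/
theorem exists_unitary_mean : ∃ J : C(Matrix.unitaryGroup (Fin N) ℂ, ℂ) →ₗ[ℂ] ℂ,
    (∀ c : ℂ, J (ContinuousMap.const _ c) = c) ∧
    ∀ (V : Matrix.unitaryGroup (Fin N) ℂ) (f : C(Matrix.unitaryGroup (Fin N) ℂ, ℂ)),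
      J (f.comp (ContinuousMap.mulLeft V)) = J f := by
  borelize ↥(Matrix.unitaryGroup (Fin N) ℂ)
  let μ : Measure (Matrix.unitaryGroup (Fin N) ℂ) := Measure.haarMeasure ⊤
  have : IsProbabilityMeasure μ := ⟨by
    have := Measure.haarMeasure_self (K₀ := (⊤ : TopologicalSpace.PositiveCompacts (Matrix.unitaryGroup (Fin N) ℂ)))
    simpa using this⟩
  have hi (f : C(Matrix.unitaryGroup (Fin N) ℂ, ℂ)) : Integrable f μ :=
    f.continuous.integrable_of_hasCompactSupport (HasCompactSupport.of_compactSpace _)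
  refine ⟨{ toFun f := ∫ U, f U ∂μ, map_add' := fun f g => integral_add (hi f) (hi g),
            map_smul' := fun c f => integral_const_mul c _ }, fun c => ?_, fun V f => ?_⟩
  · change ∫ _, c ∂μ = c
    simp
  · exact integral_mul_left_eq_self (μ := μ) (fun U => f U) V

end UnitaryMean

section InvariantPolynomials
variable {H : Type*} {N : ℕ}

/-- The generic matrix `x^{(h)}`. -/
def genMat (N : ℕ) (h : H) : PolyMat H N := Matrix.of fun i j => MvPolynomial.X (h, i, j)

theorem genMat_map_conjSubst (U : Matrix (Fin N) (Fin N) ℂ) (h : H) :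
    (genMat N h).map (conjSubst U) = U.map MvPolynomial.C * genMat N h * (star U).map MvPolynomial.C := by
  ext1 i j
  rw [Matrix.map_apply, genMat, Matrix.of_apply, conjSubst, MvPolynomial.aeval_X]

theorem map_C_mul_map_C_star {U : Matrix (Fin N) (Fin N) ℂ} (hU : U ∈ Matrix.unitaryGroup (Fin N) ℂ) :
    (U.map MvPolynomial.C * (star U).map MvPolynomial.C : PolyMat H N) = 1 := by
  rw [← Matrix.map_mul, Matrix.mem_unitaryGroup_iff.1 hU]
  exact Matrix.map_one _ (map_zero _) (map_one _)

theorem isEquivariant_trS {n : ℕ} (α : S0 n) (h : Fin n → H) :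
    IsEquivariant (trS α fun k => genMat N (h k)) := fun U hU => by
  rw [← trS_conj α _ (map_C_mul_map_C_star hU)]
  refine (trS_map (conjSubst U).toRingHom α _).trans ?_
  congr 1
  funext k
  exact genMat_map_conjSubst U (h k)

theorem IsEquivariant.add {Q R : PolyMat H N} (hQ : IsEquivariant Q) (hR : IsEquivariant R) :
    IsEquivariant (Q + R) := fun U hU => by
  rw [mul_add, add_mul, ← hQ U hU, ← hR U hU]
  ext1 i j
  simp

theorem IsEquivariant.smul {Q : PolyMat H N} (hQ : IsEquivariant Q) (c : ℂ) :
    IsEquivariant (c • Q) := fun U hU => by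
  rw [mul_smul_comm, smul_mul_assoc, ← hQ U hU]
  ext1 i j
  simp

theorem isEquivariant_zero : IsEquivariant (0 : PolyMat H N) := fun U hU => by
  rw [mul_zero, zero_mul]
  ext1 i j
  simp

/-- The span of the trace monomials. -/
def trSpan (H : Type*) (N : ℕ) : Submodule ℂ (PolyMat H N) :=
  Submodule.span ℂ {Q | ∃ (n : ℕ) (α : S0 n) (h : Fin n → H), Q = trS α fun k => genMat N (h k)}

/-- The contraction of a tensor with matrices. -/
def tenContract {I R : Type*} [Fintype I] [DecidableEq I] [CommRing R] [Algebra ℂ R]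
    (y : I → Matrix (Fin N) (Fin N) R) : Matrix (I → Fin N) (I → Fin N) ℂ →ₗ[ℂ] R where
  toFun A := ∑ s : I → Fin N, ∑ t : I → Fin N, A s t • ∏ o, y o (s o) (t o)
  map_add' A B := by
    simp only [Matrix.add_apply, add_smul, Finset.sum_add_distrib]
  map_smul' c A := by
    simp only [Matrix.smul_apply, smul_assoc, ← Finset.smul_sum, RingHom.id_apply]

theorem tenContract_permMat {R ι : Type*} [Fintype ι] [DecidableEq ι] [CommRing R] [Algebra ℂ R]
    (α : Equiv.Perm (Option ι)) (y : ι → Matrix (Fin N) (Fin N) R) (a c : Fin N) :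
    tenContract (fun o : Option ι => o.elim (Matrix.single c a 1) y) (permMat N α) = trS α y a c := by
  change ∑ s : Option ι → Fin N, ∑ t : Option ι → Fin N, permMat N α s t • _ = _
  simp only [permMat_apply, ite_smul, one_smul, zero_smul, Finset.sum_ite_eq', Finset.mem_univ, if_true]
  rfl

theorem exists_tenContract_mem_trSpan {n : ℕ} (h : Fin n → H)
    {A : Matrix (Option (Fin n) → Fin N) (Option (Fin n) → Fin N) ℂ}
    (hA : A ∈ permSpan N (Option (Fin n))) : ∃ M ∈ trSpan H N, ∀ a c,
      tenContract (fun o : Option (Fin n) => o.elim (Matrix.single c a 1) fun k => genMat N (h k)) A = M a c := by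
  induction hA using Submodule.span_induction with
  | mem A hA =>
    obtain ⟨α, rfl⟩ := hA
    exact ⟨_, Submodule.subset_span ⟨n, α, h, rfl⟩, fun a c => tenContract_permMat α _ a c⟩
  | zero => exact ⟨0, Submodule.zero_mem _, fun a c => map_zero _⟩
  | add A B _ _ hA hB =>
    obtain ⟨M, hM, hM'⟩ := hA
    obtain ⟨L, hL, hL'⟩ := hB
    exact ⟨M + L, Submodule.add_mem _ hM hL, fun a c => by rw [map_add, hM', hL']; rfl⟩
  | smul z A _ hA =>
    obtain ⟨M, hM, hM'⟩ := hA
    exact ⟨z • M, Submodule.smul_mem _ _ hM, fun a c => by rw [map_smul, hM']; rfl⟩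

/-- `U Q(U* x U) U*` -/
def conjAct (U : Matrix (Fin N) (Fin N) ℂ) (Q : PolyMat H N) : PolyMat H N :=
  U.map MvPolynomial.C * Q.map (conjSubst (star U)) * (star U).map MvPolynomial.C

theorem IsEquivariant.conjAct_eq {Q : PolyMat H N} (hQ : IsEquivariant Q) {U : Matrix (Fin N) (Fin N) ℂ}
    (hU : U ∈ Matrix.unitaryGroup (Fin N) ℂ) : conjAct U Q = Q := by
  rw [conjAct, hQ _ (Unitary.star_mem hU), star_star, ← mul_assoc, ← mul_assoc, map_C_mul_map_C_star hU,
    one_mul, mul_assoc, map_C_mul_map_C_star hU, mul_one]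

theorem conjAct_single (U : Matrix (Fin N) (Fin N) ℂ) (a c : Fin N) {n : ℕ} (h : Fin n → H)
    (i j : Fin n → Fin N) (a' c' : Fin N) :
    conjAct U (Matrix.single a c (∏ k, MvPolynomial.X (h k, i k, j k))) a' c' =
      tenContract (fun o : Option (Fin n) => o.elim (Matrix.single c' a' 1) fun k => genMat N (h k))
        (Matrix.of fun s t => ∏ o, (conj (U (s o) (o.elim c i)) * U (t o) (o.elim a j))) := by
  have h1 : conjAct U (Matrix.single a c (∏ k, MvPolynomial.X (h k, i k, j k))) a' c' =
      (MvPolynomial.C (U a' a) * MvPolynomial.C (conj (U c' c))) *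
        ∏ k, ∑ p, ∑ r, (MvPolynomial.C (conj (U p (i k)) * U r (j k)) * MvPolynomial.X (h k, p, r)) := by
    have hs : (Matrix.single a c (∏ k, MvPolynomial.X (h k, i k, j k)) : PolyMat H N).map (conjSubst (star U)) =
        Matrix.single a c (conjSubst (star U) (∏ k, MvPolynomial.X (h k, i k, j k))) :=
      Matrix.map_single _ _ _ _
    have hp (k : Fin n) : conjSubst (star U) (MvPolynomial.X (h k, i k, j k)) =
        ∑ p, ∑ r, (MvPolynomial.C (conj (U p (i k)) * U r (j k)) * MvPolynomial.X (h k, p, r)) := by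
      rw [conjSubst, MvPolynomial.aeval_X, Matrix.mul_apply, Finset.sum_comm]
      refine Finset.sum_congr rfl fun r _ => ?_
      rw [Matrix.mul_apply, Finset.sum_mul]
      refine Finset.sum_congr rfl fun p _ => ?_
      simp only [Matrix.map_apply, Matrix.star_apply, Matrix.of_apply, star_star, map_mul, Complex.star_def]
      ring
    rw [conjAct, hs, Matrix.mul_assoc, Matrix.mul_apply, Finset.sum_eq_single a, Matrix.single_mul_apply_same,
      map_prod]
    · simp only [hp, Matrix.map_apply, Matrix.star_apply, Complex.star_def]
      ring
    · intro r _ hr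
      rw [Matrix.single_mul_apply_of_ne _ _ _ _ _ hr, mul_zero]
    · simp
  have h2 : tenContract (fun o : Option (Fin n) => o.elim (Matrix.single c' a' 1) fun k => genMat N (h k))
        (Matrix.of fun s t => ∏ o, (conj (U (s o) (o.elim c i)) * U (t o) (o.elim a j))) =
      ∏ o : Option (Fin n), ∑ p, ∑ r, (MvPolynomial.C (conj (U p (o.elim c i)) * U r (o.elim a j)) *
        (o.elim (Matrix.single c' a' 1) fun k => genMat N (h k) : PolyMat H N) p r) := by
    simp only [Finset.prod_univ_sum, Fintype.piFinset_univ]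
    refine Finset.sum_congr rfl fun s _ => Finset.sum_congr rfl fun t _ => ?_
    rw [Matrix.of_apply, MvPolynomial.smul_eq_C_mul, map_prod, ← Finset.prod_mul_distrib]
  rw [h1, h2, Fintype.prod_option]
  congr 1
  simp only [Option.elim_none]
  rw [Finset.sum_eq_single c', Finset.sum_eq_single a']
  · simp [mul_comm]
  · intro r _ hr
    rw [Matrix.single_apply_of_ne, mul_zero]
    exact fun h => hr h.2.symm
  · simp
  · intro p _ hp
    refine Finset.sum_eq_zero fun r _ => ?_
    rw [Matrix.single_apply_of_ne, mul_zero]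
    exact fun h => hp h.1.symm
  · simp


theorem mem_span_prod_X {σ : Type*} (p : MvPolynomial σ ℂ) :
    p ∈ Submodule.span ℂ {q | ∃ (n : ℕ) (v : Fin n → σ), q = ∏ k, MvPolynomial.X (R := ℂ) (v k)} := by
  induction p using MvPolynomial.induction_on with
  | C a =>
    rw [← mul_one (MvPolynomial.C a), ← MvPolynomial.smul_eq_C_mul]
    exact Submodule.smul_mem _ _ (Submodule.subset_span ⟨0, Fin.elim0, by simp⟩)
  | add p q hp hq => exact Submodule.add_mem _ hp hq
  | mul_X p w hp =>
    induction hp using Submodule.span_induction with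
    | mem p hp =>
      obtain ⟨n, v, rfl⟩ := hp
      exact Submodule.subset_span ⟨n + 1, Fin.snoc v w, by simp [Fin.prod_univ_castSucc]⟩
    | zero => rw [zero_mul]; exact Submodule.zero_mem _
    | add p q _ _ h h' => rw [add_mul]; exact Submodule.add_mem _ h h'
    | smul c p _ h => rw [smul_mul_assoc]; exact Submodule.smul_mem _ _ h

theorem mem_span_single_prod_X (Q : PolyMat H N) :
    Q ∈ Submodule.span ℂ {M : PolyMat H N | ∃ (a c : Fin N) (n : ℕ) (h : Fin n → H) (i j : Fin n → Fin N),
      M = Matrix.single a c (∏ k, MvPolynomial.X (h k, i k, j k))} := by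
  rw [Matrix.matrix_eq_sum_single Q]
  refine Submodule.sum_mem _ fun a _ => Submodule.sum_mem _ fun c _ => ?_
  have h := mem_span_prod_X (Q a c)
  generalize Q a c = p at h ⊢
  induction h using Submodule.span_induction with
  | mem p hp =>
    obtain ⟨n, v, rfl⟩ := hp
    exact Submodule.subset_span ⟨a, c, n, fun k => (v k).1, fun k => (v k).2.1, fun k => (v k).2.2, rfl⟩
  | zero => rw [Matrix.single_zero]; exact Submodule.zero_mem _
  | add p q _ _ h h' => rw [Matrix.single_add]; exact Submodule.add_mem _ h h'
  | smul z p _ h => rw [← Matrix.smul_single]; exact Submodule.smul_mem _ _ h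

theorem star_transpose_mem_unitaryGroup {U : Matrix (Fin N) (Fin N) ℂ}
    (hU : U ∈ Matrix.unitaryGroup (Fin N) ℂ) : (star U).transpose ∈ Matrix.unitaryGroup (Fin N) ℂ := by
  have h := Matrix.mem_unitaryGroup_iff.1 hU
  rw [Matrix.mem_unitaryGroup_iff]
  have h1 : star (star U).transpose = U.transpose := by
    ext i j; simp [Matrix.star_apply]
  rw [h1, ← Matrix.transpose_mul, h, Matrix.transpose_one]

/-- The matrix coefficient of `Ū^{⊗ I} ⊗ U^{⊗ I}`. -/
def unitaryCoeff {I : Type*} [Fintype I] (i j s t : I → Fin N) : C(Matrix.unitaryGroup (Fin N) ℂ, ℂ) where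
  toFun U := ∏ o, (conj ((U : Matrix (Fin N) (Fin N) ℂ) (s o) (i o)) *
    (U : Matrix (Fin N) (Fin N) ℂ) (t o) (j o))
  continuous_toFun := by
    have h (a c : Fin N) : Continuous fun U : Matrix.unitaryGroup (Fin N) ℂ =>
        (U : Matrix (Fin N) (Fin N) ℂ) a c := continuous_subtype_val.matrix_elem a c
    exact continuous_finsetProd _ fun o _ => (Complex.continuous_conj.comp (h _ _)).mul (h _ _)

theorem prod_star_transpose_mul {I : Type*} [Fintype I] [DecidableEq I] (U V : Matrix (Fin N) (Fin N) ℂ)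
    (i j s t : I → Fin N) : ∏ o, (conj (((star U).transpose * V) (s o) (i o)) *
      ((star U).transpose * V) (t o) (j o)) = ∑ t' : I → Fin N, ∑ s' : I → Fin N,
        (kronPow I U s s' * kronPow I (star U) t' t) * ∏ o, (conj (V (s' o) (i o)) * V (t' o) (j o)) := by
  simp only [kronPow_apply]
  rw [Finset.prod_mul_distrib, mul_comm]
  simp only [Matrix.mul_apply, map_sum, Finset.prod_univ_sum, Fintype.piFinset_univ, Finset.sum_mul_sum]
  refine Finset.sum_congr rfl fun t' _ => Finset.sum_congr rfl fun s' _ => ?_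
  simp only [← Finset.prod_mul_distrib]
  refine Finset.prod_congr rfl fun o _ => ?_
  simp only [Matrix.transpose_apply, Matrix.star_apply, map_mul, Complex.star_def, Complex.conj_conj]
  ring

theorem mean_unitaryCoeff_mem_permSpan {I : Type*} [Fintype I] [DecidableEq I]
    {J : C(Matrix.unitaryGroup (Fin N) ℂ, ℂ) →ₗ[ℂ] ℂ}
    (hJ : ∀ (V : Matrix.unitaryGroup (Fin N) ℂ) (f : C(Matrix.unitaryGroup (Fin N) ℂ, ℂ)),
      J (f.comp (ContinuousMap.mulLeft V)) = J f) (i j : I → Fin N) :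
    (Matrix.of fun s t => J (unitaryCoeff i j s t)) ∈ permSpan N I := by
  set A : Matrix (I → Fin N) (I → Fin N) ℂ := Matrix.of fun s t => J (unitaryCoeff i j s t) with hA
  refine mem_permSpan_of_commute fun U hU => ?_
  have h1 : A = kronPow I U * A * kronPow I (star U) := by
    ext s t
    have h2 : (unitaryCoeff i j s t).comp (ContinuousMap.mulLeft ⟨_, star_transpose_mem_unitaryGroup hU⟩) =
        ∑ t', ∑ s', (kronPow I U s s' * kronPow I (star U) t' t) • unitaryCoeff i j s' t' := by
      ext V
      simp only [ContinuousMap.sum_apply]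
      exact prod_star_transpose_mul U V i j s t
    rw [hA, Matrix.of_apply, ← hJ ⟨_, star_transpose_mem_unitaryGroup hU⟩, h2, map_sum, Matrix.mul_apply]
    refine Finset.sum_congr rfl fun t' _ => ?_
    rw [map_sum, Matrix.mul_apply, Finset.sum_mul]
    refine Finset.sum_congr rfl fun s' _ => ?_
    rw [map_smul, smul_eq_mul, Matrix.of_apply]
    ring
  have h3 : kronPow I (star U) * kronPow I U = 1 := by
    rw [← kronPow_mul, Matrix.mem_unitaryGroup_iff'.1 hU, kronPow_one]
  have h4 : A * kronPow I U = kronPow I U * A := by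
    conv_lhs => rw [h1]
    rw [mul_assoc, h3, mul_one]
  exact h4.symm

theorem exists_mean_conjAct {J : C(Matrix.unitaryGroup (Fin N) ℂ, ℂ) →ₗ[ℂ] ℂ}
    (hJ : ∀ (V : Matrix.unitaryGroup (Fin N) ℂ) (f : C(Matrix.unitaryGroup (Fin N) ℂ, ℂ)),
      J (f.comp (ContinuousMap.mulLeft V)) = J f) (Q : PolyMat H N) :
    ∃ M ∈ trSpan H N, ∀ a c m, ∃ f : C(Matrix.unitaryGroup (Fin N) ℂ, ℂ),
      (∀ U, f U = (conjAct (U : Matrix (Fin N) (Fin N) ℂ) Q a c).coeff m) ∧ J f = (M a c).coeff m := by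
  have hQ := mem_span_single_prod_X Q
  induction hQ using Submodule.span_induction with
  | mem Q hQ =>
    obtain ⟨a, c, n, h, i, j, rfl⟩ := hQ
    obtain ⟨M, hM, hM'⟩ := exists_tenContract_mem_trSpan h (mean_unitaryCoeff_mem_permSpan hJ
      (fun o : Option (Fin n) => o.elim c i) fun o : Option (Fin n) => o.elim a j)
    refine ⟨M, hM, fun a' c' m => ⟨∑ s, ∑ t, (MvPolynomial.coeff m (∏ o : Option (Fin n),
      (o.elim (Matrix.single c' a' 1) fun k => genMat N (h k) : PolyMat H N) (s o) (t o))) •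
        unitaryCoeff (fun o : Option (Fin n) => o.elim c i) (fun o : Option (Fin n) => o.elim a j) s t,
      fun U => ?_, ?_⟩⟩
    · rw [conjAct_single]
      simp only [tenContract, LinearMap.coe_mk, AddHom.coe_mk, MvPolynomial.coeff_sum, MvPolynomial.coeff_smul,
        ContinuousMap.sum_apply, ContinuousMap.smul_apply]
      exact Finset.sum_congr rfl fun s _ => Finset.sum_congr rfl fun t _ => mul_comm _ _
    · rw [← hM' a' c']
      simp only [tenContract, LinearMap.coe_mk, AddHom.coe_mk, MvPolynomial.coeff_sum, MvPolynomial.coeff_smul,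
        map_sum, map_smul]
      exact Finset.sum_congr rfl fun s _ => Finset.sum_congr rfl fun t _ => mul_comm _ _
  | zero =>
    refine ⟨0, Submodule.zero_mem _, fun a c m => ⟨0, fun U => ?_, by simp⟩⟩
    have : (0 : PolyMat H N).map (conjSubst (star (U : Matrix (Fin N) (Fin N) ℂ))) = 0 := by ext1 i j; simp
    rw [conjAct, this, mul_zero, zero_mul]
    simp
  | add Q R _ _ hQ hR =>
    obtain ⟨M, hM, hM'⟩ := hQ
    obtain ⟨L, hL, hL'⟩ := hR
    refine ⟨M + L, Submodule.add_mem _ hM hL, fun a c m => ?_⟩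
    obtain ⟨f, hf, hf'⟩ := hM' a c m
    obtain ⟨g, hg, hg'⟩ := hL' a c m
    refine ⟨f + g, fun U => ?_, ?_⟩
    · have : (Q + R).map (conjSubst (star (U : Matrix (Fin N) (Fin N) ℂ))) =
          Q.map (conjSubst (star (U : Matrix (Fin N) (Fin N) ℂ))) +
            R.map (conjSubst (star (U : Matrix (Fin N) (Fin N) ℂ))) := by ext1 i j; simp
      rw [ContinuousMap.add_apply, hf, hg, ← MvPolynomial.coeff_add, conjAct, conjAct, conjAct, this, mul_add,
        add_mul]
      rfl
    · rw [map_add, hf', hg', ← MvPolynomial.coeff_add]; rfl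
  | smul z Q _ hQ =>
    obtain ⟨M, hM, hM'⟩ := hQ
    refine ⟨z • M, Submodule.smul_mem _ _ hM, fun a c m => ?_⟩
    obtain ⟨f, hf, hf'⟩ := hM' a c m
    refine ⟨z • f, fun U => ?_, ?_⟩
    · have : (z • Q).map (conjSubst (star (U : Matrix (Fin N) (Fin N) ℂ))) =
          z • Q.map (conjSubst (star (U : Matrix (Fin N) (Fin N) ℂ))) := by ext1 i j; simp
      rw [ContinuousMap.smul_apply, hf, ← MvPolynomial.coeff_smul, conjAct, conjAct, this, mul_smul_comm,
        smul_mul_assoc]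
      rfl
    · rw [map_smul, hf', ← MvPolynomial.coeff_smul]; rfl

/-- The first fundamental theorem for the unitary group: equivariant polynomial matrices are linear
combinations of trace monomials. -/
theorem IsEquivariant.mem_trSpan {Q : PolyMat H N} (hQ : IsEquivariant Q) : Q ∈ trSpan H N := by
  obtain ⟨J, hJ1, hJ⟩ := exists_unitary_mean (N := N)
  obtain ⟨M, hM, hM'⟩ := exists_mean_conjAct hJ Q
  have : Q = M := by
    ext a c m
    obtain ⟨f, hf, hf'⟩ := hM' a c m
    have h1 : f = ContinuousMap.const _ ((Q a c).coeff m) := by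
      ext U
      rw [hf, hQ.conjAct_eq U.2]; rfl
    rw [← hf', h1, hJ1]
  exact this ▸ hM

end InvariantPolynomials

section EquivariantRange
variable {H : Type*} [NormedAddCommGroup H] [InnerProductSpace ℝ H] {N : ℕ}

theorem exists_evalTP_eq {Q : PolyMat H N} (hQ : Q ∈ trSpan H N) :
    ∃ x : TP H, ∀ Y : H →ₗ[ℝ] Matrix (Fin N) (Fin N) ℂ,
      Q.map (MvPolynomial.eval fun v => Y v.1 v.2.1 v.2.2) = evalTP Y x := by
  induction hQ using Submodule.span_induction with
  | mem Q hQ =>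
    obtain ⟨n, α, h, rfl⟩ := hQ
    refine ⟨symFin α h, fun Y => ?_⟩
    rw [evalTP_symFin]
    refine (trS_map _ α _).trans ?_
    congr 1
    ext k i j
    simp [genMat]
  | zero => exact ⟨0, fun Y => by rw [map_zero]; ext i j; simp⟩
  | add Q R _ _ hQ hR =>
    obtain ⟨x, hx⟩ := hQ
    obtain ⟨y, hy⟩ := hR
    refine ⟨x + y, fun Y => ?_⟩
    rw [map_add, ← hx, ← hy]
    ext i j
    simp
  | smul z Q _ hQ =>
    obtain ⟨x, hx⟩ := hQ
    refine ⟨z • x, fun Y => ?_⟩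
    rw [map_smul, ← hx]
    ext i j
    simp

theorem exists_isEquivariant_eval_eq (x : TP H) :
    ∃ Q : PolyMat H N, IsEquivariant Q ∧ ∀ Y : H →ₗ[ℝ] Matrix (Fin N) (Fin N) ℂ,
      Q.map (MvPolynomial.eval fun v => Y v.1 v.2.1 v.2.2) = evalTP Y x := by
  induction x using TP_induction with
  | zero => exact ⟨0, isEquivariant_zero, fun Y => by rw [map_zero]; ext i j; simp⟩
  | tensor n α h =>
    refine ⟨_, isEquivariant_trS α h, fun Y => ?_⟩
    rw [evalTP_symFin]
    refine (trS_map _ α _).trans ?_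
    congr 1
    ext k i j
    simp [genMat]
  | smul z x hx =>
    obtain ⟨Q, hQ, hQ'⟩ := hx
    refine ⟨z • Q, hQ.smul z, fun Y => ?_⟩
    rw [map_smul, ← hQ']
    ext i j
    simp
  | add x y hx hy =>
    obtain ⟨Q, hQ, hQ'⟩ := hx
    obtain ⟨R, hR, hR'⟩ := hy
    refine ⟨Q + R, hQ.add hR, fun Y => ?_⟩
    rw [map_add, ← hQ', ← hR']
    ext i j
    simp

variable {Ω : Type*} {mΩ : MeasurableSpace Ω} {P : Measure Ω} [IsProbabilityMeasure P]
  {b : Fin N → Fin N → H → Ω → ℝ}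

theorem evalMat_ae_eq (hb : IsStdGaussianFamily b P) (Q : PolyMat H N) :
    evalMat b Q =ᵐ[P] fun ω => Q.map (MvPolynomial.eval fun v => linMat b ω v.1 v.2.1 v.2.2) := by
  have h1 (p : MvPolynomial (H × Fin N × Fin N) ℂ) : ∀ᵐ ω ∂P,
      MvPolynomial.eval (fun v => gaussMat b v.1 ω v.2.1 v.2.2) p =
        MvPolynomial.eval (fun v => linMat b ω v.1 v.2.1 v.2.2) p := by
    induction p using MvPolynomial.induction_on with
    | C a => simp
    | add p q hp hq => filter_upwards [hp, hq] with ω hp hq; rw [map_add, map_add, hp, hq]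
    | mul_X p v hp =>
      filter_upwards [hp, linMat_ae_eq hb v.1] with ω hp hv
      rw [map_mul, map_mul, hp, MvPolynomial.eval_X, MvPolynomial.eval_X, hv]
  have h2 : ∀ᵐ ω ∂P, ∀ i j, MvPolynomial.eval (fun v => gaussMat b v.1 ω v.2.1 v.2.2) (Q i j) =
      MvPolynomial.eval (fun v => linMat b ω v.1 v.2.1 v.2.2) (Q i j) :=
    Filter.eventually_all.2 fun i => Filter.eventually_all.2 fun j => h1 _
  filter_upwards [h2] with ω hω
  ext i j
  exact hω i j

theorem mem_Aequiv_iff (hb : IsStdGaussianFamily b P) (Y : RandMat N P) :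
    Y ∈ Aequiv b P ↔ ∃ x : TP H, Y =ᵐ[P] fun ω => evalTP (linMat b ω) x := by
  constructor
  · rintro ⟨Q, hQ, hY⟩
    obtain ⟨x, hx⟩ := exists_evalTP_eq hQ.mem_trSpan
    exact ⟨x, hY.trans ((evalMat_ae_eq hb Q).trans (Filter.EventuallyEq.of_eq (funext fun ω => hx _)))⟩
  · rintro ⟨x, hx⟩
    obtain ⟨Q, hQ, hQ'⟩ := exists_isEquivariant_eval_eq (N := N) x
    exact ⟨Q, hQ, hx.trans ((Filter.EventuallyEq.of_eq (funext fun ω => (hQ' _).symm)).trans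
      (evalMat_ae_eq hb Q).symm)⟩

end EquivariantRange

section FockTopology
variable {H : Type*} [NormedAddCommGroup H] [InnerProductSpace ℝ H] [CompleteSpace H] {N : ℕ} [NeZero N]

theorem norm_barToFock_sq (x : BarTP H) : ‖barToFock N x‖ ^ 2 = (barInner (1 / N) x x).re := by
  rw [← inner_barToFock, ← inner_self_eq_norm_sq (𝕜 := ℂ)]; rfl

theorem norm_barToFock_symI_le {n : ℕ} (α : S0 n) (F : HilbTensor H n) :
    ‖barToFock N (symI α F)‖ ≤ √(n.factorial) * ‖F‖ := by
  refine (sq_le_sq₀ (norm_nonneg _) (by positivity)).1 ?_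
  rw [norm_barToFock_sq, barInner_symI, Complex.ofReal_re, kernelForm_apply, mul_pow,
    Real.sq_sqrt (Nat.cast_nonneg _)]
  refine (Finset.sum_le_card_nsmul _ _ (‖F‖ ^ 2) fun σ _ => ?_).trans_eq ?_
  · have h1 : (1 : ℝ) ≤ N := by exact_mod_cast NeZero.one_le
    have h0 : 0 ≤ chi (1 / N) (α * conj0 σ α⁻¹) := by rw [chi]; positivity
    have h2 : chi (1 / N) (α * conj0 σ α⁻¹) ≤ 1 :=
      pow_le_one₀ (by positivity) ((div_le_one (by positivity)).2 h1)
    have h3 := abs_le.1 (abs_real_inner_le_norm F (hilbPerm n σ F))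
    rw [norm_hilbPerm, ← sq] at h3
    nlinarith [h3.1, h3.2, sq_nonneg ‖F‖]
  · simp [Fintype.card_perm]

theorem continuous_barToFock_symI {n : ℕ} (α : S0 n) :
    Continuous fun F : HilbTensor H n => barToFock N (symI α F) := by
  let f : HilbTensor H n →+ Fock H N := (barToFock N).toAddMonoidHom.comp (symIₗ α).toAddMonoidHom
  exact AddMonoidHomClass.continuous_of_bound f (√(n.factorial)) fun F => norm_barToFock_symI_le α F

theorem symI_toHilb {n : ℕ} (α : S0 n) (F : AlgTensor H n) :
    symI α (toHilb n F) = tpToBar (toTP (ten α F)) := (tpToBar_toTP_ten α F).symm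

/-- Maps on `BarTP H` which depend continuously on the tensors are determined by their values on the
image of `TP H`. -/
theorem barTP_eq_of_tpToBar {V : Type*} [AddCommGroup V] [Module ℂ V] [TopologicalSpace V] [T2Space V]
    {σ : ℂ →+* ℂ} {f g : BarTP H →ₛₗ[σ] V}
    (hf : ∀ (n : ℕ) (α : S0 n), Continuous fun F : HilbTensor H n => f (symI α F))
    (hg : ∀ (n : ℕ) (α : S0 n), Continuous fun F : HilbTensor H n => g (symI α F))
    (h : ∀ x : TP H, f (tpToBar x) = g (tpToBar x)) (x : BarTP H) : f x = g x := by
  induction x using barTP_induction with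
  | zero => rw [map_zero, map_zero]
  | tensor n α F =>
    refine (toHilb_dense n).induction_on F (isClosed_eq (hf n α) (hg n α)) fun F => ?_
    rw [symI_toHilb, h]
  | smul c x hx => rw [map_smulₛₗ, map_smulₛₗ, hx]
  | add x y hx hy => rw [map_add, map_add, hx, hy]

/-- The canonical map from `TP H` to the Fock space. -/
def tpToFock (N : ℕ) [NeZero N] : TP H →ₗ[ℂ] Fock H N := barToFock N ∘ₗ tpToBar

theorem denseRange_tpToFock : DenseRange (tpToFock (H := H) N) := by
  have h1 (x : BarTP H) : barToFock N x ∈ closure (Set.range (tpToFock (H := H) N)) := by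
    have hc : closure (Set.range (tpToFock (H := H) N)) =
        ((LinearMap.range (tpToFock (H := H) N)).topologicalClosure : Set (Fock H N)) := rfl
    rw [hc]
    induction x using barTP_induction with
    | zero => rw [map_zero]; exact Submodule.zero_mem _
    | tensor n α F =>
      refine (toHilb_dense n).induction_on F ?_ fun F => ?_
      · exact IsClosed.preimage (continuous_barToFock_symI α) (Submodule.isClosed_topologicalClosure _)
      · rw [symI_toHilb]
        exact subset_closure ⟨_, rfl⟩
    | smul c x hx => rw [map_smul]; exact Submodule.smul_mem _ _ hx
    | add x y hx hy => rw [map_add]; exact Submodule.add_mem _ hx hy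
  intro ξ
  exact UniformSpace.Completion.induction_on ξ isClosed_closure fun x => h1 x

theorem continuous_barMul_symI_symI {q : ℝ} (hq : q ≠ 0) {n k : ℕ} (α : S0 n) (β : S0 k) :
    Continuous fun p : HilbTensor H n × HilbTensor H k =>
      barToFock N (barMul q hq (symI α p.1) (symI β p.2)) := by
  simp only [barMul_symI, barMulFib, LinearMap.sum_apply, map_sum]
  refine continuous_finsetSum _ fun π _ => ?_
  split_ifs with hπ
  · simp only [barMulTerm_apply]
    have h (c : ℝ) (z : BarTP H) : barToFock N (c • z) = (c : ℂ) • barToFock N z :=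
      (barToFock N).map_smul (c : ℂ) z
    simp only [h]
    have hc : Continuous fun p : HilbTensor H n × HilbTensor H k => crossHilb (H := H) π hπ p.1 p.2 :=
      (crossHilb (H := H) π hπ).continuous₂
    exact Continuous.const_smul (M := ℂ) ((continuous_barToFock_symI (N := N) _).comp hc) _
  · simp only [LinearMap.zero_apply, map_zero]
    exact continuous_const

theorem continuous_barMul_left {q : ℝ} (hq : q ≠ 0) (z : BarTP H) (n : ℕ) (α : S0 n) :
    Continuous fun F : HilbTensor H n => barToFock N (barMul q hq (symI α F) z) := by
  induction z using barTP_induction with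
  | zero => simp only [map_zero]; exact continuous_const
  | tensor k β G =>
    have hc : Continuous fun F : HilbTensor H n => ((F, G) : HilbTensor H n × HilbTensor H k) := by
      fun_prop
    have hb := continuous_barMul_symI_symI (N := N) (H := H) hq α β
    generalize hT : (fun p : HilbTensor H n × HilbTensor H k =>
      barToFock N (barMul q hq (symI α p.1) (symI β p.2))) = T at hb
    have : (fun F : HilbTensor H n => barToFock N (barMul q hq (symI α F) (symI β G))) =
        fun F => T (F, G) := by rw [← hT]
    rw [this]
    exact hb.comp hc
  | smul c z hz => simp only [map_smul]; exact hz.const_smul c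
  | add z w hz hw => simp only [map_add]; exact hz.add hw

theorem continuous_barMul_right {q : ℝ} (hq : q ≠ 0) (z : BarTP H) (n : ℕ) (α : S0 n) :
    Continuous fun F : HilbTensor H n => barToFock N (barMul q hq z (symI α F)) := by
  induction z using barTP_induction with
  | zero => simp only [map_zero, LinearMap.zero_apply]; exact continuous_const
  | tensor k β G =>
    have hc : Continuous fun F : HilbTensor H n => ((G, F) : HilbTensor H k × HilbTensor H n) := by
      fun_prop
    have hb := continuous_barMul_symI_symI (N := N) (H := H) hq β α
    generalize hT : (fun p : HilbTensor H k × HilbTensor H n =>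
      barToFock N (barMul q hq (symI β p.1) (symI α p.2))) = T at hb
    have : (fun F : HilbTensor H n => barToFock N (barMul q hq (symI β G) (symI α F))) =
        fun F => T (G, F) := by rw [← hT]
    rw [this]
    exact hb.comp hc
  | smul c z hz => simp only [map_smul, LinearMap.smul_apply]; exact hz.const_smul c
  | add z w hz hw => simp only [map_add, LinearMap.add_apply]; exact hz.add hw

theorem barGamma_tpToBar (K : Submodule ℝ H) [K.HasOrthogonalProjection] (x : TP H) :
    barGamma K (tpToBar x) = tpToBar (gam (projOn K) x) := by
  have : barGamma K ∘ₗ tpToBar = tpToBar ∘ₗ gam (projOn K) := TP_ext fun n α h => by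
    rw [LinearMap.comp_apply, LinearMap.comp_apply, gam_symFin, tpToBar_symFin, tpToBar_symFin, barGamma_symI,
      hilbProj, hilbExtend_toHilb, algProj_tprod]
    rfl
  exact LinearMap.congr_fun this x

theorem continuous_barGamma (K : Submodule ℝ H) [K.HasOrthogonalProjection] (n : ℕ) (α : S0 n) :
    Continuous fun F : HilbTensor H n => barToFock N (barGamma K (symI α F)) := by
  simp only [barGamma_symI]
  exact (continuous_barToFock_symI α).comp (hilbProj K n).continuous

theorem continuous_barStar (n : ℕ) (α : S0 n) :
    Continuous fun F : HilbTensor H n => barToFock N (barStar (symI α F)) := by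
  simp only [barStar_symI]
  exact continuous_barToFock_symI α⁻¹

end FockTopology

section RandMat
variable {Ω : Type*} [MeasurableSpace Ω] {P : Measure Ω} {N : ℕ}

theorem aestronglyMeasurable_matrix {f : Ω → Matrix (Fin N) (Fin N) ℂ}
    (hf : ∀ i j, AEStronglyMeasurable (fun ω => f ω i j) P) : AEStronglyMeasurable f P := by
  have h : f = fun ω => ∑ i, ∑ j, f ω i j • Matrix.single i j (1 : ℂ) := by
    funext ω
    conv_lhs => rw [Matrix.matrix_eq_sum_single (f ω)]
    simp
  rw [h]
  exact Finset.aestronglyMeasurable_fun_sum _ fun i _ =>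
    Finset.aestronglyMeasurable_fun_sum _ fun j _ => (hf i j).smul_const _

theorem randMat_ext {Y Z : RandMat N P} (h : ∀ i j, (fun ω => Y ω i j) =ᵐ[P] fun ω => Z ω i j) : Y = Z := by
  have : ∀ᵐ ω ∂P, ∀ i j, Y ω i j = Z ω i j :=
    Filter.eventually_all.2 fun i => Filter.eventually_all.2 fun j => h i j
  exact AEEqFun.ext (this.mono fun ω hω => Matrix.ext hω)

/-- The random matrix with given square integrable entries. -/
def toRand (N : ℕ) (P : Measure Ω) : (Fin N → Fin N → Lp ℂ 2 P) →ₗ[ℂ] RandMat N P where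
  toFun Z := AEEqFun.mk (fun ω => Matrix.of fun i j => Z i j ω)
    (aestronglyMeasurable_matrix fun i j => Lp.aestronglyMeasurable (Z i j))
  map_add' Z W := by
    rw [AEEqFun.mk_add_mk, AEEqFun.mk_eq_mk]
    have : ∀ᵐ ω ∂P, ∀ i j, (Z i j + W i j) ω = Z i j ω + W i j ω :=
      Filter.eventually_all.2 fun i => Filter.eventually_all.2 fun j => Lp.coeFn_add _ _
    exact this.mono fun ω hω => Matrix.ext hω
  map_smul' c Z := by
    have : ∀ᵐ ω ∂P, ∀ i j, (c • Z i j) ω = c • Z i j ω :=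
      Filter.eventually_all.2 fun i => Filter.eventually_all.2 fun j => Lp.coeFn_smul _ _
    exact AEEqFun.mk_eq_mk.2 (this.mono fun ω hω => Matrix.ext hω)

theorem coeFn_toRand (Z : Fin N → Fin N → Lp ℂ 2 P) :
    ∀ᵐ ω ∂P, ∀ i j, toRand N P Z ω i j = Z i j ω :=
  (AEEqFun.coeFn_mk _ _).mono fun ω hω i j => by
    change (AEEqFun.mk _ _ : RandMat N P) ω i j = _
    rw [hω]; rfl

theorem toRand_entry (Z : Fin N → Fin N → Lp ℂ 2 P) (i j : Fin N) :
    (fun ω => toRand N P Z ω i j) =ᵐ[P] Z i j := (coeFn_toRand Z).mono fun _ hω => hω i j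

theorem toRand_eq_iff (Z : Fin N → Fin N → Lp ℂ 2 P) (Y : RandMat N P) :
    toRand N P Z = Y ↔ ∀ i j, Z i j =ᵐ[P] fun ω => Y ω i j := by
  constructor
  · rintro rfl i j
    exact (toRand_entry Z i j).symm
  · intro h
    exact randMat_ext fun i j => (toRand_entry Z i j).trans (h i j)

theorem memL2_toRand (Z : Fin N → Fin N → Lp ℂ 2 P) : MemL2 (toRand N P Z) := fun i j =>
  (memLp_congr_ae (toRand_entry Z i j)).2 (Lp.memLp (Z i j))

theorem exists_toRand_eq {Y : RandMat N P} (hY : MemL2 Y) :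
    toRand N P (fun i j => (hY i j).toLp) = Y :=
  (toRand_eq_iff _ _).2 fun i j => (hY i j).coeFn_toLp

theorem coeFn_mul_entry (Y Z : RandMat N P) : ∀ᵐ ω ∂P, ∀ i j, (Y * Z) ω i j = ∑ k, Y ω i k * Z ω k j :=
  (AEEqFun.coeFn_mul Y Z).mono fun ω hω i j => by rw [hω, Pi.mul_apply, Matrix.mul_apply]

theorem coeFn_star_entry (Y : RandMat N P) : ∀ᵐ ω ∂P, ∀ i j, (star Y) ω i j = conj (Y ω j i) :=
  (AEEqFun.coeFn_star Y).mono fun ω hω i j => by rw [hω, Pi.star_apply, Matrix.star_apply]; rfl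

theorem expMat_star_mul_toRand (Z W : Fin N → Fin N → Lp ℂ 2 P) (i j : Fin N) :
    expMat (star (toRand N P Z) * toRand N P W) i j = ∑ k, inner ℂ (Z k i) (W k j) := by
  simp only [expMat, Matrix.of_apply, L2.inner_def]
  rw [← integral_finsetSum _ fun k _ => L2.integrable_inner _ _]
  refine integral_congr_ae ?_
  filter_upwards [coeFn_mul_entry (star (toRand N P Z)) (toRand N P W), coeFn_star_entry (toRand N P Z),
    coeFn_toRand Z, coeFn_toRand W] with ω h1 h2 h3 h4
  rw [h1]
  refine Finset.sum_congr rfl fun k _ => ?_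
  rw [h2, h3, h4, RCLike.inner_apply, mul_comm]

end RandMat

section Evaluation
variable {H : Type*} [NormedAddCommGroup H] [InnerProductSpace ℝ H] [CompleteSpace H]
  {Ω : Type*} [MeasurableSpace Ω] {P : Measure Ω} [IsProbabilityMeasure P]
  {N : ℕ} {b : Fin N → Fin N → H → Ω → ℝ}

/-- `T(α ⊗ (h₁ ⊗ ⋯ ⊗ hₙ)) ↦ Tr_α(X(h₁), …, X(hₙ))`. -/
def evalRand (hb : IsStdGaussianFamily b P) : TP H →ₗ[ℂ] RandMat N P where
  toFun x := AEEqFun.mk (fun ω => evalTP (linMat b ω) x)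
    (aestronglyMeasurable_matrix fun i j => (measurable_evalTP_linMat hb x i j).aestronglyMeasurable)
  map_add' x y := by
    rw [AEEqFun.mk_add_mk]
    congr 1
    funext ω
    exact map_add _ _ _
  map_smul' c x := by
    exact AEEqFun.mk_eq_mk.2 (.of_forall fun ω => map_smul (evalTP (linMat b ω)) c x)

theorem coeFn_evalRand (hb : IsStdGaussianFamily b P) (x : TP H) :
    evalRand hb x =ᵐ[P] fun ω => evalTP (linMat b ω) x := AEEqFun.coeFn_mk _ _

theorem evalRand_entry (hb : IsStdGaussianFamily b P) (x : TP H) (i j : Fin N) :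
    (fun ω => evalRand hb x ω i j) =ᵐ[P] fun ω => evalTP (linMat b ω) x i j :=
  (coeFn_evalRand hb x).mono fun ω hω => by simp only [hω]

theorem evalRand_one (hb : IsStdGaussianFamily b P) : evalRand hb (1 : TP H) = 1 :=
  AEEqFun.ext <| (coeFn_evalRand hb 1).trans <| Filter.EventuallyEq.symm <|
    AEEqFun.coeFn_one.mono fun ω hω => hω.trans (evalTP_one (linMat b ω)).symm

theorem evalRand_mul (hb : IsStdGaussianFamily b P) (x y : TP H) :
    evalRand hb (x * y) = evalRand hb x * evalRand hb y := by
  refine AEEqFun.ext ?_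
  filter_upwards [coeFn_evalRand hb (x * y), coeFn_evalRand hb x, coeFn_evalRand hb y,
    AEEqFun.coeFn_mul (evalRand hb x) (evalRand hb y)] with ω h1 h2 h3 h4
  rw [h1, h4, Pi.mul_apply, h2, h3, mul_eq_mulTP, evalTP_mul]

theorem evalRand_star (hb : IsStdGaussianFamily b P) (x : TP H) :
    evalRand hb (star x) = star (evalRand hb x) := by
  refine AEEqFun.ext ?_
  filter_upwards [coeFn_evalRand hb (star x), coeFn_evalRand hb x, AEEqFun.coeFn_star (evalRand hb x)]
    with ω h1 h2 h3
  rw [h1, h3, Pi.star_apply, h2, star_eq_starTP, evalTP_star _ (star_linMat ω)]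

theorem trAlpha_gaussMat_ae_eq (hb : IsStdGaussianFamily b P) {n : ℕ} (α : S0 n) (h : Fin n → H) :
    (fun ω => trAlpha α fun k => gaussMat b (h k) ω) =ᵐ[P]
      fun ω => evalTP (linMat b ω) (toTP (ten α (PiTensorProduct.tprod ℝ h))) := by
  have : ∀ᵐ ω ∂P, ∀ k, linMat b ω (h k) = gaussMat b (h k) ω :=
    Filter.eventually_all.2 fun k => linMat_ae_eq hb (h k)
  filter_upwards [this] with ω hω
  rw [← symFin_apply, evalTP_symFin, trAlpha_eq_trS]
  simp only [hω]

theorem evalRand_mem_Aequiv (hb : IsStdGaussianFamily b P) (x : TP H) : evalRand hb x ∈ Aequiv b P :=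
  (mem_Aequiv_iff hb _).2 ⟨x, coeFn_evalRand hb x⟩

theorem integrable_evalRand (hb : IsStdGaussianFamily b P) (x : TP H) (i j : Fin N) :
    Integrable (fun ω => evalRand hb x ω i j) P :=
  (integrable_congr (evalRand_entry hb x i j)).2 (allMoments_evalTP_linMat hb x i j).integrable

theorem expMat_evalRand [NeZero N] (hb : IsStdGaussianFamily b P) (x : APre H) :
    expMat (evalRand hb (toTP x)) = phi (1 / N) x • 1 := by
  ext i j
  rw [expMat, Matrix.of_apply, integral_congr_ae (evalRand_entry hb _ i j), integral_evalTP_linMat hb,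
    phi_eq_counit]

end Evaluation

section WickMap
variable {H : Type*} [NormedAddCommGroup H] [InnerProductSpace ℝ H] [CompleteSpace H]
  {Ω : Type*} [MeasurableSpace Ω] {P : Measure Ω} [IsProbabilityMeasure P]
  {N : ℕ} [NeZero N] {b : Fin N → Fin N → H → Ω → ℝ}

theorem one_div_natCast_ne_zero (N : ℕ) [NeZero N] : (1 / N : ℝ) ≠ 0 :=
  one_div_ne_zero (Nat.cast_ne_zero.2 (NeZero.ne N))

theorem memLp_evalTP_linMat (hb : IsStdGaussianFamily b P) (x : TP H) (i j : Fin N) :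
    MemLp (fun ω => evalTP (linMat b ω) x i j) 2 P := by
  exact_mod_cast allMoments_evalTP_linMat hb x i j 2

/-- The entries of the random matrix attached to the element `I(x) = T(e^{-L} x)`. -/
def wickL2 (hb : IsStdGaussianFamily b P) : TP H →ₗ[ℂ] (Fin N → Fin N → Lp ℂ 2 P) where
  toFun x i j := (memLp_evalTP_linMat hb (expT (1 / N) (-innerₗ H) x) i j).toLp
  map_add' x y := by
    funext i j
    rw [Pi.add_apply, Pi.add_apply, ← MemLp.toLp_add]
    refine (MemLp.toLp_eq_toLp_iff _ _).2 (.of_forall fun ω => ?_)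
    simp only [map_add, Matrix.add_apply, Pi.add_apply]
  map_smul' c x := by
    funext i j
    rw [RingHom.id_apply, Pi.smul_apply, Pi.smul_apply, ← MemLp.toLp_const_smul]
    refine (MemLp.toLp_eq_toLp_iff _ _).2 (.of_forall fun ω => ?_)
    simp only [map_smul, Matrix.smul_apply, Pi.smul_apply]

theorem coeFn_wickL2 (hb : IsStdGaussianFamily b P) (x : TP H) (i j : Fin N) :
    wickL2 hb x i j =ᵐ[P] fun ω => evalTP (linMat b ω) (expT (1 / N) (-innerₗ H) x) i j :=
  (memLp_evalTP_linMat hb _ i j).coeFn_toLp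

theorem toRand_wickL2 (hb : IsStdGaussianFamily b P) (x : TP H) :
    toRand N P (wickL2 hb x) = evalRand hb (expT (1 / N) (-innerₗ H) x) :=
  (toRand_eq_iff _ _).2 fun i j => (coeFn_wickL2 hb x i j).trans (evalRand_entry hb _ i j).symm

theorem sum_inner_wickL2 (hb : IsStdGaussianFamily b P) (x y : TP H) (i j : Fin N) :
    ∑ k, inner ℂ (wickL2 hb x k i) (wickL2 hb y k j) =
      (inner ℂ (tpToFock N x) (tpToFock N y) • (1 : Matrix (Fin N) (Fin N) ℂ)) i j := by
  have hq := one_div_natCast_ne_zero N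
  rw [← expMat_star_mul_toRand, toRand_wickL2, toRand_wickL2, ← evalRand_star, ← evalRand_mul, expMat,
    Matrix.of_apply, integral_congr_ae (evalRand_entry hb _ i j), integral_evalTP_linMat hb, mul_eq_mulTP,
    star_eq_starTP, expT_mul hq, ← expT_starTP, expT_neg_cancel hq, expT_neg_cancel hq,
    counit_crossMul_star hq, tpToFock, LinearMap.comp_apply, LinearMap.comp_apply, inner_barToFock]

theorem norm_wickL2_le (hb : IsStdGaussianFamily b P) (x : TP H) :
    ‖wickL2 hb x‖ ≤ 1 * ‖tpToFock N x‖ := by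
  rw [one_mul]
  refine (pi_norm_le_iff_of_nonneg (norm_nonneg _)).2 fun i =>
    (pi_norm_le_iff_of_nonneg (norm_nonneg _)).2 fun j => ?_
  refine (sq_le_sq₀ (norm_nonneg _) (norm_nonneg _)).1 ?_
  have h := congrArg Complex.re (sum_inner_wickL2 hb x x j j)
  rw [Matrix.smul_apply, Matrix.one_apply_eq, smul_eq_mul, mul_one, Complex.re_sum] at h
  have h2 (k : Fin N) : (inner ℂ (wickL2 hb x k j) (wickL2 hb x k j)).re = ‖wickL2 hb x k j‖ ^ 2 :=
    inner_self_eq_norm_sq (𝕜 := ℂ) _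
  have h3 : (inner ℂ (tpToFock N x) (tpToFock N x)).re = ‖tpToFock N x‖ ^ 2 :=
    inner_self_eq_norm_sq (𝕜 := ℂ) _
  simp only [h2, h3] at h
  rw [← h]
  exact Finset.single_le_sum (f := fun k => ‖wickL2 hb x k j‖ ^ 2) (fun k _ => sq_nonneg _) (Finset.mem_univ i)

/-- The extension of `wickL2` to the Fock space. -/
def fockL2 (hb : IsStdGaussianFamily b P) : Fock H N →L[ℂ] (Fin N → Fin N → Lp ℂ 2 P) :=
  (wickL2 hb).extendOfNorm (tpToFock N)

theorem fockL2_tpToFock (hb : IsStdGaussianFamily b P) (x : TP H) :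
    fockL2 hb (tpToFock N x) = wickL2 hb x :=
  LinearMap.extendOfNorm_eq denseRange_tpToFock ⟨1, norm_wickL2_le hb⟩ x

theorem continuous_fockL2_entry (hb : IsStdGaussianFamily b P) (i j : Fin N) :
    Continuous fun ξ => fockL2 hb ξ i j :=
  (continuous_apply j).comp ((continuous_apply i).comp (fockL2 hb).continuous)

theorem sum_inner_fockL2 (hb : IsStdGaussianFamily b P) (ξ ζ : Fock H N) (i j : Fin N) :
    ∑ k, inner ℂ (fockL2 hb ξ k i) (fockL2 hb ζ k j) =
      (inner ℂ ξ ζ • (1 : Matrix (Fin N) (Fin N) ℂ)) i j := by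
  refine denseRange_tpToFock.induction_on₂
    (p := fun ξ ζ => ∑ k, inner ℂ (fockL2 hb ξ k i) (fockL2 hb ζ k j) =
      (inner ℂ ξ ζ • (1 : Matrix (Fin N) (Fin N) ℂ)) i j) ?_ ?_ ξ ζ
  · refine isClosed_eq (continuous_finsetSum _ fun k _ => ?_) ?_
    · exact ((continuous_fockL2_entry hb k i).comp continuous_fst).inner
        ((continuous_fockL2_entry hb k j).comp continuous_snd)
    · simp only [Matrix.smul_apply]
      have hc : Continuous fun p : Fock H N × Fock H N => (inner ℂ p.1 p.2 : ℂ) :=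
        continuous_fst.inner continuous_snd
      exact hc.smul continuous_const
  · intro x y
    rw [fockL2_tpToFock, fockL2_tpToFock, sum_inner_wickL2]

/-- The map from the Fock space to random matrices. -/
def fockRand (hb : IsStdGaussianFamily b P) : Fock H N →ₗ[ℂ] RandMat N P :=
  toRand N P ∘ₗ (fockL2 hb).toLinearMap

theorem fockRand_entry (hb : IsStdGaussianFamily b P) (ξ : Fock H N) (i j : Fin N) :
    (fun ω => fockRand hb ξ ω i j) =ᵐ[P] fockL2 hb ξ i j := toRand_entry _ i j

theorem fockRand_algToBar (hb : IsStdGaussianFamily b P) (x : APre H) :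
    fockRand hb (barToFock N (algToBar (1 / N) x)) = evalRand hb (toTP x) := by
  have h : barToFock N (algToBar (1 / N) x) = tpToFock N (expT (1 / N) (innerₗ H) (toTP x)) := by
    rw [algToBar_eq]; rfl
  rw [h, fockRand, LinearMap.comp_apply, ContinuousLinearMap.coe_coe, fockL2_tpToFock, toRand_wickL2,
    expT_neg_cancel' (one_div_natCast_ne_zero N)]

theorem expMat_star_mul_fockRand (hb : IsStdGaussianFamily b P) (ξ ζ : Fock H N) :
    expMat (star (fockRand hb ξ) * fockRand hb ζ) = inner ℂ ξ ζ • 1 := by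
  ext i j
  exact (expMat_star_mul_toRand _ _ i j).trans (sum_inner_fockL2 hb ξ ζ i j)

theorem norm_fock_le (hb : IsStdGaussianFamily b P) (ξ : Fock H N) : ‖ξ‖ ≤ √N * ‖fockL2 hb ξ‖ := by
  refine (sq_le_sq₀ (norm_nonneg _) (by positivity)).1 ?_
  have h := congrArg Complex.re (sum_inner_fockL2 hb ξ ξ 0 0)
  rw [Matrix.smul_apply, Matrix.one_apply_eq, smul_eq_mul, mul_one, Complex.re_sum] at h
  have h2 (k : Fin N) : (inner ℂ (fockL2 hb ξ k 0) (fockL2 hb ξ k 0)).re = ‖fockL2 hb ξ k 0‖ ^ 2 :=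
    inner_self_eq_norm_sq (𝕜 := ℂ) _
  have h3 : (inner ℂ ξ ξ).re = ‖ξ‖ ^ 2 := inner_self_eq_norm_sq (𝕜 := ℂ) _
  simp only [h2, h3] at h
  rw [← h, mul_pow, Real.sq_sqrt (Nat.cast_nonneg _)]
  refine (Finset.sum_le_card_nsmul _ _ (‖fockL2 hb ξ‖ ^ 2) fun k _ => ?_).trans_eq (by simp)
  exact pow_le_pow_left₀ (norm_nonneg _) ((norm_le_pi_norm _ _).trans (norm_le_pi_norm _ _)) 2

theorem isClosed_range_fockL2 (hb : IsStdGaussianFamily b P) : IsClosed (Set.range (fockL2 hb)) := by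
  have h : AntilipschitzWith (Real.toNNReal √N) (fockL2 hb) :=
    AddMonoidHomClass.antilipschitz_of_bound (fockL2 hb) fun ξ => by
      rw [Real.coe_toNNReal _ (Real.sqrt_nonneg _)]
      exact norm_fock_le hb ξ
  exact h.isClosed_range (fockL2 hb).uniformContinuous

theorem edist_entries_lt {Z W : Fin N → Fin N → Lp ℂ 2 P} {ε : ENNReal} (hε : 0 < ε)
    (h : ∀ i j, edist (Z i j) (W i j) < ε) : edist Z W < ε := by
  rw [edist_pi_def, Finset.sup_lt_iff hε]
  intro i _
  rw [edist_pi_def, Finset.sup_lt_iff hε]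
  exact fun j _ => h i j

theorem range_fockRand (hb : IsStdGaussianFamily b P) : Set.range (fockRand hb) = A2equiv b P := by
  have hed {Z W : Fin N → Fin N → Lp ℂ 2 P} (i j : Fin N) :
      eLpNorm (fun ω => toRand N P Z ω i j - toRand N P W ω i j) 2 P = edist (Z i j) (W i j) := by
    rw [Lp.edist_def]
    exact eLpNorm_congr_ae ((toRand_entry Z i j).sub (toRand_entry W i j))
  apply Set.Subset.antisymm
  · rintro _ ⟨ξ, rfl⟩
    refine ⟨memL2_toRand _, fun ε hε => ?_⟩
    have hU : {ζ | edist (fockL2 hb ξ) (fockL2 hb ζ) < ε} ∈ nhds ξ := by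
      refine (isOpen_lt ?_ continuous_const).mem_nhds ?_
      · exact continuous_const.edist (fockL2 hb).continuous
      · simpa using hε
    obtain ⟨x, hx⟩ := denseRange_tpToFock.exists_mem_open isOpen_interior ⟨ξ, mem_interior_iff_mem_nhds.2 hU⟩
    have hx' : tpToFock N x ∈ {ζ | edist (fockL2 hb ξ) (fockL2 hb ζ) < ε} := interior_subset hx
    refine ⟨fockRand hb (tpToFock N x), ?_, fun i j => ?_⟩
    · rw [fockRand, LinearMap.comp_apply, ContinuousLinearMap.coe_coe, fockL2_tpToFock, toRand_wickL2]
      exact evalRand_mem_Aequiv hb _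
    · refine (hed i j).trans_lt (lt_of_le_of_lt ?_ hx')
      exact (edist_le_pi_edist (fockL2 hb ξ i) (fockL2 hb (tpToFock N x) i) j).trans
        (edist_le_pi_edist (fockL2 hb ξ) (fockL2 hb (tpToFock N x)) i)
  · rintro Y ⟨hY, hε⟩
    have hmem : (fun i j => (hY i j).toLp : Fin N → Fin N → Lp ℂ 2 P) ∈ Set.range (fockL2 hb) := by
      rw [← (isClosed_range_fockL2 hb).closure_eq, EMetric.mem_closure_iff]
      intro ε hε0
      obtain ⟨Z, hZ, hZε⟩ := hε ε hε0
      obtain ⟨x, hx⟩ := (mem_Aequiv_iff hb Z).1 hZ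
      have hZx : Z = toRand N P (fockL2 hb (tpToFock N (expT (1 / N) (innerₗ H) x))) := by
        rw [fockL2_tpToFock, toRand_wickL2, expT_neg_cancel' (one_div_natCast_ne_zero N)]
        exact AEEqFun.ext (hx.trans (coeFn_evalRand hb x).symm)
      refine ⟨_, ⟨tpToFock N (expT (1 / N) (innerₗ H) x), rfl⟩, edist_entries_lt hε0 fun i j => ?_⟩
      refine lt_of_eq_of_lt ?_ (hZε i j)
      have := hed (Z := fun i j => (hY i j).toLp)
        (W := fockL2 hb (tpToFock N (expT (1 / N) (innerₗ H) x))) i j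
      rw [← hZx, exists_toRand_eq hY] at this
      exact this.symm
    obtain ⟨ξ, hξ⟩ := hmem
    exact ⟨ξ, by rw [fockRand, LinearMap.comp_apply, ContinuousLinearMap.coe_coe, hξ, exists_toRand_eq hY]⟩

end WickMap

section LpAlgebra
variable {Ω : Type*} [MeasurableSpace Ω] {P : Measure Ω} {N : ℕ}

/-- The product of square integrable functions, as an integrable function. -/
def mulL1 (P : Measure Ω) : Lp ℂ 2 P →L[ℂ] Lp ℂ 2 P →L[ℂ] Lp ℂ 1 P :=
  (ContinuousLinearMap.mul ℂ ℂ).holderL P 2 2 1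

theorem coeFn_mulL1 (f g : Lp ℂ 2 P) : mulL1 P f g =ᵐ[P] fun ω => f ω * g ω :=
  (ContinuousLinearMap.mul ℂ ℂ).coeFn_holder f g

/-- The inclusion of `L²` in `L¹`. -/
def toL1 (P : Measure Ω) [IsFiniteMeasure P] : Lp ℂ 2 P →L[ℂ] Lp ℂ 1 P :=
  mulL1 P ((memLp_const (1 : ℂ)).toLp)

theorem coeFn_toL1 [IsFiniteMeasure P] (f : Lp ℂ 2 P) : toL1 P f =ᵐ[P] f := by
  filter_upwards [coeFn_mulL1 ((memLp_const (1 : ℂ)).toLp) f, (memLp_const (1 : ℂ)).coeFn_toLp (μ := P) (p := 2)]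
    with ω h1 h2
  rw [toL1, h1, h2, one_mul]

theorem coeFn_sum_L1 {ι : Type*} (s : Finset ι) (f : ι → Lp ℂ 1 P) :
    ∀ᵐ ω ∂P, (∑ k ∈ s, f k : Lp ℂ 1 P) ω = ∑ k ∈ s, f k ω := by
  classical
  induction s using Finset.induction_on with
  | empty => exact (Lp.coeFn_zero ℂ 1 P).mono fun ω hω => by simpa using hω
  | insert a s ha ih =>
    simp only [Finset.sum_insert ha]
    filter_upwards [ih, Lp.coeFn_add (f a) (∑ k ∈ s, f k)] with ω h1 h2
    rw [h2, Pi.add_apply, h1]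

theorem toRand_eq_mul_iff [IsFiniteMeasure P] (V Z W : Fin N → Fin N → Lp ℂ 2 P) :
    toRand N P V = toRand N P Z * toRand N P W ↔
      ∀ i j, toL1 P (V i j) = ∑ k, mulL1 P (Z i k) (W k j) := by
  have h (i j : Fin N) : (fun ω => (toRand N P Z * toRand N P W) ω i j) =ᵐ[P]
      (∑ k, mulL1 P (Z i k) (W k j) : Lp ℂ 1 P) := by
    have h1 : ∀ᵐ ω ∂P, ∀ k, mulL1 P (Z i k) (W k j) ω = Z i k ω * W k j ω :=
      Filter.eventually_all.2 fun k => coeFn_mulL1 _ _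
    filter_upwards [h1, coeFn_mul_entry (toRand N P Z) (toRand N P W), coeFn_toRand Z, coeFn_toRand W,
      coeFn_sum_L1 Finset.univ fun k => mulL1 P (Z i k) (W k j)] with ω h1 h2 h3 h4 h5
    simp only [h5, h2, h1, h3, h4]
  rw [toRand_eq_iff]
  refine forall₂_congr fun i j => ?_
  constructor
  · intro h1
    exact Lp.ext ((coeFn_toL1 _).trans (h1.trans (h i j)))
  · intro h1
    refine (coeFn_toL1 _).symm.trans (Filter.EventuallyEq.trans ?_ (h i j).symm)
    rw [h1]

/-- Complex conjugation on `L²`. -/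
def conjL2 (P : Measure Ω) : Lp ℂ 2 P →L⋆[ℂ] Lp ℂ 2 P :=
  ((starL ℂ : ℂ ≃L⋆[ℂ] ℂ) : ℂ →L⋆[ℂ] ℂ).compLpL 2 P

theorem coeFn_conjL2 (f : Lp ℂ 2 P) : conjL2 P f =ᵐ[P] fun ω => conj (f ω) :=
  ((starL ℂ : ℂ ≃L⋆[ℂ] ℂ) : ℂ →L⋆[ℂ] ℂ).coeFn_compLpL f

theorem toRand_eq_star_iff (V Z : Fin N → Fin N → Lp ℂ 2 P) :
    toRand N P V = star (toRand N P Z) ↔ ∀ i j, V i j = conjL2 P (Z j i) := by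
  have h (i j : Fin N) : (fun ω => (star (toRand N P Z)) ω i j) =ᵐ[P] conjL2 P (Z j i) := by
    filter_upwards [coeFn_star_entry (toRand N P Z), coeFn_toRand Z, coeFn_conjL2 (Z j i)] with ω h1 h2 h3
    rw [h1, h2, h3]
  rw [toRand_eq_iff]
  refine forall₂_congr fun i j => ?_
  constructor
  · intro h1
    exact Lp.ext (h1.trans (h i j))
  · intro h1
    refine Filter.EventuallyEq.trans ?_ (h i j).symm
    rw [h1]

theorem coeFn_condExpL2 {Ω : Type*} {m m0 : MeasurableSpace Ω} {P : @Measure Ω m0} [IsFiniteMeasure P]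
    (hm : m ≤ m0) (f : Lp ℂ 2 P) :
    ((condExpL2 ℂ ℂ hm f : Lp ℂ 2 P) : Ω → ℂ) =ᵐ[P] P[f | m] := by
  have := (Lp.memLp f).condExpL2_ae_eq_condExp (𝕜 := ℂ) hm
  rwa [Lp.toLp_coeFn] at this

end LpAlgebra

section FockAlgebra
variable {H : Type*} [NormedAddCommGroup H] [InnerProductSpace ℝ H] [CompleteSpace H]
  {Ω : Type*} [MeasurableSpace Ω] {P : Measure Ω} [IsProbabilityMeasure P]
  {N : ℕ} [NeZero N] {b : Fin N → Fin N → H → Ω → ℝ}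

/-- The entries of the random matrix attached to an element of the Fock space. -/
def fockEntry (hb : IsStdGaussianFamily b P) (i j : Fin N) : Fock H N →L[ℂ] Lp ℂ 2 P :=
  (ContinuousLinearMap.proj j).comp ((ContinuousLinearMap.proj i).comp (fockL2 hb))

/-- `fockEntry` on `BarTP H`. -/
def barEntry (hb : IsStdGaussianFamily b P) (i j : Fin N) : BarTP H →ₗ[ℂ] Lp ℂ 2 P :=
  (fockEntry hb i j).toLinearMap ∘ₗ barToFock N

theorem continuous_barEntry (hb : IsStdGaussianFamily b P) (i j : Fin N) {n : ℕ}
    {f : HilbTensor H n → BarTP H} (hf : Continuous fun F => barToFock N (f F)) :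
    Continuous fun F => barEntry hb i j (f F) := (fockEntry hb i j).continuous.comp hf

theorem fockRand_tpToBar (hb : IsStdGaussianFamily b P) (x : TP H) :
    fockRand hb (barToFock N (tpToBar x)) = evalRand hb (expT (1 / N) (-innerₗ H) x) := by
  rw [← toRand_wickL2, ← fockL2_tpToFock]; rfl

theorem expT_neg_crossMul {q : ℝ} (hq : q ≠ 0) (x y : TP H) :
    expT q (-innerₗ H) (crossMul q x y) = expT q (-innerₗ H) x * expT q (-innerₗ H) y := by
  rw [← expT_neg_cancel' hq (innerₗ H) (_ * _), mul_eq_mulTP, expT_mul hq, expT_neg_cancel hq, expT_neg_cancel hq]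

theorem barEntry_mul (hb : IsStdGaussianFamily b P) (x y : BarTP H) (i j : Fin N) :
    toL1 P (barEntry hb i j (barMul (1 / N) (one_div_natCast_ne_zero N) x y)) =
      ∑ k, mulL1 P (barEntry hb i k x) (barEntry hb k j y) := by
  have hq := one_div_natCast_ne_zero N
  let B₁ : BarTP H →ₗ[ℂ] BarTP H →ₗ[ℂ] Lp ℂ 1 P :=
    (barMul (1 / N) hq).compr₂ ((toL1 P).toLinearMap ∘ₗ barEntry hb i j)
  let M : Lp ℂ 2 P →ₗ[ℂ] Lp ℂ 2 P →ₗ[ℂ] Lp ℂ 1 P := (mulL1 P).toLinearMap₁₂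
  let B₂ : BarTP H →ₗ[ℂ] BarTP H →ₗ[ℂ] Lp ℂ 1 P :=
    ∑ k, M.compl₁₂ (barEntry hb i k) (barEntry hb k j)
  have hB₂ (x y : BarTP H) : B₂ x y = ∑ k, mulL1 P (barEntry hb i k x) (barEntry hb k j y) := by
    simp only [B₂, LinearMap.sum_apply]; rfl
  have hB₁ (x y : BarTP H) : B₁ x y = toL1 P (barEntry hb i j (barMul (1 / N) hq x y)) := rfl
  rw [← hB₁, ← hB₂]
  have hE (k l : Fin N) (n : ℕ) (α : S0 n) : Continuous fun F : HilbTensor H n => barEntry hb k l (symI α F) :=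
    continuous_barEntry hb k l (continuous_barToFock_symI α)
  refine barTP_eq_of_tpToBar (f := B₁ x) (g := B₂ x) (fun n α => ?_) (fun n α => ?_) (fun y => ?_) y
  · simp only [hB₁]
    exact (toL1 P).continuous.comp (continuous_barEntry hb i j (continuous_barMul_right hq x n α))
  · simp only [hB₂]
    exact continuous_finsetSum _ fun k _ => (mulL1 P _).continuous.comp (hE k j n α)
  refine barTP_eq_of_tpToBar (f := B₁.flip (tpToBar y)) (g := B₂.flip (tpToBar y)) (fun n α => ?_)
    (fun n α => ?_) (fun x => ?_) x
  · simp only [LinearMap.flip_apply, hB₁]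
    exact (toL1 P).continuous.comp (continuous_barEntry hb i j (continuous_barMul_left hq _ n α))
  · simp only [LinearMap.flip_apply, hB₂]
    exact continuous_finsetSum _ fun k _ => ((mulL1 P).flip _).continuous.comp (hE i k n α)
  rw [LinearMap.flip_apply, LinearMap.flip_apply, hB₁, hB₂]
  refine (toRand_eq_mul_iff (fockL2 hb _) (fockL2 hb (barToFock N (tpToBar x)))
    (fockL2 hb (barToFock N (tpToBar y)))).1 ?_ i j
  change fockRand hb (barToFock N _) = fockRand hb _ * fockRand hb _
  rw [barMul_tpToBar, fockRand_tpToBar, fockRand_tpToBar, fockRand_tpToBar, expT_neg_crossMul hq, evalRand_mul]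

theorem fockRand_barMul (hb : IsStdGaussianFamily b P) (x y : BarTP H) :
    fockRand hb (barToFock N (barMul (1 / N) (one_div_natCast_ne_zero N) x y)) =
      fockRand hb (barToFock N x) * fockRand hb (barToFock N y) :=
  (toRand_eq_mul_iff _ _ _).2 fun i j => barEntry_mul hb x y i j

theorem fockRand_barStar (hb : IsStdGaussianFamily b P) (x : BarTP H) :
    fockRand hb (barToFock N (barStar x)) = star (fockRand hb (barToFock N x)) := by
  refine (toRand_eq_star_iff _ _).2 fun i j => ?_
  refine barTP_eq_of_tpToBar (σ := starRingEnd ℂ) (f := (barEntry hb i j).comp barStar)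
    (g := (conjL2 P).toLinearMap.comp (barEntry hb j i)) (fun n α => ?_) (fun n α => ?_) (fun x => ?_) x
  · exact continuous_barEntry hb i j (continuous_barStar n α)
  · exact (conjL2 P).continuous.comp (continuous_barEntry hb j i (continuous_barToFock_symI α))
  · refine (toRand_eq_star_iff (fockL2 hb (barToFock N (barStar (tpToBar x))))
      (fockL2 hb (barToFock N (tpToBar x)))).1 ?_ i j
    change fockRand hb (barToFock N _) = star (fockRand hb _)
    rw [barStar_tpToBar, fockRand_tpToBar, fockRand_tpToBar, ← evalRand_star, star_eq_starTP, expT_starTP]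

theorem condExp_fockRand (hb : IsStdGaussianFamily b P) (K : Submodule ℝ H) [K.HasOrthogonalProjection]
    (x : BarTP H) (i j : Fin N) :
    P[fun ω => fockRand hb (barToFock N x) ω i j | sigmaX b K] =ᵐ[P]
      fun ω => fockRand hb (barToFock N (barGamma K x)) ω i j := by
  have hm := sigmaX_le hb (K : Set H)
  let C : Lp ℂ 2 P →L[ℂ] Lp ℂ 2 P := (lpMeas ℂ ℂ (sigmaX b K) 2 P).subtypeL.comp (condExpL2 ℂ ℂ hm)
  have hC (f : Lp ℂ 2 P) : C f =ᵐ[P] P[f | sigmaX b K] := coeFn_condExpL2 (P := P) hm f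
  have h : C (barEntry hb i j x) = barEntry hb i j (barGamma K x) := by
    refine barTP_eq_of_tpToBar (f := C.toLinearMap ∘ₗ barEntry hb i j)
      (g := barEntry hb i j ∘ₗ barGamma K) (fun n α => ?_) (fun n α => ?_) (fun x => ?_) x
    · exact C.continuous.comp (continuous_barEntry hb i j (continuous_barToFock_symI α))
    · exact continuous_barEntry hb i j (continuous_barGamma K n α)
    · change C (barEntry hb i j (tpToBar x)) = barEntry hb i j (barGamma K (tpToBar x))
      have hw (x : TP H) : barEntry hb i j (tpToBar x) =ᵐ[P]
          fun ω => evalTP (linMat b ω) (expT (1 / N) (-innerₗ H) x) i j := by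
        have : barEntry hb i j (tpToBar x) = wickL2 hb x i j := by rw [← fockL2_tpToFock]; rfl
        rw [this]
        exact coeFn_wickL2 hb x i j
      rw [barGamma_tpToBar]
      refine Lp.ext ((hC _).trans ((condExp_congr_ae (hw x)).trans ?_))
      exact (condExp_evalTP_expT_neg K hb x i j).trans (hw _).symm
  refine (condExp_congr_ae (fockRand_entry hb _ i j)).trans ?_
  refine (hC (barEntry hb i j x)).symm.trans ?_
  rw [h]
  exact (fockRand_entry hb _ i j).symm

theorem condExp_trAlpha (hb : IsStdGaussianFamily b P) (K : Submodule ℝ H) [K.HasOrthogonalProjection]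
    {n : ℕ} (α : S0 n) (h : Fin n → H) (i j : Fin N) :
    P[fun ω => trAlpha α (fun k => gaussMat b (h k) ω) i j | sigmaX b K] =ᵐ[P]
      fun ω => fockRand hb (barToFock N (barGamma K (algToBar (1 / N)
        (ten α (PiTensorProduct.tprod ℝ h))))) ω i j := by
  refine Filter.EventuallyEq.trans (condExp_congr_ae ?_) (condExp_fockRand hb K _ i j)
  rw [fockRand_algToBar]
  refine Filter.EventuallyEq.trans ?_ (evalRand_entry hb _ i j).symm
  exact (trAlpha_gaussMat_ae_eq hb α h).mono fun ω hω => congrFun (congrFun hω i) j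

end FockAlgebra

end TracePoly
end

theorem mainTheorem2 {H : Type*} [NormedAddCommGroup H] [InnerProductSpace ℝ H] [CompleteSpace H]
    {Ω : Type*} [MeasurableSpace Ω] (P : Measure Ω) [IsProbabilityMeasure P]
    (N : ℕ) [NeZero N] (b : Fin N → Fin N → H → Ω → ℝ) (hb : IsStdGaussianFamily b P) :
    ∃ E : TP H →ₗ[ℂ] RandMat N P,
      (∀ (n : ℕ) (α : S0 n) (h : Fin n → H),
        E (toTP (ten α (PiTensorProduct.tprod ℝ h))) =ᵐ[P]
          fun ω => trAlpha α fun k => gaussMat b (h k) ω) ∧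
      (∀ x, E x ∈ Aequiv b P) ∧
      E 1 = 1 ∧ (∀ x y, E (x * y) = E x * E y) ∧ (∀ x, E (star x) = star (E x)) ∧
      (∀ x : APre H, (∀ i j, Integrable (fun ω => E (toTP x) ω i j) P) ∧
        expMat (E (toTP x)) = phi (1 / N) x • 1) ∧
      ∃ (m : BarTP H →ₗ[ℂ] BarTP H →ₗ[ℂ] BarTP H) (s : BarTP H →ₗ⋆[ℂ] BarTP H),
        IsStarAlgExtension (1 / N) m s ∧
        (∀ m' s', IsStarAlgExtension (1 / N) m' s' → m' = m ∧ s' = s) ∧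
        ∃ Φ : Fock H N →ₗ[ℂ] RandMat N P,
          (∀ x : APre H, Φ (barToFock N (algToBar (1 / N) x)) = E (toTP x)) ∧
          (∀ ξ, MemL2 (Φ ξ)) ∧
          (∀ ξ ζ, expMat (star (Φ ξ) * Φ ζ) = inner ℂ ξ ζ • 1) ∧
          Set.range Φ = A2equiv b P ∧
          (∀ x y : BarTP H,
            Φ (barToFock N (m x y)) = Φ (barToFock N x) * Φ (barToFock N y)) ∧
          (∀ x : BarTP H, Φ (barToFock N (s x)) = star (Φ (barToFock N x))) ∧
          (∀ (K : Submodule ℝ H) [K.HasOrthogonalProjection],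
            (∀ (A : BarTP H) (i j : Fin N),
              P[fun ω => Φ (barToFock N A) ω i j | sigmaX b K] =ᵐ[P]
                fun ω => Φ (barToFock N (barGamma K A)) ω i j) ∧
            (∀ (n : ℕ) (α : S0 n) (h : Fin n → H) (i j : Fin N),
              P[fun ω => trAlpha α (fun k => gaussMat b (h k) ω) i j | sigmaX b K] =ᵐ[P]
                fun ω => Φ (barToFock N (barGamma K (algToBar (1 / N)
                  (ten α (PiTensorProduct.tprod ℝ h))))) ω i j)) := by
  have hq := one_div_natCast_ne_zero N
  refine ⟨evalRand hb, fun n α h => ?_, evalRand_mem_Aequiv hb, evalRand_one hb, evalRand_mul hb,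
    evalRand_star hb, fun x => ⟨integrable_evalRand hb _, expMat_evalRand hb x⟩,
    barMul (1 / N) hq, barStar, isStarAlgExtension_bar (1 / N) hq,
    fun m' s' h' => isStarAlgExtension_unique hq (isStarAlgExtension_bar (1 / N) hq) h',
    fockRand hb, fockRand_algToBar hb, fun ξ => memL2_toRand _, expMat_star_mul_fockRand hb,
    range_fockRand hb, fockRand_barMul hb, fockRand_barStar hb,
    fun K _ => ⟨condExp_fockRand hb K, fun n α h => condExp_trAlpha hb K α h⟩⟩
  exact (coeFn_evalRand hb _).trans (trAlpha_gaussMat_ae_eq hb α h).symm
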